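/- **Setting and notation.** Let $\ell\ge 2$ be an integer, let $L$ be the smallest odd integer with $L\ge\ell$, and put $\gamma=1+(\ell \bmod 2)$, $\bar i=i\bmod 2$. Let $f(u)=\tfrac12\sin 2u$, $Q(y)=2\arctan y$, $\Lambda=y\partial_y$, $\Lambda_0=1+y\partial_y$, and for $\boldsymbol u=(u,\dot u)$ put $\boldsymbol\Lambda\boldsymbol u=(\Lambda u,\Lambda_0\dot u)$ and $$\boldsymbol F(\boldsymbol u)=\Big(\dot u,\ u''+\tfrac1y u'-\tfrac{1}{y^2}f(u)\Big).$$ Let $\boldsymbol Q=(Q,0)$, $\Lambda Q=\frac{2y}{1+y^2}$, $Z=\frac{1-y^2}{1+y^2}$, $A=-\partial_y+\frac Zy$, $A^*=\partial_y+\frac{1+Z}{y}$, $H=A^*A$, $\boldsymbol H(u,\dot u)=(-\dot u,Hu)$. The adapted derivatives are $f_0=f$, $f_{k+1}=Af_k$ for $k$ even, $f_{k+1}=A^*f_k$ for $k$ odd; write $\mathcal A^kf=f_k$. With $\Gamma=\Lambda Q\int_1^y\frac{dx}{x(\Lambda Q)^2}$ put $$H^{-1}f=\Lambda Q\int_0^y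 f\,\Gamma\,x\,dx-\Gamma\int_0^y f\,\Lambda Q\,x\,dx,\qquad \boldsymbol H^{-1}(u,\dot u)=(H^{-1}\dot u,-u),\qquad \boldsymbol T_i=(-\boldsymbol H)^{-i}(\Lambda Q,0)\quad(i\ge0).$$ Let $\langle u,v\rangle=\int_0^\infty uv\,y\,dy$ and $\|u\|_{L^2(|y|\le R)}^2=\int_0^R u^2\,y\,dy$. Fix a smooth $\chi$ with $\chi(r)=1$ for $r\le1$ and $\chi(r)=0$ for $r\ge2$, and put $\chi_B(y)=\chi(y/B)$. For $0<b_1<1$ let $B_0=1/b_1$, $B_1=|\log b_1|^\gamma/b_1$, and $$c_{b_1,1}=\frac{\langle\Lambda_0\Lambda Q,\Lambda Q\rangle}{\langle\chi_{B_0/4}\Lambda Q,\Lambda Q\rangle},\qquad c_{b_1,i}=\frac{4}{\langle\chi_{B_0/4}\Lambda Q,\Lambda Q\rangle}\quad(i\ne1).$$ **Admissible and homogeneous functions.** Fix $0<b_0<1$. A function $\boldsymbol f(b_1,y)\in\mathbb R^2$ on $(0,b_0)\times[0,\infty)$ is *$b_1$-admissible of degree* $(p_1,p_2,\iota)\in\mathbb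 N\times\mathbb Z\times\{0,1\}$ if its only nonzero coordinate is the $(\iota+1)$-th one, say $f$, where $f$ is smooth and * for $0\le y\le1$, $f$ is a finite sum of terms $h(b_1)\tilde f(y)$ with $h,\tilde f$ smooth, $|h^{(l)}|\lesssim b_1^{-l}$ for all $l\ge0$, and $\tilde f(y)=\sum_{p_1-\iota\le k\le 2p,\ k\text{ even}}c_ky^{k+1}+O(y^{2p+3})$ as $y\to0$ for all $p$ with $2p\ge p_1$, also after taking derivatives; * there is $c>0$ such that for all $k\ge0$, $l\ge1$, $y\ge1$, with $n=p_2-k-\iota$, $$|f_k|\lesssim y^{n-1}\Big(g_n+\frac{(1+|\log y|)^c}{y^2}+\frac{\mathbf 1_{\{n\ge3,\,y\ge3B_0\}}}{y^2b_1^2|\log b_1|}\Big),\qquad |\partial_{b_1}^lf_k|\lesssim\frac{y^{n-1}}{b_1^l|\log b_1|}\Big(\tilde g_n+\frac{(1+|\log y|)^c}{y^2}+\frac{\mathbf 1_{\{n\ge3,\,y\ge3B_0\}}}{y^2b_1^2}\Big),$$ $$g_n=\frac{1+|\log(b_1y)|\mathbf 1_{\{n\ge1\}}}{|\log b_1|}\mathbf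 1_{y\le3B_0},\qquad \tilde g_n=\Big(\frac{1+|\log y|\mathbf 1_{\{n\ge1\}}}{|\log b_1|}+\mathbf 1_{y\ge B_0/4}\Big)\mathbf 1_{y\le3B_0},$$ with implied constants that may depend on $k,l$ but not on $b_1,y$. A function $\boldsymbol S(b,y)$ of $b=(b_1,\dots,b_L)\in(0,b_0)\times\mathbb R^{L-1}$ and $y\ge0$ is *homogeneous of degree* $(p_1,p_2,\iota,p_3)$ if it is a finite sum of terms $\big(\prod_{k=1}^Lb_k^{J_k}\big)\boldsymbol S_J(b_1,y)$ with $\boldsymbol S_J$ $b_1$-admissible of degree $(p_1,p_2,\iota)$, $J_1\in\mathbb Z$, $J_2,\dots,J_L\in\mathbb N$ and $\sum_kkJ_k=p_3$. **Proposition.** There are $b_0\in(0,1)$, $M_0>0$, numbers $b^*(M)\in(0,b_0]$ for $M\ge M_0$, functions $\boldsymbol S_i(b,y)$ for $1\le i\le L+2$, each homogeneous of degree $(i,i,\bar i,i)$, and a function $\boldsymbol\psi_b(y)=(\psi_b,\dot\psi_b)$ of $(b,y)$, such that $\boldsymbol S_1=0$, $\partial\boldsymbol S_i/\partial b_j=0$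 for $2\le i\le j\le L$, and the following holds with $$\boldsymbol Q_b=\boldsymbol Q+\sum_{i=1}^Lb_i\boldsymbol T_i+\sum_{i=2}^{L+2}\boldsymbol S_i.$$ For every $C^1$ map $s\mapsto b(s)\in(0,b_0)\times\mathbb R^{L-1}$ on an interval and every $y>0$, $$\partial_s\boldsymbol Q_b-\boldsymbol F(\boldsymbol Q_b)+b_1\boldsymbol\Lambda\boldsymbol Q_b=\mathbf{Mod}+\boldsymbol\psi_b,$$ $$\mathbf{Mod}=\sum_{i=1}^L\big((b_i)_s+(i-1+c_{b_1,i})b_1b_i-b_{i+1}\big)\Big(\boldsymbol T_i+\sum_{j=i+1}^{L+2}\frac{\partial\boldsymbol S_j}{\partial b_i}\Big),\qquad b_{L+1}:=0.$$ Moreover there is an exponent $p$ such that for each $K>0$ there are constants $C>0$, independent of $M$, and $C(M)$ such that, for all $M\ge M_0$ and all $b$ with $0<b_1<b^*(M)$ and $|b_k|\le Kb_1^k$ for $1\le k\le L$: 1. (global bounds) for $2\le k\le L-1$, $$\|\mathcal A^k\psi_b\|_{L^2(|y|\le2B_1)}+\|\mathcal A^{k-1}\dot\psi_b\|_{L^2(|y|\le2B_1)}\le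 C\,b_1^{k+1}|\log b_1|^{p},$$ $$\|\mathcal A^L\psi_b\|_{L^2(|y|\le2B_1)}+\|\mathcal A^{L-1}\dot\psi_b\|_{L^2(|y|\le2B_1)}\le C\,\frac{b_1^{L+1}}{|\log b_1|^{1/2}},$$ $$\|\mathcal A^{L+1}\psi_b\|_{L^2(|y|\le2B_1)}+\|\mathcal A^{L}\dot\psi_b\|_{L^2(|y|\le2B_1)}\le C\,\frac{b_1^{L+2}}{|\log b_1|};$$ 2. (logarithmic weighted bounds) for $m\ge1$ and $0\le k\le m$, $$\Big\|\frac{1+|\log y|}{1+y^{m-k}}\mathcal A^k\psi_b\Big\|_{L^2(|y|\le2B_1)}\le C\,b_1^{m+1}|\log b_1|^{p}\quad(m\le L+1),$$ $$\Big\|\frac{1+|\log y|}{1+y^{m-k}}\mathcal A^k\dot\psi_b\Big\|_{L^2(|y|\le2B_1)}\le C\,b_1^{m+2}|\log b_1|^{p}\quad(m\le L);$$ 3. (improved local bound) for $2\le k\le L+1$, $$\|\mathcal A^k\psi_b\|_{L^2(|y|\le2M)}+\|\mathcal A^{k-1}\dot\psi_b\|_{L^2(|y|\le2M)}\le C(M)\,b_1^{L+3}.$$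 -/

import Mathlib

open Set Filter Topology MeasureTheory
open scoped ContDiff ENNReal

noncomputable section

namespace WaveMap

/-! ### The 1-corotational wave map flow near the harmonic map -/

/-- The harmonic map `Q(y) = 2 arctan y`. -/
def Q (y : ℝ) : ℝ := 2 * Real.arctan y

/-- The nonlinearity `f(u) = sin(2u) / 2`. -/
def nonlin (u : ℝ) : ℝ := Real.sin (2 * u) / 2

/-- The scaling generator `Λ = y ∂_y`. -/
def Lam (f : ℝ → ℝ) (y : ℝ) : ℝ := y * deriv f y

/-- The scaling generator `Λ₀ = 1 + y ∂_y`. -/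
def Lam0 (f : ℝ → ℝ) (y : ℝ) : ℝ := f y + y * deriv f y

/-- The vector scaling generator `(u, v) ↦ (Λ u, Λ₀ v)`. -/
def LamVec (u : ℝ → ℝ × ℝ) (y : ℝ) : ℝ × ℝ :=
  (Lam (fun x => (u x).1) y, Lam0 (fun x => (u x).2) y)

/-- The flow `F(u, v) = (v, u'' + u' / y - f(u) / y²)`. -/
def F (u : ℝ → ℝ × ℝ) (y : ℝ) : ℝ × ℝ :=
  ((u y).2,
    deriv (deriv (fun x => (u x).1)) y + deriv (fun x => (u x).1) y / y
      - nonlin (u y).1 / y ^ 2)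

/-- The resonance `ΛQ(y) = 2y / (1 + y²)`; it is `Lam Q`, see `Lam_Q`. -/
def LamQ (y : ℝ) : ℝ := 2 * y / (1 + y ^ 2)

theorem Lam_Q : Lam Q = LamQ := by
  funext y
  have h : HasDerivAt Q (2 * (1 / (1 + y ^ 2))) y :=
    (Real.hasDerivAt_arctan y).const_mul 2
  unfold Lam LamQ
  rw [h.deriv]
  ring

/-- The potential `Z(y) = (1 - y²) / (1 + y²)` of the factorization `H = A* A`. -/
def Z (y : ℝ) : ℝ := (1 - y ^ 2) / (1 + y ^ 2)

/-- `A = -∂_y + Z / y`. -/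
def opA (f : ℝ → ℝ) (y : ℝ) : ℝ := -deriv f y + Z y / y * f y

/-- `A* = ∂_y + (1 + Z) / y`. -/
def opAstar (f : ℝ → ℝ) (y : ℝ) : ℝ := deriv f y + (1 + Z y) / y * f y

/-- The adapted derivatives `f_k = 𝒜^k f`: `f_0 = f`, `f_{k+1} = A f_k` for even `k` and
`f_{k+1} = A* f_k` for odd `k`. -/
def adapted : ℕ → (ℝ → ℝ) → ℝ → ℝ
  | 0, f => f
  | k + 1, f => if Even k then opA (adapted k f) else opAstar (adapted k f)

/-- The second (singular) element `Γ` of the kernel of `H` on `y > 0`. -/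
def Gam (y : ℝ) : ℝ := LamQ y * ∫ x in (1 : ℝ)..y, 1 / (x * LamQ x ^ 2)

/-- The formal inverse of `H`, normalized at the origin. -/
def Hinv (f : ℝ → ℝ) (y : ℝ) : ℝ :=
  LamQ y * (∫ x in (0 : ℝ)..y, f x * Gam x * x)
    - Gam y * ∫ x in (0 : ℝ)..y, f x * LamQ x * x

/-- The inverse `(u, v) ↦ (H⁻¹ v, -u)` of the matrix operator `𝐇 (u, v) = (-v, H u)`. -/
def HHinv (u : ℝ → ℝ × ℝ) (y : ℝ) : ℝ × ℝ := (Hinv (fun x => (u x).2) y, -(u y).1)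

/-- The generalized kernel `T_i = (-𝐇)^{-i} (ΛQ, 0)`. -/
def T : ℕ → ℝ → ℝ × ℝ
  | 0 => fun y => (LamQ y, 0)
  | i + 1 => fun y => -HHinv (T i) y

/-- `⟨u, v⟩ = ∫₀^∞ u v y dy`. -/
def radInner (u v : ℝ → ℝ) : ℝ := ∫ y in Ioi (0 : ℝ), u y * v y * y

/-- The norm of `L²(|y| ≤ R)` for radial functions, with values in `[0, ∞]`. -/
def radNorm (R : ℝ) (f : ℝ → ℝ) : ℝ≥0∞ :=
  (∫⁻ y in Ioc (0 : ℝ) R, ENNReal.ofReal (f y ^ 2 * y)) ^ (1 / 2 : ℝ)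

/-- `B₀ = 1 / b₁`. -/
def B0 (b₁ : ℝ) : ℝ := 1 / b₁

/-- `B₁ = |log b₁|^γ / b₁` with `γ = 1 + (ℓ mod 2)`. -/
def B1 (ℓ : ℕ) (b₁ : ℝ) : ℝ := |Real.log b₁| ^ (1 + ℓ % 2) / b₁

/-- `⟨χ_{B₀/4} ΛQ, ΛQ⟩`, where `χ_B(y) = χ(y / B)`. -/
def cutMass (χ : ℝ → ℝ) (b₁ : ℝ) : ℝ :=
  radInner (fun y => χ (y / (B0 b₁ / 4)) * LamQ y) LamQ

/-- The constants `c_{b₁,i}`. -/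
def cMod (χ : ℝ → ℝ) (b₁ : ℝ) (i : ℕ) : ℝ :=
  if i = 1 then radInner (Lam0 LamQ) LamQ / cutMass χ b₁ else 4 / cutMass χ b₁

/-! ### `b₁`-admissible and homogeneous functions -/

/-- A scalar placed in the coordinate number `ι + 1`, for `ι ∈ {0, 1}`. -/
def place (ι : ℕ) (x : ℝ) : ℝ × ℝ := if ι = 0 then (x, 0) else (0, x)

/-- Expansion at the origin: for all `2p ≥ p₁`,
`f(y) = ∑_{p₁ - ι ≤ k ≤ 2p, k even} c_k y^{k+1} + O(y^{2p+3})` as `y → 0+`, and the same after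
taking derivatives. -/
def OriginExpansion (p₁ ι : ℕ) (f : ℝ → ℝ) : Prop :=
  ∃ c : ℕ → ℝ, ∀ p : ℕ, p₁ ≤ 2 * p → ∀ m : ℕ, m ≤ 2 * p + 3 →
    (iteratedDeriv m (fun x => f x -
        ∑ k ∈ (Finset.range (2 * p + 1)).filter (fun k => p₁ ≤ k + ι ∧ Even k),
          c k * x ^ (k + 1)))
      =O[𝓝[>] (0 : ℝ)] fun y => y ^ (2 * p + 3 - m)

/-- `g_l(b₁, y) = (1 + |log(b₁ y)| 1_{l ≥ 1}) / |log b₁|` on `y ≤ 3 B₀`, and `0` beyond. -/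
def gLog (l : ℤ) (b₁ y : ℝ) : ℝ :=
  if y ≤ 3 * B0 b₁ then
    (1 + if 1 ≤ l then |Real.log (b₁ * y)| else 0) / |Real.log b₁|
  else 0

/-- The weight of the `b₁`-derivatives:
`(1 + |log y| 1_{l ≥ 1}) / |log b₁| + 1_{y ≥ B₀/4}` on `y ≤ 3 B₀`, and `0` beyond.
The second term accounts for the `b₁`-derivatives of cutoffs at the scale `B₀`. -/
def gLogTilde (l : ℤ) (b₁ y : ℝ) : ℝ :=
  if y ≤ 3 * B0 b₁ then
    (1 + if 1 ≤ l then |Real.log y| else 0) / |Real.log b₁|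
      + (if B0 b₁ / 4 ≤ y then 1 else 0)
  else 0

/-- `1_{p₂ ≥ k + 3 + ι, y ≥ 3 B₀}`. -/
def farInd (p₂ : ℤ) (k ι : ℕ) (b₁ y : ℝ) : ℝ :=
  if (k : ℤ) + 3 + ι ≤ p₂ ∧ 3 * B0 b₁ ≤ y then 1 else 0

/-- The scalar conditions in the definition of a `b₁`-admissible function of degree
`(p₁, p₂, ι)`, for `0 < b₁ < b₀`. -/
structure ScalarAdmissible (b₀ : ℝ) (p₁ : ℕ) (p₂ : ℤ) (ι : ℕ) (f : ℝ → ℝ → ℝ) : Prop where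
  smooth : ContDiffOn ℝ ∞ (fun z : ℝ × ℝ => f z.1 z.2) (Ioo 0 b₀ ×ˢ Ici 0)
  /-- Near the origin `f` is a finite sum of functions `h(b₁) φ(y)`. -/
  origin : ∃ (n : ℕ) (h φ : Fin n → ℝ → ℝ),
    (∀ j, ContDiffOn ℝ ∞ (h j) (Ioo 0 b₀)) ∧
    (∀ j, ∀ l : ℕ, ∃ C : ℝ, ∀ b₁ ∈ Ioo 0 b₀, |iteratedDeriv l (h j) b₁| ≤ C / b₁ ^ l) ∧
    (∀ j, ContDiffOn ℝ ∞ (φ j) (Ici 0)) ∧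
    (∀ j, OriginExpansion p₁ ι (φ j)) ∧
    ∀ b₁ ∈ Ioo 0 b₀, ∀ y ∈ Icc (0 : ℝ) 1, f b₁ y = ∑ j, h j b₁ * φ j y
  /-- Bounds for `y ≥ 1` on the adapted derivatives and on their `b₁`-derivatives. -/
  far : ∃ c : ℝ, 0 < c ∧
    (∀ k : ℕ, ∃ C : ℝ, ∀ b₁ ∈ Ioo 0 b₀, ∀ y : ℝ, 1 ≤ y →
      |adapted k (f b₁) y| ≤ C * y ^ (p₂ - k - 1 - ι) *
        (gLog (p₂ - k - ι) b₁ y + (1 + |Real.log y|) ^ c / y ^ 2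
          + farInd p₂ k ι b₁ y / (y ^ 2 * b₁ ^ 2 * |Real.log b₁|))) ∧
    (∀ k l : ℕ, 1 ≤ l → ∃ C : ℝ, ∀ b₁ ∈ Ioo 0 b₀, ∀ y : ℝ, 1 ≤ y →
      |iteratedDeriv l (fun β => adapted k (f β) y) b₁| ≤
        C * (y ^ (p₂ - k - 1 - ι) / (b₁ ^ l * |Real.log b₁|)) *
          (gLogTilde (p₂ - k - ι) b₁ y + (1 + |Real.log y|) ^ c / y ^ 2
            + farInd p₂ k ι b₁ y / (y ^ 2 * b₁ ^ 2)))

/-- `b₁`-admissible vector functions of degree `(p₁, p₂, ι)`, for `0 < b₁ < b₀`. -/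
def Admissible (b₀ : ℝ) (p₁ : ℕ) (p₂ : ℤ) (ι : ℕ) (f : ℝ → ℝ → ℝ × ℝ) : Prop :=
  ∃ g : ℝ → ℝ → ℝ, ScalarAdmissible b₀ p₁ p₂ ι g ∧
    ∀ b₁ ∈ Ioo 0 b₀, ∀ y : ℝ, 0 ≤ y → f b₁ y = place ι (g b₁ y)

/-- The coordinate `b_k`, for `1 ≤ k ≤ L`, of `b = (b_1, …, b_L)`, and `0` for other `k`. The entry
of `b` with index `i : Fin L` is `b_{i+1}`. -/
def coord {L : ℕ} (b : Fin L → ℝ) (k : ℕ) : ℝ :=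
  if h : 1 ≤ k ∧ k ≤ L then b ⟨k - 1, by omega⟩ else 0

/-- The parameters `b` with `0 < b_1 < b₀`. -/
def dom (L : ℕ) (b₀ : ℝ) : Set (Fin L → ℝ) := {b | 0 < coord b 1 ∧ coord b 1 < b₀}

/-- Homogeneous functions of degree `(p₁, p₂, ι, p₃)`: finite sums of terms
`b_1^{J_1} ⋯ b_L^{J_L} s(b_1, y)` with `∑ k J_k = p₃` and `s` a `b₁`-admissible function of degree
`(p₁, p₂, ι)`. Since `b_1 > 0`, the exponent `J_1` may be negative; the others are not. -/
def Homogeneous {L : ℕ} (b₀ : ℝ) (p₁ : ℕ) (p₂ : ℤ) (ι p₃ : ℕ)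
    (S : (Fin L → ℝ) → ℝ → ℝ × ℝ) : Prop :=
  ∃ (n : ℕ) (J : Fin n → Fin L → ℤ) (s : Fin n → ℝ → ℝ → ℝ × ℝ),
    (∀ m, Admissible b₀ p₁ p₂ ι (s m)) ∧
    (∀ (m : Fin n) (k : Fin L), 1 ≤ (k : ℕ) → 0 ≤ J m k) ∧
    (∀ m, ∑ k : Fin L, ((k : ℤ) + 1) * J m k = p₃) ∧
    ∀ b ∈ dom L b₀, ∀ y : ℝ, 0 ≤ y →
      S b y = ∑ m, (∏ k, b k ^ J m k) • s m (coord b 1) y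

/-! ### The approximate profile -/

/-- `L` is the smallest odd integer `≥ ℓ`. -/
def bigL (ℓ : ℕ) : ℕ := ℓ + (ℓ + 1) % 2

/-- The partial derivative of `S(b, y)` in the entry of `b` with index `i`. -/
def partialB {L : ℕ} (i : Fin L) (S : (Fin L → ℝ) → ℝ → ℝ × ℝ) (b : Fin L → ℝ) (y : ℝ) : ℝ × ℝ :=
  deriv (fun t => S (Function.update b i t) y) (b i)

/-- `Q_b = (Q, 0) + ∑_{i=1}^L b_i T_i + ∑_{i=2}^{L+2} S_i(b)`. -/
def profile {L : ℕ} (S : ℕ → (Fin L → ℝ) → ℝ → ℝ × ℝ) (b : Fin L → ℝ) (y : ℝ) : ℝ × ℝ :=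
  (Q y, 0) + ∑ i ∈ Finset.Icc 1 L, coord b i • T i y + ∑ i ∈ Finset.Icc 2 (L + 2), S i b y

/-- The modulation term
`∑_{i=1}^L ((b_i)_s + (i - 1 + c_{b₁,i}) b_1 b_i - b_{i+1}) (T_i + ∑_{j=i+1}^{L+2} ∂S_j/∂b_i)`,
with `b_{L+1} = 0`, where `b'` stands for `b_s`. The summation index is `i - 1`. -/
def modTerm {L : ℕ} (χ : ℝ → ℝ) (S : ℕ → (Fin L → ℝ) → ℝ → ℝ × ℝ) (b b' : Fin L → ℝ) (y : ℝ) :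
    ℝ × ℝ :=
  ∑ i : Fin L,
    (b' i + ((i : ℝ) + cMod χ (coord b 1) (i + 1)) * coord b 1 * b i - coord b (i + 2)) •
      (T (i + 1) y + ∑ j ∈ Finset.Icc ((i : ℕ) + 2) (L + 2), partialB i (S j) b y)

end WaveMap

end

/-!
Everything is computed in the variable `σ = 1 + y²`. On functions `y F(σ)` and `y² F(σ)` the operators
`A` and `A^*` become first order operators `stepE` and `stepO` in `σ`, built from the Euler derivative
`eul = σ ∂_σ` (`adapted_eq_adS`), and `H⁻¹` becomes an explicit iterated average `regInv` along segments
issuing from `σ = 1`. It is a right inverse of `stepO ∘ stepE` (`stepO_stepE_regInv`) that keeps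
smoothness at the origin, gains one order of vanishing there and one power of `σ` at infinity. The
generalized kernel is `T_{2r} = (y τ_r, 0)`, `T_{2r+1} = (0, y τ_r)` with
`τ_r = σ^{r-1} (t + θ log σ)` up to lower order (`exists_tau_eq`).

The corrections are `S_i = y χ(b₁² σ) u_i`, placed in the coordinate given by the parity of `i`; the
`u_i` are determined recursively by collecting the terms of homogeneity `i` in the equation (`errX`):
`u_i = errX` for odd `i`, where the first component is solved, and `u_i = -regInv errX` for even `i`,
where the second one is. The nonlinearity enters through its Taylor polynomial. The linear
source term from `b_{2r}` or `b_{2r+1}`, `r ≥ 1`, is `σ^{r-1} (2θ - c_{b₁} (t + θ log σ))` to leading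
order. As
`c_{b₁} = 4 / ⟨χ_{B₀/4} ΛQ, ΛQ⟩` equals `1 / |log b₁|` up to a relative error `O(1 / |log b₁|)`
(`exists_modCoef`), this is `σ^{r-1} O((1 + |log (b₁² σ)|) / |log b₁|)`: the modulation constants
make the logarithms balance at `σ ∼ b₁^{-2}`. For `b₁` itself the logarithm appears only after applying
`regInv`, and `⟨Λ₀ΛQ, ΛQ⟩ = 2` makes it balance too. The spaces `Asy (balSys hc)` encode this balance as a
linear condition on the coefficients of the leading term, stable under `eul`, `b₁ ∂_{b₁}` and `regInv`,
so that it propagates through the recursion (`cor_mem`); the adapted derivatives and the derivatives in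
`b₁` gain exactly as admissibility demands, because the operators annihilate the logarithm when
it would become critical. Cutting off at `b₁² σ ∼ 1` costs nothing, the balanced leading terms having
the size `1 / |log b₁|` there. This gives homogeneity (`homogeneous_corS`).

The error `ψ` is what remains in the equation once the modulation terms are taken out
(`profile_equation`). For `b₁² σ < 1` the cut-off equals one, the first component vanishes and the second
one consists of terms of homogeneity at least `L + 3`: `b₁ Λ₀ S_{L+2}`, the modulation of `S_{L+2}`, and
the Taylor remainder. For `b₁² σ ≥ 1` no cancellation between the pieces is needed, since each of
them is already small by balance or by a spare power of `b₁`. In both regions the squares of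
the adapted derivatives are bounded by a power of `σ` times the weight
`errW = |log b₁|^{-2} logMaj(b₁² σ) + σ^{-3/2}` (`exists_psiOne_sq_bound`, `exists_psiTwo_sq_bound`),
whose two parts are integrable on the scales `σ ∼ b₁^{-2}` and `σ ∼ 1`; integrating it gives the norms
(`radNorm_adapted_le`). The powers of `|log b₁|` lost at low order come from `B₁`. The local bounds follow
because `b^*(M)` is small enough for `|y| ≤ 2M` to lie in the region `b₁² σ < 1`.
-/

noncomputable section

namespace WaveMap

open Real
open Finset (sum_congr mul_sum sum_add_distrib sum_sub_distrib sum_insert prod_congr sum_eq_zero range)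
open Submodule (smul_mem span_induction span_mono subset_span)
open Function (update)
open ENNReal (ofReal)
open intervalIntegral (integral_eq_sub_of_hasDerivAt)

/-! ### Integrals depending smoothly on a parameter -/

theorem hasDerivAt_integral_of_contDiffOn {V : Set (ℝ × ℝ)} (hV : IsOpen V) {U : Set ℝ}
    (hU : IsOpen U) {a b : ℝ} (hab : a ≤ b) (hUV : U ×ˢ Icc a b ⊆ V) {f : ℝ → ℝ → ℝ}
    (hf : ContDiffOn ℝ ∞ (fun z : ℝ × ℝ => f z.1 z.2) V) {x : ℝ} (hx : x ∈ U) :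
    HasDerivAt (fun x => ∫ t in a..b, f x t)
      (∫ t in a..b, fderiv ℝ (fun z : ℝ × ℝ => f z.1 z.2) (x, t) (1, 0)) x := by
  have hd : ∀ z ∈ V, HasFDerivAt (fun z : ℝ × ℝ => f z.1 z.2)
      (fderiv ℝ (fun z : ℝ × ℝ => f z.1 z.2) z) z := fun z hz =>
    ((hf.contDiffAt (hV.mem_nhds hz)).differentiableAt (by simp)).hasFDerivAt
  have hcf : ContinuousOn (fun z : ℝ × ℝ => fderiv ℝ (fun z : ℝ × ℝ => f z.1 z.2) z (1, 0)) V := by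
    have : ContDiffOn ℝ ∞ (fderiv ℝ (fun z : ℝ × ℝ => f z.1 z.2)) V :=
      hf.fderiv_of_isOpen hV (by simp)
    exact this.continuousOn.clm_apply continuousOn_const
  obtain ⟨ε, hε, hball⟩ := Metric.nhds_basis_closedBall.mem_iff.1 (hU.mem_nhds hx)
  have hK : IsCompact (Metric.closedBall x ε ×ˢ Icc a b) :=
    (isCompact_closedBall x ε).prod isCompact_Icc
  have hKV : Metric.closedBall x ε ×ˢ Icc a b ⊆ V := (prod_mono hball subset_rfl).trans hUV
  obtain ⟨C, hC⟩ := hK.exists_bound_of_continuousOn (hcf.mono hKV)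
  have hcurve : ∀ y ∈ U, ContinuousOn (fun t => (y, t)) (Icc a b) := fun y _ => by fun_prop
  have hmaps : ∀ y ∈ U, MapsTo (fun t => ((y, t) : ℝ × ℝ)) (Icc a b) V := fun y hy t ht =>
    hUV ⟨hy, ht⟩
  have hfc : ∀ y ∈ U, ContinuousOn (fun t => f y t) (Icc a b) := fun y hy =>
    hf.continuousOn.comp (hcurve y hy) (hmaps y hy)
  have hIoc : uIoc a b ⊆ Icc a b := by rw [uIoc_of_le hab]; exact Ioc_subset_Icc_self
  refine (intervalIntegral.hasDerivAt_integral_of_dominated_loc_of_deriv_le (μ := volume)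
    (F := f) (F' := fun y t => fderiv ℝ (fun z : ℝ × ℝ => f z.1 z.2) (y, t) (1, 0))
    (bound := fun _ => C) (Metric.closedBall_mem_nhds x hε) ?_ ?_ ?_ ?_ ?_ ?_).2
  · filter_upwards [hU.mem_nhds hx] with y hy
    exact ((hfc y hy).mono hIoc).aestronglyMeasurable measurableSet_uIoc
  · exact ContinuousOn.intervalIntegrable (by rw [uIcc_of_le hab]; exact hfc x hx)
  · exact ((hcf.comp (hcurve x hx) (hmaps x hx)).mono hIoc).aestronglyMeasurable measurableSet_uIoc
  · exact Eventually.of_forall fun t ht y hy => hC (y, t) ⟨hy, hIoc ht⟩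
  · exact intervalIntegrable_const
  · refine Eventually.of_forall fun t ht y hy => ?_
    have h1 : HasDerivAt (fun y : ℝ => ((y, t) : ℝ × ℝ)) (1, 0) y :=
      (hasDerivAt_id y).prodMk (hasDerivAt_const y t)
    exact (hd (y, t) (hKV ⟨hy, hIoc ht⟩)).comp_hasDerivAt y h1

theorem contDiffOn_integral_param {V : Set (ℝ × ℝ)} (hV : IsOpen V) {U : Set ℝ}
    (hU : IsOpen U) {a b : ℝ} (hab : a ≤ b) (hUV : U ×ˢ Icc a b ⊆ V) {f : ℝ → ℝ → ℝ}
    (hf : ContDiffOn ℝ ∞ (fun z : ℝ × ℝ => f z.1 z.2) V) :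
    ContDiffOn ℝ ∞ (fun x => ∫ t in a..b, f x t) U := by
  rw [contDiffOn_infty]
  intro n
  induction n generalizing f with
  | zero =>
    exact contDiffOn_zero.2 fun x hx =>
      (hasDerivAt_integral_of_contDiffOn hV hU hab hUV hf hx).continuousAt.continuousWithinAt
  | succ n ih =>
    rw [show ((n + 1 : ℕ) : WithTop ℕ∞) = (n : WithTop ℕ∞) + 1 by push_cast; rfl,
      contDiffOn_succ_iff_deriv_of_isOpen hU]
    refine ⟨fun x hx => (hasDerivAt_integral_of_contDiffOn hV hU hab hUV hf
      hx).differentiableAt.differentiableWithinAt, by simp, ?_⟩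
    have h2 : ContDiffOn ℝ ∞ (fun z : ℝ × ℝ =>
        fderiv ℝ (fun z : ℝ × ℝ => f z.1 z.2) (z.1, z.2) (1, 0)) V :=
      (hf.fderiv_of_isOpen hV (by simp)).clm_apply contDiffOn_const
    refine (ih (f := fun x t =>
      fderiv ℝ (fun z : ℝ × ℝ => f z.1 z.2) (x, t) (1, 0)) h2).congr fun x hx => ?_
    exact (hasDerivAt_integral_of_contDiffOn hV hU hab hUV hf hx).deriv

/-- The fundamental theorem of calculus along the segment from `a` to `x`. -/
theorem segment_integral {a x : ℝ} {F F' : ℝ → ℝ}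
    (hF : ∀ t ∈ Icc (0 : ℝ) 1, HasDerivAt F (F' (a + t * (x - a))) (a + t * (x - a)))
    (hc : ContinuousOn (fun t => F' (a + t * (x - a))) (Icc 0 1)) :
    (x - a) * ∫ t in (0 : ℝ)..1, F' (a + t * (x - a)) = F x - F a := by
  rw [← uIcc_of_le zero_le_one] at hF hc
  have h2 : ∀ t : ℝ, HasDerivAt (fun t => a + t * (x - a)) (x - a) t := fun t => by
    simpa using ((hasDerivAt_id t).mul_const (x - a)).const_add a
  rw [mul_comm, ← intervalIntegral.integral_mul_const, integral_eq_sub_of_hasDerivAt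
    (fun t ht => (hF t ht).comp t (h2 t)) (hc.mul continuousOn_const).intervalIntegrable]
  simp

/-- Hadamard's lemma. -/
theorem exists_contDiffOn_sub_mul {U : Set ℝ} (hU : IsOpen U) (hc : Convex ℝ U) {a : ℝ}
    (ha : a ∈ U) {F : ℝ → ℝ} (hF : ContDiffOn ℝ ∞ F U) :
    ∃ G : ℝ → ℝ, ContDiffOn ℝ ∞ G U ∧ ∀ x ∈ U, F x = F a + (x - a) * G x := by
  have hF' : ContDiffOn ℝ ∞ (deriv F) U := ((contDiffOn_infty_iff_deriv_of_isOpen hU).1 hF).2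
  have hcm : Continuous fun z : ℝ × ℝ => a + z.2 * (z.1 - a) := by fun_prop
  have hsm : ContDiff ℝ ∞ fun z : ℝ × ℝ => a + z.2 * (z.1 - a) := by fun_prop
  have hmem : ∀ x ∈ U, ∀ t ∈ Icc (0 : ℝ) 1, a + t * (x - a) ∈ U := fun x hx t ht => by
    have := hc ha hx (sub_nonneg.2 ht.2) ht.1 (by ring)
    simpa [show (1 - t) * a + t * x = a + t * (x - a) by ring] using this
  refine ⟨fun x => ∫ t in (0 : ℝ)..1, deriv F (a + t * (x - a)),
    contDiffOn_integral_param (V := (fun z : ℝ × ℝ => a + z.2 * (z.1 - a)) ⁻¹' U)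
      (hU.preimage hcm) hU zero_le_one (fun z hz => hmem z.1 hz.1 z.2 hz.2)
      (hF'.comp hsm.contDiffOn fun z hz => hz), fun x hx => ?_⟩
  rw [segment_integral (fun t ht => ((hF.contDiffAt (hU.mem_nhds (hmem x hx t ht))).differentiableAt
    (by simp)).hasDerivAt) (hF'.continuousOn.comp (by fun_prop) (hmem x hx))]
  ring

/-! ### Weighted averages along segments from the point `1` -/

/-- Smooth functions on the half-line `σ > 0`. -/
def SmoothPos (F : ℝ → ℝ) : Prop := ContDiffOn ℝ ∞ F (Ioi 0)

theorem SmoothPos.deriv {F : ℝ → ℝ} (h : SmoothPos F) : SmoothPos (deriv F) :=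
  ((contDiffOn_infty_iff_deriv_of_isOpen isOpen_Ioi).1 h).2

theorem SmoothPos.hasDerivAt {F : ℝ → ℝ} (h : SmoothPos F) {s : ℝ} (hs : 0 < s) :
    HasDerivAt F (_root_.deriv F s) s :=
  ((h.contDiffAt (isOpen_Ioi.mem_nhds hs)).differentiableAt (by simp)).hasDerivAt

theorem SmoothPos.congr {F G : ℝ → ℝ} (h : SmoothPos F) (hG : ∀ s, 0 < s → G s = F s) :
    SmoothPos G :=
  ContDiffOn.congr h fun s hs => hG s hs

theorem deriv_congr_pos {F G : ℝ → ℝ} (h : ∀ s, 0 < s → F s = G s) {s : ℝ} (hs : 0 < s) :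
    deriv F s = deriv G s :=
  Filter.EventuallyEq.deriv_eq (eventuallyEq_of_mem (isOpen_Ioi.mem_nhds hs) h)

/-- The average `∫₀¹ t^v G(1 + t (σ - 1)) dt`; thus
`(σ - 1)^(v+1) avg v G σ = ∫₁^σ (s - 1)^v G(s) ds`. -/
def avg (v : ℕ) (G : ℝ → ℝ) (s : ℝ) : ℝ := ∫ t in (0 : ℝ)..1, t ^ v * G (1 + t * (s - 1))

theorem segment_pos {s t : ℝ} (hs : 0 < s) (ht : t ∈ Icc (0 : ℝ) 1) : 0 < 1 + t * (s - 1) := by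
  rcases ht.1.eq_or_lt with h | h
  · simp [← h]
  · nlinarith [ht.2, mul_pos h hs]

theorem avg_congr {v : ℕ} {F G : ℝ → ℝ} (h : ∀ s, 0 < s → F s = G s) {s : ℝ} (hs : 0 < s) :
    avg v F s = avg v G s := by
  refine intervalIntegral.integral_congr fun t ht => ?_
  rw [uIcc_of_le zero_le_one] at ht
  simp only [h _ (segment_pos hs ht)]

theorem SmoothPos.continuousOn_segment {G : ℝ → ℝ} (hG : SmoothPos G) {s : ℝ} (hs : 0 < s) :
    ContinuousOn (fun t => G (1 + t * (s - 1))) (Icc 0 1) :=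
  hG.continuousOn.comp (by fun_prop) fun _ ht => segment_pos hs ht

theorem SmoothPos.avg_integrable {G : ℝ → ℝ} (hG : SmoothPos G) (v : ℕ) {s : ℝ} (hs : 0 < s) :
    IntervalIntegrable (fun t => t ^ v * G (1 + t * (s - 1))) volume 0 1 := by
  refine ContinuousOn.intervalIntegrable ?_
  rw [uIcc_of_le zero_le_one]
  exact (by fun_prop : Continuous fun t : ℝ => t ^ v).continuousOn.mul (hG.continuousOn_segment hs)

theorem SmoothPos.avg {G : ℝ → ℝ} (hG : SmoothPos G) (v : ℕ) : SmoothPos (avg v G) := by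
  have hcm : Continuous fun z : ℝ × ℝ => 1 + z.2 * (z.1 - 1) := by fun_prop
  refine contDiffOn_integral_param
    (V := (fun z : ℝ × ℝ => 1 + z.2 * (z.1 - 1)) ⁻¹' Ioi 0) (isOpen_Ioi.preimage hcm) isOpen_Ioi
    zero_le_one (fun z hz => segment_pos hz.1 hz.2) ?_
  have h1 : ContDiff ℝ ∞ fun z : ℝ × ℝ => z.2 ^ v := by fun_prop
  have h2 : ContDiff ℝ ∞ fun z : ℝ × ℝ => 1 + z.2 * (z.1 - 1) := by fun_prop
  exact h1.contDiffOn.mul (ContDiffOn.comp hG h2.contDiffOn fun z hz => hz)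

theorem deriv_avg {G : ℝ → ℝ} (hG : SmoothPos G) (v : ℕ) {s : ℝ} (hs : 0 < s) :
    deriv (avg v G) s = avg (v + 1) (deriv G) s := by
  have hcm : Continuous fun z : ℝ × ℝ => 1 + z.2 * (z.1 - 1) := by fun_prop
  have h1 : ContDiff ℝ ∞ fun z : ℝ × ℝ => z.2 ^ v := by fun_prop
  have h2 : ContDiff ℝ ∞ fun z : ℝ × ℝ => 1 + z.2 * (z.1 - 1) := by fun_prop
  have hsm : ContDiffOn ℝ ∞ (fun z : ℝ × ℝ => z.2 ^ v * G (1 + z.2 * (z.1 - 1)))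
      ((fun z : ℝ × ℝ => 1 + z.2 * (z.1 - 1)) ⁻¹' Ioi 0) :=
    h1.contDiffOn.mul (ContDiffOn.comp hG h2.contDiffOn fun z hz => hz)
  refine ((hasDerivAt_integral_of_contDiffOn (isOpen_Ioi.preimage hcm) isOpen_Ioi zero_le_one
    (fun z hz => segment_pos hz.1 hz.2) hsm (mem_Ioi.2 hs)).deriv).trans ?_
  refine intervalIntegral.integral_congr fun t ht => ?_
  rw [uIcc_of_le zero_le_one] at ht
  have hz : ((s, t) : ℝ × ℝ) ∈ (fun z : ℝ × ℝ => 1 + z.2 * (z.1 - 1)) ⁻¹' Ioi 0 :=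
    segment_pos hs ht
  have hd := ((hsm.contDiffAt ((isOpen_Ioi.preimage hcm).mem_nhds hz)).differentiableAt
    (by simp)).hasFDerivAt
  have hl : HasDerivAt (fun y : ℝ => ((y, t) : ℝ × ℝ)) (1, 0) s :=
    (hasDerivAt_id s).prodMk (hasDerivAt_const s t)
  have e1 := hd.comp_hasDerivAt s hl
  have h3 : HasDerivAt (fun y => 1 + t * (y - 1)) t s := by
    simpa using (((hasDerivAt_id s).sub_const 1).const_mul t).const_add 1
  have e2 := ((hG.hasDerivAt (segment_pos hs ht)).comp s h3).const_mul (t ^ v)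
  have := e1.unique e2
  simp only [this]
  ring

theorem avg_add {F G : ℝ → ℝ} (hF : SmoothPos F) (hG : SmoothPos G) (v : ℕ) {s : ℝ}
    (hs : 0 < s) : avg v (fun x => F x + G x) s = avg v F s + avg v G s := by
  rw [avg, avg, avg, ← intervalIntegral.integral_add (hF.avg_integrable v hs)
    (hG.avg_integrable v hs)]
  simp only [mul_add]

theorem avg_const_mul (a : ℝ) (F : ℝ → ℝ) (v : ℕ) (s : ℝ) :
    avg v (fun x => a * F x) s = a * avg v F s := by
  rw [avg, avg, ← intervalIntegral.integral_const_mul]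
  exact intervalIntegral.integral_congr fun t _ => by ring

theorem avg_pow_mul (v m : ℕ) (G : ℝ → ℝ) (s : ℝ) :
    avg v (fun x => (x - 1) ^ m * G x) s = (s - 1) ^ m * avg (v + m) G s := by
  rw [avg, avg, ← intervalIntegral.integral_const_mul]
  refine intervalIntegral.integral_congr fun t _ => ?_
  simp only [add_sub_cancel_left, mul_pow]
  ring

/-- Averages solve a first-order equation that is singular at the point `1`. -/
theorem avg_eq_of_ode {Y G : ℝ → ℝ} (hY : SmoothPos Y) (hG : SmoothPos G) (v : ℕ)
    (h : ∀ s, 0 < s → (s - 1) * deriv Y s + (v + 1) * Y s = G s) {s : ℝ} (hs : 0 < s) :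
    avg v G s = Y s := by
  have hder : ∀ t ∈ uIcc (0 : ℝ) 1, HasDerivAt (fun t => t ^ (v + 1) * Y (1 + t * (s - 1)))
      (t ^ v * G (1 + t * (s - 1))) t := fun t ht => by
    rw [uIcc_of_le zero_le_one] at ht
    have h2 : HasDerivAt (fun t => 1 + t * (s - 1)) (s - 1) t := by
      simpa using ((hasDerivAt_id t).mul_const (s - 1)).const_add 1
    refine ((hasDerivAt_pow (v + 1) t).mul
      ((hY.hasDerivAt (segment_pos hs ht)).comp t h2)).congr_deriv ?_
    rw [← h _ (segment_pos hs ht)]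
    simp [add_tsub_cancel_right]
    ring
  rw [avg, integral_eq_sub_of_hasDerivAt hder (hG.avg_integrable v hs)]
  simp

theorem avg_ode {G : ℝ → ℝ} (hG : SmoothPos G) (v : ℕ) {s : ℝ} (hs : 0 < s) :
    (s - 1) * deriv (avg v G) s + (v + 1) * avg v G s = G s := by
  have h1 : SmoothPos fun x => (x - 1) ^ 1 * deriv G x :=
    (by fun_prop : ContDiff ℝ ∞ fun x : ℝ => (x - 1) ^ 1).contDiffOn.mul hG.deriv
  have h2 : SmoothPos fun x => ((v : ℝ) + 1) * G x := contDiffOn_const.mul hG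
  rw [deriv_avg hG v hs, ← pow_one (s - 1), ← avg_pow_mul, ← avg_const_mul, ← avg_add h1 h2 v hs,
    avg_eq_of_ode hG (h1.add h2) v (fun s _ => by ring) hs]

/-- The fundamental theorem of calculus along the segment. -/
theorem mul_avg_zero {U g : ℝ → ℝ} (hg : SmoothPos g) (hU : ∀ x, 0 < x → HasDerivAt U (g x) x)
    {s : ℝ} (hs : 0 < s) : (s - 1) * avg 0 g s = U s - U 1 := by
  simp [avg]
  exact segment_integral (fun t ht => hU _ (segment_pos hs ht)) (hg.continuousOn_segment hs)

/-! ### Symbol estimates for the Euler operator -/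

/-- The Euler operator `x d/dx`. -/
def eul (f : ℝ → ℝ) (x : ℝ) : ℝ := x * deriv f x

/-- A region for symbol estimates: functions depending on a parameter in `P` are smooth on the open
set `dom` and estimated at the points of `reg`. -/
structure SymRegion (P : Type*) where
  /-- the open set on which the functions are smooth -/
  dom : Set ℝ
  /-- the parameters and points at which the estimates hold -/
  reg : Set (P × ℝ)
  isOpen : IsOpen dom
  sub : ∀ p x, (p, x) ∈ reg → x ∈ dom

/-- `f` and its Euler derivatives up to order `n` are bounded on the region by multiples of the
weight `w`. -/
def SymUpTo {P : Type*} (Q : SymRegion P) (w : P → ℝ → ℝ) (n : ℕ) (f : P → ℝ → ℝ) : Prop :=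
  (∀ p, ContDiffOn ℝ ∞ (f p) Q.dom) ∧
    ∀ m ≤ n, ∃ C, 0 ≤ C ∧ ∀ p x, (p, x) ∈ Q.reg → |eul^[m] (f p) x| ≤ C * w p x

/-- `f` and all its Euler derivatives are bounded on the region by multiples of the weight `w`. -/
def Sym {P : Type*} (Q : SymRegion P) (w : P → ℝ → ℝ) (f : P → ℝ → ℝ) : Prop :=
  ∀ n, SymUpTo Q w n f

theorem eul_congr {Ω : Set ℝ} (hΩ : IsOpen Ω) {f g : ℝ → ℝ} (h : ∀ x ∈ Ω, f x = g x) :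
    ∀ x ∈ Ω, eul f x = eul g x := fun x hx => by
  rw [eul, eul, Filter.EventuallyEq.deriv_eq (eventuallyEq_of_mem (hΩ.mem_nhds hx) h)]

theorem eul_iterate_congr {Ω : Set ℝ} (hΩ : IsOpen Ω) (m : ℕ) {f g : ℝ → ℝ}
    (h : ∀ x ∈ Ω, f x = g x) : ∀ x ∈ Ω, eul^[m] f x = eul^[m] g x := by
  induction m generalizing f g with
  | zero => exact h
  | succ m ih => exact ih (eul_congr hΩ h)

theorem contDiffOn_eul {Ω : Set ℝ} (hΩ : IsOpen Ω) {f : ℝ → ℝ} (h : ContDiffOn ℝ ∞ f Ω) :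
    ContDiffOn ℝ ∞ (eul f) Ω :=
  contDiffOn_id.mul ((contDiffOn_infty_iff_deriv_of_isOpen hΩ).1 h).2

theorem contDiffOn_differentiableAt {Ω : Set ℝ} (hΩ : IsOpen Ω) {f : ℝ → ℝ}
    (h : ContDiffOn ℝ ∞ f Ω) {x : ℝ} (hx : x ∈ Ω) : DifferentiableAt ℝ f x :=
  (h.contDiffAt (hΩ.mem_nhds hx)).differentiableAt (by simp)

theorem eul_add_apply {f g : ℝ → ℝ} {x : ℝ} (hf : DifferentiableAt ℝ f x)
    (hg : DifferentiableAt ℝ g x) : eul (fun x => f x + g x) x = eul f x + eul g x := by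
  simp only [eul]; rw [deriv_fun_add hf hg]; ring

theorem eul_mul_apply {f g : ℝ → ℝ} {x : ℝ} (hf : DifferentiableAt ℝ f x)
    (hg : DifferentiableAt ℝ g x) :
    eul (fun x => f x * g x) x = eul f x * g x + f x * eul g x := by
  simp only [eul]; rw [deriv_fun_mul hf hg]; ring

theorem eul_const_mul_apply (a : ℝ) {f : ℝ → ℝ} {x : ℝ} :
    eul (fun x => a * f x) x = a * eul f x := by
  simp only [eul]; rw [deriv_const_mul_field]; ring

namespace SymUpTo

variable {P : Type*} {Q : SymRegion P} {w w₁ w₂ : P → ℝ → ℝ} {n m : ℕ} {f g : P → ℝ → ℝ}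

theorem congr (hf : SymUpTo Q w n f) (h : ∀ p, ∀ x ∈ Q.dom, g p x = f p x) : SymUpTo Q w n g := by
  refine ⟨fun p => (hf.1 p).congr (h p), fun m hm => ?_⟩
  obtain ⟨C, hC, hb⟩ := hf.2 m hm
  refine ⟨C, hC, fun p x hx => ?_⟩
  rw [eul_iterate_congr Q.isOpen m (h p) x (Q.sub p x hx)]
  exact hb p x hx

theorem of_le (hf : SymUpTo Q w n f) (h : m ≤ n) : SymUpTo Q w m f :=
  ⟨hf.1, fun k hk => hf.2 k (hk.trans h)⟩

theorem succ_iff : SymUpTo Q w (n + 1) f ↔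
    SymUpTo Q w 0 f ∧ SymUpTo Q w n (fun p => eul (f p)) := by
  constructor
  · exact fun h => ⟨h.of_le (Nat.zero_le _), fun p => contDiffOn_eul Q.isOpen (h.1 p),
      fun m hm => by simpa using h.2 (m + 1) (by omega)⟩
  · rintro ⟨h0, h1⟩
    refine ⟨h0.1, fun m hm => ?_⟩
    cases m with
    | zero => exact h0.2 0 le_rfl
    | succ m => simpa using h1.2 m (by omega)

theorem mono (hf : SymUpTo Q w n f) {C : ℝ} (hC : 0 ≤ C)
    (h : ∀ p x, (p, x) ∈ Q.reg → w p x ≤ C * w₁ p x) : SymUpTo Q w₁ n f := by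
  refine ⟨hf.1, fun m hm => ?_⟩
  obtain ⟨D, hD, hb⟩ := hf.2 m hm
  refine ⟨D * C, mul_nonneg hD hC, fun p x hx => (hb p x hx).trans ?_⟩
  rw [mul_assoc]
  exact mul_le_mul_of_nonneg_left (h p x hx) hD

theorem bound_zero (h : ∀ p, ContDiffOn ℝ ∞ (f p) Q.dom) {C : ℝ} (hC : 0 ≤ C)
    (hb : ∀ p x, (p, x) ∈ Q.reg → |f p x| ≤ C * w p x) : SymUpTo Q w 0 f :=
  ⟨h, fun m hm => ⟨C, hC, by simpa [Nat.le_zero.1 hm] using hb⟩⟩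

theorem exists_bound (hf : SymUpTo Q w n f) :
    ∃ C, 0 ≤ C ∧ ∀ p x, (p, x) ∈ Q.reg → |f p x| ≤ C * w p x := by
  simpa using hf.2 0 (Nat.zero_le _)

theorem diff (hf : SymUpTo Q w n f) (p : P) {x : ℝ} (hx : x ∈ Q.dom) :
    DifferentiableAt ℝ (f p) x :=
  contDiffOn_differentiableAt Q.isOpen (hf.1 p) hx

theorem add (hf : SymUpTo Q w n f) (hg : SymUpTo Q w n g) :
    SymUpTo Q w n (fun p x => f p x + g p x) := by
  induction n generalizing f g with
  | zero =>
    obtain ⟨C, hC, hb⟩ := hf.exists_bound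
    obtain ⟨D, hD, hc⟩ := hg.exists_bound
    refine bound_zero (fun p => (hf.1 p).add (hg.1 p)) (add_nonneg hC hD) fun p x hx => ?_
    rw [add_mul]
    exact (abs_add_le _ _).trans (add_le_add (hb p x hx) (hc p x hx))
  | succ n ih =>
    exact succ_iff.2 ⟨(ih (hf.of_le n.le_succ) (hg.of_le n.le_succ)).of_le n.zero_le,
      (ih (succ_iff.1 hf).2 (succ_iff.1 hg).2).congr fun p x hx =>
        eul_add_apply (hf.diff p hx) (hg.diff p hx)⟩

theorem mul (hf : SymUpTo Q w₁ n f) (hg : SymUpTo Q w₂ n g) :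
    SymUpTo Q (fun p x => w₁ p x * w₂ p x) n (fun p x => f p x * g p x) := by
  induction n generalizing f g with
  | zero =>
    obtain ⟨C, hC, hb⟩ := hf.exists_bound
    obtain ⟨D, hD, hc⟩ := hg.exists_bound
    refine bound_zero (fun p => (hf.1 p).mul (hg.1 p)) (mul_nonneg hC hD) fun p x hx => ?_
    rw [abs_mul, mul_mul_mul_comm]
    exact mul_le_mul (hb p x hx) (hc p x hx) (abs_nonneg _) ((abs_nonneg _).trans (hb p x hx))
  | succ n ih =>
    have h := ih (hf.of_le n.le_succ) (hg.of_le n.le_succ)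
    exact succ_iff.2 ⟨h.of_le n.zero_le, ((ih (succ_iff.1 hf).2 (hg.of_le n.le_succ)).add
      (ih (hf.of_le n.le_succ) (succ_iff.1 hg).2)).congr fun p x hx =>
        eul_mul_apply (hf.diff p hx) (hg.diff p hx)⟩

theorem const_mul (a : P → ℝ) (hf : SymUpTo Q w n f) :
    SymUpTo Q (fun p x => |a p| * w p x) n (fun p x => a p * f p x) := by
  induction n generalizing f with
  | zero =>
    obtain ⟨C, hC, hb⟩ := hf.exists_bound
    refine bound_zero (fun p => contDiffOn_const.mul (hf.1 p)) hC fun p x hx => ?_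
    rw [abs_mul, mul_left_comm]
    exact mul_le_mul_of_nonneg_left (hb p x hx) (abs_nonneg _)
  | succ n ih =>
    exact succ_iff.2 ⟨(ih (hf.of_le n.le_succ)).of_le n.zero_le, (ih (succ_iff.1 hf).2).congr
      fun p x _ => eul_const_mul_apply (a p)⟩

end SymUpTo

namespace Sym

variable {P : Type*} {Q : SymRegion P} {w w₁ w₂ : P → ℝ → ℝ} {f g : P → ℝ → ℝ}

theorem smooth (hf : Sym Q w f) (p : P) : ContDiffOn ℝ ∞ (f p) Q.dom := (hf 0).1 p

theorem diff (hf : Sym Q w f) (p : P) {x : ℝ} (hx : x ∈ Q.dom) : DifferentiableAt ℝ (f p) x :=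
  (hf 0).diff p hx

theorem exists_bound (hf : Sym Q w f) :
    ∃ C, 0 ≤ C ∧ ∀ p x, (p, x) ∈ Q.reg → |f p x| ≤ C * w p x := (hf 0).exists_bound

theorem congr (hf : Sym Q w f) (h : ∀ p, ∀ x ∈ Q.dom, g p x = f p x) : Sym Q w g :=
  fun n => (hf n).congr h

theorem mono (hf : Sym Q w f) {C : ℝ} (hC : 0 ≤ C)
    (h : ∀ p x, (p, x) ∈ Q.reg → w p x ≤ C * w₁ p x) : Sym Q w₁ f := fun n => (hf n).mono hC h

theorem add (hf : Sym Q w f) (hg : Sym Q w g) : Sym Q w (fun p x => f p x + g p x) :=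
  fun n => (hf n).add (hg n)

theorem mul (hf : Sym Q w₁ f) (hg : Sym Q w₂ g) :
    Sym Q (fun p x => w₁ p x * w₂ p x) (fun p x => f p x * g p x) := fun n => (hf n).mul (hg n)

theorem param_mul (a : P → ℝ) (hf : Sym Q w f) :
    Sym Q (fun p x => |a p| * w p x) (fun p x => a p * f p x) := fun n => (hf n).const_mul a

theorem const_mul (a : ℝ) (hf : Sym Q w f) : Sym Q w (fun p x => a * f p x) :=
  (hf.param_mul fun _ => a).mono (abs_nonneg a) fun _ _ _ => le_rfl

theorem neg (hf : Sym Q w f) : Sym Q w (fun p x => -f p x) :=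
  (hf.const_mul (-1)).congr fun p x _ => by ring

theorem sub (hf : Sym Q w f) (hg : Sym Q w g) : Sym Q w (fun p x => f p x - g p x) :=
  (hf.add hg.neg).congr fun p x _ => by ring

theorem eul (hf : Sym Q w f) : Sym Q w (fun p => eul (f p)) :=
  fun n => (SymUpTo.succ_iff.1 (hf (n + 1))).2

theorem of_eul (h : ∀ p, ContDiffOn ℝ ∞ (f p) Q.dom) {C : ℝ} (hC : 0 ≤ C)
    (hb : ∀ p x, (p, x) ∈ Q.reg → |f p x| ≤ C * w p x) (he : Sym Q w (fun p => WaveMap.eul (f p))) :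
    Sym Q w f := fun n => by
  cases n with
  | zero => exact SymUpTo.bound_zero h hC hb
  | succ n => exact SymUpTo.succ_iff.2 ⟨SymUpTo.bound_zero h hC hb, he n⟩

theorem zero : Sym Q w (fun _ _ => 0) := fun n => by
  induction n with
  | zero => exact SymUpTo.bound_zero (fun p => contDiffOn_const) le_rfl (by simp)
  | succ n ih =>
    refine SymUpTo.succ_iff.2
      ⟨SymUpTo.bound_zero (fun p => contDiffOn_const) le_rfl (by simp), ih.congr fun p x _ => ?_⟩
    simp [WaveMap.eul]

theorem sum {ι : Type*} (s : Finset ι) {F : ι → P → ℝ → ℝ}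
    (h : ∀ i ∈ s, Sym Q w (F i)) :
    Sym Q w (fun p x => ∑ i ∈ s, F i p x) := by
  classical
  induction s using Finset.induction_on with
  | empty => simpa using zero
  | insert a s ha ih =>
    simp only [sum_insert ha]
    exact (h a (Finset.mem_insert_self _ _)).add
      (ih fun i hi => h i (Finset.mem_insert_of_mem hi))

theorem one : Sym Q (fun _ _ => 1) (fun _ _ => (1 : ℝ)) :=
  of_eul (fun p => contDiffOn_const) zero_le_one (by simp)
    (zero.congr fun p x _ => by simp [WaveMap.eul])

theorem const (a : ℝ) : Sym Q (fun _ _ => 1) (fun _ _ => a) := by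
  simpa using (one (Q := Q)).const_mul a

theorem pow (hf : Sym Q w f) (k : ℕ) : Sym Q (fun p x => w p x ^ k) (fun p x => f p x ^ k) := by
  induction k with
  | zero => simpa using one
  | succ k ih => simpa only [pow_succ] using ih.mul hf

/-- The composition of a smooth function with a bounded symbol is a bounded symbol. -/
theorem comp {Φ : ℝ → ℝ} (hΦ : ContDiff ℝ ∞ Φ) (hf : Sym Q (fun _ _ => 1) f) :
    Sym Q (fun _ _ => 1) (fun p x => Φ (f p x)) := fun n => by
  have key : ∀ Φ : ℝ → ℝ, ContDiff ℝ ∞ Φ →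
      SymUpTo Q (fun _ _ => 1) 0 (fun p x => Φ (f p x)) := fun Φ hΦ => by
    obtain ⟨C, hC, hb⟩ := hf.exists_bound
    obtain ⟨D, hD⟩ := (isCompact_Icc (a := -C) (b := C)).exists_bound_of_continuousOn
      hΦ.continuous.continuousOn
    refine SymUpTo.bound_zero (fun p => hΦ.comp_contDiffOn (hf.smooth p)) (le_max_right D 0)
      fun p x hx => ?_
    rw [mul_one]
    exact (hD _ (abs_le.1 (by simpa using hb p x hx))).trans (le_max_left _ _)
  induction n generalizing Φ with
  | zero => exact key Φ hΦ
  | succ n ih =>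
    have hΦ' : ContDiff ℝ ∞ (deriv Φ) := (contDiff_infty_iff_deriv.1 hΦ).2
    refine SymUpTo.succ_iff.2 ⟨key Φ hΦ, ?_⟩
    have h1 := (ih hΦ').mul (hf.eul n)
    simp at h1
    refine h1.congr fun p x hx => ?_
    have h2 := ((hΦ.differentiable (by simp)) (f p x)).hasDerivAt.comp x
      (hf.diff p hx).hasDerivAt
    simp only [WaveMap.eul]
    rw [show deriv (fun x => Φ (f p x)) x = _ from h2.deriv]
    ring

theorem zpow (hQ : ∀ x ∈ Q.dom, 0 < x) (r : ℤ) :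
    Sym Q (fun _ x => x ^ r) (fun _ x => x ^ r) := fun n => by
  have hs : ∀ _ : P, ContDiffOn ℝ ∞ (fun x : ℝ => x ^ r) Q.dom := fun _ x hx =>
    (analyticAt_id.zpow (hQ x hx).ne').contDiffAt.contDiffWithinAt
  have h0 : SymUpTo Q (fun _ x => x ^ r) 0 (fun _ x => x ^ r) :=
    SymUpTo.bound_zero hs zero_le_one fun p x hx => by
      rw [one_mul, abs_of_nonneg (zpow_nonneg (hQ x (Q.sub p x hx)).le _)]
  induction n with
  | zero => exact h0
  | succ n ih =>
    refine SymUpTo.succ_iff.2 ⟨h0, ?_⟩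
    refine ((ih.const_mul fun _ => (r : ℝ)).mono (abs_nonneg (r : ℝ))
      (fun _ _ _ => le_rfl)).congr fun p x hx => ?_
    simp only [WaveMap.eul]
    rw [deriv_zpow, mul_left_comm, ← zpow_one_add₀ (hQ x hx).ne']
    simp

theorem log (hQ : ∀ x ∈ Q.dom, 0 < x) :
    Sym Q (fun _ x => 1 + |log x|) (fun _ x => log x) := by
  refine of_eul (fun p x hx => (contDiffAt_log.2 (hQ x hx).ne').contDiffWithinAt) zero_le_one
    (fun p x hx => ?_) ?_
  · rw [one_mul]; linarith [abs_nonneg (Real.log x)]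
  · refine ((one (Q := Q)).mono zero_le_one fun p x hx => ?_).congr fun p x hx => ?_
    · rw [one_mul]; linarith [abs_nonneg (Real.log x)]
    · simp only [WaveMap.eul, Real.deriv_log]
      exact mul_inv_cancel₀ (hQ x hx).ne'

end Sym

/-! ### Symbols in one variable and the inverse of the Hamiltonian -/

/-- The half-line `σ ≥ 1` as a region for symbol estimates. -/
def farRegion : SymRegion Unit :=
  ⟨Ioi 0, {z | 1 ≤ z.2}, isOpen_Ioi, fun _ x h =>
    mem_Ioi.2 (zero_lt_one.trans_le (show 1 ≤ x from h))⟩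

/-- Symbols of order `r` up to `c` logarithms: `F` is smooth on `σ > 0`, and `F` and its Euler
derivatives are `O(σ^r (1 + log σ)^c)` on `σ ≥ 1`. -/
def SymF (r : ℤ) (c : ℕ) (F : ℝ → ℝ) : Prop :=
  Sym farRegion (fun _ s => s ^ r * (1 + log s) ^ c) (fun _ => F)

namespace SymF

variable {r r₁ r₂ : ℤ} {c c₁ c₂ : ℕ} {F G : ℝ → ℝ}

theorem smooth (h : SymF r c F) : SmoothPos F := Sym.smooth h ()

theorem exists_bound (h : SymF r c F) :
    ∃ C, 0 ≤ C ∧ ∀ s, 1 ≤ s → |F s| ≤ C * (s ^ r * (1 + log s) ^ c) := by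
  obtain ⟨C, hC, hb⟩ := Sym.exists_bound h
  exact ⟨C, hC, fun s hs => hb () s hs⟩

theorem congr (h : SymF r c F) (hG : ∀ s, 0 < s → G s = F s) : SymF r c G :=
  Sym.congr h fun _ s hs => hG s hs

theorem add (hF : SymF r c F) (hG : SymF r c G) : SymF r c (fun s => F s + G s) := Sym.add hF hG

theorem sub (hF : SymF r c F) (hG : SymF r c G) : SymF r c (fun s => F s - G s) := Sym.sub hF hG

theorem neg (hF : SymF r c F) : SymF r c (fun s => -F s) := Sym.neg hF

theorem const_mul (a : ℝ) (hF : SymF r c F) : SymF r c (fun s => a * F s) := Sym.const_mul a hF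

theorem zero : SymF r c (fun _ => 0) := Sym.zero

theorem eul (hF : SymF r c F) : SymF r c (eul F) := Sym.eul hF

theorem mul (hF : SymF r₁ c₁ F) (hG : SymF r₂ c₂ G) :
    SymF (r₁ + r₂) (c₁ + c₂) (fun s => F s * G s) :=
  (Sym.mul hF hG).mono zero_le_one fun _ s hs => by
    have : 0 < s := zero_lt_one.trans_le hs
    rw [one_mul, zpow_add₀ this.ne', pow_add]
    exact le_of_eq (by ring)

theorem mono (hF : SymF r₁ c₁ F) (hr : r₁ ≤ r₂) (hc : c₁ ≤ c₂) : SymF r₂ c₂ F :=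
  Sym.mono hF zero_le_one fun _ s hs => by
    rw [one_mul]
    have h1 : 1 ≤ s := hs
    have h2 := log_nonneg h1
    exact mul_le_mul (zpow_le_zpow_right₀ h1 hr) (pow_le_pow_right₀ (by linarith) hc)
      (by positivity) (by positivity)

theorem zpow (r : ℤ) : SymF r 0 (fun s => s ^ r) :=
  (Sym.zpow (Q := farRegion) (fun _ h => h) r).mono zero_le_one fun _ s _ => by simp

theorem log : SymF 0 1 log :=
  (Sym.log (Q := farRegion) (fun _ h => h)).mono zero_le_one fun _ s hs => by
    rw [abs_of_nonneg (log_nonneg hs)]; simp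

theorem const (a : ℝ) : SymF 0 0 (fun _ => a) := by
  have := (zpow 0).const_mul a
  simpa using this

theorem inv : SymF (-1) 0 (fun s => s⁻¹) := (zpow (-1)).congr fun s _ => by simp

theorem zpow_mul (hF : SymF r c F) (k : ℤ) : SymF (k + r) c (fun s => s ^ k * F s) := by
  simpa using (zpow k).mul hF

theorem div (hF : SymF r c F) : SymF (r - 1) c (fun s => F s / s) := by
  have := hF.zpow_mul (-1)
  rw [show -1 + r = r - 1 by ring] at this
  exact this.congr fun s _ => by rw [zpow_neg_one, div_eq_inv_mul]

end SymF

/-- The half-line `σ ≥ 2`, for functions smooth on `σ > 1`. -/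
def farRegionTwo : SymRegion Unit :=
  ⟨Ioi 1, {z | 2 ≤ z.2}, isOpen_Ioi, fun _ x h =>
    mem_Ioi.2 (one_lt_two.trans_le (show 2 ≤ x from h))⟩

/-- On the compact interval `[1, 2]` symbol estimates hold by continuity. -/
theorem SymF.of_farRegionTwo {r : ℤ} {c : ℕ} {F : ℝ → ℝ} (hF : SmoothPos F)
    (h : Sym farRegionTwo (fun _ s => s ^ r * (1 + Real.log s) ^ c) (fun _ => F)) : SymF r c F := by
  refine fun n => ⟨fun _ => hF, fun m hm => ?_⟩
  obtain ⟨C, hC, hb⟩ := (h n).2 m hm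
  have hs : ∀ m, SmoothPos (WaveMap.eul^[m] F) := fun m => by
    induction m with
    | zero => exact hF
    | succ m ih => rw [Function.iterate_succ_apply']; exact contDiffOn_eul isOpen_Ioi ih
  have hpos : ∀ s : ℝ, 1 ≤ s → 0 < s ^ r * (1 + Real.log s) ^ c := fun s h1 => by
    have := Real.log_nonneg h1
    have : 0 < s := by linarith
    positivity
  have hcont : ContinuousOn (fun s => WaveMap.eul^[m] F s / (s ^ r * (1 + Real.log s) ^ c))
      (Icc 1 2) := by
    have h0 : ∀ s ∈ Icc (1 : ℝ) 2, s ≠ 0 := fun s hs => by linarith [hs.1]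
    refine ((hs m).continuousOn.mono fun s hs => zero_lt_one.trans_le hs.1).div ?_
      fun s hs => (hpos s hs.1).ne'
    exact (continuousOn_id.zpow₀ r fun s hs => Or.inl (h0 s hs)).mul
      ((continuousOn_const.add (continuousOn_log.mono h0)).pow c)
  obtain ⟨D, hD⟩ := isCompact_Icc.exists_bound_of_continuousOn hcont
  refine ⟨max C D, le_max_of_le_left hC, fun p s h1 => ?_⟩
  have h1 : 1 ≤ s := h1
  have hp := hpos s h1
  rcases le_total 2 s with h2 | h2
  · exact (hb p s h2).trans (mul_le_mul_of_nonneg_right (le_max_left _ _) hp.le)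
  · have := hD s ⟨h1, h2⟩
    rw [norm_eq_abs, abs_div, abs_of_pos hp, div_le_iff₀ hp] at this
    exact this.trans (mul_le_mul_of_nonneg_right (le_max_right _ _) hp.le)

theorem sym_div_sub_one : Sym farRegionTwo (fun _ _ => 1) (fun _ s => s / (s - 1)) := by
  have hsm : ∀ _ : Unit, ContDiffOn ℝ ∞ (fun s : ℝ => s / (s - 1)) (Ioi 1) := fun _ =>
    contDiffOn_id.div (contDiffOn_id.sub contDiffOn_const) fun s hs =>
      (sub_pos.2 (mem_Ioi.1 hs)).ne'
  have h0 : SymUpTo farRegionTwo (fun _ _ => 1) 0 (fun _ s => s / (s - 1)) := by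
    refine SymUpTo.bound_zero hsm (C := 2) zero_le_two fun p s hs => ?_
    have hs : 2 ≤ s := hs
    rw [abs_of_nonneg (div_nonneg (by linarith) (by linarith)), div_le_iff₀ (by linarith)]
    linarith
  intro n
  induction n with
  | zero => exact h0
  | succ n ih =>
    refine SymUpTo.succ_iff.2 ⟨h0, ?_⟩
    have h2 := (ih.mul ih).mono (w₁ := fun _ _ => 1) zero_le_one (by simp)
    have h3 : SymUpTo farRegionTwo (fun _ _ => 1) n
        (fun _ s => s / (s - 1) + -1 * (s / (s - 1) * (s / (s - 1)))) :=
      ih.add ((h2.const_mul fun _ => -1).mono (w₁ := fun _ _ => 1) zero_le_one (by simp))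
    refine h3.congr fun _ s hs => ?_
    have hs' : s - 1 ≠ 0 := (sub_pos.2 (mem_Ioi.1 hs)).ne'
    have := ((hasDerivAt_id s).div ((hasDerivAt_id s).sub_const 1) hs').deriv
    simp only [id] at this
    simp only [eul]
    rw [show deriv (fun s : ℝ => s / (s - 1)) s = _ from this]
    field_simp
    ring

theorem avg_inv_le {s : ℝ} (hs : 2 ≤ s) :
    ∫ t in (0 : ℝ)..1, (1 + t * (s - 1))⁻¹ ≤ 2 * s⁻¹ * (1 + log s) := by
  have hs0 : 0 < s := by linarith
  have h := segment_integral (fun t ht => hasDerivAt_log (segment_pos hs0 ht).ne')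
    (ContinuousOn.inv₀ (by fun_prop) fun t ht => (segment_pos hs0 ht).ne')
  rw [log_one, sub_zero, mul_comm, ← eq_div_iff (by linarith)] at h
  rw [h, div_le_iff₀ (by linarith)]
  have hl := log_nonneg (by linarith : (1 : ℝ) ≤ s)
  have : 1 ≤ 2 * s⁻¹ * (s - 1) := by
    field_simp
    linarith
  nlinarith

/-- Averages of symbols are symbols, with one more logarithm. -/
theorem SymF.avg {r : ℤ} {c : ℕ} {G : ℝ → ℝ} (hG : SymF r c G) (v : ℕ) (hr : -1 - (v : ℤ) ≤ r) :
    SymF r (c + 1) (avg v G) := by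
  refine SymF.of_farRegionTwo (hG.smooth.avg v) ?_
  have hG2 : Sym farRegionTwo (fun _ s => s ^ r * (1 + Real.log s) ^ (c + 1)) (fun _ => G) :=
    fun n => ⟨fun _ => hG.smooth.mono (Ioi_subset_Ioi zero_le_one), fun m hm => by
      obtain ⟨C, hC, hb⟩ := (hG n).2 m hm
      refine ⟨C, hC, fun p s hs => (hb p s (one_le_two.trans (show (2 : ℝ) ≤ s from hs) :
        (1 : ℝ) ≤ s)).trans ?_⟩
      have hs1 : 1 ≤ s := one_le_two.trans (show (2 : ℝ) ≤ s from hs)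
      have hl := log_nonneg hs1
      have hs0 : 0 < s := by linarith
      refine mul_le_mul_of_nonneg_left (mul_le_mul_of_nonneg_left ?_ (by positivity)) hC
      exact pow_le_pow_right₀ (by linarith) c.le_succ⟩
  have h0 : SymUpTo farRegionTwo (fun _ s => s ^ r * (1 + Real.log s) ^ (c + 1)) 0
      (fun _ => WaveMap.avg v G) := by
    obtain ⟨C, hC, hb⟩ := hG.exists_bound
    refine SymUpTo.bound_zero (fun _ => (hG.smooth.avg v).mono (Ioi_subset_Ioi zero_le_one))
      (C := 2 * C) (by positivity) fun _ s hs => ?_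
    have hs : 2 ≤ s := hs
    have hs0 : 0 < s := by linarith
    have hl := Real.log_nonneg (by linarith : (1 : ℝ) ≤ s)
    have hpt : ∀ t ∈ Icc (0 : ℝ) 1, |t ^ v * G (1 + t * (s - 1))| ≤
        C * (s ^ (r + 1) * (1 + Real.log s) ^ c) * (1 + t * (s - 1))⁻¹ := fun t ht => by
      have hx1 : 1 ≤ 1 + t * (s - 1) := by nlinarith [ht.1]
      have hxs : 1 + t * (s - 1) ≤ s := by nlinarith [ht.1, ht.2]
      have htx : t ≤ (1 + t * (s - 1)) / s := by rw [le_div_iff₀ hs0]; nlinarith [ht.2]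
      set x := 1 + t * (s - 1) with hx
      have hx0 : 0 < x := by linarith
      have h1 : t ^ v ≤ (x / s) ^ v := pow_le_pow_left₀ ht.1 htx v
      have h2 : x ^ (r + 1 + v) ≤ s ^ (r + 1 + v) := by
        obtain ⟨k, hk⟩ := Int.eq_ofNat_of_zero_le (by omega : 0 ≤ r + 1 + v)
        rw [hk, zpow_natCast, zpow_natCast]
        exact pow_le_pow_left₀ hx0.le hxs k
      have h3 : (1 + Real.log x) ^ c ≤ (1 + Real.log s) ^ c :=
        pow_le_pow_left₀ (by linarith [Real.log_nonneg hx1])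
          (by linarith [Real.log_le_log hx0 hxs]) c
      have h4 : (x / s) ^ v * x ^ r ≤ s ^ (r + 1) * x⁻¹ := by
        have e1 : x ^ (r + 1 + v) = x ^ r * x * x ^ v := by
          rw [zpow_add₀ hx0.ne', zpow_add₀ hx0.ne', zpow_one, zpow_natCast]
        have e2 : s ^ (r + 1 + v) = s ^ (r + 1) * s ^ v := by
          rw [zpow_add₀ hs0.ne', zpow_natCast]
        rw [e1, e2] at h2
        rw [div_pow, div_mul_eq_mul_div, div_le_iff₀ (by positivity), mul_right_comm,
          ← div_eq_mul_inv, le_div_iff₀ hx0]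
        linarith
      rw [abs_mul, abs_of_nonneg (pow_nonneg ht.1 v)]
      calc t ^ v * |G x| ≤ (x / s) ^ v * (C * (x ^ r * (1 + Real.log x) ^ c)) :=
            mul_le_mul h1 (hb x hx1) (abs_nonneg _) (by positivity)
        _ = C * (((x / s) ^ v * x ^ r) * (1 + Real.log x) ^ c) := by ring
        _ ≤ C * ((s ^ (r + 1) * x⁻¹) * (1 + Real.log s) ^ c) := by
            have := Real.log_nonneg hx1
            gcongr
        _ = _ := by ring
    have hi : IntervalIntegrable (fun t : ℝ => C * (s ^ (r + 1) * (1 + Real.log s) ^ c) *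
        (1 + t * (s - 1))⁻¹) volume 0 1 := by
      refine ContinuousOn.intervalIntegrable ?_
      rw [uIcc_of_le zero_le_one]
      exact continuousOn_const.mul
        (ContinuousOn.inv₀ (by fun_prop) fun t ht => (segment_pos hs0 ht).ne')
    have h1 := intervalIntegral.norm_integral_le_of_norm_le (μ := volume) zero_le_one
      (f := fun t => t ^ v * G (1 + t * (s - 1)))
      (Eventually.of_forall fun t ht => hpt t (Ioc_subset_Icc_self ht)) hi
    rw [intervalIntegral.integral_const_mul] at h1
    refine h1.trans ?_
    calc C * (s ^ (r + 1) * (1 + Real.log s) ^ c) * ∫ t in (0 : ℝ)..1, (1 + t * (s - 1))⁻¹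
        ≤ C * (s ^ (r + 1) * (1 + Real.log s) ^ c) * (2 * s⁻¹ * (1 + Real.log s)) :=
          mul_le_mul_of_nonneg_left (avg_inv_le hs) (by positivity)
      _ = 2 * C * (s ^ r * (1 + Real.log s) ^ (c + 1)) := by
          rw [zpow_add_one₀ hs0.ne', pow_succ]
          field_simp
  intro n
  induction n with
  | zero => exact h0
  | succ n ih =>
    refine SymUpTo.succ_iff.2 ⟨h0, ?_⟩
    have h1 := (sym_div_sub_one n).mul ((hG2 n).add ((ih.const_mul fun _ => -((v : ℝ) + 1)).mono
      (w₁ := fun _ s => s ^ r * (1 + Real.log s) ^ (c + 1)) (abs_nonneg (-((v : ℝ) + 1)))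
      (fun _ _ _ => le_rfl)))
    simp at h1
    refine h1.congr fun _ s hs => ?_
    have hs1 : 1 < s := hs
    have hs' : s - 1 ≠ 0 := (sub_pos.2 hs1).ne'
    have := avg_ode hG.smooth v (zero_lt_one.trans hs1)
    rw [← this, WaveMap.eul]
    field_simp
    ring

/-- `F` vanishes to order `v` at `σ = 1`. -/
def Van (v : ℕ) (F : ℝ → ℝ) : Prop := ∃ G, SmoothPos G ∧ ∀ s, 0 < s → F s = (s - 1) ^ v * G s

/-- The operator induced by `A` on functions `y F(1 + y²)`: `A (y F) = y² stepE F`. -/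
def stepE (F : ℝ → ℝ) (s : ℝ) : ℝ := -(2 / s) * (F s + eul F s)

/-- The operator induced by `A*` on functions `y² G(1 + y²)`: `A* (y² G) = y stepO G`. -/
def stepO (G : ℝ → ℝ) (s : ℝ) : ℝ := 2 * (1 - 1 / s) * eul G s + 2 * G s + 2 / s * G s

/-- The operator induced by `H⁻¹` on functions `y F(1 + y²)`. -/
def regInv (F : ℝ → ℝ) (s : ℝ) : ℝ :=
  -((s - 1) / (4 * s)) * avg 0 (fun x => x ^ 2 * avg 1 (fun y => F y / y) x) s

theorem SmoothPos.div_id {F : ℝ → ℝ} (hF : SmoothPos F) : SmoothPos (fun y => F y / y) :=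
  ContDiffOn.div hF contDiffOn_id fun _ hs => (mem_Ioi.1 hs).ne'

theorem SmoothPos.sq_mul {F : ℝ → ℝ} (hF : SmoothPos F) : SmoothPos (fun y => y ^ 2 * F y) :=
  (by fun_prop : ContDiff ℝ ∞ fun y : ℝ => y ^ 2).contDiffOn.mul hF

theorem smoothPos_regInv {F : ℝ → ℝ} (hF : SmoothPos F) : SmoothPos (regInv F) := by
  refine ContDiffOn.mul ?_ ((hF.div_id.avg 1).sq_mul.avg 0)
  exact ((contDiffOn_id.sub contDiffOn_const).div (contDiffOn_const.mul contDiffOn_id)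
    fun s hs => (mul_pos four_pos (mem_Ioi.1 hs)).ne').neg

theorem regInv_congr {F G : ℝ → ℝ} (h : ∀ s, 0 < s → F s = G s) {s : ℝ} (hs : 0 < s) :
    regInv F s = regInv G s := by
  rw [regInv, regInv]
  congr 1
  refine avg_congr (fun x hx => ?_) hs
  congr 1
  exact avg_congr (fun y hy => by rw [h y hy]) hx

theorem regInv_add {F G : ℝ → ℝ} (hF : SmoothPos F) (hG : SmoothPos G) {s : ℝ} (hs : 0 < s) :
    regInv (fun x => F x + G x) s = regInv F s + regInv G s := by
  have h1 : ∀ x, 0 < x → x ^ 2 * avg 1 (fun y => (F y + G y) / y) x =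
      x ^ 2 * avg 1 (fun y => F y / y) x + x ^ 2 * avg 1 (fun y => G y / y) x := fun x hx => by
    rw [← mul_add, ← avg_add hF.div_id hG.div_id 1 hx]
    simp only [add_div]
  rw [regInv, avg_congr h1 hs,
    avg_add (hF.div_id.avg 1).sq_mul (hG.div_id.avg 1).sq_mul 0 hs, mul_add]
  rfl

theorem regInv_const_mul (a : ℝ) (F : ℝ → ℝ) (s : ℝ) :
    regInv (fun x => a * F x) s = a * regInv F s := by
  have h1 : (fun x => x ^ 2 * avg 1 (fun y => (a * F y) / y) x) =
      fun x => a * (x ^ 2 * avg 1 (fun y => F y / y) x) := by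
    funext x
    simp only [mul_div_assoc]
    rw [avg_const_mul]
    ring
  rw [regInv, h1, avg_const_mul, regInv]
  ring

theorem Van.regInv {v : ℕ} {F : ℝ → ℝ} (h : Van v F) : Van (v + 1) (regInv F) := by
  obtain ⟨G, hG, hFG⟩ := h
  refine ⟨fun s => -(1 / (4 * s)) * WaveMap.avg (0 + v)
    (fun x => x ^ 2 * WaveMap.avg (1 + v) (fun y => G y / y) x) s,
    ContDiffOn.mul ?_ ((hG.div_id.avg _).sq_mul.avg _), fun s hs => ?_⟩
  · exact (contDiffOn_const.div (contDiffOn_const.mul contDiffOn_id)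
      fun s hs => (mul_pos four_pos (mem_Ioi.1 hs)).ne').neg
  · have h1 : ∀ x, 0 < x → x ^ 2 * WaveMap.avg 1 (fun y => F y / y) x =
        (x - 1) ^ v * (x ^ 2 * WaveMap.avg (1 + v) (fun y => G y / y) x) := fun x hx => by
      rw [avg_congr (fun y hy => show F y / y = (y - 1) ^ v * (G y / y) by
        rw [hFG y hy, mul_div_assoc]) hx, avg_pow_mul]
      ring
    rw [WaveMap.regInv, avg_congr h1 hs, avg_pow_mul, pow_succ]
    field_simp

theorem SymF.regInv {r : ℤ} {c : ℕ} {F : ℝ → ℝ} (hF : SymF r c F) (hr : -1 ≤ r) :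
    SymF (r + 1) (c + 2) (regInv F) := by
  have h1 := (hF.div.avg 1 (by push_cast; omega)).zpow_mul 2
  have h2 := h1.avg 0 (by push_cast; omega)
  have h3 : SymF 0 0 (fun s => -(1 / 4) + 1 / 4 * s⁻¹) :=
    (SymF.const _).add ((SymF.inv.const_mul (1 / 4)).mono (by norm_num) le_rfl)
  have h4 := h3.mul h2
  rw [show 0 + (2 + (r - 1)) = r + 1 by ring, show 0 + (c + 1 + 1) = c + 2 by ring] at h4
  refine h4.congr fun s hs => ?_
  rw [WaveMap.regInv]
  have e : (fun s : ℝ => s ^ (2 : ℤ) * WaveMap.avg 1 (fun s => F s / s) s) =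
      fun s => s ^ 2 * WaveMap.avg 1 (fun s => F s / s) s := by
    funext s; norm_cast
  rw [e]
  congr 1
  field_simp
  ring

theorem stepE_congr {F G : ℝ → ℝ} (h : ∀ s, 0 < s → F s = G s) {s : ℝ} (hs : 0 < s) :
    stepE F s = stepE G s := by
  rw [stepE, stepE, h s hs, eul_congr isOpen_Ioi (fun s hs => h s hs) s hs]

theorem stepO_congr {F G : ℝ → ℝ} (h : ∀ s, 0 < s → F s = G s) {s : ℝ} (hs : 0 < s) :
    stepO F s = stepO G s := by
  rw [stepO, stepO, h s hs, eul_congr isOpen_Ioi (fun s hs => h s hs) s hs]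

theorem stepE_regInv {F : ℝ → ℝ} (hF : SmoothPos F) {s : ℝ} (hs : 0 < s) :
    stepE (regInv F) s = s / 2 * avg 1 (fun y => F y / y) s := by
  have hM := (hF.div_id.avg 1).sq_mul
  have hA := hM.avg 0
  have hode := avg_ode hM 0 hs
  set A := avg 0 (fun x => x ^ 2 * avg 1 (fun y => F y / y) x) with hAdef
  have h1 : HasDerivAt (fun s => -((s - 1) / (4 * s))) (-(1 / (4 * s ^ 2))) s := by
    have := ((((hasDerivAt_id s).sub_const 1).div ((hasDerivAt_id s).const_mul 4)
      (mul_pos four_pos hs).ne')).neg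
    refine this.congr_deriv ?_
    simp only [id]
    field_simp
    ring
  have h2 := h1.mul (hA.hasDerivAt hs)
  rw [stepE, eul, show deriv (regInv F) s = _ from h2.deriv, regInv, ← hAdef]
  simp at hode
  have e : avg 1 (fun y => F y / y) s = ((s - 1) * deriv A s + A s) / s ^ 2 := by
    rw [hode]; field_simp
  rw [e]
  field_simp
  ring

/-- `regInv` inverts the operator induced by `H`. -/
theorem stepO_stepE_regInv {F : ℝ → ℝ} (hF : SmoothPos F) {s : ℝ} (hs : 0 < s) :
    stepO (stepE (regInv F)) s = F s := by
  rw [stepO_congr (fun s hs => stepE_regInv hF hs) hs, stepO, eul]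
  have hM := hF.div_id.avg 1
  have hode := avg_ode hF.div_id 1 hs
  have h1 := (((hasDerivAt_id s).div_const 2).mul (hM.hasDerivAt hs)).deriv
  simp only [id] at h1
  rw [show deriv (fun s => s / 2 * avg 1 (fun y => F y / y) s) s = _ from h1]
  have e : F s = s * (F s / s) := by field_simp
  rw [e, ← hode]
  push_cast
  field_simp
  ring

theorem smoothPos_eul {F : ℝ → ℝ} (hF : SmoothPos F) : SmoothPos (eul F) :=
  contDiffOn_eul isOpen_Ioi hF

theorem smoothPos_stepE {F : ℝ → ℝ} (hF : SmoothPos F) : SmoothPos (stepE F) :=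
  ((contDiffOn_const.div contDiffOn_id fun _ hs => (mem_Ioi.1 hs).ne').neg).mul
    (ContDiffOn.add hF (smoothPos_eul hF))

theorem smoothPos_stepO {F : ℝ → ℝ} (hF : SmoothPos F) : SmoothPos (stepO F) := by
  have h1 : SmoothPos fun s : ℝ => 2 * (1 - 1 / s) := contDiffOn_const.mul
    (contDiffOn_const.sub (contDiffOn_const.div contDiffOn_id fun _ hs => (mem_Ioi.1 hs).ne'))
  have h2 : SmoothPos fun s : ℝ => 2 / s :=
    contDiffOn_const.div contDiffOn_id fun _ hs => (mem_Ioi.1 hs).ne'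
  exact ((ContDiffOn.mul h1 (smoothPos_eul hF)).add (contDiffOn_const.mul hF)).add
    (ContDiffOn.mul h2 hF)

/-- The left inverse property, up to the resonance `σ⁻¹`. -/
theorem regInv_stepO_stepE {u : ℝ → ℝ} (hu : SmoothPos u) {s : ℝ} (hs : 0 < s) :
    regInv (stepO (stepE u)) s = u s - u 1 / s := by
  have hG := smoothPos_stepE hu
  have h2 : ∀ x, 0 < x → x ^ 2 * avg 1 (fun y => stepO (stepE u) y / y) x =
      -4 * (u x + x * deriv u x) := fun x hx => by
    have hY : SmoothPos fun x => 2 * stepE u x / x :=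
      SmoothPos.div_id (contDiffOn_const.mul hG)
    rw [avg_eq_of_ode hY (smoothPos_stepO hG).div_id 1 (fun x hx => ?_) hx]
    · rw [stepE, eul]
      field_simp
      ring
    · have := (((hG.hasDerivAt hx).const_mul 2).div (hasDerivAt_id x) hx.ne').deriv
      simp only [id] at this
      rw [show deriv (fun x => 2 * stepE u x / x) x = _ from this, stepO, eul]
      push_cast
      field_simp
      ring
  have h4 := mul_avg_zero (g := fun x => -4 * (u x + x * deriv u x)) (U := fun x => -4 * (x * u x))
    (contDiffOn_const.mul (ContDiffOn.add hu (contDiffOn_id.mul hu.deriv)))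
    (fun x hx => (((hasDerivAt_id x).mul (hu.hasDerivAt hx)).const_mul (-4)).congr_deriv
      (by simp)) hs
  rw [regInv, avg_congr h2 hs]
  generalize avg 0 _ s = a at h4 ⊢
  field_simp
  linear_combination -h4

theorem eul_zpow (q : ℤ) {s : ℝ} (hs : 0 < s) : eul (fun x => x ^ q) s = q * s ^ q := by
  rw [eul, deriv_zpow, mul_left_comm, ← zpow_one_add₀ hs.ne']
  simp

theorem smoothPos_zpow (q : ℤ) : SmoothPos fun x => x ^ q := (SymF.zpow q).smooth

theorem smoothPos_zpow_mul_log (q : ℤ) : SmoothPos fun x => x ^ q * log x :=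
  ((SymF.zpow q).mul SymF.log).smooth

theorem eul_zpow_mul_add_log (q : ℤ) (α β : ℝ) {s : ℝ} (hs : 0 < s) :
    eul (fun x => x ^ q * (α + β * log x)) s = q * (s ^ q * (α + β * log s)) + s ^ q * β := by
  have h : eul (fun x => α + β * log x) s = β := by
    rw [eul, deriv_const_add, deriv_const_mul_field, deriv_log]
    field_simp
  rw [eul_mul_apply (f := fun x => x ^ q) (differentiableAt_zpow.2 (Or.inl hs.ne'))
    (((differentiableAt_log hs.ne').const_mul β).const_add α), eul_zpow q hs, h]
  ring

theorem eul_zpow_mul_log (q : ℤ) {s : ℝ} (hs : 0 < s) :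
    eul (fun x => x ^ q * log x) s = q * (s ^ q * log s) + s ^ q := by
  simpa using eul_zpow_mul_add_log q 0 1 hs

theorem stepE_zpow (q : ℤ) {s : ℝ} (hs : 0 < s) :
    stepE (fun x => x ^ (q + 1)) s = -2 * (q + 2) * s ^ q := by
  rw [stepE, eul_zpow _ hs, zpow_add_one₀ hs.ne']
  push_cast
  field_simp
  ring

theorem stepE_zpow_mul_log (q : ℤ) {s : ℝ} (hs : 0 < s) :
    stepE (fun x => x ^ (q + 1) * log x) s =
      -2 * (q + 2) * (s ^ q * log s) + -2 * s ^ q := by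
  rw [stepE, eul_zpow_mul_log _ hs, zpow_add_one₀ hs.ne']
  push_cast
  field_simp
  ring

theorem stepO_zpow (q : ℤ) {s : ℝ} (hs : 0 < s) :
    stepO (fun x => x ^ q) s = 2 * (q + 1) * s ^ q + 2 * (1 - q) * s ^ (q - 1) := by
  rw [stepO, eul_zpow _ hs, zpow_sub_one₀ hs.ne']
  field_simp
  ring

theorem stepO_zpow_mul_log (q : ℤ) {s : ℝ} (hs : 0 < s) :
    stepO (fun x => x ^ q * log x) s = 2 * (q + 1) * (s ^ q * log s) + 2 * s ^ q +
      2 * (1 - q) * (s ^ (q - 1) * log s) + -2 * s ^ (q - 1) := by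
  rw [stepO, eul_zpow_mul_log _ hs, zpow_sub_one₀ hs.ne']
  field_simp
  ring

theorem stepE_lin (a b : ℝ) {F G : ℝ → ℝ} (hF : SmoothPos F) (hG : SmoothPos G) {s : ℝ}
    (hs : 0 < s) : stepE (fun x => a * F x + b * G x) s = a * stepE F s + b * stepE G s := by
  have h1 := (hF.hasDerivAt hs).differentiableAt
  have h2 := (hG.hasDerivAt hs).differentiableAt
  simp only [stepE]
  rw [eul_add_apply (h1.const_mul a) (h2.const_mul b), eul_const_mul_apply, eul_const_mul_apply]
  ring

theorem stepO_lin (a b : ℝ) {F G : ℝ → ℝ} (hF : SmoothPos F) (hG : SmoothPos G) {s : ℝ}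
    (hs : 0 < s) : stepO (fun x => a * F x + b * G x) s = a * stepO F s + b * stepO G s := by
  have h1 := (hF.hasDerivAt hs).differentiableAt
  have h2 := (hG.hasDerivAt hs).differentiableAt
  simp only [stepO]
  rw [eul_add_apply (h1.const_mul a) (h2.const_mul b), eul_const_mul_apply, eul_const_mul_apply]
  ring

/-- Away from the resonance, the inverse of the Hamiltonian multiplies the leading terms `σ^q` and
`σ^q log σ` by the same constant, up to one power of `σ` and a correction of `σ^q log σ` without
logarithm. The remainders come from the left inverse property applied to `σ^(q+1)` and
`σ^(q+1) log σ`. -/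
theorem exists_regInv_zpow {q : ℤ} (hq : 0 ≤ q) :
    ∃ (κ κ' : ℝ) (R R' : ℝ → ℝ), SymF q 3 R ∧ SymF q 3 R' ∧
      (∀ s, 0 < s → regInv (fun x => x ^ q) s = κ * s ^ (q + 1) + R s) ∧
      ∀ s, 0 < s → regInv (fun x => x ^ q * log x) s =
        κ * (s ^ (q + 1) * log s) + κ' * s ^ (q + 1) + R' s := by
  have hq0 : (0 : ℝ) ≤ q := by exact_mod_cast hq
  have hq1 : (q : ℝ) + 1 ≠ 0 := by positivity
  have hq2 : (q : ℝ) + 2 ≠ 0 := by positivity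
  -- the Hamiltonian applied to the two leading terms
  have hE : ∀ s, 0 < s → stepO (stepE fun x => x ^ (q + 1)) s =
      -4 * (q + 2) * (q + 1) * s ^ q + -4 * (q + 2) * (1 - q) * s ^ (q - 1) := fun s hs => by
    rw [stepO_congr (fun s hs => (stepE_zpow q hs).trans
      (by ring : _ = -2 * ((q : ℝ) + 2) * s ^ q + 0 * s ^ q)) hs,
      stepO_lin _ _ (smoothPos_zpow q) (smoothPos_zpow q) hs, stepO_zpow q hs]
    ring
  have hL : ∀ s, 0 < s → stepO (stepE fun x => x ^ (q + 1) * log x) s =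
      -4 * (q + 2) * (q + 1) * (s ^ q * log s) + (-4 * (q + 2) - 4 * (q + 1)) * s ^ q +
      (-4 * (q + 2) * (1 - q) * (s ^ (q - 1) * log s) +
        (4 * (q + 2) - 4 * (1 - q)) * s ^ (q - 1)) := fun s hs => by
    rw [stepO_congr (fun s hs => stepE_zpow_mul_log q hs) hs,
      stepO_lin _ _ (smoothPos_zpow_mul_log q) (smoothPos_zpow q) hs, stepO_zpow q hs,
      stepO_zpow_mul_log q hs]
    ring
  set κ : ℝ := -1 / (4 * (q + 2) * (q + 1)) with hκ
  have hκm : -4 * ((q : ℝ) + 2) * (q + 1) * κ = 1 := by rw [hκ]; field_simp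
  have s0 := smoothPos_zpow q
  have s1 := smoothPos_zpow (q - 1)
  have sl0 := smoothPos_zpow_mul_log q
  have sl1 := smoothPos_zpow_mul_log (q - 1)
  have r1 : SymF q 3 (regInv fun x => x ^ (q - 1)) := ((SymF.zpow (q - 1)).regInv (by omega)).mono (by omega) (by omega)
  have rl1 : SymF q 3 (regInv fun x => x ^ (q - 1) * log x) := (((SymF.zpow (q - 1)).mul SymF.log).regInv (by omega)).mono (by omega) (by omega)
  have ri : SymF q 3 (fun s => s⁻¹) := SymF.inv.mono (by omega) (by omega)
  have eP : ∀ s, 0 < s → regInv (fun x => x ^ q) s =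
      κ * s ^ (q + 1) + (-κ * s⁻¹ + 4 * (q + 2) * (1 - q) * κ * regInv (fun x => x ^ (q - 1)) s) := by
    intro s hs
    have h := regInv_stepO_stepE (smoothPos_zpow (q + 1)) hs
    rw [regInv_congr hE hs, regInv_add (contDiffOn_const.mul s0) (contDiffOn_const.mul s1) hs,
      regInv_const_mul, regInv_const_mul] at h
    simp at h
    linear_combination (-regInv (fun x => x ^ q) s) * hκm + κ * h
  refine ⟨κ, 4 * (2 * q + 3) * κ ^ 2, _, fun s =>
    4 * (2 * q + 3) * κ * (-κ * s⁻¹ + 4 * (q + 2) * (1 - q) * κ * regInv (fun x => x ^ (q - 1)) s) +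
    (4 * (q + 2) * (1 - q) * κ * regInv (fun x => x ^ (q - 1) * log x) s +
      (-(4 * (q + 2) - 4 * (1 - q)) * κ) * regInv (fun x => x ^ (q - 1)) s),
    (ri.const_mul (-κ)).add (r1.const_mul _), ?_, eP, fun s hs => ?_⟩
  · exact (((ri.const_mul (-κ)).add (r1.const_mul _)).const_mul _).add
      ((rl1.const_mul _).add (r1.const_mul _))
  · have h := regInv_stepO_stepE (smoothPos_zpow_mul_log (q + 1)) hs
    have t1 : SmoothPos fun x : ℝ => -4 * (q + 2) * (q + 1) * (x ^ q * log x) +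
        (-4 * (q + 2) - 4 * (q + 1)) * x ^ q :=
      (contDiffOn_const.mul sl0).add (contDiffOn_const.mul s0)
    have t2 : SmoothPos fun x : ℝ => -4 * (q + 2) * (1 - q) * (x ^ (q - 1) * log x) +
        (4 * (q + 2) - 4 * (1 - q)) * x ^ (q - 1) :=
      (contDiffOn_const.mul sl1).add (contDiffOn_const.mul s1)
    rw [regInv_congr hL hs, regInv_add t1 t2 hs,
      regInv_add (contDiffOn_const.mul sl0) (contDiffOn_const.mul s0) hs,
      regInv_add (contDiffOn_const.mul sl1) (contDiffOn_const.mul s1) hs,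
      regInv_const_mul, regInv_const_mul, regInv_const_mul, regInv_const_mul, eP s hs] at h
    simp [zero_div] at h
    linear_combination (-regInv (fun x => x ^ q * log x) s) * hκm + κ * h

/-- At the resonance the inverse produces a logarithm. -/
theorem exists_regInv_inv : ∃ R : ℝ → ℝ, SymF (-1) 3 R ∧
    ∀ s, 0 < s → regInv (fun x => x⁻¹) s = -(1 / 4) * log s + 1 / 2 + R s := by
  set M := avg 1 (fun y : ℝ => y⁻¹ / y) with hM
  have hMs : SymF (-2) 1 M := by
    have := SymF.inv.div.avg 1 (by norm_num)
    exact this.mono (by norm_num) (by norm_num)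
  have hNs : SymF 0 1 (fun s => s ^ (2 : ℤ) * M s) :=
    (hMs.zpow_mul 2).mono (by norm_num) le_rfl
  have hW : ∀ s, 0 < s → (s - 1) ^ 2 * M s = log s + 1 / s - 1 := fun s hs => by
    have hg : SmoothPos fun x => (x - 1) ^ 1 * (x⁻¹ / x) :=
      (by fun_prop : ContDiff ℝ ∞ fun x : ℝ => (x - 1) ^ 1).contDiffOn.mul SymF.inv.smooth.div_id
    have := mul_avg_zero hg (U := fun x => log x + x⁻¹) (fun x hx =>
      ((hasDerivAt_log hx.ne').add (hasDerivAt_inv hx.ne')).congr_deriv (by field_simp; ring)) hs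
    rw [avg_pow_mul, pow_one, log_one, inv_one] at this
    rw [hM, one_div]
    linear_combination this
  -- the part of `s² M` beyond `log s - 1`
  set ρ : ℝ → ℝ := fun s => s⁻¹ + (2 * s⁻¹ - s⁻¹ * s⁻¹) * (s ^ (2 : ℤ) * M s) with hρ
  have hρs : SymF (-1) 1 ρ := by
    have h1 : SymF (-1) 0 (fun s : ℝ => 2 * s⁻¹ - s⁻¹ * s⁻¹) :=
      (SymF.inv.const_mul 2).sub ((SymF.inv.mul SymF.inv).mono (by norm_num) le_rfl)
    exact (SymF.inv.mono le_rfl (by norm_num)).add ((h1.mul hNs).mono (by norm_num) (by norm_num))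
  have hN : ∀ s, 0 < s → s ^ 2 * M s = (log s + -1) + ρ s := fun s hs => by
    have := hW s hs
    rw [hρ]
    have e : log s = (s - 1) ^ 2 * M s - 1 / s + 1 := by linarith
    simp only
    rw [e, show s ^ (2 : ℤ) = s ^ 2 by norm_cast]
    field_simp
    ring
  have hl : SmoothPos fun s => log s + -1 := (SymF.log.smooth).add contDiffOn_const
  refine ⟨fun s => (-(1 / 2)) * s⁻¹ + (-(1 / 4) + 1 / 4 * s⁻¹) * avg 0 ρ s, ?_, fun s hs => ?_⟩
  · have h3 : SymF 0 0 (fun s => -(1 / 4) + 1 / 4 * s⁻¹) :=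
      (SymF.const _).add ((SymF.inv.const_mul (1 / 4)).mono (by norm_num) le_rfl)
    exact ((SymF.inv.const_mul _).mono le_rfl (by norm_num)).add
      ((h3.mul (hρs.avg 0 (by norm_num))).mono (by norm_num) (by norm_num))
  · rw [regInv, avg_congr hN hs, avg_add hl hρs.smooth 0 hs]
    have := mul_avg_zero hl (U := fun x => x * log x - 2 * x) (fun x hx =>
      (((hasDerivAt_id x).mul (hasDerivAt_log hx.ne')).sub
        ((hasDerivAt_id x).const_mul 2)).congr_deriv (by simp [hx.ne']; ring)) hs
    rw [log_one] at this
    field_simp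
    linear_combination -2 * this

theorem regInv_zpow_neg_two {s : ℝ} (hs : 0 < s) :
    regInv (fun x => x ^ (-2 : ℤ)) s = -(1 / 8) + 1 / 8 * s⁻¹ := by
  have h := regInv_stepO_stepE (smoothPos_zpow (-1 + 1)) hs
  have h1 : ∀ s : ℝ, 0 < s → stepO (stepE fun x => x ^ (-1 + 1 : ℤ)) s =
      -8 * s ^ (-2 : ℤ) := fun s hs => by
    rw [stepO_congr (fun s hs => (stepE_zpow (-1) hs).trans
      (by push_cast; ring : _ = -2 * s ^ (-1 : ℤ) + 0 * s ^ (-1 : ℤ))) hs,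
      stepO_lin _ _ (smoothPos_zpow _) (smoothPos_zpow _) hs, stepO_zpow _ hs]
    norm_num
    ring
  rw [regInv_congr h1 hs, regInv_const_mul] at h
  norm_num at h ⊢
  linarith

/-! ### Coefficients depending on `b₁` -/

/-- The interval `(0, b₀)` as a region for symbol estimates in `b₁`. -/
def coefRegion (b₀ : ℝ) : SymRegion Unit :=
  ⟨Ioo 0 b₀, {z | z.2 ∈ Ioo 0 b₀}, isOpen_Ioo, fun _ _ h => h⟩

/-- Coefficients `h(b₁)` with `|b₁^l h^(l)| ≲ |log b₁|^(-j)` for all `l`. -/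
def KCoef (b₀ : ℝ) (j : ℕ) : Submodule ℝ (ℝ → ℝ) where
  carrier := {h | Sym (coefRegion b₀) (fun _ b => (|log b| ^ j)⁻¹) (fun _ => h)}
  add_mem' h h' := Sym.add h h'
  zero_mem' := Sym.zero
  smul_mem' a _ h := Sym.const_mul a h

namespace KCoef

variable {b₀ : ℝ} {i j : ℕ} {h k : ℝ → ℝ}

theorem smooth (hh : h ∈ KCoef b₀ j) : ContDiffOn ℝ ∞ h (Ioo 0 b₀) := Sym.smooth hh ()

theorem exists_bound (hh : h ∈ KCoef b₀ j) :
    ∃ C, 0 ≤ C ∧ ∀ b ∈ Ioo 0 b₀, |h b| ≤ C * (|log b| ^ j)⁻¹ := by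
  obtain ⟨C, hC, hb⟩ := Sym.exists_bound hh
  exact ⟨C, hC, fun s hs => hb () s hs⟩

theorem congr (hh : h ∈ KCoef b₀ j) (hk : ∀ b ∈ Ioo 0 b₀, k b = h b) : k ∈ KCoef b₀ j :=
  Sym.congr hh fun _ => hk

theorem eul (hh : h ∈ KCoef b₀ j) : eul h ∈ KCoef b₀ j := Sym.eul hh

theorem mul (hh : h ∈ KCoef b₀ i) (hk : k ∈ KCoef b₀ j) : (fun b => h b * k b) ∈ KCoef b₀ (i + j) :=
  (Sym.mul hh hk).mono zero_le_one fun _ b _ => by rw [one_mul, pow_add, mul_inv]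

theorem one_le_abs_log (hb₀ : b₀ ≤ 1 / 4) {b : ℝ} (hb : b ∈ Ioo 0 b₀) : 1 ≤ |log b| := by
  have h1 : log b ≤ log (1 / 4) := log_le_log hb.1 (hb.2.le.trans hb₀)
  have h2 : log (1 / 4) ≤ -1 := by
    rw [log_div one_ne_zero four_ne_zero, log_one, zero_sub, neg_le_neg_iff,
      le_log_iff_exp_le four_pos]
    linarith [exp_one_lt_d9]
  rw [abs_of_neg (by linarith)]
  linarith

theorem mono (hb₀ : b₀ ≤ 1 / 4) (hij : i ≤ j) (hh : h ∈ KCoef b₀ j) : h ∈ KCoef b₀ i :=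
  Sym.mono hh zero_le_one fun _ b hb => by
    have := one_le_abs_log hb₀ hb
    rw [one_mul]
    exact inv_anti₀ (by positivity) (pow_le_pow_right₀ this hij)

theorem const (a : ℝ) : (fun _ => a) ∈ KCoef b₀ 0 :=
  (Sym.const (Q := coefRegion b₀) a).mono zero_le_one fun _ _ _ => by simp

end KCoef

/-- Coefficients of `KCoef b₀ j` whose derivatives gain one more logarithm. -/
def LCoef (b₀ : ℝ) (j : ℕ) : Submodule ℝ (ℝ → ℝ) where
  carrier := {h | h ∈ KCoef b₀ j ∧ eul h ∈ KCoef b₀ (j + 1)}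
  add_mem' {h k} hh hk := ⟨add_mem hh.1 hk.1, KCoef.congr (add_mem hh.2 hk.2) fun b hb =>
    eul_add_apply (contDiffOn_differentiableAt isOpen_Ioo (KCoef.smooth hh.1) hb)
      (contDiffOn_differentiableAt isOpen_Ioo (KCoef.smooth hk.1) hb)⟩
  zero_mem' := ⟨zero_mem _, KCoef.congr (zero_mem _) fun b _ => by simp [eul]⟩
  smul_mem' a h hh := ⟨smul_mem _ a hh.1,
    KCoef.congr (smul_mem _ a hh.2) fun b _ => eul_const_mul_apply a⟩

namespace LCoef

variable {b₀ : ℝ} {i j : ℕ} {h k : ℝ → ℝ}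

theorem smooth (hh : h ∈ LCoef b₀ j) : ContDiffOn ℝ ∞ h (Ioo 0 b₀) := KCoef.smooth hh.1

theorem congr (hh : h ∈ LCoef b₀ j) (hk : ∀ b ∈ Ioo 0 b₀, k b = h b) : k ∈ LCoef b₀ j :=
  ⟨KCoef.congr hh.1 hk, KCoef.congr hh.2 (eul_congr isOpen_Ioo hk)⟩

theorem mul (hh : h ∈ LCoef b₀ i) (hk : k ∈ LCoef b₀ j) :
    (fun b => h b * k b) ∈ LCoef b₀ (i + j) := by
  refine ⟨KCoef.mul hh.1 hk.1, ?_⟩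
  have h1 := KCoef.mul hh.2 hk.1
  have h2 := KCoef.mul hh.1 hk.2
  rw [show i + 1 + j = i + j + 1 by ring] at h1
  exact KCoef.congr (add_mem h1 h2) fun b hb =>
    eul_mul_apply (contDiffOn_differentiableAt isOpen_Ioo (KCoef.smooth hh.1) hb)
      (contDiffOn_differentiableAt isOpen_Ioo (KCoef.smooth hk.1) hb)

theorem mono (hb₀ : b₀ ≤ 1 / 4) (hij : i ≤ j) (hh : h ∈ LCoef b₀ j) : h ∈ LCoef b₀ i :=
  ⟨KCoef.mono hb₀ hij hh.1, KCoef.mono hb₀ (by omega) hh.2⟩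

theorem of_KCoef (hb₀ : b₀ ≤ 1 / 4) (hij : i < j) (hh : h ∈ KCoef b₀ j) : h ∈ LCoef b₀ i :=
  ⟨KCoef.mono hb₀ hij.le hh, KCoef.mono hb₀ hij (KCoef.eul hh)⟩

theorem const (a : ℝ) : (fun _ => a) ∈ LCoef b₀ 0 :=
  ⟨KCoef.const a, KCoef.congr (zero_mem _) fun b _ => by simp [eul]⟩

end LCoef

/-! ### Functions of `(b₁, σ)` -/

/-- Equality for `b₁ ∈ (0, b₀)` and `σ > 0`. -/
def EqDom (b₀ : ℝ) (g g' : ℝ → ℝ → ℝ) : Prop := ∀ b ∈ Ioo 0 b₀, ∀ s, 0 < s → g b s = g' b s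

/-- Joint smoothness for `b₁ ∈ (0, b₀)` and `σ > 0`. -/
def Smooth2 (b₀ : ℝ) (g : ℝ → ℝ → ℝ) : Prop :=
  ContDiffOn ℝ ∞ (fun z : ℝ × ℝ => g z.1 z.2) (Ioo 0 b₀ ×ˢ Ioi 0)

theorem EqDom.trans {b₀ : ℝ} {g g' g'' : ℝ → ℝ → ℝ} (h : EqDom b₀ g g') (h' : EqDom b₀ g' g'') :
    EqDom b₀ g g'' :=
  fun b hb s hs => (h b hb s hs).trans (h' b hb s hs)

namespace Smooth2

variable {b₀ : ℝ} {g g' : ℝ → ℝ → ℝ}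

theorem congr (hg : Smooth2 b₀ g) (h : EqDom b₀ g' g) : Smooth2 b₀ g' :=
  ContDiffOn.congr hg fun z hz => h z.1 hz.1 z.2 hz.2

theorem add (hg : Smooth2 b₀ g) (hg' : Smooth2 b₀ g') : Smooth2 b₀ (g + g') := ContDiffOn.add hg hg'

theorem mul (hg : Smooth2 b₀ g) (hg' : Smooth2 b₀ g') : Smooth2 b₀ (g * g') := ContDiffOn.mul hg hg'

theorem smul (a : ℝ) (hg : Smooth2 b₀ g) : Smooth2 b₀ (a • g) := contDiffOn_const.mul hg

theorem of_fst {h : ℝ → ℝ} (hh : ContDiffOn ℝ ∞ h (Ioo 0 b₀)) : Smooth2 b₀ (fun b _ => h b) :=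
  hh.comp contDiff_fst.contDiffOn fun _ hz => hz.1

theorem of_snd {F : ℝ → ℝ} (hF : SmoothPos F) : Smooth2 b₀ (fun _ s => F s) :=
  ContDiffOn.comp hF contDiff_snd.contDiffOn fun _ hz => hz.2

theorem right (hg : Smooth2 b₀ g) {b : ℝ} (hb : b ∈ Ioo 0 b₀) : SmoothPos (g b) :=
  ContDiffOn.comp (g := fun z : ℝ × ℝ => g z.1 z.2) (t := Ioo 0 b₀ ×ˢ Ioi 0) hg
    (contDiff_prodMk_right b).contDiffOn fun _ hs => ⟨hb, hs⟩

theorem left (hg : Smooth2 b₀ g) {s : ℝ} (hs : 0 < s) :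
    ContDiffOn ℝ ∞ (fun b => g b s) (Ioo 0 b₀) :=
  ContDiffOn.comp (g := fun z : ℝ × ℝ => g z.1 z.2) (t := Ioo 0 b₀ ×ˢ Ioi 0) hg
    (contDiff_prodMk_left s).contDiffOn fun _ hb => ⟨hb, hs⟩

theorem diff_right (hg : Smooth2 b₀ g) {b s : ℝ} (hb : b ∈ Ioo 0 b₀) (hs : 0 < s) :
    DifferentiableAt ℝ (g b) s := ((hg.right hb).hasDerivAt hs).differentiableAt

theorem diff_left (hg : Smooth2 b₀ g) {b s : ℝ} (hb : b ∈ Ioo 0 b₀) (hs : 0 < s) :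
    DifferentiableAt ℝ (fun b => g b s) b :=
  contDiffOn_differentiableAt isOpen_Ioo (hg.left hs) hb

end Smooth2

/-- The Euler operator in `σ`. -/
def eulS (g : ℝ → ℝ → ℝ) (b s : ℝ) : ℝ := eul (g b) s

/-- The Euler operator in `b₁`. -/
def eulB (g : ℝ → ℝ → ℝ) (b s : ℝ) : ℝ := eul (fun β => g β s) b

/-- Operators which are linear on smooth functions and depend only on the values for
`b₁ ∈ (0, b₀)`, `σ > 0`. -/
structure DomLin (b₀ : ℝ) (Φ : (ℝ → ℝ → ℝ) → ℝ → ℝ → ℝ) : Prop where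
  congr : ∀ g g', EqDom b₀ g g' → EqDom b₀ (Φ g) (Φ g')
  add : ∀ g g', Smooth2 b₀ g → Smooth2 b₀ g' → EqDom b₀ (Φ (g + g')) (Φ g + Φ g')
  smul : ∀ (a : ℝ) g, Smooth2 b₀ g → EqDom b₀ (Φ (a • g)) (a • Φ g)

theorem domLin_eulS (b₀ : ℝ) : DomLin b₀ eulS where
  congr _ _ h b hb s hs := eul_congr isOpen_Ioi (fun s hs => h b hb s hs) s hs
  add _ _ hg hg' b hb s hs := eul_add_apply (hg.diff_right hb hs) (hg'.diff_right hb hs)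
  smul a _ _ _ _ _ _ := eul_const_mul_apply a

theorem domLin_eulB (b₀ : ℝ) : DomLin b₀ eulB where
  congr _ _ h b hb s hs := eul_congr isOpen_Ioo (fun b hb => h b hb s hs) b hb
  add _ _ hg hg' b hb s hs := eul_add_apply (hg.diff_left hb hs) (hg'.diff_left hb hs)
  smul a _ _ _ _ _ _ := eul_const_mul_apply a

theorem domLin_regInv (b₀ : ℝ) : DomLin b₀ (fun g b => regInv (g b)) where
  congr _ _ h b hb s hs := regInv_congr (fun s hs => h b hb s hs) hs
  add _ _ hg hg' b hb s hs := regInv_add (hg.right hb) (hg'.right hb) hs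
  smul a g _ b _ s _ := regInv_const_mul a (g b) s

theorem domLin_mul (b₀ : ℝ) (m : ℝ → ℝ → ℝ) : DomLin b₀ (fun g => m * g) where
  congr _ _ h b hb s hs := by simp [h b hb s hs]
  add _ _ _ _ _ _ _ _ := by simp only [mul_add]
  smul a _ _ _ _ _ _ := by simp only [mul_smul_comm]

/-- Membership depends only on the values for `b₁ ∈ (0, b₀)`, `σ > 0`. -/
def DomClosed (b₀ : ℝ) (M : Submodule ℝ (ℝ → ℝ → ℝ)) : Prop :=
  ∀ g ∈ M, ∀ g', EqDom b₀ g' g → g' ∈ M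

/-- Finite sums of products `h(b₁) F(σ)` with `h ∈ X` and `F ∈ 𝓕`. -/
def Tens (b₀ : ℝ) (X 𝓕 : Submodule ℝ (ℝ → ℝ)) : Submodule ℝ (ℝ → ℝ → ℝ) :=
  Submodule.span ℝ {g | ∃ h ∈ X, ∃ F ∈ 𝓕, EqDom b₀ g fun b s => h b * F s}

namespace Tens

variable {b₀ : ℝ} {X Y X' 𝓕 𝓖 𝓕' : Submodule ℝ (ℝ → ℝ)} {g g' : ℝ → ℝ → ℝ}

theorem of_mul {h F : ℝ → ℝ} (hh : h ∈ X) (hF : F ∈ 𝓕) (hg : EqDom b₀ g fun b s => h b * F s) :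
    g ∈ Tens b₀ X 𝓕 := subset_span ⟨h, hh, F, hF, hg⟩

theorem domClosed : DomClosed b₀ (Tens b₀ X 𝓕) := fun g hg g' h => by
  have : g' - g ∈ Tens b₀ X 𝓕 := of_mul (zero_mem X) (zero_mem 𝓕) fun b hb s hs => by
    simp [h b hb s hs]
  simpa using add_mem this hg

theorem mono (hX : X ≤ X') (h𝓕 : 𝓕 ≤ 𝓕') : Tens b₀ X 𝓕 ≤ Tens b₀ X' 𝓕' :=
  span_mono fun _ ⟨h, hh, F, hF, e⟩ => ⟨h, hX hh, F, h𝓕 hF, e⟩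

theorem smooth2 (hX : ∀ h ∈ X, ContDiffOn ℝ ∞ h (Ioo 0 b₀)) (h𝓕 : ∀ F ∈ 𝓕, SmoothPos F)
    (hg : g ∈ Tens b₀ X 𝓕) : Smooth2 b₀ g := by
  induction hg using span_induction with
  | mem g hg =>
    obtain ⟨h, hh, F, hF, e⟩ := hg
    exact ((Smooth2.of_fst (hX h hh)).mul (Smooth2.of_snd (h𝓕 F hF))).congr e
  | zero => exact contDiffOn_const
  | add g g' _ _ h h' => exact h.add h'
  | smul a g _ h => exact h.smul a

theorem map_op (hX : ∀ h ∈ X, ContDiffOn ℝ ∞ h (Ioo 0 b₀)) (h𝓕 : ∀ F ∈ 𝓕, SmoothPos F)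
    {Φ : (ℝ → ℝ → ℝ) → ℝ → ℝ → ℝ} (hΦ : DomLin b₀ Φ) {M : Submodule ℝ (ℝ → ℝ → ℝ)}
    (hM : DomClosed b₀ M) (hgen : ∀ h ∈ X, ∀ F ∈ 𝓕, Φ (fun b s => h b * F s) ∈ M)
    (hg : g ∈ Tens b₀ X 𝓕) : Φ g ∈ M := by
  induction hg using span_induction with
  | mem g hg =>
    obtain ⟨h, hh, F, hF, e⟩ := hg
    exact hM _ (hgen h hh F hF) _ (hΦ.congr _ _ e)
  | zero =>
    have h0 : EqDom b₀ (Φ 0) ((0 : ℝ) • Φ 0) := by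
      simpa using hΦ.smul 0 0 contDiffOn_const
    exact hM 0 (zero_mem M) _ (by simpa using h0)
  | add g g' hg hg' h h' =>
    exact hM _ (add_mem h h') _ (hΦ.add g g' (smooth2 hX h𝓕 hg) (smooth2 hX h𝓕 hg'))
  | smul a g hg h => exact hM _ (M.smul_mem a h) _ (hΦ.smul a g (smooth2 hX h𝓕 hg))

theorem mul (hXY : ∀ h ∈ X, ∀ k ∈ Y, (fun b => h b * k b) ∈ X')
    (h𝓕𝓖 : ∀ F ∈ 𝓕, ∀ G ∈ 𝓖, (fun s => F s * G s) ∈ 𝓕') (hg : g ∈ Tens b₀ X 𝓕)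
    (hg' : g' ∈ Tens b₀ Y 𝓖) : g * g' ∈ Tens b₀ X' 𝓕' := by
  induction hg using span_induction with
  | mem g hg =>
    obtain ⟨h, hh, F, hF, e⟩ := hg
    induction hg' using span_induction with
    | mem g' hg' =>
      obtain ⟨k, hk, G, hG, e'⟩ := hg'
      refine of_mul (hXY h hh k hk) (h𝓕𝓖 F hF G hG) fun b hb s hs => ?_
      simp [e b hb s hs, e' b hb s hs]
      ring
    | zero => simp
    | add g₁ g₂ _ _ h₁ h₂ => rw [mul_add]; exact add_mem h₁ h₂
    | smul a g₁ _ h₁ => rw [mul_smul_comm]; exact smul_mem _ a h₁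
  | zero => simp
  | add g₁ g₂ _ _ h₁ h₂ => rw [add_mul]; exact add_mem h₁ h₂
  | smul a g₁ _ h₁ => rw [smul_mul_assoc]; exact smul_mem _ a h₁

end Tens

/-- The symbols of order `r` up to `c` logarithms. -/
def SymFs (r : ℤ) (c : ℕ) : Submodule ℝ (ℝ → ℝ) where
  carrier := {F | SymF r c F}
  add_mem' h h' := SymF.add h h'
  zero_mem' := SymF.zero
  smul_mem' a _ h := SymF.const_mul a h

/-- The symbols of order `r` up to `c` logarithms that vanish to order `v` at `σ = 1`. -/
def SymVan (r : ℤ) (c v : ℕ) : Submodule ℝ (ℝ → ℝ) where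
  carrier := {F | SymF r c F ∧ Van v F}
  add_mem' := by
    rintro F F' ⟨h, G, hG, e⟩ ⟨h', G', hG', e'⟩
    exact ⟨h.add h', fun s => G s + G' s, ContDiffOn.add hG hG', fun s hs => by
      simp [e s hs, e' s hs]; ring⟩
  zero_mem' := ⟨SymF.zero, fun _ => 0, contDiffOn_const, by simp⟩
  smul_mem' := by
    rintro a F ⟨h, G, hG, e⟩
    exact ⟨h.const_mul a, fun s => a * G s, contDiffOn_const.mul hG, fun s hs => by
      simp [e s hs]; ring⟩

/-! ### Functions with a leading term `σ^q (α(b₁) + β(b₁) log σ)` -/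

/-- The admitted coefficients: pairs `(α, β)` for the leading term, and the coefficients of the
remainder. -/
structure CoefSys (b₀ : ℝ) where
  /-- the pairs `(α, β)` of the leading term -/
  lead : Submodule ℝ ((ℝ → ℝ) × (ℝ → ℝ))
  /-- the coefficients of the remainder -/
  rest : Submodule ℝ (ℝ → ℝ)
  smooth : ∀ h ∈ rest, ContDiffOn ℝ ∞ h (Ioo 0 b₀)
  shift : ∀ p ∈ lead, (p.2, (0 : ℝ → ℝ)) ∈ lead
  fst_mem : ∀ p ∈ lead, p.1 ∈ rest
  snd_mem : ∀ p ∈ lead, p.2 ∈ rest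

/-- The leading term `σ^q (α(b₁) + β(b₁) log σ)`. -/
def leadTerm (q : ℤ) (p : (ℝ → ℝ) × (ℝ → ℝ)) (b s : ℝ) : ℝ := s ^ q * (p.1 b + p.2 b * log s)

/-- The sums of a leading term `σ^q (α(b₁) + β(b₁) log σ)` and a remainder which is smaller by
`σ⁻¹ (1 + log σ)^c`. -/
def Asy {b₀ : ℝ} (S : CoefSys b₀) (q : ℤ) (c : ℕ) : Submodule ℝ (ℝ → ℝ → ℝ) where
  carrier := {g | ∃ p ∈ S.lead, ∃ R ∈ Tens b₀ S.rest (SymFs (q - 1) c),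
    EqDom b₀ g fun b s => leadTerm q p b s + R b s}
  add_mem' := by
    rintro g g' ⟨p, hp, R, hR, e⟩ ⟨p', hp', R', hR', e'⟩
    refine ⟨p + p', add_mem hp hp', R + R', add_mem hR hR', fun b hb s hs => ?_⟩
    simp [e b hb s hs, e' b hb s hs, leadTerm]
    ring
  zero_mem' := ⟨0, zero_mem _, 0, zero_mem _, fun b _ s _ => by simp [leadTerm]⟩
  smul_mem' := by
    rintro a g ⟨p, hp, R, hR, e⟩
    refine ⟨a • p, S.lead.smul_mem a hp, a • R, smul_mem _ a hR, fun b hb s hs => ?_⟩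
    simp [e b hb s hs, leadTerm]
    ring

namespace Asy

variable {b₀ : ℝ} {S S' : CoefSys b₀} {q : ℤ} {c c' : ℕ} {g : ℝ → ℝ → ℝ}

theorem domClosed : DomClosed b₀ (Asy S q c) := by
  rintro g ⟨p, hp, R, hR, e⟩ g' h
  exact ⟨p, hp, R, hR, h.trans e⟩

theorem of_rest (hg : g ∈ Tens b₀ S.rest (SymFs (q - 1) c)) : g ∈ Asy S q c :=
  ⟨0, zero_mem _, g, hg, fun b _ s _ => by simp [leadTerm]⟩

theorem smooth2_rest {r : ℤ} {R : ℝ → ℝ → ℝ} (hR : R ∈ Tens b₀ S.rest (SymFs r c)) :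
    Smooth2 b₀ R :=
  Tens.smooth2 S.smooth (fun _ h => SymF.smooth h) hR

theorem smooth2_lead {p : (ℝ → ℝ) × (ℝ → ℝ)} (hp : p ∈ S.lead) : Smooth2 b₀ (leadTerm q p) :=
  (Smooth2.of_snd (smoothPos_zpow q)).mul ((Smooth2.of_fst (S.smooth _ (S.fst_mem p hp))).add
    ((Smooth2.of_fst (S.smooth _ (S.snd_mem p hp))).mul (Smooth2.of_snd SymF.log.smooth)))

theorem smooth2 (hg : g ∈ Asy S q c) : Smooth2 b₀ g := by
  obtain ⟨p, hp, R, hR, e⟩ := hg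
  exact ((smooth2_lead hp).add (smooth2_rest hR)).congr e

theorem map_eq {Φ : (ℝ → ℝ → ℝ) → ℝ → ℝ → ℝ} (hΦ : DomLin b₀ Φ) {p : (ℝ → ℝ) × (ℝ → ℝ)}
    (hp : p ∈ S.lead) {R : ℝ → ℝ → ℝ} {r : ℤ} (hR : R ∈ Tens b₀ S.rest (SymFs r c))
    (e : EqDom b₀ g (leadTerm q p + R)) : EqDom b₀ (Φ g) (Φ (leadTerm q p) + Φ R) :=
  (hΦ.congr _ _ e).trans (hΦ.add _ _ (smooth2_lead hp) (smooth2_rest hR))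

theorem mono (hc : c ≤ c') : Asy S q c ≤ Asy S q c' := by
  rintro g ⟨p, hp, R, hR, e⟩
  exact ⟨p, hp, R, Tens.mono le_rfl (fun F hF => SymF.mono hF le_rfl hc) hR, e⟩

theorem leadTerm_mem_tens {p : (ℝ → ℝ) × (ℝ → ℝ)} (hp : p ∈ S.lead) (hc : 1 ≤ c) :
    leadTerm q p ∈ Tens b₀ S.rest (SymFs q c) := by
  have h1 : (fun b s => p.1 b * s ^ q) ∈ Tens b₀ S.rest (SymFs q c) :=
    Tens.of_mul (S.fst_mem p hp) (F := fun s => s ^ q) ((SymF.zpow q).mono le_rfl (Nat.zero_le c))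
      fun _ _ _ _ => rfl
  have h2 : (fun b s => p.2 b * (s ^ q * log s)) ∈ Tens b₀ S.rest (SymFs q c) :=
    Tens.of_mul (S.snd_mem p hp) (F := fun s => s ^ q * log s)
      (((SymF.zpow q).mul SymF.log).mono (by simp) (by omega)) fun _ _ _ _ => rfl
  refine Tens.domClosed _ (add_mem h1 h2) _ fun b _ s _ => ?_
  simp [leadTerm]
  ring

theorem le_tens (hc : 1 ≤ c) : Asy S q c ≤ Tens b₀ S.rest (SymFs q c) := by
  rintro g ⟨p, hp, R, hR, e⟩
  exact Tens.domClosed _ (add_mem (leadTerm_mem_tens hp hc)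
    (Tens.mono le_rfl (fun F hF => SymF.mono hF (by omega) le_rfl) hR)) _ e

/-- A term of lower order can be counted as remainder. -/
theorem le_succ (hc : 1 ≤ c) : Asy S (q - 1) c ≤ Asy S q c := fun _ hg => of_rest (le_tens hc hg)

theorem eulS_mem (hg : g ∈ Asy S q c) : eulS g ∈ Asy S q c := by
  obtain ⟨p, hp, R, hR, e⟩ := hg
  have hR' : eulS R ∈ Tens b₀ S.rest (SymFs (q - 1) c) :=
    Tens.map_op S.smooth (fun _ h => SymF.smooth h) (domLin_eulS b₀) Tens.domClosed
      (fun h hh F hF => Tens.of_mul hh (SymF.eul hF) fun b _ s _ => eul_const_mul_apply _) hR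
  refine ⟨(q : ℝ) • p + (p.2, 0), add_mem (S.lead.smul_mem _ hp) (S.shift p hp), eulS R, hR',
    fun b hb s hs => ?_⟩
  rw [map_eq (domLin_eulS b₀) hp hR e b hb s hs, Pi.add_apply, Pi.add_apply]
  congr 1
  refine (eul_zpow_mul_add_log q _ _ hs).trans ?_
  simp [leadTerm]
  ring

theorem inv_mul_mem (hg : g ∈ Asy S q c) : (fun b s => s⁻¹ * g b s) ∈ Asy S (q - 1) c := by
  obtain ⟨p, hp, R, hR, e⟩ := hg
  have hR' : (fun _ s => s⁻¹) * R ∈ Tens b₀ S.rest (SymFs (q - 1 - 1) c) :=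
    Tens.map_op S.smooth (fun _ h => SymF.smooth h) (domLin_mul b₀ _) Tens.domClosed
      (fun h hh F hF => Tens.of_mul hh (SymF.div hF) fun b _ s _ => by
        simp; ring) hR
  refine ⟨p, hp, _, hR', fun b hb s hs => ?_⟩
  simp [e b hb s hs, leadTerm, zpow_sub_one₀ hs.ne']
  ring

theorem coef_mul_mem {h : ℝ → ℝ} (hP : ∀ p ∈ S.lead, (h * p.1, h * p.2) ∈ S'.lead)
    (hX : ∀ k ∈ S.rest, h * k ∈ S'.rest) (hg : g ∈ Asy S q c) :
    (fun b s => h b * g b s) ∈ Asy S' q c := by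
  obtain ⟨p, hp, R, hR, e⟩ := hg
  have hR' : (fun b _ => h b) * R ∈ Tens b₀ S'.rest (SymFs (q - 1) c) :=
    Tens.map_op S.smooth (fun _ h => SymF.smooth h) (domLin_mul b₀ _) Tens.domClosed
      (fun k hk F hF => Tens.of_mul (hX k hk) hF fun b _ s _ => by
        simp; ring) hR
  refine ⟨_, hP p hp, _, hR', fun b hb s hs => ?_⟩
  simp [e b hb s hs, leadTerm]
  ring

theorem eulB_mem (hP : ∀ p ∈ S.lead, (eul p.1, eul p.2) ∈ S'.lead)
    (hX : ∀ k ∈ S.rest, eul k ∈ S'.rest) (hg : g ∈ Asy S q c) : eulB g ∈ Asy S' q c := by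
  obtain ⟨p, hp, R, hR, e⟩ := hg
  have hR' : eulB R ∈ Tens b₀ S'.rest (SymFs (q - 1) c) :=
    Tens.map_op S.smooth (fun _ h => SymF.smooth h) (domLin_eulB b₀) Tens.domClosed
      (fun k hk F hF => Tens.of_mul (hX k hk) hF fun b _ s _ => by
        have := eul_const_mul_apply (F s) (f := k) (x := b)
        simp only [eulB, mul_comm _ (F s)]
        exact this) hR
  refine ⟨_, hP p hp, _, hR', fun b hb s hs => ?_⟩
  rw [map_eq (domLin_eulB b₀) hp hR e b hb s hs, Pi.add_apply, Pi.add_apply]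
  congr 1
  have h1 := contDiffOn_differentiableAt isOpen_Ioo (S.smooth _ (S.fst_mem p hp)) hb
  have h2 := contDiffOn_differentiableAt isOpen_Ioo (S.smooth _ (S.snd_mem p hp)) hb
  have h3 := eul_const_mul_apply (s ^ q) (f := fun b => p.1 b + log s * p.2 b) (x := b)
  rw [eul_add_apply h1 (h2.const_mul _), eul_const_mul_apply (log s)] at h3
  simp only [eulB, leadTerm]
  simp only [mul_comm _ (log s)]
  exact h3

theorem stepE_mem (hg : g ∈ Asy S q c) : (fun b => stepE (g b)) ∈ Asy S (q - 1) c := by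
  have h := inv_mul_mem (add_mem hg (eulS_mem hg))
  refine domClosed _ ((Asy S (q - 1) c).smul_mem (-2) h) _ fun b _ s _ => ?_
  simp only [stepE, Pi.smul_apply, Pi.add_apply, smul_eq_mul, eulS]
  ring

theorem stepO_mem (hc : 1 ≤ c) (hg : g ∈ Asy S q c) : (fun b => stepO (g b)) ∈ Asy S q c := by
  have h := add_mem (add_mem hg (eulS_mem hg))
    (le_succ hc (inv_mul_mem (sub_mem hg (eulS_mem hg))))
  refine domClosed _ ((Asy S q c).smul_mem 2 h) _ fun b _ s _ => ?_
  simp only [stepO, Pi.smul_apply, Pi.add_apply, Pi.sub_apply, smul_eq_mul, eulS]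
  ring

/-- At the resonance `q = -1` the operator `stepO` annihilates `σ^q` and turns `σ^q log σ` into a
multiple of `σ^q`: the leading term `(α, β)` becomes `(2β, 0)`. -/
theorem stepO_mem_resonance (hc : 1 ≤ c) (hP : ∀ p ∈ S.lead, (p.2, (0 : ℝ → ℝ)) ∈ S'.lead)
    (hX : S.rest ≤ S'.rest) (hg : g ∈ Asy S (-1) c) : (fun b => stepO (g b)) ∈ Asy S' (-1) c := by
  have hlow : (fun b s => s⁻¹ * (g - eulS g) b s) ∈ Tens b₀ S'.rest (SymFs (-1 - 1) c) :=
    Tens.mono hX le_rfl (le_tens hc (inv_mul_mem (sub_mem hg (eulS_mem hg))))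
  obtain ⟨p, hp, R, hR, e⟩ := hg
  have hR' : eulS R ∈ Tens b₀ S.rest (SymFs (-1 - 1) c) :=
    Tens.map_op S.smooth (fun _ h => SymF.smooth h) (domLin_eulS b₀) Tens.domClosed
      (fun h hh F hF => Tens.of_mul hh (SymF.eul hF) fun b _ s _ => eul_const_mul_apply _) hR
  refine ⟨(2 : ℝ) • (p.2, 0), S'.lead.smul_mem _ (hP p hp),
    (2 : ℝ) • ((R + eulS R) + fun b s => s⁻¹ * (g - eulS g) b s),
    smul_mem _ _ (add_mem (Tens.mono hX le_rfl (add_mem hR hR')) hlow),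
    fun b hb s hs => ?_⟩
  have h5 : eulS g b s = eul (fun s => s ^ (-1 : ℤ) * (p.1 b + p.2 b * log s)) s +
      eulS R b s := map_eq (domLin_eulS b₀) hp hR e b hb s hs
  have h6 := e b hb s hs
  have h7 : eul (g b) s = eulS g b s := rfl
  simp only [leadTerm] at h6
  simp only [stepO, Pi.smul_apply, Pi.add_apply, Pi.sub_apply, smul_eq_mul, leadTerm,
    Prod.smul_fst, Prod.smul_snd, Pi.zero_apply, h7, h5, eul_zpow_mul_add_log _ _ _ hs, h6]
  push_cast
  ring

theorem regInv_mem (hq : 0 ≤ q) (hg : g ∈ Asy S q c) :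
    (fun b => regInv (g b)) ∈ Asy S (q + 1) (c + 3) := by
  obtain ⟨p, hp, R, hR, e⟩ := hg
  obtain ⟨κ, κ', R₁, R₂, h₁, h₂, e₁, e₂⟩ := exists_regInv_zpow hq
  have hR' : (fun b => regInv (R b)) ∈ Tens b₀ S.rest (SymFs (q + 1 - 1) (c + 3)) :=
    Tens.map_op S.smooth (fun _ h => SymF.smooth h) (domLin_regInv b₀) Tens.domClosed
      (fun h hh F hF => Tens.of_mul hh (F := regInv F)
        ((SymF.regInv hF (by omega)).mono (by omega) (by omega))
        fun b _ s _ => regInv_const_mul _ _ _) hR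
  have hm : ∀ {h F : ℝ → ℝ}, h ∈ S.rest → SymF q 3 F →
      (fun b s => h b * F s) ∈ Tens b₀ S.rest (SymFs (q + 1 - 1) (c + 3)) := fun hh hF =>
    Tens.of_mul hh (SymF.mono hF (by omega) (by omega)) fun _ _ _ _ => rfl
  refine ⟨κ • p + κ' • (p.2, 0), add_mem (S.lead.smul_mem _ hp) (S.lead.smul_mem _ (S.shift p hp)),
    _, add_mem (add_mem (hm (S.fst_mem p hp) h₁) (hm (S.snd_mem p hp) h₂)) hR',
    fun b hb s hs => ?_⟩
  have s1 : SmoothPos fun s : ℝ => p.1 b * s ^ q := contDiffOn_const.mul (smoothPos_zpow q)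
  have s2 : SmoothPos fun s : ℝ => p.2 b * (s ^ q * log s) :=
    contDiffOn_const.mul (smoothPos_zpow_mul_log q)
  have h := regInv_congr (F := g b)
    (G := fun s => (p.1 b * s ^ q + p.2 b * (s ^ q * log s)) + R b s)
    (fun s hs => by simp only [e b hb s hs, leadTerm]; ring) hs
  rw [regInv_add (ContDiffOn.add s1 s2) ((smooth2_rest hR).right hb) hs, regInv_add s1 s2 hs,
    regInv_const_mul, regInv_const_mul, e₁ s hs, e₂ s hs] at h
  refine h.trans ?_
  simp [leadTerm]
  ring

end Asy

/-! ### The constants `c_{b₁,i}` -/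

/-- The properties of `b₁ ↦ c_{b₁,2}` used in the construction: it equals `1 / |log b₁|` up to a
relative error `O(1 / |log b₁|)`, with matching bounds on the derivatives. -/
structure ModCoef (b₀ : ℝ) (cc : ℝ → ℝ) : Prop where
  pos : 0 < b₀
  le : b₀ ≤ 1 / 4
  mem : cc ∈ LCoef b₀ 1
  log : ∃ C, 0 ≤ C ∧ ∀ b ∈ Ioo 0 b₀, |1 - cc b * (|log b|)| ≤ C / |log b|

theorem ModCoef.one_le {b₀ : ℝ} {cc : ℝ → ℝ} (h : ModCoef b₀ cc) {b : ℝ} (hb : b ∈ Ioo 0 b₀) :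
    1 ≤ |Real.log b| := KCoef.one_le_abs_log h.le hb

theorem hasDerivAt_one_add_sq (y : ℝ) : HasDerivAt (fun y : ℝ => 1 + y ^ 2) (2 * y) y := by
  simpa using (hasDerivAt_pow 2 y).const_add 1

theorem one_add_sq_pos (y : ℝ) : 0 < 1 + y ^ 2 := by positivity

theorem radInner_Lam0_LamQ : radInner (Lam0 LamQ) LamQ = 2 := by
  have hd : ∀ y : ℝ, HasDerivAt LamQ ((2 * (1 + y ^ 2) - 2 * y * (2 * y)) / (1 + y ^ 2) ^ 2) y := by
    intro y
    have h1 : HasDerivAt (fun y : ℝ => 2 * y) 2 y := by simpa using (hasDerivAt_id y).const_mul 2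
    exact h1.div (hasDerivAt_one_add_sq y) (by positivity)
  have hF : ∀ y ∈ Ici (0 : ℝ), HasDerivAt (fun y : ℝ => 2 * (y ^ 2 / (1 + y ^ 2)) ^ 2)
      (Lam0 LamQ y * LamQ y * y) y := by
    intro y _
    have h3 : HasDerivAt (fun y : ℝ => y ^ 2) (2 * y) y := by simpa using hasDerivAt_pow 2 y
    have h4 : (1 + y ^ 2 : ℝ) ≠ 0 := by positivity
    refine (((h3.div (hasDerivAt_one_add_sq y) h4).pow 2).const_mul 2).congr_deriv ?_
    rw [Lam0, (hd y).deriv, LamQ]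
    simp
    field_simp
    ring
  have hlim : Tendsto (fun y : ℝ => 2 * (y ^ 2 / (1 + y ^ 2)) ^ 2) atTop (𝓝 2) := by
    have h1 : Tendsto (fun y : ℝ => 1 + y ^ 2) atTop atTop :=
      tendsto_atTop_add_const_left _ _ (tendsto_pow_atTop two_ne_zero)
    have h2 : Tendsto (fun y : ℝ => 2 * (1 - (1 + y ^ 2)⁻¹) ^ 2) atTop (𝓝 (2 * (1 - 0) ^ 2)) :=
      ((tendsto_const_nhds.sub h1.inv_tendsto_atTop).pow 2).const_mul 2
    simp [one_pow] at h2
    refine h2.congr fun y => ?_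
    have h4 : (1 + y ^ 2 : ℝ) ≠ 0 := by positivity
    field_simp
    ring
  have := integral_Ioi_of_hasDerivAt_of_nonneg' hF (fun y hy => ?_) hlim
  · rw [radInner, this]; simp
  · have hy : 0 < y := hy
    rw [Lam0, (hd y).deriv, LamQ]
    have : 2 * y / (1 + y ^ 2) + y * ((2 * (1 + y ^ 2) - 2 * y * (2 * y)) / (1 + y ^ 2) ^ 2) =
        4 * y / (1 + y ^ 2) ^ 2 := by
      field_simp
      ring
    rw [this]
    positivity

/-- Smooth cutoff functions which are `1` for `r ≤ 1` and `0` for `r ≥ 2`. -/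
structure Cutoff (χ : ℝ → ℝ) : Prop where
  smooth : ContDiff ℝ ∞ χ
  one : ∀ r : ℝ, r ≤ 1 → χ r = 1
  zero : ∀ r : ℝ, 2 ≤ r → χ r = 0

/-- After rescaling, the integral defining the cut mass splits into an explicit part over `[0, 1]`,
which carries the logarithm, and a smooth function of `b₁`. -/
theorem exists_cutMass_eq {χ : ℝ → ℝ} (hχ : Cutoff χ) :
    ∃ ρ : ℝ → ℝ, ContDiff ℝ ∞ ρ ∧ ∀ b, 0 < b → cutMass χ b = -4 * log b + ρ b := by
  set f : ℝ → ℝ → ℝ := fun b r => χ r * (4 * r ^ 3 / (r ^ 2 + 16 * b ^ 2) ^ 2) with hf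
  have hfs : ContDiffOn ℝ ∞ (fun z : ℝ × ℝ => f z.1 z.2) {z : ℝ × ℝ | 0 < z.2} := by
    refine (hχ.smooth.comp contDiff_snd).contDiffOn.mul (ContDiffOn.div ?_ ?_ ?_)
    · exact (by fun_prop : ContDiff ℝ ∞ fun z : ℝ × ℝ => 4 * z.2 ^ 3).contDiffOn
    · exact (by fun_prop : ContDiff ℝ ∞ fun z : ℝ × ℝ => (z.2 ^ 2 + 16 * z.1 ^ 2) ^ 2).contDiffOn
    · intro z hz
      have hz : 0 < z.2 := hz
      positivity
  have hint : ContDiffOn ℝ ∞ (fun b => ∫ r in (1 : ℝ)..2, f b r) univ :=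
    contDiffOn_integral_param (isOpen_lt continuous_const continuous_snd) isOpen_univ one_le_two
      (fun z hz => zero_lt_one.trans_le hz.2.1) hfs
  refine ⟨fun b => 2 * log (1 + 16 * b ^ 2) + 2 * (16 * b ^ 2 / (1 + 16 * b ^ 2)) - 2 -
    2 * log 16 + ∫ r in (1 : ℝ)..2, f b r, ?_, fun b hb => ?_⟩
  · have h1 : ContDiff ℝ ∞ fun b : ℝ => 1 + 16 * b ^ 2 := by fun_prop
    have h0 : ∀ b : ℝ, 1 + 16 * b ^ 2 ≠ 0 := fun b => by positivity
    refine (((ContDiff.add ?_ ?_).sub contDiff_const).sub contDiff_const).add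
      (contDiffOn_univ.1 hint)
    · exact contDiff_const.mul (h1.log h0)
    · exact contDiff_const.mul ((by fun_prop : ContDiff ℝ ∞ fun b : ℝ => 16 * b ^ 2).div h1 h0)
  · have hsub := integral_comp_mul_left_Ioi
      (fun y => χ (y / (B0 b / 4)) * LamQ y * LamQ y * y) 0 (b := (4 * b)⁻¹) (by positivity)
    rw [mul_zero, inv_inv, smul_eq_mul] at hsub
    have e1 : cutMass χ b = ∫ r in Ioi (0 : ℝ), f b r := by
      have : cutMass χ b = (4 * b)⁻¹ * ((4 * b) *
          ∫ x in Ioi (0 : ℝ), χ (x / (B0 b / 4)) * LamQ x * LamQ x * x) := by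
        rw [inv_mul_cancel_left₀ (by positivity)]
        rfl
      rw [this, ← hsub, ← integral_const_mul]
      refine setIntegral_congr_fun measurableSet_Ioi fun r hr => ?_
      have hr : 0 < r := hr
      simp only [hf, LamQ, B0]
      rw [show (4 * b)⁻¹ * r / (1 / b / 4) = r by field_simp]
      have : (r ^ 2 + 16 * b ^ 2) ≠ 0 := by positivity
      field_simp
      ring
    have e2 : ∫ r in Ioi (0 : ℝ), f b r = ∫ r in (0 : ℝ)..2, f b r := by
      rw [intervalIntegral.integral_of_le zero_le_two]
      have hz : ∀ r ∈ Ioi (0 : ℝ) \ Ioc 0 2, f b r = 0 := fun r hr => ?_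
      · exact setIntegral_eq_of_subset_of_forall_sdiff_eq_zero (μ := volume) measurableSet_Ioi
          (fun r hr => hr.1) hz
      have h1 : 0 < r := hr.1
      have h2 : 2 < r := by
        by_contra h
        exact hr.2 ⟨h1, not_lt.1 h⟩
      simp [hf, hχ.zero r h2.le]
    have hcont : Continuous (f b) := by
      have h0 : ∀ r : ℝ, (r ^ 2 + 16 * b ^ 2) ^ 2 ≠ 0 := fun r => by positivity
      exact hχ.smooth.continuous.mul ((by fun_prop : Continuous fun r : ℝ => 4 * r ^ 3).div
        (by fun_prop) h0)
    have e3 : ∫ r in (0 : ℝ)..1, f b r = 2 * (log (1 + 16 * b ^ 2) +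
        16 * b ^ 2 / (1 + 16 * b ^ 2)) - 2 * (log (16 * b ^ 2) + 1) := by
      have hder : ∀ r ∈ uIcc (0 : ℝ) 1, HasDerivAt (fun r : ℝ => 2 * (log (r ^ 2 + 16 * b ^ 2) +
          16 * b ^ 2 / (r ^ 2 + 16 * b ^ 2))) (f b r) r := by
        intro r hr
        rw [uIcc_of_le zero_le_one] at hr
        have h0 : (r ^ 2 + 16 * b ^ 2) ≠ 0 := by positivity
        have h1 : HasDerivAt (fun r : ℝ => r ^ 2 + 16 * b ^ 2) (2 * r) r := by
          simpa using (hasDerivAt_pow 2 r).add_const (16 * b ^ 2)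
        refine (((h1.log h0).add ((hasDerivAt_const r (16 * b ^ 2)).div h1 h0)).const_mul
          2).congr_deriv ?_
        simp only [hf, hχ.one r hr.2]
        field_simp
        ring
      rw [integral_eq_sub_of_hasDerivAt hder (hcont.intervalIntegrable _ _)]
      have : 16 * b ^ 2 ≠ 0 := by positivity
      simp [one_pow, ne_eq, OfNat.ofNat_ne_zero, not_false_eq_true, zero_pow, div_self this]
    rw [e1, e2, ← intervalIntegral.integral_add_adjacent_intervals
      (hcont.intervalIntegrable 0 1) (hcont.intervalIntegrable 1 2), e3,
      log_mul (by norm_num) (by positivity), log_pow]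
    push_cast
    ring

/-- The constants are determined by `b₁ ↦ c_{b₁,2}`. -/
theorem cMod_eq (χ : ℝ → ℝ) (b : ℝ) (i : ℕ) :
    cMod χ b i = (if i = 1 then 1 / 2 else 1) * (4 / cutMass χ b) := by
  unfold cMod
  split_ifs
  · rw [radInner_Lam0_LamQ]; ring
  · ring

theorem sym_id {b₀ : ℝ} (hb₀ : b₀ ≤ 1 / 4) :
    Sym (coefRegion b₀) (fun _ _ => 1) (fun _ b => b) := fun n => by
  have h0 : SymUpTo (coefRegion b₀) (fun _ _ => 1) 0 (fun _ b => b) :=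
    SymUpTo.bound_zero (fun _ => contDiffOn_id) zero_le_one fun _ b hb => by
      have hb : b ∈ Ioo 0 b₀ := hb
      rw [abs_of_pos hb.1]
      linarith [hb.2]
  induction n with
  | zero => exact h0
  | succ n ih =>
    exact SymUpTo.succ_iff.2 ⟨h0, ih.congr fun _ b _ => by simp [eul]⟩

theorem exists_modCoef {χ : ℝ → ℝ} (hχ : Cutoff χ) :
    ∃ b₀ : ℝ, ModCoef b₀ (fun b => 4 / cutMass χ b) := by
  obtain ⟨ρ, hρ, hm⟩ := exists_cutMass_eq hχ
  obtain ⟨C, hC⟩ := (isCompact_Icc (a := (0 : ℝ)) (b := 1 / 4)).exists_bound_of_continuousOn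
    hρ.continuous.continuousOn
  have hC0 : 0 ≤ C := (norm_nonneg _).trans (hC 0 (by norm_num))
  set b₀ : ℝ := min (1 / 4) (exp (-C)) with hb₀
  have hpos : 0 < b₀ := lt_min (by norm_num) (exp_pos _)
  have hle : b₀ ≤ 1 / 4 := min_le_left _ _
  have hlog : ∀ b ∈ Ioo 0 b₀, 1 ≤ |log b| ∧ C ≤ |log b| ∧
      cutMass χ b = 4 * |log b| + ρ b ∧ |ρ b| ≤ C := fun b hb => by
    have h1 := KCoef.one_le_abs_log hle hb
    have h2 : log b ≤ -C := by
      rw [← log_exp (-C)]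
      exact log_le_log hb.1 (hb.2.le.trans (min_le_right _ _))
    have h3 : |log b| = -log b := abs_of_nonpos (by linarith)
    refine ⟨h1, by linarith, ?_, hC b ⟨hb.1.le, hb.2.le.trans hle⟩⟩
    rw [hm b hb.1, h3]
    ring
  have hmass : ∀ b ∈ Ioo 0 b₀, 3 * |log b| ≤ cutMass χ b := fun b hb => by
    obtain ⟨h1, h2, h3, h4⟩ := hlog b hb
    rw [h3]
    linarith [(abs_le.1 h4).1]
  set cc : ℝ → ℝ := fun b => 4 / cutMass χ b with hcc
  have hccb : ∀ b ∈ Ioo 0 b₀, |cc b| ≤ 2 * |log b|⁻¹ := fun b hb => by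
    have h1 := hmass b hb
    have h2 := (hlog b hb).1
    rw [hcc, abs_of_nonneg (div_nonneg (by norm_num) (by linarith)), ← div_eq_mul_inv, div_le_div_iff₀ (by linarith)
      (by linarith)]
    linarith
  have hms : ContDiffOn ℝ ∞ (cutMass χ) (Ioo 0 b₀) :=
    ContDiffOn.congr (f := fun b => -4 * log b + ρ b) ((contDiffOn_const.mul fun b hb =>
      (contDiffAt_log.2 hb.1.ne').contDiffWithinAt).add hρ.contDiffOn) fun b hb => hm b hb.1
  have hccs : ContDiffOn ℝ ∞ cc (Ioo 0 b₀) := contDiffOn_const.div hms fun b hb => by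
    have := hmass b hb
    have := (hlog b hb).1
    linarith
  -- the Euler derivative of the mass
  set μ : ℝ → ℝ := fun b => -(1 / 4) * (-4 + eul ρ b) with hμ
  have hμK : μ ∈ KCoef b₀ 0 := by
    have h1 : ρ ∈ KCoef b₀ 0 := (Sym.comp hρ (sym_id hle)).mono zero_le_one fun _ _ _ => by simp
    exact (KCoef b₀ 0).smul_mem (-(1 / 4)) (add_mem (KCoef.const (-4)) (KCoef.eul h1))
  have heul : ∀ b ∈ Ioo 0 b₀, eul cc b = μ b * (cc b * cc b) := fun b hb => by
    have h1 : HasDerivAt (fun b => -4 * log b + ρ b) (-4 * b⁻¹ + deriv ρ b) b :=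
      ((hasDerivAt_log hb.1.ne').const_mul (-4)).add
        (hρ.differentiable (by simp) b).hasDerivAt
    have h2 : HasDerivAt (cutMass χ) (-4 * b⁻¹ + deriv ρ b) b :=
      h1.congr_of_eventuallyEq (eventuallyEq_of_mem (isOpen_Ioi.mem_nhds hb.1) fun b hb => hm b hb)
    have h3 : cutMass χ b ≠ 0 := by
      have := hmass b hb
      have := (hlog b hb).1
      linarith
    have h4 := ((hasDerivAt_const b (4 : ℝ)).div h2 h3).deriv
    have hb0 := hb.1.ne'
    rw [eul, show deriv cc b = _ from h4, hμ, hcc]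
    simp only [eul]
    field_simp
    ring
  have hccK : cc ∈ KCoef b₀ 1 := by
    have h0 : SymUpTo (coefRegion b₀) (fun _ b => (|log b| ^ 1)⁻¹) 0 (fun _ => cc) :=
      SymUpTo.bound_zero (fun _ => hccs) zero_le_two fun _ b hb => by
        simpa using hccb b hb
    intro n
    induction n with
    | zero => exact h0
    | succ n ih =>
      refine SymUpTo.succ_iff.2 ⟨h0, ?_⟩
      have h1 := (SymUpTo.mul (hμK n) (ih.mul ih)).mono
        (w₁ := fun _ b => (|log b| ^ 1)⁻¹) zero_le_one fun _ b hb => by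
        have := inv_le_one_of_one_le₀ (hlog b hb).1
        have h3 : (0 : ℝ) ≤ |log b|⁻¹ := by positivity
        simp [inv_one, pow_one]
        nlinarith
      exact h1.congr fun _ b hb => heul b hb
  refine ⟨b₀, hpos, hle, ⟨hccK, ?_⟩, C / 3, by positivity, fun b hb => ?_⟩
  · exact by simpa using KCoef.congr (KCoef.mul hμK (KCoef.mul hccK hccK)) heul
  · obtain ⟨h1, h2, h3, h4⟩ := hlog b hb
    have h5 := hmass b hb
    have h6 : 0 < cutMass χ b := by linarith
    have h7 : 1 - cc b * |log b| = ρ b / cutMass χ b := by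
      simp only [hcc]
      field_simp
      linarith
    rw [h7, abs_div, abs_of_pos h6, div_div]
    exact div_le_div₀ hC0 h4 (by linarith) h5

/-! ### The coefficient systems of the construction -/

section Systems

variable {b₀ : ℝ} {cc : ℝ → ℝ}

theorem ModCoef.memK (h : ModCoef b₀ cc) : cc ∈ KCoef b₀ 1 := h.mem.1

/-- Leading coefficients `(α, β) ≈ a (1, - c_{b₁,2} / 2)`. Since `c_{b₁,2} ≈ 1 / |log b₁|`, the
leading term `α + β log σ` is of size `(1 + |log (b₁² σ)|) / |log b₁|`: the two parts cancel
near `σ = b₁⁻²`. -/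
def balSys (hc : ModCoef b₀ cc) : CoefSys b₀ where
  lead :=
    { carrier := {p | ∃ a : ℝ, (fun b => p.1 b - a) ∈ LCoef b₀ 1 ∧
        (fun b => p.2 b + a / 2 * cc b) ∈ KCoef b₀ 2}
      add_mem' := by
        rintro p p' ⟨a, h1, h2⟩ ⟨a', h1', h2'⟩
        refine ⟨a + a', ?_, ?_⟩
        · convert add_mem h1 h1' using 1
          funext b; simp; ring
        · convert add_mem h2 h2' using 1
          funext b; simp; ring
      zero_mem' := ⟨0, by
        convert zero_mem (LCoef b₀ 1) using 1; funext b; simp, by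
        convert zero_mem (KCoef b₀ 2) using 1; funext b; simp⟩
      smul_mem' := by
        rintro r p ⟨a, h1, h2⟩
        refine ⟨r * a, ?_, ?_⟩
        · convert smul_mem _ r h1 using 1
          funext b; simp; ring
        · convert smul_mem _ r h2 using 1
          funext b; simp; ring }
  rest := LCoef b₀ 0
  smooth _ h := LCoef.smooth h
  shift := by
    rintro p ⟨a, -, h2⟩
    refine ⟨0, ?_, ?_⟩
    · have := sub_mem (LCoef.of_KCoef hc.le one_lt_two h2) ((LCoef b₀ 1).smul_mem (a / 2) hc.mem)
      refine LCoef.congr this fun b _ => ?_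
      simp only [Pi.sub_apply, Pi.smul_apply, smul_eq_mul]; ring
    · exact KCoef.congr (zero_mem _) fun b _ => by simp
  fst_mem := by
    rintro p ⟨a, h1, -⟩
    refine LCoef.congr (add_mem (LCoef.mono hc.le zero_le_one h1) (LCoef.const a)) fun b _ => ?_
    simp only [Pi.add_apply]; ring
  snd_mem := by
    rintro p ⟨a, -, h2⟩
    refine LCoef.congr (sub_mem (LCoef.of_KCoef hc.le two_pos h2)
      ((LCoef b₀ 0).smul_mem (a / 2) (LCoef.mono hc.le zero_le_one hc.mem))) fun b _ => ?_
    simp only [Pi.sub_apply, Pi.smul_apply, smul_eq_mul]; ring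

/-- Leading coefficients `α = O(1 / |log b₁|)` without logarithm in `σ`. -/
def balZeroSys (hc : ModCoef b₀ cc) : CoefSys b₀ where
  lead := (LCoef b₀ 1).prod ⊥
  rest := LCoef b₀ 0
  smooth _ h := LCoef.smooth h
  shift p hp := ⟨by rw [(Submodule.mem_bot ℝ).1 hp.2]; exact zero_mem _, zero_mem _⟩
  fst_mem p hp := LCoef.mono hc.le zero_le_one hp.1
  snd_mem p hp := by rw [(Submodule.mem_bot ℝ).1 hp.2]; exact zero_mem _

/-- The system containing the `b₁`-derivatives of functions with the system `balSys`. -/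
def balDerivSys (hc : ModCoef b₀ cc) : CoefSys b₀ where
  lead := (KCoef b₀ 2).prod (KCoef b₀ 2)
  rest := KCoef b₀ 1
  smooth _ h := KCoef.smooth h
  shift p hp := ⟨hp.2, zero_mem _⟩
  fst_mem p hp := KCoef.mono hc.le one_le_two hp.1
  snd_mem p hp := KCoef.mono hc.le one_le_two hp.2

/-- The system containing the `b₁`-derivatives of functions with the system `balZeroSys`. -/
def balZeroDerivSys (hc : ModCoef b₀ cc) : CoefSys b₀ where
  lead := (KCoef b₀ 2).prod ⊥
  rest := KCoef b₀ 1
  smooth _ h := KCoef.smooth h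
  shift p hp := ⟨by rw [(Submodule.mem_bot ℝ).1 hp.2]; exact zero_mem _, zero_mem _⟩
  fst_mem p hp := KCoef.mono hc.le one_le_two hp.1
  snd_mem p hp := by rw [(Submodule.mem_bot ℝ).1 hp.2]; exact zero_mem _

variable (hc : ModCoef b₀ cc) {q : ℤ} {c : ℕ} {g : ℝ → ℝ → ℝ}

theorem eul_sub_const_mem {j : ℕ} {h : ℝ → ℝ} {a : ℝ} (hh : (fun b => h b - a) ∈ LCoef b₀ j) :
    eul h ∈ KCoef b₀ (j + 1) :=
  KCoef.congr hh.2 fun b _ => by simp only [eul]; rw [deriv_sub_const]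

theorem eulB_mem_balDeriv (hg : g ∈ Asy (balSys hc) q c) :
    eulB g ∈ Asy (balDerivSys hc) q c := by
  refine Asy.eulB_mem (S := balSys hc) ?_ (fun k hk => hk.2) hg
  rintro p ⟨a, h1, h2⟩
  refine ⟨eul_sub_const_mem h1, ?_⟩
  refine KCoef.congr (sub_mem (KCoef.eul h2) ((KCoef b₀ 2).smul_mem (a / 2) hc.mem.2))
    fun b hb => ?_
  have d1 := contDiffOn_differentiableAt isOpen_Ioo (KCoef.smooth h2) hb
  have d2 := contDiffOn_differentiableAt isOpen_Ioo (KCoef.smooth hc.memK) hb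
  have e1 : p.2 = fun b => (p.2 b + a / 2 * cc b) + -(a / 2) * cc b := by funext b; ring
  simp
  rw [show eul p.2 b = eul (fun b => (p.2 b + a / 2 * cc b) + -(a / 2) * cc b) b by rw [← e1],
    eul_add_apply d1 (d2.const_mul _), eul_const_mul_apply]
  ring

theorem eulB_mem_balDerivSys (hg : g ∈ Asy (balDerivSys hc) q c) :
    eulB g ∈ Asy (balDerivSys hc) q c :=
  Asy.eulB_mem (S := balDerivSys hc) (fun _ hp => ⟨KCoef.eul hp.1, KCoef.eul hp.2⟩) (fun _ hk => KCoef.eul hk) hg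

theorem eul_zero : eul (0 : ℝ → ℝ) = 0 := by
  funext x
  simp [eul]

theorem eulB_mem_balZeroDeriv (hg : g ∈ Asy (balZeroSys hc) q c) :
    eulB g ∈ Asy (balZeroDerivSys hc) q c :=
  Asy.eulB_mem (S := balZeroSys hc) (fun p hp => ⟨hp.1.2, by
    rw [(Submodule.mem_bot ℝ).1 hp.2, eul_zero]; exact zero_mem _⟩) (fun _ hk => hk.2) hg

theorem eulB_mem_balZeroDerivSys (hg : g ∈ Asy (balZeroDerivSys hc) q c) :
    eulB g ∈ Asy (balZeroDerivSys hc) q c :=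
  Asy.eulB_mem (S := balZeroDerivSys hc) (fun p hp => ⟨KCoef.eul hp.1, by
    rw [(Submodule.mem_bot ℝ).1 hp.2, eul_zero]; exact zero_mem _⟩) (fun _ hk => KCoef.eul hk) hg

theorem balDeriv_le_bal : Asy (balDerivSys hc) q c ≤ Asy (balSys hc) q c := by
  rintro g ⟨p, hp, R, hR, e⟩
  refine ⟨p, ⟨0, ?_, ?_⟩, R, Tens.mono (fun h hh => LCoef.of_KCoef hc.le zero_lt_one hh) le_rfl hR,
    e⟩
  · exact LCoef.congr (LCoef.of_KCoef hc.le one_lt_two hp.1) fun b _ => by simp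
  · exact KCoef.congr hp.2 fun b _ => by simp

theorem eulB_mem_bal (hg : g ∈ Asy (balSys hc) q c) : eulB g ∈ Asy (balSys hc) q c :=
  balDeriv_le_bal hc (eulB_mem_balDeriv hc hg)

/-- Multiplication by `c_{b₁,2}`. -/
theorem coef_mul_mem_bal (hg : g ∈ Asy (balSys hc) q c) :
    (fun b s => cc b * g b s) ∈ Asy (balSys hc) q c := by
  refine Asy.coef_mul_mem ?_ (fun k hk => LCoef.mono hc.le (by omega) (LCoef.mul hc.mem hk)) hg
  rintro p ⟨a, h1, h2⟩
  refine ⟨0, ?_, ?_⟩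
  · refine LCoef.congr (add_mem (LCoef.mono hc.le (by omega) (LCoef.mul hc.mem h1))
      ((LCoef b₀ 1).smul_mem a hc.mem)) fun b _ => ?_
    simp; ring
  · refine KCoef.congr (sub_mem (KCoef.mono hc.le (by omega) (KCoef.mul hc.memK h2))
      ((KCoef b₀ 2).smul_mem (a / 2) (KCoef.mul hc.memK hc.memK))) fun b _ => ?_
    simp; ring

/-! ### Pointwise bounds -/

theorem Tens.exists_bound {X : Submodule ℝ (ℝ → ℝ)} {j : ℕ} (hX : X ≤ KCoef b₀ j) {r : ℤ}
    {R : ℝ → ℝ → ℝ} (hR : R ∈ Tens b₀ X (SymFs r c)) :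
    ∃ C, 0 ≤ C ∧ ∀ b ∈ Ioo 0 b₀, ∀ s, 1 ≤ s →
      |R b s| ≤ C * ((|log b| ^ j)⁻¹ * (s ^ r * (1 + log s) ^ c)) := by
  induction hR using span_induction with
  | mem R hR =>
    obtain ⟨h, hh, F, hF, e⟩ := hR
    obtain ⟨C, hC, hb⟩ := KCoef.exists_bound (hX hh)
    obtain ⟨D, hD, hb'⟩ := SymF.exists_bound hF
    refine ⟨C * D, mul_nonneg hC hD, fun b hb₁ s hs => ?_⟩
    rw [e b hb₁ s (zero_lt_one.trans_le hs), abs_mul, mul_mul_mul_comm]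
    exact mul_le_mul (hb b hb₁) (hb' s hs) (abs_nonneg _) (by positivity)
  | zero => exact ⟨0, le_rfl, by simp⟩
  | add R R' _ _ h h' =>
    obtain ⟨C, hC, hb⟩ := h
    obtain ⟨C', hC', hb'⟩ := h'
    refine ⟨C + C', add_nonneg hC hC', fun b hb₁ s hs => ?_⟩
    rw [add_mul]
    exact (abs_add_le _ _).trans (add_le_add (hb b hb₁ s hs) (hb' b hb₁ s hs))
  | smul a R _ h =>
    obtain ⟨C, hC, hb⟩ := h
    refine ⟨|a| * C, mul_nonneg (abs_nonneg a) hC, fun b hb₁ s hs => ?_⟩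
    rw [Pi.smul_apply, Pi.smul_apply, smul_eq_mul, abs_mul, mul_assoc]
    exact mul_le_mul_of_nonneg_left (hb b hb₁ s hs) (abs_nonneg a)

/-- A bound for the coefficient of the leading term gives a bound for the function. -/
theorem Asy.exists_bound {S : CoefSys b₀} {j : ℕ} (hX : S.rest ≤ KCoef b₀ j) {m : ℝ → ℝ → ℝ}
    (hm : ∀ p ∈ S.lead, ∃ C, 0 ≤ C ∧ ∀ b ∈ Ioo 0 b₀, ∀ s, 1 ≤ s →
      |p.1 b + p.2 b * log s| ≤ C * ((|log b| ^ j)⁻¹ * m b s))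
    (hm0 : ∀ b ∈ Ioo 0 b₀, ∀ s, 1 ≤ s → 0 ≤ m b s) (hg : g ∈ Asy S q c) :
    ∃ C, 0 ≤ C ∧ ∀ b ∈ Ioo 0 b₀, ∀ s, 1 ≤ s →
      |g b s| ≤ C * ((|log b| ^ j)⁻¹ * (s ^ q * (m b s + (1 + log s) ^ c / s))) := by
  obtain ⟨p, hp, R, hR, e⟩ := hg
  obtain ⟨C, hC, hb⟩ := hm p hp
  obtain ⟨D, hD, hb'⟩ := Tens.exists_bound hX hR
  refine ⟨max C D, le_max_of_le_left hC, fun b hb₁ s hs => ?_⟩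
  have hs0 : 0 < s := zero_lt_one.trans_le hs
  have hl := log_nonneg hs
  have hq : 0 ≤ s ^ q := zpow_nonneg hs0.le q
  rw [e b hb₁ s hs0]
  refine (abs_add_le _ _).trans ?_
  have h1 : |leadTerm q p b s| ≤ max C D * ((|log b| ^ j)⁻¹ * (s ^ q * m b s)) := by
    rw [leadTerm, abs_mul, abs_of_nonneg hq]
    calc _ ≤ s ^ q * (C * ((|log b| ^ j)⁻¹ * m b s)) :=
          mul_le_mul_of_nonneg_left (hb b hb₁ s hs) hq
      _ = C * ((|log b| ^ j)⁻¹ * (s ^ q * m b s)) := by ring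
      _ ≤ _ := mul_le_mul_of_nonneg_right (le_max_left _ _)
          (mul_nonneg (by positivity) (mul_nonneg hq (hm0 b hb₁ s hs)))
  have h2 : |R b s| ≤ max C D * ((|log b| ^ j)⁻¹ * (s ^ q * ((1 + log s) ^ c / s))) := by
    refine (hb' b hb₁ s hs).trans ?_
    rw [zpow_sub_one₀ hs0.ne']
    calc _ = D * ((|log b| ^ j)⁻¹ * (s ^ q * ((1 + log s) ^ c / s))) := by
          rw [div_eq_mul_inv]; ring
      _ ≤ _ := mul_le_mul_of_nonneg_right (le_max_right _ _) (by positivity)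
  calc _ ≤ _ := add_le_add h1 h2
    _ = _ := by ring

theorem ModCoef.log_sq_mul (hc : ModCoef b₀ cc) {b s : ℝ} (hb : b ∈ Ioo 0 b₀) (hs : 0 < s) :
    Real.log s = Real.log (b ^ 2 * s) + 2 * |Real.log b| := by
  have hb0 : b ≠ 0 := hb.1.ne'
  have hneg : Real.log b ≤ 0 := Real.log_nonpos hb.1.le (by linarith [hb.2, hc.le])
  rw [Real.log_mul (pow_ne_zero 2 hb0) hs.ne', Real.log_pow, abs_of_nonpos hneg]
  push_cast
  ring

theorem exists_bound_bal (hg : g ∈ Asy (balSys hc) q c) :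
    ∃ C, 0 ≤ C ∧ ∀ b ∈ Ioo 0 b₀, ∀ s, 1 ≤ s →
      |g b s| ≤ C * (s ^ q * ((1 + |log (b ^ 2 * s)|) / |log b| +
        (1 + Real.log s) ^ c / s)) := by
  have key := Asy.exists_bound (j := 0) (S := balSys hc)
    (m := fun b s => (1 + |log (b ^ 2 * s)|) / |log b|) (fun h hh => hh.1) ?_
    (fun b _ s _ => by positivity) hg
  · simpa using key
  rintro p ⟨a, h1, h2⟩
  obtain ⟨C₁, hC₁, hb₁⟩ := KCoef.exists_bound h1.1
  obtain ⟨C₂, hC₂, hb₂⟩ := KCoef.exists_bound h2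
  obtain ⟨C₃, hC₃, hb₃⟩ := hc.log
  obtain ⟨C₄, hC₄, hb₄⟩ := KCoef.exists_bound hc.memK
  refine ⟨C₁ + 2 * C₂ + |a| * C₃ + |a| * C₄, by positivity, fun b hb s hs => ?_⟩
  have hl := hc.one_le hb
  have hlog := hc.log_sq_mul hb (zero_lt_one.trans_le hs)
  set ℓ := |Real.log b| with hℓ
  set X := log (b ^ 2 * s) with hX
  have hℓ0 : 0 < ℓ := by linarith
  have i1 := hb₁ b hb
  have i2 := hb₂ b hb
  have i3 := hb₃ b hb
  have i4 := hb₄ b hb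
  rw [pow_one, ← div_eq_mul_inv] at i1 i4
  simp [inv_one]
  have e1 : p.1 b + p.2 b * log s = (p.1 b - a) + a * (1 - cc b * ℓ) +
      (p.2 b + a / 2 * cc b) * (X + 2 * ℓ) - a / 2 * (cc b * X) := by
    rw [hlog]; ring
  have b1 : |a * (1 - cc b * ℓ)| ≤ |a| * C₃ * ((1 + |X|) / ℓ) := by
    rw [abs_mul, mul_assoc]
    refine mul_le_mul_of_nonneg_left (i3.trans ?_) (abs_nonneg a)
    rw [← mul_div_assoc]
    gcongr
    nlinarith [abs_nonneg X]
  have b0 : |p.1 b - a| ≤ C₁ * ((1 + |X|) / ℓ) := by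
    refine i1.trans ?_
    rw [← mul_div_assoc]
    gcongr
    nlinarith [abs_nonneg X]
  have b2 : |(p.2 b + a / 2 * cc b) * (X + 2 * ℓ)| ≤ 2 * C₂ * ((1 + |X|) / ℓ) := by
    rw [abs_mul]
    have h3 : |X + 2 * ℓ| ≤ 2 * ((1 + |X|) * ℓ) := by
      refine (abs_add_le _ _).trans ?_
      rw [abs_of_pos (by linarith : 0 < 2 * ℓ)]
      nlinarith [abs_nonneg X]
    calc _ ≤ C₂ * (ℓ ^ 2)⁻¹ * (2 * ((1 + |X|) * ℓ)) := by gcongr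
      _ = _ := by field_simp
  have b3 : |a / 2 * (cc b * X)| ≤ |a| * C₄ * ((1 + |X|) / ℓ) := by
    rw [abs_mul, abs_mul, abs_div, abs_two, mul_assoc]
    have : |cc b| * |X| ≤ C₄ * ((1 + |X|) / ℓ) := by
      calc _ ≤ C₄ / ℓ * (1 + |X|) := mul_le_mul i4 (by linarith) (abs_nonneg _) (by positivity)
        _ = _ := by ring
    exact mul_le_mul (by linarith [abs_nonneg a]) this (by positivity) (abs_nonneg a)
  rw [e1]
  calc _ ≤ |p.1 b - a| + |a * (1 - cc b * ℓ)| + |(p.2 b + a / 2 * cc b) * (X + 2 * ℓ)| +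
        |a / 2 * (cc b * X)| :=
        (abs_sub _ _).trans (add_le_add_left ((abs_add_le _ _).trans
          (add_le_add_left (abs_add_le _ _) _)) _)
    _ ≤ _ := by linarith

theorem exists_bound_balZero (hg : g ∈ Asy (balZeroSys hc) q c) :
    ∃ C, 0 ≤ C ∧ ∀ b ∈ Ioo 0 b₀, ∀ s, 1 ≤ s →
      |g b s| ≤ C * (s ^ q * (1 / |log b| + (1 + log s) ^ c / s)) := by
  have key := Asy.exists_bound (j := 0) (S := balZeroSys hc)
    (m := fun b s => 1 / |log b|) (fun h hh => hh.1) ?_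
    (fun b _ s _ => by positivity) hg
  · simpa using key
  rintro p ⟨h1, h2⟩
  obtain ⟨C₁, hC₁, hb₁⟩ := KCoef.exists_bound h1.1
  refine ⟨C₁, hC₁, fun b hb s hs => ?_⟩
  rw [(Submodule.mem_bot ℝ).1 h2]
  simpa using hb₁ b hb

theorem exists_bound_balDeriv (hg : g ∈ Asy (balDerivSys hc) q c) :
    ∃ C, 0 ≤ C ∧ ∀ b ∈ Ioo 0 b₀, ∀ s, 1 ≤ s →
      |g b s| ≤ C * (|log b|⁻¹ * (s ^ q * ((1 + log s) / |log b| +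
        (1 + log s) ^ c / s))) := by
  have key := Asy.exists_bound (j := 1) (S := balDerivSys hc)
    (m := fun b s => (1 + log s) / |log b|) (fun h hh => hh) ?_
    (fun b _ s hs => by have := log_nonneg hs; positivity) hg
  · simpa using key
  rintro p ⟨h1, h2⟩
  obtain ⟨C₁, hC₁, hb₁⟩ := KCoef.exists_bound h1
  obtain ⟨C₂, hC₂, hb₂⟩ := KCoef.exists_bound h2
  refine ⟨C₁ + C₂, by positivity, fun b hb s hs => ?_⟩
  have hl := hc.one_le hb
  have hs' := log_nonneg hs
  set ℓ := |log b| with hℓ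
  have i1 := hb₁ b hb
  have i2 := hb₂ b hb
  calc _ ≤ |p.1 b| + |p.2 b| * log s := by
        refine (abs_add_le _ _).trans ?_
        rw [abs_mul, abs_of_nonneg hs']
    _ ≤ C₁ * (ℓ ^ 2)⁻¹ * (1 + log s) + C₂ * (ℓ ^ 2)⁻¹ * (1 + log s) := by
        gcongr
        · nlinarith [abs_nonneg (p.1 b)]
        · linarith
    _ = _ := by field_simp

theorem exists_bound_balZeroDeriv (hg : g ∈ Asy (balZeroDerivSys hc) q c) :
    ∃ C, 0 ≤ C ∧ ∀ b ∈ Ioo 0 b₀, ∀ s, 1 ≤ s →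
      |g b s| ≤ C * (|log b|⁻¹ * (s ^ q * (1 / |log b| + (1 + log s) ^ c / s))) := by
  have key := Asy.exists_bound (j := 1) (S := balZeroDerivSys hc)
    (m := fun b s => 1 / |log b|) (fun h hh => hh) ?_
    (fun b _ s _ => by positivity) hg
  · simpa using key
  rintro p ⟨h1, h2⟩
  obtain ⟨C₁, hC₁, hb₁⟩ := KCoef.exists_bound h1
  refine ⟨C₁, hC₁, fun b hb s hs => ?_⟩
  have hl := hc.one_le hb
  rw [(Submodule.mem_bot ℝ).1 h2]
  simp only [Pi.zero_apply, zero_mul, add_zero]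
  refine (hb₁ b hb).trans (le_of_eq ?_)
  rw [pow_one, sq, mul_inv, one_div]

/-! ### Adapted derivatives in the variable `σ` -/

/-- The operator induced by the adapted derivative of order `k` on functions `y F(1 + y²)`. -/
def adS : ℕ → (ℝ → ℝ) → ℝ → ℝ
  | 0, F => F
  | k + 1, F => if Even k then stepE (adS k F) else stepO (adS k F)

theorem smoothPos_adS (k : ℕ) {F : ℝ → ℝ} (hF : SmoothPos F) : SmoothPos (adS k F) := by
  induction k with
  | zero => exact hF
  | succ k ih =>
    rw [adS]
    split_ifs
    · exact smoothPos_stepE ih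
    · exact smoothPos_stepO ih

theorem adS_congr {Ω : Set ℝ} (hΩ : IsOpen Ω) (k : ℕ) {F G : ℝ → ℝ} (h : ∀ s ∈ Ω, F s = G s) :
    ∀ s ∈ Ω, adS k F s = adS k G s := by
  induction k with
  | zero => exact h
  | succ k ih =>
    intro s hs
    have h1 := ih s hs
    have h2 := eul_congr hΩ ih s hs
    rw [adS, adS]
    split_ifs
    · rw [stepE, stepE, h1, h2]
    · rw [stepO, stepO, h1, h2]

theorem adS_succ_mem {M : ℤ → Submodule ℝ (ℝ → ℝ → ℝ)}
    (hE : ∀ q, ∀ g ∈ M q, (fun b => stepE (g b)) ∈ M (q - 1))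
    (hO : ∀ q, ∀ g ∈ M q, (fun b => stepO (g b)) ∈ M q) {k : ℕ}
    (h : (fun b => adS k (g b)) ∈ M (q - ((k + 1) / 2 : ℕ))) :
    (fun b => adS (k + 1) (g b)) ∈ M (q - ((k + 1 + 1) / 2 : ℕ)) := by
  by_cases hk : Even k
  · simp only [adS, if_pos hk]
    obtain ⟨m, rfl⟩ := hk
    rw [show q - ((m + m + 1 + 1) / 2 : ℕ) = q - ((m + m + 1) / 2 : ℕ) - 1 by omega]
    exact hE _ _ h
  · simp only [adS, if_neg hk]
    obtain ⟨m, rfl⟩ := Nat.not_even_iff_odd.1 hk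
    rw [show q - ((2 * m + 1 + 1 + 1) / 2 : ℕ) = q - ((2 * m + 1 + 1) / 2 : ℕ) by omega]
    exact hO _ _ h

theorem adS_mem_of_closed {M : ℤ → Submodule ℝ (ℝ → ℝ → ℝ)}
    (hE : ∀ q, ∀ g ∈ M q, (fun b => stepE (g b)) ∈ M (q - 1))
    (hO : ∀ q, ∀ g ∈ M q, (fun b => stepO (g b)) ∈ M q) (k : ℕ) (hg : g ∈ M q) :
    (fun b => adS k (g b)) ∈ M (q - ((k + 1) / 2 : ℕ)) := by
  induction k with
  | zero => simpa [adS] using hg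
  | succ k ih => exact adS_succ_mem hE hO ih

theorem adS_mem_bal (hc1 : 1 ≤ c) (k : ℕ) (hg : g ∈ Asy (balSys hc) q c) :
    (fun b => adS k (g b)) ∈ Asy (balSys hc) (q - ((k + 1) / 2 : ℕ)) c :=
  adS_mem_of_closed (M := fun q => Asy (balSys hc) q c) (fun _ _ h => Asy.stepE_mem h)
    (fun _ _ h => Asy.stepO_mem hc1 h) k hg

/-- Beyond the resonance the logarithmic leading term disappears. -/
theorem adS_mem_balZero (hc1 : 1 ≤ c) {r k : ℕ} (hr : 1 ≤ r) (hk : 2 * r ≤ k)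
    (hg : g ∈ Asy (balSys hc) ((r : ℤ) - 1) c) :
    (fun b => adS k (g b)) ∈ Asy (balZeroSys hc) ((r : ℤ) - 1 - ((k + 1) / 2 : ℕ)) c := by
  induction k, hk using Nat.le_induction with
  | base =>
    obtain ⟨m, rfl⟩ : ∃ m, r = m + 1 := ⟨r - 1, by omega⟩
    have h1 := adS_mem_bal hc hc1 (2 * m + 1) hg
    rw [show ((m + 1 : ℕ) : ℤ) - 1 - ((2 * m + 1 + 1) / 2 : ℕ) = -1 by omega] at h1
    have h2 := Asy.stepO_mem_resonance (S := balSys hc) (S' := balZeroSys hc) hc1 ?_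
      (fun _ h => h) h1
    · have hodd : ¬ Even (2 * m + 1) := by simp
      rw [show 2 * (m + 1) = 2 * m + 1 + 1 by ring]
      simp only [adS, if_neg hodd]
      rwa [show ((m + 1 : ℕ) : ℤ) - 1 - ((2 * m + 1 + 1 + 1) / 2 : ℕ) = -1 by omega]
    · rintro p ⟨a, -, h⟩
      refine ⟨?_, zero_mem _⟩
      have := sub_mem (LCoef.of_KCoef hc.le one_lt_two h) ((LCoef b₀ 1).smul_mem (a / 2) hc.mem)
      refine LCoef.congr this fun b _ => ?_
      simp only [Pi.sub_apply, Pi.smul_apply, smul_eq_mul]; ring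
  | succ k hk ih =>
    exact adS_succ_mem (M := fun q => Asy (balZeroSys hc) q c) (fun _ _ h => Asy.stepE_mem h)
      (fun _ _ h => Asy.stepO_mem hc1 h) ih

end Systems

/-! ### Cut-off functions -/

/-- Finite sums of products `ρ(b₁² σ) g(b₁, σ)` with `ρ` smooth and `g ∈ Asy (balSys hc) q c`. -/
def CutSpan {b₀ : ℝ} {cc : ℝ → ℝ} (hc : ModCoef b₀ cc) (q : ℤ) (c : ℕ) :
    Submodule ℝ (ℝ → ℝ → ℝ) :=
  Submodule.span ℝ {G | ∃ ρ : ℝ → ℝ, ContDiff ℝ ∞ ρ ∧ ∃ g ∈ Asy (balSys hc) q c,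
    EqDom b₀ G fun b s => ρ (b ^ 2 * s) * g b s}

namespace CutSpan

variable {b₀ : ℝ} {cc : ℝ → ℝ} {hc : ModCoef b₀ cc} {q : ℤ} {c : ℕ} {G g : ℝ → ℝ → ℝ}

theorem of_mul {ρ : ℝ → ℝ} (hρ : ContDiff ℝ ∞ ρ) (hg : g ∈ Asy (balSys hc) q c)
    (hG : EqDom b₀ G fun b s => ρ (b ^ 2 * s) * g b s) : G ∈ CutSpan hc q c :=
  subset_span ⟨ρ, hρ, g, hg, hG⟩

theorem domClosed : DomClosed b₀ (CutSpan hc q c) := fun G hG G' h => by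
  have : G' - G ∈ CutSpan hc q c :=
    of_mul (ρ := fun _ => 0) contDiff_const (zero_mem _) fun b hb s hs => by simp [h b hb s hs]
  simpa using add_mem this hG

theorem smooth2_cutoff {ρ : ℝ → ℝ} (hρ : ContDiff ℝ ∞ ρ) :
    Smooth2 b₀ fun b s => ρ (b ^ 2 * s) :=
  (hρ.comp (by fun_prop : ContDiff ℝ ∞ fun z : ℝ × ℝ => z.1 ^ 2 * z.2)).contDiffOn

theorem smooth2 (hG : G ∈ CutSpan hc q c) : Smooth2 b₀ G := by
  induction hG using span_induction with
  | mem G hG =>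
    obtain ⟨ρ, hρ, g, hg, e⟩ := hG
    exact ((smooth2_cutoff hρ).mul (Asy.smooth2 hg)).congr e
  | zero => exact contDiffOn_const
  | add g g' _ _ h h' => exact h.add h'
  | smul a g _ h => exact h.smul a

theorem map_op {Φ : (ℝ → ℝ → ℝ) → ℝ → ℝ → ℝ} (hΦ : DomLin b₀ Φ)
    {M : Submodule ℝ (ℝ → ℝ → ℝ)} (hM : DomClosed b₀ M)
    (hgen : ∀ ρ : ℝ → ℝ, ContDiff ℝ ∞ ρ → ∀ g ∈ Asy (balSys hc) q c,
      Φ (fun b s => ρ (b ^ 2 * s) * g b s) ∈ M)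
    (hG : G ∈ CutSpan hc q c) : Φ G ∈ M := by
  induction hG using span_induction with
  | mem G hG =>
    obtain ⟨ρ, hρ, g, hg, e⟩ := hG
    exact hM _ (hgen ρ hρ g hg) _ (hΦ.congr _ _ e)
  | zero =>
    have h0 : EqDom b₀ (Φ 0) ((0 : ℝ) • Φ 0) := by
      simpa using hΦ.smul 0 0 contDiffOn_const
    exact hM 0 (zero_mem M) _ (by simpa using h0)
  | add g g' hg hg' h h' =>
    exact hM _ (add_mem h h') _ (hΦ.add g g' (smooth2 hg) (smooth2 hg'))
  | smul a g hg h => exact hM _ (M.smul_mem a h) _ (hΦ.smul a g (smooth2 hg))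

theorem contDiff_eul {ρ : ℝ → ℝ} (hρ : ContDiff ℝ ∞ ρ) : ContDiff ℝ ∞ (eul ρ) :=
  contDiff_id.mul (contDiff_infty_iff_deriv.1 hρ).2

theorem eul_cutoff (ρ : ℝ → ℝ) (b s : ℝ) :
    eul (fun s => ρ (b ^ 2 * s)) s = eul ρ (b ^ 2 * s) := by
  simp only [eul]
  rw [deriv_comp_mul_left, smul_eq_mul]
  ring

theorem eul_cutoff_left {ρ : ℝ → ℝ} (hρ : ContDiff ℝ ∞ ρ) (b s : ℝ) :
    eul (fun b => ρ (b ^ 2 * s)) b = 2 * eul ρ (b ^ 2 * s) := by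
  have h1 : HasDerivAt (fun b : ℝ => b ^ 2 * s) (2 * b * s) b := by
    simpa using (hasDerivAt_pow 2 b).mul_const s
  have h2 := ((hρ.differentiable (by simp)) (b ^ 2 * s)).hasDerivAt.comp b h1
  simp only [eul]
  rw [show deriv (fun b => ρ (b ^ 2 * s)) b = _ from h2.deriv]
  ring

theorem eulS_mem (hG : G ∈ CutSpan hc q c) : eulS G ∈ CutSpan hc q c := by
  refine map_op (domLin_eulS b₀) domClosed (fun ρ hρ g hg => ?_) hG
  refine domClosed _ (add_mem (of_mul (contDiff_eul hρ) hg fun _ _ _ _ => rfl)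
    (of_mul hρ (Asy.eulS_mem hg) fun _ _ _ _ => rfl)) _ fun b hb s hs => ?_
  have := eul_mul_apply ((smooth2_cutoff hρ).diff_right hb hs) ((Asy.smooth2 hg).diff_right hb hs)
  rw [eul_cutoff] at this
  exact this

theorem eulB_mem (hG : G ∈ CutSpan hc q c) : eulB G ∈ CutSpan hc q c := by
  refine map_op (domLin_eulB b₀) domClosed (fun ρ hρ g hg => ?_) hG
  refine domClosed _ (add_mem ((CutSpan hc q c).smul_mem 2
    (of_mul (contDiff_eul hρ) hg fun _ _ _ _ => rfl))
    (of_mul hρ (eulB_mem_bal hc hg) fun _ _ _ _ => rfl)) _ fun b hb s hs => ?_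
  have := eul_mul_apply ((smooth2_cutoff hρ).diff_left hb hs) ((Asy.smooth2 hg).diff_left hb hs)
  rw [eul_cutoff_left hρ] at this
  simp [← mul_assoc]
  exact this

theorem inv_mul_mem (hG : G ∈ CutSpan hc q c) : (fun b s => s⁻¹ * G b s) ∈ CutSpan hc (q - 1) c :=
  map_op (domLin_mul b₀ fun _ s => s⁻¹) domClosed (fun ρ hρ g hg =>
    of_mul hρ (Asy.inv_mul_mem hg) fun b _ s _ => by simp; ring) hG

theorem coef_mul_mem (hG : G ∈ CutSpan hc q c) : (fun b s => cc b * G b s) ∈ CutSpan hc q c :=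
  map_op (domLin_mul b₀ fun b _ => cc b) domClosed (fun ρ hρ g hg =>
    of_mul hρ (coef_mul_mem_bal hc hg) fun b _ s _ => by simp; ring) hG

theorem le_succ (hc1 : 1 ≤ c) : CutSpan hc (q - 1) c ≤ CutSpan hc q c :=
  span_mono fun _ ⟨ρ, hρ, g, hg, e⟩ => ⟨ρ, hρ, g, Asy.le_succ hc1 hg, e⟩

theorem mono {c' : ℕ} (h : c ≤ c') : CutSpan hc q c ≤ CutSpan hc q c' :=
  span_mono fun _ ⟨ρ, hρ, g, hg, e⟩ => ⟨ρ, hρ, g, Asy.mono h hg, e⟩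

theorem stepE_mem (hg : g ∈ CutSpan hc q c) : (fun b => stepE (g b)) ∈ CutSpan hc (q - 1) c := by
  have h := inv_mul_mem (add_mem hg (eulS_mem hg))
  refine domClosed _ ((CutSpan hc (q - 1) c).smul_mem (-2) h) _ fun b _ s _ => ?_
  simp [stepE, eulS]
  ring

theorem stepO_mem (hc1 : 1 ≤ c) (hg : g ∈ CutSpan hc q c) :
    (fun b => stepO (g b)) ∈ CutSpan hc q c := by
  have h := add_mem (add_mem hg (eulS_mem hg))
    (le_succ hc1 (inv_mul_mem (sub_mem hg (eulS_mem hg))))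
  refine domClosed _ ((CutSpan hc q c).smul_mem 2 h) _ fun b _ s _ => ?_
  simp [stepO, eulS]
  ring

theorem adS_mem (hc1 : 1 ≤ c) (k : ℕ) (hg : g ∈ CutSpan hc q c) :
    (fun b => adS k (g b)) ∈ CutSpan hc (q - ((k + 1) / 2 : ℕ)) c :=
  adS_mem_of_closed (M := fun q => CutSpan hc q c) (fun _ _ h => stepE_mem h)
    (fun _ _ h => stepO_mem hc1 h) k hg

end CutSpan

/-- Powers of the logarithm are dominated by small powers. -/
theorem exists_one_add_log_pow_le (c : ℕ) {ε : ℝ} (hε : 0 < ε) :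
    ∃ C, 0 ≤ C ∧ ∀ s : ℝ, 1 ≤ s → (1 + log s) ^ c ≤ C * s ^ ε := by
  set δ := ε / (c + 1) with hδ
  have hδ0 : 0 < δ := by positivity
  refine ⟨(1 + 1 / δ) ^ c, by positivity, fun s hs => ?_⟩
  have hs0 : 0 < s := zero_lt_one.trans_le hs
  have h1 : log s ≤ s ^ δ / δ := log_le_rpow_div hs0.le hδ0
  have h2 : 1 ≤ s ^ δ := one_le_rpow hs hδ0.le
  have h3 : 1 + log s ≤ (1 + 1 / δ) * s ^ δ := by
    rw [add_mul, one_mul, one_div_mul_eq_div]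
    linarith
  calc _ ≤ ((1 + 1 / δ) * s ^ δ) ^ c :=
        pow_le_pow_left₀ (by have := log_nonneg hs; linarith) h3 c
    _ = (1 + 1 / δ) ^ c * s ^ (δ * c) := by rw [mul_pow, ← rpow_mul_natCast hs0.le]
    _ ≤ _ := by
      refine mul_le_mul_of_nonneg_left (rpow_le_rpow_of_exponent_le hs ?_) (by positivity)
      rw [hδ, div_mul_eq_mul_div, div_le_iff₀ (by positivity)]
      nlinarith

section

variable {b₀ : ℝ} {cc : ℝ → ℝ}

theorem ModCoef.abs_log_le (hc : ModCoef b₀ cc) {b : ℝ} (hb : b ∈ Ioo 0 b₀) :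
    |Real.log b| ≤ b⁻¹ := by
  have hneg : Real.log b ≤ 0 := Real.log_nonpos hb.1.le (by linarith [hb.2, hc.le])
  rw [abs_of_nonpos hneg, ← log_inv]
  linarith [log_le_sub_one_of_pos (inv_pos.2 hb.1)]

/-- Beyond `σ = b₁⁻²` a gain of `σ⁻¹`, up to logarithms, is a gain of `1 / |log b₁|`. -/
theorem ModCoef.exists_log_pow_div_le (hc : ModCoef b₀ cc) (c : ℕ) :
    ∃ C, 0 ≤ C ∧ ∀ b ∈ Ioo 0 b₀, ∀ s, 1 ≤ b ^ 2 * s →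
      1 ≤ s ∧ (1 + Real.log s) ^ c / s ≤ C / |Real.log b| := by
  obtain ⟨C, hC, h⟩ := exists_one_add_log_pow_le c (ε := 1 / 2) (by norm_num)
  refine ⟨C, hC, fun b hb s hbs => ?_⟩
  have hb1 : b < 1 := by linarith [hb.2, hc.le]
  have hs0 : 0 < s := by
    by_contra hs
    nlinarith [mul_nonneg (sq_nonneg b) (neg_nonneg.2 (not_lt.1 hs))]
  have hs : 1 ≤ s := by nlinarith [hb.1, mul_pos hb.1 hs0]
  refine ⟨hs, ?_⟩
  have hl := hc.one_le hb
  have h1 : b⁻¹ ≤ s ^ (1 / 2 : ℝ) := by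
    rw [← sqrt_eq_rpow]
    refine le_sqrt_of_sq_le ?_
    rw [inv_pow, inv_le_iff_one_le_mul₀ (by have := hb.1; positivity)]
    linarith
  have h2 : s ^ (1 / 2 : ℝ) * s ^ (1 / 2 : ℝ) = s := by
    rw [← rpow_add hs0]; norm_num
  have h3 : 0 < s ^ (1 / 2 : ℝ) := rpow_pos_of_pos hs0 _
  rw [div_le_div_iff₀ hs0 (by linarith)]
  have h4 := (hc.abs_log_le hb).trans h1
  calc _ ≤ (C * s ^ (1 / 2 : ℝ)) * s ^ (1 / 2 : ℝ) :=
        mul_le_mul (h s hs) h4 (abs_nonneg _) (by positivity)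
    _ = C * s := by rw [mul_assoc, h2]

theorem CutSpan.exists_bound {hc : ModCoef b₀ cc} {q : ℤ} {c : ℕ} {G : ℝ → ℝ → ℝ}
    (hG : G ∈ CutSpan hc q c) : ∃ C, 0 ≤ C ∧ ∀ b ∈ Ioo 0 b₀, ∀ s, 1 ≤ b ^ 2 * s → b ^ 2 * s ≤ 2 →
      |G b s| ≤ C * (s ^ q / |log b|) := by
  induction hG using span_induction with
  | mem G hG =>
    obtain ⟨ρ, hρ, g, hg, e⟩ := hG
    obtain ⟨C, hC, hb⟩ := exists_bound_bal hc hg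
    obtain ⟨D, hD, hb'⟩ := hc.exists_log_pow_div_le c
    obtain ⟨E, hE⟩ := (isCompact_Icc (a := (1 : ℝ)) (b := 2)).exists_bound_of_continuousOn
      hρ.continuous.continuousOn
    have hE0 : 0 ≤ E := (norm_nonneg _).trans (hE 1 (by norm_num))
    refine ⟨E * (C * (2 + D)), by positivity, fun b hb₁ s h1 h2 => ?_⟩
    obtain ⟨hs, h3⟩ := hb' b hb₁ s h1
    have hs0 : 0 < s := zero_lt_one.trans_le hs
    have hl := hc.one_le hb₁
    rw [e b hb₁ s hs0, abs_mul, mul_assoc E]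
    refine mul_le_mul (hE _ ⟨h1, h2⟩) ((hb b hb₁ s hs).trans ?_) (abs_nonneg _) hE0
    have h4 : |log (b ^ 2 * s)| ≤ 1 := by
      rw [abs_of_nonneg (log_nonneg h1)]
      linarith [log_le_sub_one_of_pos (zero_lt_one.trans_le h1)]
    calc _ ≤ C * (s ^ q * ((1 + 1) / |log b| + D / |log b|)) := by gcongr
      _ = _ := by ring
  | zero => exact ⟨0, le_rfl, by simp⟩
  | add R R' _ _ h h' =>
    obtain ⟨C, hC, hb⟩ := h
    obtain ⟨C', hC', hb'⟩ := h'
    refine ⟨C + C', add_nonneg hC hC', fun b hb₁ s hs hs' => ?_⟩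
    rw [add_mul]
    exact (abs_add_le _ _).trans (add_le_add (hb b hb₁ s hs hs') (hb' b hb₁ s hs hs'))
  | smul a R _ h =>
    obtain ⟨C, hC, hb⟩ := h
    refine ⟨|a| * C, mul_nonneg (abs_nonneg a) hC, fun b hb₁ s hs hs' => ?_⟩
    rw [Pi.smul_apply, Pi.smul_apply, smul_eq_mul, abs_mul, mul_assoc]
    exact mul_le_mul_of_nonneg_left (hb b hb₁ s hs hs') (abs_nonneg a)

/-! ### Derivatives in `b₁` -/

theorem contDiffOn_iteratedDeriv {Ω : Set ℝ} (hΩ : IsOpen Ω) (l : ℕ) {h : ℝ → ℝ}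
    (hh : ContDiffOn ℝ ∞ h Ω) : ContDiffOn ℝ ∞ (iteratedDeriv l h) Ω := by
  induction l with
  | zero => simpa using hh
  | succ l ih =>
    rw [iteratedDeriv_succ]
    exact ((contDiffOn_infty_iff_deriv_of_isOpen hΩ).1 ih).2

theorem eul_pow_mul_iteratedDeriv {Ω : Set ℝ} (hΩ : IsOpen Ω) (l : ℕ) {h : ℝ → ℝ}
    (hh : ContDiffOn ℝ ∞ h Ω) {b : ℝ} (hb : b ∈ Ω) :
    b ^ (l + 1) * iteratedDeriv (l + 1) h b =
      eul (fun b => b ^ l * iteratedDeriv l h b) b - l * (b ^ l * iteratedDeriv l h b) := by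
  have h1 := contDiffOn_differentiableAt hΩ (contDiffOn_iteratedDeriv hΩ l hh) hb
  have h2 : eul (fun b => b ^ l) b = l * b ^ l := by
    simp only [eul, deriv_pow_field]
    rcases l with _ | l
    · simp
    · simp; ring
  rw [eul_mul_apply (differentiableAt_pow l) h1, h2, iteratedDeriv_succ]
  simp only [eul]
  ring

theorem iteratedDeriv_mem {M : Submodule ℝ (ℝ → ℝ → ℝ)} (hM : DomClosed b₀ M)
    (hE : ∀ g ∈ M, eulB g ∈ M) {φ : ℝ → ℝ → ℝ} (hφ : Smooth2 b₀ φ) (h1 : eulB φ ∈ M) {l : ℕ}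
    (hl : 1 ≤ l) : (fun b s => b ^ l * iteratedDeriv l (fun β => φ β s) b) ∈ M := by
  induction l, hl using Nat.le_induction with
  | base =>
    simp only [pow_one, iteratedDeriv_one]
    exact h1
  | succ l _ ih =>
    refine hM _ (sub_mem (hE _ ih) (M.smul_mem (l : ℝ) ih)) _ fun b hb s hs => ?_
    exact eul_pow_mul_iteratedDeriv isOpen_Ioo l (hφ.left hs) hb

end

/-! ### Adapted derivatives and expansions at the origin -/

theorem SmoothPos.comp_one_add_sq {F : ℝ → ℝ} (hF : SmoothPos F) (y : ℝ) :
    HasDerivAt (fun y => F (1 + y ^ 2)) (_root_.deriv F (1 + y ^ 2) * (2 * y)) y :=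
  (hF.hasDerivAt (one_add_sq_pos y)).comp y (hasDerivAt_one_add_sq y)

/-- In the variable `σ = 1 + y²` the adapted derivatives act through `stepE` and `stepO`. -/
theorem adapted_eq_adS (k : ℕ) {F : ℝ → ℝ} (hF : SmoothPos F) :
    ∀ y ∈ Ioi (0 : ℝ), adapted k (fun y => y * F (1 + y ^ 2)) y =
      y ^ (1 + k % 2) * adS k F (1 + y ^ 2) := by
  induction k with
  | zero => intro y _; simp [adapted, adS]
  | succ k ih =>
    intro y hy
    have hy : 0 < y := hy
    have hG := smoothPos_adS k hF
    have hs := one_add_sq_pos y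
    have h1 := ih y hy
    have h2 := Filter.EventuallyEq.deriv_eq (eventuallyEq_of_mem (isOpen_Ioi.mem_nhds hy) ih)
    have h3 := ((hasDerivAt_pow (1 + k % 2) y).mul (SmoothPos.comp_one_add_sq hG y)).deriv
    have h4 : deriv (adapted k fun y => y * F (1 + y ^ 2)) y = _ := h2.trans h3
    rw [adapted, adS]
    split_ifs with hk
    · have hk' : (k + 1) % 2 = 1 := by have := Nat.even_iff.1 hk; omega
      rw [opA, h4, h1, stepE, Z, eul, Nat.even_iff.1 hk, hk']
      push_cast
      field_simp
      ring
    · have hk1 : k % 2 = 1 := Nat.not_even_iff.1 hk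
      have hk' : (k + 1) % 2 = 0 := by omega
      rw [opAstar, h4, h1, stepO, Z, eul, hk1, hk']
      push_cast
      field_simp
      ring

/-- A smooth function has a full Taylor expansion, with smooth remainders. -/
theorem exists_taylor_coeff {U : Set ℝ} (hU : IsOpen U) (hc : Convex ℝ U) {a : ℝ}
    (ha : a ∈ U) {F : ℝ → ℝ} (hF : ContDiffOn ℝ ∞ F U) :
    ∃ g : ℕ → ℝ, ∀ N, ∃ G : ℝ → ℝ, ContDiffOn ℝ ∞ G U ∧
      ∀ x ∈ U, F x = ∑ n ∈ range N, g n * (x - a) ^ n + (x - a) ^ N * G x := by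
  choose! H hH using fun (F : ℝ → ℝ) (hF : ContDiffOn ℝ ∞ F U) =>
    exists_contDiffOn_sub_mul hU hc ha hF
  have hs : ∀ N, ContDiffOn ℝ ∞ (H^[N] F) U := fun N => by
    induction N with
    | zero => exact hF
    | succ N ih => rw [Function.iterate_succ_apply']; exact (hH _ ih).1
  refine ⟨fun n => H^[n] F a, fun N => ⟨H^[N] F, hs N, fun x hx => ?_⟩⟩
  induction N with
  | zero => simp
  | succ N ih =>
    rw [ih, Finset.sum_range_succ, Function.iterate_succ_apply', (hH _ (hs N)).2 x hx]
    ring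

theorem iteratedDeriv_pow_mul {K : ℝ → ℝ} (hK : ContDiff ℝ ∞ K) (N m : ℕ) (hm : m ≤ N) :
    ∃ K' : ℝ → ℝ, ContDiff ℝ ∞ K' ∧
      iteratedDeriv m (fun x => x ^ N * K x) = fun x => x ^ (N - m) * K' x := by
  induction m with
  | zero => exact ⟨K, hK, by simp⟩
  | succ m ih =>
    obtain ⟨K', hK', e⟩ := ih (by omega)
    refine ⟨fun x => (N - m : ℕ) * K' x + x * deriv K' x, (contDiff_const.mul hK').add
      (contDiff_id.mul (contDiff_infty_iff_deriv.1 hK').2), ?_⟩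
    rw [iteratedDeriv_succ, e]
    funext x
    have h := ((hasDerivAt_pow (N - m) x).mul
      ((hK'.differentiable (by simp)) x).hasDerivAt).deriv
    refine Eq.trans h ?_
    obtain ⟨j, hj⟩ : ∃ j, N - m = j + 1 := ⟨N - m - 1, by omega⟩
    rw [show N - (m + 1) = j by omega, hj, Nat.add_sub_cancel, pow_succ]
    ring

theorem contDiff_comp_one_add_sq {F : ℝ → ℝ} (hF : SmoothPos F) :
    ContDiff ℝ ∞ fun y : ℝ => F (1 + y ^ 2) :=
  contDiffOn_univ.1 (ContDiffOn.comp (g := F) (t := Ioi 0) hF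
    (by fun_prop : ContDiff ℝ ∞ fun y : ℝ => 1 + y ^ 2).contDiffOn fun y _ => one_add_sq_pos y)

/-- The expansion of `y F(1 + y²)` at the origin, when `F` vanishes to order `r` at `σ = 1`. -/
theorem originExpansion_of_van {r ι : ℕ} (hι : ι ≤ 1) {F : ℝ → ℝ} (hF : Van r F) :
    OriginExpansion (2 * r + ι) ι fun y => y * F (1 + y ^ 2) := by
  obtain ⟨G, hG, hFG⟩ := hF
  obtain ⟨g, hg⟩ := exists_taylor_coeff isOpen_Ioi (convex_Ioi 0)
    (mem_Ioi.2 one_pos) hG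
  refine ⟨fun k => g (k / 2 - r), fun p hp m hm => ?_⟩
  have hrp : r ≤ p := by omega
  obtain ⟨K, hK, hGK⟩ := hg (p + 1 - r)
  have key : (fun x : ℝ => x * F (1 + x ^ 2) -
      ∑ k ∈ (range (2 * p + 1)).filter (fun k => 2 * r + ι ≤ k + ι ∧ Even k),
        g (k / 2 - r) * x ^ (k + 1)) = fun x => x ^ (2 * p + 3) * K (1 + x ^ 2) := by
    funext x
    have hs : ∑ k ∈ (range (2 * p + 1)).filter (fun k => 2 * r + ι ≤ k + ι ∧ Even k),
        g (k / 2 - r) * x ^ (k + 1) =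
        ∑ n ∈ range (p + 1 - r), g n * x ^ (2 * (n + r) + 1) := by
      symm
      refine Finset.sum_bij (fun n _ => 2 * (n + r)) ?_ ?_ ?_ ?_
      · intro n hn
        simp only [Finset.mem_filter, Finset.mem_range] at hn ⊢
        exact ⟨by omega, by omega, even_two_mul _⟩
      · intro a _ b _ h; omega
      · intro k hk
        simp only [Finset.mem_filter, Finset.mem_range] at hk
        obtain ⟨h1, h2, j, rfl⟩ := hk
        exact ⟨j - r, Finset.mem_range.2 (by omega), by omega⟩
      · intro n _
        rw [show 2 * (n + r) / 2 - r = n by omega]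
    rw [hs, hFG _ (one_add_sq_pos x), hGK _ (one_add_sq_pos x), add_sub_cancel_left]
    rw [show 2 * p + 3 = 1 + 2 * r + 2 * (p + 1 - r) by omega, pow_add, pow_add, pow_mul, pow_mul,
      pow_one]
    have h1 : ∑ n ∈ range (p + 1 - r), g n * x ^ (2 * (n + r) + 1) =
        x * ((x ^ 2) ^ r * ∑ n ∈ range (p + 1 - r), g n * (x ^ 2) ^ n) := by
      rw [mul_sum, mul_sum]
      refine sum_congr rfl fun n _ => ?_
      rw [mul_add 2, pow_succ, pow_add, pow_mul, pow_mul]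
      ring
    rw [h1]
    ring
  rw [key]
  obtain ⟨K', hK', e⟩ := iteratedDeriv_pow_mul (contDiff_comp_one_add_sq hK) (2 * p + 3) m hm
  rw [e]
  have h1 : K' =O[𝓝[>] (0 : ℝ)] fun _ => (1 : ℝ) :=
    (hK'.continuous.continuousWithinAt (s := Ioi 0) (x := 0)).isBigO_one ℝ
  simpa using (Asymptotics.isBigO_refl (fun y : ℝ => y ^ (2 * p + 3 - m)) (𝓝[>] 0)).mul h1

/-! ### Admissibility of the cut-off functions -/

theorem SymVan.mono {q q' : ℤ} {c c' v v' : ℕ} (hq : q ≤ q') (hc : c ≤ c') (hv : v' ≤ v) :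
    SymVan q c v ≤ SymVan q' c' v' := by
  rintro F ⟨h, G, hG, e⟩
  refine ⟨h.mono hq hc, fun s => (s - 1) ^ (v - v') * G s,
    (by fun_prop : ContDiff ℝ ∞ fun s : ℝ => (s - 1) ^ (v - v')).contDiffOn.mul hG, fun s hs => ?_⟩
  rw [e s hs, ← mul_assoc, ← pow_add, Nat.add_sub_cancel' hv]

/-- The functions admitted as coefficients of the corrections of degree `2r` and `2r + 1`. -/
def ProfSpan {b₀ : ℝ} {cc : ℝ → ℝ} (hc : ModCoef b₀ cc) (r : ℕ) : Submodule ℝ (ℝ → ℝ → ℝ) where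
  carrier := {g | ∃ c : ℕ, 1 ≤ c ∧ g ∈ Asy (balSys hc) ((r : ℤ) - 1) c ∧
    g ∈ Tens b₀ (LCoef b₀ 0) (SymVan ((r : ℤ) - 1) c r)}
  add_mem' := by
    rintro g g' ⟨c, h1, h2, h3⟩ ⟨c', h1', h2', h3'⟩
    exact ⟨max c c', le_max_of_le_left h1,
      add_mem (Asy.mono (le_max_left _ _) h2) (Asy.mono (le_max_right _ _) h2'),
      add_mem (Tens.mono le_rfl (SymVan.mono le_rfl (le_max_left _ _) le_rfl) h3)
        (Tens.mono le_rfl (SymVan.mono le_rfl (le_max_right _ _) le_rfl) h3')⟩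
  zero_mem' := ⟨1, le_rfl, zero_mem _, zero_mem _⟩
  smul_mem' := by
    rintro a g ⟨c, h1, h2, h3⟩
    exact ⟨c, h1, smul_mem _ a h2, smul_mem _ a h3⟩

/-- Functions with a finite expansion of products `h(b₁) y F(1 + y²)` satisfy the condition at the
origin. -/
theorem exists_origin_of_tens {b₀ : ℝ} {q : ℤ} {c r ι : ℕ} (hι : ι ≤ 1)
    {g : ℝ → ℝ → ℝ} (hg : g ∈ Tens b₀ (LCoef b₀ 0) (SymVan q c r)) :
    ∃ (n : ℕ) (h φ : Fin n → ℝ → ℝ),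
      (∀ j, ContDiffOn ℝ ∞ (h j) (Ioo 0 b₀)) ∧
      (∀ j, ∀ l : ℕ, ∃ C : ℝ, ∀ b₁ ∈ Ioo 0 b₀, |iteratedDeriv l (h j) b₁| ≤ C / b₁ ^ l) ∧
      (∀ j, ContDiffOn ℝ ∞ (φ j) (Ici 0)) ∧
      (∀ j, OriginExpansion (2 * r + ι) ι (φ j)) ∧
      ∀ b₁ ∈ Ioo 0 b₀, ∀ y : ℝ, y * g b₁ (1 + y ^ 2) = ∑ j, h j b₁ * φ j y := by
  obtain ⟨n, a, e, rfl⟩ := Submodule.mem_span_set'.1 hg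
  choose h hh F hF hE using fun j => (e j).2
  refine ⟨n, fun j b => a j * h j b, fun j y => y * F j (1 + y ^ 2), fun j => ?_, fun j l => ?_,
    fun j => ?_, fun j => originExpansion_of_van hι (hF j).2, fun b hb y => ?_⟩
  · exact contDiffOn_const.mul (LCoef.smooth (hh j))
  · have hk : (fun b => a j * h j b) ∈ KCoef b₀ 0 := (KCoef b₀ 0).smul_mem (a j) (hh j).1
    have hD : (fun b => b ^ l * iteratedDeriv l (fun b => a j * h j b) b) ∈ KCoef b₀ 0 := by
      induction l with
      | zero => simpa using hk
      | succ l ih =>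
        refine KCoef.congr (sub_mem (KCoef.eul ih) ((KCoef b₀ 0).smul_mem (l : ℝ) ih))
          fun b hb => ?_
        exact eul_pow_mul_iteratedDeriv isOpen_Ioo l (KCoef.smooth hk) hb
    obtain ⟨C, -, hC⟩ := KCoef.exists_bound hD
    refine ⟨C, fun b hb => ?_⟩
    have hb0 := hb.1
    have := hC b hb
    rw [abs_mul, abs_of_pos (pow_pos hb0 l)] at this
    rw [le_div_iff₀ (pow_pos hb0 l)]
    simpa [mul_comm] using this
  · exact (contDiff_id.mul (contDiff_comp_one_add_sq (hF j).1.smooth)).contDiffOn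
  · simp [Finset.sum_apply, mul_sum]
    refine sum_congr rfl fun j _ => ?_
    rw [hE j b hb _ (one_add_sq_pos y)]
    ring

section

variable {y : ℝ}

theorem log_one_add_sq_le (hy : 1 ≤ y) : log (1 + y ^ 2) ≤ 1 + 2 * |log y| := by
  have hy0 : 0 < y := by linarith
  have h1 : log (1 + y ^ 2) ≤ log (2 * y ^ 2) :=
    log_le_log (by positivity) (by nlinarith)
  rw [log_mul two_ne_zero (by positivity), log_pow] at h1
  rw [abs_of_nonneg (log_nonneg hy)]
  push_cast at h1
  linarith [log_two_lt_d9]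

theorem log_pow_div_le (hy : 1 ≤ y) (c : ℕ) :
    (1 + log (1 + y ^ 2)) ^ c / (1 + y ^ 2) ≤ 2 ^ c * ((1 + |log y|) ^ c / y ^ 2) := by
  have hy0 : 0 < y := by linarith
  have h0 : 0 ≤ log (1 + y ^ 2) := log_nonneg (by nlinarith)
  rw [← mul_div_assoc, ← mul_pow]
  have := log_one_add_sq_le hy
  gcongr
  · linarith
  · linarith

theorem zpow_one_add_sq_le (hy : 1 ≤ y) (q : ℤ) : (1 + y ^ 2) ^ q ≤ 2 ^ |q| * y ^ (2 * q) := by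
  have hy0 : 0 < y := by linarith
  rw [zpow_mul, show y ^ (2 : ℤ) = y ^ 2 from zpow_ofNat y 2]
  rcases le_total 0 q with h | h
  · rw [abs_of_nonneg h, ← mul_zpow]
    exact zpow_le_zpow_left₀ h (by positivity) (by nlinarith)
  · have h1 : (1 + y ^ 2) ^ q ≤ (y ^ 2) ^ q := by
      obtain ⟨n, rfl⟩ : ∃ n : ℕ, q = -n := ⟨q.natAbs, by omega⟩
      rw [zpow_neg, zpow_neg, zpow_natCast, zpow_natCast]
      gcongr
      linarith
    have h2 : (1 : ℝ) ≤ 2 ^ |q| := one_le_zpow₀ one_le_two (abs_nonneg q)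
    have h3 : 0 ≤ (y ^ 2) ^ q := by positivity
    nlinarith

theorem pow_mul_zpow_one_add_sq_le (hy : 1 ≤ y) (r k : ℕ) :
    y ^ (1 + k % 2) * (1 + y ^ 2) ^ ((r : ℤ) - 1 - ((k + 1) / 2 : ℕ)) ≤
      2 ^ |(r : ℤ) - 1 - ((k + 1) / 2 : ℕ)| * y ^ (2 * (r : ℤ) - k - 1) := by
  have hy0 : 0 < y := by linarith
  calc _ ≤ y ^ (1 + k % 2) * (2 ^ |(r : ℤ) - 1 - ((k + 1) / 2 : ℕ)| *
        y ^ (2 * ((r : ℤ) - 1 - ((k + 1) / 2 : ℕ)))) :=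
        mul_le_mul_of_nonneg_left (zpow_one_add_sq_le hy _) (by positivity)
    _ = 2 ^ |(r : ℤ) - 1 - ((k + 1) / 2 : ℕ)| * (y ^ ((1 + k % 2 : ℕ) : ℤ) *
        y ^ (2 * ((r : ℤ) - 1 - ((k + 1) / 2 : ℕ)))) := by rw [zpow_natCast]; ring
    _ = _ := by
      rw [← zpow_add₀ hy0.ne']
      congr 2
      omega

theorem abs_log_sq_mul_le (hy : 1 ≤ y) {b : ℝ} (hb : 0 < b) :
    |log (b ^ 2 * (1 + y ^ 2))| ≤ 1 + 2 * |log (b * y)| := by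
  have hy0 : 0 < y := by linarith
  have h1 : b ^ 2 * (1 + y ^ 2) = (b * y) ^ 2 * ((1 + y ^ 2) / y ^ 2) := by field_simp
  have h2 : 1 ≤ (1 + y ^ 2) / y ^ 2 := by rw [le_div_iff₀ (by positivity)]; linarith
  have h3 : (1 + y ^ 2) / y ^ 2 ≤ 2 := by rw [div_le_iff₀ (by positivity)]; nlinarith
  rw [h1, log_mul (by positivity) (by positivity), log_pow]
  refine (abs_add_le _ _).trans ?_
  rw [abs_mul, abs_of_nonneg (log_nonneg h2)]
  have h4 := log_le_sub_one_of_pos (zero_lt_one.trans_le h2)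
  simp only [Nat.cast_ofNat, abs_two]
  linarith

end

section

variable {b₀ : ℝ} {cc : ℝ → ℝ} {χ : ℝ → ℝ} {g : ℝ → ℝ → ℝ}

/-- The cut-off of `g` at the scale `σ = b₁⁻²`. -/
def cutoff (χ : ℝ → ℝ) (g : ℝ → ℝ → ℝ) (b s : ℝ) : ℝ := χ (b ^ 2 * s) * g b s

theorem isOpen_mul_lt (a c : ℝ) : IsOpen {s : ℝ | a * s < c} :=
  isOpen_lt (by fun_prop) continuous_const

theorem isOpen_lt_mul (a c : ℝ) : IsOpen {s : ℝ | c < a * s} :=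
  isOpen_lt continuous_const (by fun_prop)

theorem adS_zero (k : ℕ) (s : ℝ) : adS k (fun _ => 0) s = 0 := by
  induction k generalizing s with
  | zero => rfl
  | succ k ih =>
    have h1 : adS k (fun _ => 0) = fun _ => (0 : ℝ) := funext ih
    rw [adS, h1]
    split_ifs <;> simp [stepE, stepO, eul]

theorem adS_cutoff_of_lt (hχ : Cutoff χ) (k : ℕ) {b s : ℝ}
    (h : b ^ 2 * s < 1) : adS k (cutoff χ g b) s = adS k (g b) s :=
  adS_congr (isOpen_mul_lt (b ^ 2) 1) k (fun s hs => by
    rw [cutoff, hχ.one _ (le_of_lt hs), one_mul]) s h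

theorem adS_cutoff_of_gt (hχ : Cutoff χ) (k : ℕ) {b s : ℝ}
    (h : 2 < b ^ 2 * s) : adS k (cutoff χ g b) s = 0 :=
  (adS_congr (isOpen_lt_mul (b ^ 2) 2) k (fun s hs => by
    rw [cutoff, hχ.zero _ (le_of_lt hs), zero_mul]) s h).trans (adS_zero k s)

theorem cutoff_mem {hc : ModCoef b₀ cc} (hχ : Cutoff χ) {q : ℤ} {c : ℕ}
    (hg : g ∈ Asy (balSys hc) q c) : cutoff χ g ∈ CutSpan hc q c :=
  CutSpan.of_mul hχ.smooth hg fun _ _ _ _ => rfl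

theorem farInd_nonneg (p₂ : ℤ) (k ι : ℕ) (b y : ℝ) : 0 ≤ farInd p₂ k ι b y := by
  unfold farInd; split_ifs <;> norm_num

theorem gLog_nonneg (l : ℤ) (b y : ℝ) : 0 ≤ gLog l b y := by
  unfold gLog; split_ifs <;> positivity

theorem gLogTilde_nonneg (l : ℤ) (b y : ℝ) : 0 ≤ gLogTilde l b y := by
  unfold gLogTilde; split_ifs <;> positivity

theorem le_three_B0 {b y : ℝ} (hb : 0 < b) (h : b ^ 2 * (1 + y ^ 2) ≤ 2) : y ≤ 3 * B0 b := by
  rw [B0, mul_one_div, le_div_iff₀ hb]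
  nlinarith [sq_nonneg (b * y), sq_nonneg (b * y - 3)]

theorem B0_div_four_le {b y : ℝ} (hb : 0 < b) (hb1 : b ≤ 1 / 4) (hy : 0 < y)
    (h : 1 ≤ b ^ 2 * (1 + y ^ 2)) : B0 b / 4 ≤ y := by
  rw [B0, div_div, div_le_iff₀ (by positivity)]
  nlinarith [mul_pos hb hy]

theorem one_div_abs_log_le_gLog (hc : ModCoef b₀ cc) {l : ℤ} {b y : ℝ} (hb : b ∈ Ioo 0 b₀)
    (h : y ≤ 3 * B0 b) : 1 / |log b| ≤ gLog l b y := by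
  have := hc.one_le hb
  rw [gLog, if_pos h]
  gcongr
  have : (0 : ℝ) ≤ if 1 ≤ l then |log (b * y)| else 0 := by split_ifs <;> positivity
  linarith

/-- A function bounded in the zone `b₁²σ < 1` and in the transition zone, and vanishing beyond it,
is bounded with the weight of an admissible function. -/
theorem exists_bound_of_zones {f W G : ℝ → ℝ → ℝ} {c : ℕ} (hW : ∀ b y, 0 ≤ W b y)
    (hG : ∀ b y, 0 ≤ G b y)
    (h₁ : ∃ C, 0 ≤ C ∧ ∀ b ∈ Ioo 0 b₀, ∀ y : ℝ, 1 ≤ y → b ^ 2 * (1 + y ^ 2) < 1 →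
      |f b y| ≤ C * (W b y * (G b y + (1 + log (1 + y ^ 2)) ^ c / (1 + y ^ 2))))
    (h₀ : ∃ C, 0 ≤ C ∧ ∀ b ∈ Ioo 0 b₀, ∀ y : ℝ, 1 ≤ y → 1 ≤ b ^ 2 * (1 + y ^ 2) →
      b ^ 2 * (1 + y ^ 2) ≤ 2 → |f b y| ≤ C * (W b y * G b y))
    (h₂ : ∀ b y : ℝ, 2 < b ^ 2 * (1 + y ^ 2) → f b y = 0) :
    ∃ C, 0 ≤ C ∧ ∀ b ∈ Ioo 0 b₀, ∀ y : ℝ, 1 ≤ y →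
      |f b y| ≤ C * (W b y * (G b y + (1 + |log y|) ^ c / y ^ 2)) := by
  obtain ⟨C₁, hC₁, h₁⟩ := h₁
  obtain ⟨C₀, hC₀, h₀⟩ := h₀
  refine ⟨C₁ * 2 ^ c + C₀, by positivity, fun b hb y hy => ?_⟩
  have hw := hW b y
  have hg := hG b y
  have hp : 0 ≤ (1 + |log y|) ^ c / y ^ 2 := by positivity
  have hm : C₁ * 2 ^ c * (W b y * (G b y + (1 + |log y|) ^ c / y ^ 2)) +
      C₀ * (W b y * (G b y + (1 + |log y|) ^ c / y ^ 2)) =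
      (C₁ * 2 ^ c + C₀) * (W b y * (G b y + (1 + |log y|) ^ c / y ^ 2)) := by ring
  rw [← hm]
  rcases lt_or_ge (b ^ 2 * (1 + y ^ 2)) 1 with hx | hx
  · refine (h₁ b hb y hy hx).trans (le_add_of_le_of_nonneg ?_ (by positivity))
    rw [mul_assoc C₁, mul_left_comm (2 ^ c), mul_add (2 ^ c)]
    gcongr
    · exact le_mul_of_one_le_left hg (one_le_pow₀ one_le_two)
    · exact log_pow_div_le hy c
  rcases le_or_gt (b ^ 2 * (1 + y ^ 2)) 2 with hx2 | hx2
  · refine (h₀ b hb y hy hx hx2).trans (le_add_of_nonneg_of_le (by positivity) ?_)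
    gcongr
    linarith
  · rw [h₂ b y hx2, abs_zero]
    positivity

/-- The bounds for the adapted derivatives of a cut-off function. -/
theorem exists_bound_adS_cutoff (hc : ModCoef b₀ cc) (hχ : Cutoff χ) {r c : ℕ}
    (hr : 1 ≤ r) (hc1 : 1 ≤ c) (hg : g ∈ Asy (balSys hc) ((r : ℤ) - 1) c) (k : ℕ) :
    ∃ C, 0 ≤ C ∧ ∀ b ∈ Ioo 0 b₀, ∀ y : ℝ, 1 ≤ y →
      |adS k (cutoff χ g b) (1 + y ^ 2)| ≤ C * ((1 + y ^ 2) ^ ((r : ℤ) - 1 - ((k + 1) / 2 : ℕ)) *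
        (gLog (2 * (r : ℤ) - k) b y + (1 + |log y|) ^ c / y ^ 2)) := by
  refine exists_bound_of_zones (fun b y => by positivity) (gLog_nonneg _) ?_ ?_ fun b y hx =>
    adS_cutoff_of_gt hχ k hx
  · suffices ∃ C, 0 ≤ C ∧ ∀ b ∈ Ioo 0 b₀, ∀ y : ℝ, 1 ≤ y → b ^ 2 * (1 + y ^ 2) < 1 →
        |adS k (g b) (1 + y ^ 2)| ≤ C * ((1 + y ^ 2) ^ ((r : ℤ) - 1 - ((k + 1) / 2 : ℕ)) *
          (gLog (2 * (r : ℤ) - k) b y + (1 + log (1 + y ^ 2)) ^ c / (1 + y ^ 2))) by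
      obtain ⟨C, hC, h⟩ := this
      exact ⟨C, hC, fun b hb y hy hx => by rw [adS_cutoff_of_lt hχ k hx]; exact h b hb y hy hx⟩
    rcases lt_or_ge k (2 * r) with hk | hk
    · obtain ⟨C, hC, h⟩ := exists_bound_bal hc (adS_mem_bal hc hc1 k hg)
      refine ⟨C * 2, by positivity, fun b hb y hy hx => (h b hb _ (by nlinarith)).trans ?_⟩
      have hl := hc.one_le hb
      have hB := le_three_B0 (y := y) hb.1 (by linarith)
      have hlog : 0 ≤ log (1 + y ^ 2) := log_nonneg (by nlinarith)
      have h2 : (1 + |log (b ^ 2 * (1 + y ^ 2))|) / |log b| ≤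
          2 * gLog (2 * (r : ℤ) - k) b y := by
        rw [gLog, if_pos hB, if_pos (by omega), ← mul_div_assoc]
        gcongr
        linarith [abs_log_sq_mul_le hy hb.1]
      have h3 : 0 ≤ (1 + log (1 + y ^ 2)) ^ c / (1 + y ^ 2) := by positivity
      rw [mul_assoc C, mul_left_comm 2]
      gcongr
      linarith
    · obtain ⟨C, hC, h⟩ := exists_bound_balZero hc (adS_mem_balZero hc hc1 hr hk hg)
      refine ⟨C, by positivity, fun b hb y hy hx => (h b hb _ (by nlinarith)).trans ?_⟩
      have hB := le_three_B0 (y := y) hb.1 (by linarith)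
      gcongr
      exact one_div_abs_log_le_gLog hc hb hB
  · obtain ⟨C, hC, h⟩ := CutSpan.exists_bound (CutSpan.adS_mem hc1 k (cutoff_mem hχ hg))
    refine ⟨C, hC, fun b hb y hy hx hx2 => (h b hb _ hx hx2).trans ?_⟩
    rw [← mul_one_div]
    gcongr
    exact one_div_abs_log_le_gLog hc hb (le_three_B0 hb.1 hx2)

/-- The bounds for the `b₁`-derivatives of the adapted derivatives of a cut-off function. -/
theorem exists_bound_iteratedDeriv_adS_cutoff (hc : ModCoef b₀ cc) (hχ : Cutoff χ) {r c : ℕ}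
    (hr : 1 ≤ r) (hc1 : 1 ≤ c) (hg : g ∈ Asy (balSys hc) ((r : ℤ) - 1) c) (k : ℕ) {l : ℕ}
    (hl1 : 1 ≤ l) :
    ∃ C, 0 ≤ C ∧ ∀ b ∈ Ioo 0 b₀, ∀ y : ℝ, 1 ≤ y →
      |b ^ l * iteratedDeriv l (fun β => adS k (cutoff χ g β) (1 + y ^ 2)) b| ≤
        C * (|log b|⁻¹ * (1 + y ^ 2) ^ ((r : ℤ) - 1 - ((k + 1) / 2 : ℕ)) *
        (gLogTilde (2 * (r : ℤ) - k) b y + (1 + |log y|) ^ c / y ^ 2)) := by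
  have hm := CutSpan.adS_mem hc1 k (cutoff_mem hχ hg)
  have hcont : ∀ b y : ℝ, ContinuousAt (fun β : ℝ => β ^ 2 * (1 + y ^ 2)) b := by fun_prop
  refine exists_bound_of_zones (fun b y => by positivity) (gLogTilde_nonneg _) ?_ ?_
    fun b y hx => ?_
  · suffices ∃ C, 0 ≤ C ∧ ∀ b ∈ Ioo 0 b₀, ∀ y : ℝ, 1 ≤ y → b ^ 2 * (1 + y ^ 2) < 1 →
        |b ^ l * iteratedDeriv l (fun β => adS k (g β) (1 + y ^ 2)) b| ≤
          C * (|log b|⁻¹ * (1 + y ^ 2) ^ ((r : ℤ) - 1 - ((k + 1) / 2 : ℕ)) *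
          (gLogTilde (2 * (r : ℤ) - k) b y + (1 + log (1 + y ^ 2)) ^ c / (1 + y ^ 2))) by
      obtain ⟨C, hC, h⟩ := this
      refine ⟨C, hC, fun b hb y hy hx => ?_⟩
      rw [EventuallyEq.iteratedDeriv_eq l (g := fun β => adS k (g β) (1 + y ^ 2))]
      · exact h b hb y hy hx
      filter_upwards [(hcont b y).eventually_lt continuousAt_const hx] with β hβ
      exact adS_cutoff_of_lt hχ k hβ
    have hgt : ∀ {b y : ℝ}, (0 : ℝ) ≤ if B0 b / 4 ≤ y then 1 else 0 := fun {b y} => by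
      split_ifs <;> norm_num
    rcases lt_or_ge k (2 * r) with hk | hk
    · have hk1 := adS_mem_bal hc hc1 k hg
      obtain ⟨C, hC, h⟩ := exists_bound_balDeriv hc (iteratedDeriv_mem Asy.domClosed
        (fun _ => eulB_mem_balDerivSys hc) (Asy.smooth2 hk1) (eulB_mem_balDeriv hc hk1) hl1)
      refine ⟨C * 2, by positivity, fun b hb y hy hx => (h b hb _ (by nlinarith)).trans ?_⟩
      have hl := hc.one_le hb
      have hB := le_three_B0 (y := y) hb.1 (by linarith)
      have hlog : 0 ≤ log (1 + y ^ 2) := log_nonneg (by nlinarith)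
      have h2 : (1 + log (1 + y ^ 2)) / |log b| ≤
          2 * gLogTilde (2 * (r : ℤ) - k) b y := by
        rw [gLogTilde, if_pos hB, if_pos (by omega), mul_add, ← mul_div_assoc]
        refine le_add_of_le_of_nonneg ?_ (mul_nonneg zero_le_two hgt)
        gcongr
        linarith [log_one_add_sq_le hy]
      have h3 : 0 ≤ (1 + log (1 + y ^ 2)) ^ c / (1 + y ^ 2) := by positivity
      rw [mul_assoc C, mul_left_comm 2, mul_assoc |log b|⁻¹]
      gcongr
      linarith
    · have hk1 := adS_mem_balZero hc hc1 hr hk hg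
      obtain ⟨C, hC, h⟩ := exists_bound_balZeroDeriv hc (iteratedDeriv_mem Asy.domClosed
        (fun _ => eulB_mem_balZeroDerivSys hc) (Asy.smooth2 hk1) (eulB_mem_balZeroDeriv hc hk1)
        hl1)
      refine ⟨C, by positivity, fun b hb y hy hx => (h b hb _ (by nlinarith)).trans ?_⟩
      have hB := le_three_B0 (y := y) hb.1 (by linarith)
      have hl := hc.one_le hb
      rw [mul_assoc |log b|⁻¹]
      gcongr
      rw [gLogTilde, if_pos hB]
      refine le_add_of_le_of_nonneg ?_ hgt
      gcongr
      have : (0 : ℝ) ≤ if 1 ≤ 2 * (r : ℤ) - k then |log y| else 0 := by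
        split_ifs <;> positivity
      linarith
  · obtain ⟨C, hC, h⟩ := CutSpan.exists_bound (iteratedDeriv_mem CutSpan.domClosed
      (fun _ => CutSpan.eulB_mem) (CutSpan.smooth2 hm) (CutSpan.eulB_mem hm) hl1)
    refine ⟨C, hC, fun b hb y hy hx hx2 => (h b hb _ hx hx2).trans ?_⟩
    rw [div_eq_inv_mul]
    refine mul_le_mul_of_nonneg_left (le_mul_of_one_le_right (by positivity) ?_) hC
    rw [gLogTilde, if_pos (le_three_B0 hb.1 hx2),
      if_pos (B0_div_four_le hb.1 (hb.2.le.trans hc.le) (by linarith) hx)]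
    have : (0 : ℝ) ≤ (1 + if 1 ≤ 2 * (r : ℤ) - k then |log y| else 0) / |log b| := by
      split_ifs <;> positivity
    linarith
  · rw [EventuallyEq.iteratedDeriv_eq l (g := fun _ => 0), iteratedDeriv_const]
    · simp
    filter_upwards [continuousAt_const.eventually_lt (hcont b y) hx] with β hβ
    exact adS_cutoff_of_gt hχ k hβ

theorem scalarAdmissible_cutoff (hc : ModCoef b₀ cc) (hχ : Cutoff χ) {r ι : ℕ}
    (hr : 1 ≤ r) (hι : ι ≤ 1) (hg : g ∈ ProfSpan hc r) :
    ScalarAdmissible b₀ (2 * r + ι) ((2 * r + ι : ℕ) : ℤ) ι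
      fun b y => y * cutoff χ g b (1 + y ^ 2) := by
  obtain ⟨c, hc1, hg1, hg2⟩ := hg
  have hcut := CutSpan.smooth2 (cutoff_mem hχ hg1)
  have hexp : ∀ k : ℕ, ((2 * r + ι : ℕ) : ℤ) - k - 1 - ι = 2 * (r : ℤ) - k - 1 := by
    intro k; push_cast; ring
  have hexp' : ∀ k : ℕ, ((2 * r + ι : ℕ) : ℤ) - k - ι = 2 * (r : ℤ) - k := by
    intro k; push_cast; ring
  have hlink : ∀ k : ℕ, ∀ b ∈ Ioo 0 b₀, ∀ y : ℝ, 1 ≤ y →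
      adapted k (fun y => y * cutoff χ g b (1 + y ^ 2)) y =
        y ^ (1 + k % 2) * adS k (cutoff χ g b) (1 + y ^ 2) := fun k b hb y hy =>
    adapted_eq_adS k (hcut.right hb) y (mem_Ioi.2 (by linarith))
  refine ⟨?_, ?_, c, by exact_mod_cast hc1, fun k => ?_, fun k l hl => ?_⟩
  · refine contDiffOn_snd.mul (ContDiffOn.comp (g := fun z : ℝ × ℝ => cutoff χ g z.1 z.2)
      (t := Ioo 0 b₀ ×ˢ Ioi 0) (f := fun z : ℝ × ℝ => (z.1, 1 + z.2 ^ 2)) hcut ?_ ?_)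
    · exact (by fun_prop : ContDiff ℝ ∞ fun z : ℝ × ℝ => (z.1, 1 + z.2 ^ 2)).contDiffOn
    · intro z hz
      exact ⟨hz.1, one_add_sq_pos _⟩
  · obtain ⟨n, h, φ, h1, h2, h3, h4, h5⟩ := exists_origin_of_tens hι hg2
    refine ⟨n, h, φ, h1, h2, h3, h4, fun b hb y hy => ?_⟩
    rw [← h5 b hb y, cutoff, hχ.one, one_mul]
    have hb1 : b ≤ 1 / 4 := hb.2.le.trans hc.le
    have hy2 : y ^ 2 ≤ 1 := pow_le_one₀ hy.1 hy.2
    nlinarith [hb.1, sq_nonneg b]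
  · obtain ⟨C, hC, h⟩ := exists_bound_adS_cutoff hc hχ hr hc1 hg1 k
    refine ⟨C * 2 ^ |(r : ℤ) - 1 - ((k + 1) / 2 : ℕ)|, fun b hb y hy => ?_⟩
    have hy0 : 0 < y := by linarith
    rw [hlink k b hb y hy, hexp, hexp', rpow_natCast, abs_mul,
      abs_of_pos (pow_pos hy0 _)]
    have hg0 := gLog_nonneg (2 * (r : ℤ) - k) b y
    have hf := farInd_nonneg ((2 * r + ι : ℕ) : ℤ) k ι b y
    calc _ ≤ y ^ (1 + k % 2) * (C * ((1 + y ^ 2) ^ ((r : ℤ) - 1 - ((k + 1) / 2 : ℕ)) *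
          (gLog (2 * (r : ℤ) - k) b y + (1 + |log y|) ^ c / y ^ 2))) := by
          gcongr; exact h b hb y hy
      _ = C * (y ^ (1 + k % 2) * (1 + y ^ 2) ^ ((r : ℤ) - 1 - ((k + 1) / 2 : ℕ))) *
          (gLog (2 * (r : ℤ) - k) b y + (1 + |log y|) ^ c / y ^ 2) := by ring
      _ ≤ C * (2 ^ |(r : ℤ) - 1 - ((k + 1) / 2 : ℕ)| * y ^ (2 * (r : ℤ) - k - 1)) *
          (gLog (2 * (r : ℤ) - k) b y + (1 + |log y|) ^ c / y ^ 2 +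
            farInd ((2 * r + ι : ℕ) : ℤ) k ι b y / (y ^ 2 * b ^ 2 * |log b|)) := by
          refine mul_le_mul (mul_le_mul_of_nonneg_left (pow_mul_zpow_one_add_sq_le hy r k) hC)
            (le_add_of_nonneg_right ?_) ?_ ?_ <;> positivity
      _ = _ := by ring
  · obtain ⟨C, hC, h⟩ := exists_bound_iteratedDeriv_adS_cutoff hc hχ hr hc1 hg1 k hl
    refine ⟨C * 2 ^ |(r : ℤ) - 1 - ((k + 1) / 2 : ℕ)|, fun b hb y hy => ?_⟩
    have hy0 : 0 < y := by linarith
    have hb0 := hb.1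
    have he : (fun β => adapted k (fun y => y * cutoff χ g β (1 + y ^ 2)) y) =ᶠ[𝓝 b]
        fun β => y ^ (1 + k % 2) * adS k (cutoff χ g β) (1 + y ^ 2) :=
      eventuallyEq_of_mem (isOpen_Ioo.mem_nhds hb) fun β hβ => hlink k β hβ y hy
    rw [he.iteratedDeriv_eq, iteratedDeriv_const_mul_field, hexp, hexp', rpow_natCast, abs_mul,
      abs_of_pos (pow_pos hy0 _)]
    have h1 := h b hb y hy
    rw [abs_mul, abs_of_pos (pow_pos hb0 l), mul_comm, ← le_div_iff₀ (pow_pos hb0 l)] at h1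
    have hg0 := gLogTilde_nonneg (2 * (r : ℤ) - k) b y
    have hf := farInd_nonneg ((2 * r + ι : ℕ) : ℤ) k ι b y
    have hl1 := hc.one_le hb
    calc _ ≤ y ^ (1 + k % 2) * (C * (|log b|⁻¹ *
          (1 + y ^ 2) ^ ((r : ℤ) - 1 - ((k + 1) / 2 : ℕ)) *
          (gLogTilde (2 * (r : ℤ) - k) b y + (1 + |log y|) ^ c / y ^ 2)) / b ^ l) := by
          gcongr
      _ = C * (y ^ (1 + k % 2) * (1 + y ^ 2) ^ ((r : ℤ) - 1 - ((k + 1) / 2 : ℕ))) /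
          (b ^ l * |log b|) *
          (gLogTilde (2 * (r : ℤ) - k) b y + (1 + |log y|) ^ c / y ^ 2) := by
          field_simp
      _ ≤ C * (2 ^ |(r : ℤ) - 1 - ((k + 1) / 2 : ℕ)| * y ^ (2 * (r : ℤ) - k - 1)) /
          (b ^ l * |log b|) *
          (gLogTilde (2 * (r : ℤ) - k) b y + (1 + |log y|) ^ c / y ^ 2 +
            farInd ((2 * r + ι : ℕ) : ℤ) k ι b y / (y ^ 2 * b ^ 2)) := by
          refine mul_le_mul (div_le_div_of_nonneg_right (mul_le_mul_of_nonneg_left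
            (pow_mul_zpow_one_add_sq_le hy r k) hC) ?_) (le_add_of_nonneg_right ?_) ?_ ?_ <;>
            positivity
      _ = _ := by ring

end

/-! ### Homogeneous functions of `b` and `σ` -/

/-- Monomials `∏ b_k^{J_k}` of weight `w` in `b_1` and the `b_k` with `2 ≤ k < d`; only the exponent
of `b_1` may be negative. The index of `b_k` is `k - 1`. -/
structure MonoWt {L : ℕ} (J : Fin L → ℤ) (w : ℤ) (d : ℕ) : Prop where
  nonneg : ∀ k : Fin L, 1 ≤ (k : ℕ) → 0 ≤ J k
  wt : ∑ k : Fin L, ((k : ℤ) + 1) * J k = w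
  eq_zero : ∀ k : Fin L, 1 ≤ (k : ℕ) → d ≤ (k : ℕ) + 1 → J k = 0

/-- Equality for `b ∈ dom L b₀` and `σ > 0`. -/
def EqOnDom {L : ℕ} (b₀ : ℝ) (U U' : (Fin L → ℝ) → ℝ → ℝ) : Prop :=
  ∀ b ∈ dom L b₀, ∀ s, 0 < s → U b s = U' b s

/-- Finite sums of products of monomials of weight `w` in `b_1, …, b_{d-1}` and functions
`g(b_1, σ)` with `g ∈ V`. -/
def HomSpan (L : ℕ) (b₀ : ℝ) (w : ℤ) (d : ℕ) (V : Submodule ℝ (ℝ → ℝ → ℝ)) :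
    Submodule ℝ ((Fin L → ℝ) → ℝ → ℝ) :=
  Submodule.span ℝ {U | ∃ J : Fin L → ℤ, MonoWt J w d ∧ ∃ g ∈ V,
    EqOnDom b₀ U fun b s => (∏ k, b k ^ J k) * g (coord b 1) s}

/-- Operators acting on functions of `σ`, possibly depending on `b_1`, that are linear on smooth
functions. -/
structure FibLin (Φ : ℝ → (ℝ → ℝ) → ℝ → ℝ) : Prop where
  congr : ∀ b F G, (∀ s, 0 < s → F s = G s) → ∀ s, 0 < s → Φ b F s = Φ b G s
  add : ∀ b F G, SmoothPos F → SmoothPos G → ∀ s, 0 < s →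
    Φ b (fun x => F x + G x) s = Φ b F s + Φ b G s
  smul : ∀ b (a : ℝ) F, SmoothPos F → ∀ s, 0 < s → Φ b (fun x => a * F x) s = a * Φ b F s

theorem fibLin_eul : FibLin fun _ => eul where
  congr _ _ _ h s hs := eul_congr isOpen_Ioi (fun s hs => h s hs) s hs
  add _ _ _ hF hG _ hs := eul_add_apply (hF.hasDerivAt hs).differentiableAt
    (hG.hasDerivAt hs).differentiableAt
  smul _ a _ _ _ _ := eul_const_mul_apply a

theorem fibLin_regInv : FibLin fun _ => regInv where
  congr _ _ _ h _ hs := regInv_congr h hs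
  add _ _ _ hF hG _ hs := regInv_add hF hG hs
  smul _ a F _ s _ := regInv_const_mul a F s

theorem fibLin_mul (m : ℝ → ℝ → ℝ) : FibLin fun b F s => m b s * F s where
  congr _ _ _ h s hs := by simp only [h s hs]
  add _ _ _ _ _ _ _ := mul_add _ _ _
  smul _ _ _ _ _ _ := mul_left_comm _ _ _

theorem fibLin_stepE : FibLin fun _ => stepE where
  congr _ _ _ h _ hs := stepE_congr h hs
  add _ _ _ hF hG _ hs := by simpa using stepE_lin 1 1 hF hG hs
  smul _ a _ hF _ hs := by simpa using stepE_lin a 0 hF hF hs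

theorem fibLin_stepO : FibLin fun _ => stepO where
  congr _ _ _ h _ hs := stepO_congr h hs
  add _ _ _ hF hG _ hs := by simpa using stepO_lin 1 1 hF hG hs
  smul _ a _ hF _ hs := by simpa using stepO_lin a 0 hF hF hs

section

variable {L : ℕ} {b₀ : ℝ}

theorem coord_one (hL : 0 < L) (b : Fin L → ℝ) : coord b 1 = b ⟨0, hL⟩ :=
  dif_pos ⟨le_rfl, hL⟩

theorem coord_of_le {b : Fin L → ℝ} {k : ℕ} (hk : k < L) : coord b (k + 1) = b ⟨k, hk⟩ :=
  dif_pos ⟨by omega, by omega⟩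

theorem coord_of_gt {b : Fin L → ℝ} {k : ℕ} (hk : L < k) : coord b k = 0 :=
  dif_neg (by omega)

theorem coord_mem_Ioo {b : Fin L → ℝ} (hb : b ∈ dom L b₀) : coord b 1 ∈ Ioo 0 b₀ := hb

theorem isOpen_dom (L : ℕ) (b₀ : ℝ) : IsOpen (dom L b₀) := by
  have hcont : Continuous fun b : Fin L → ℝ => coord b 1 := by
    by_cases h : 1 ≤ 1 ∧ 1 ≤ L
    · simp only [coord, dif_pos h]; fun_prop
    · simp only [coord, dif_neg h]; fun_prop
  exact (isOpen_lt continuous_const hcont).inter (isOpen_lt hcont continuous_const)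

theorem update_mem_dom {b : Fin L → ℝ} (hb : b ∈ dom L b₀) {j : Fin L} (hj : 1 ≤ (j : ℕ)) (t : ℝ) :
    coord (update b j t) 1 = coord b 1 ∧ update b j t ∈ dom L b₀ := by
  have hL : 0 < L := lt_of_le_of_lt (Nat.zero_le _) j.2
  have h : coord (update b j t) 1 = coord b 1 := by
    rw [coord_one hL, coord_one hL, Function.update_of_ne]
    intro h
    rw [← h] at hj
    simp at hj
  exact ⟨h, by exact ⟨h.symm ▸ hb.1, h.symm ▸ hb.2⟩⟩

theorem prod_update_zpow (b : Fin L → ℝ) (j : Fin L) (t : ℝ) (J : Fin L → ℤ) :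
    ∏ k, update b j t k ^ J k = t ^ J j * ∏ k ∈ Finset.univ.erase j, b k ^ J k := by
  rw [← Finset.mul_prod_erase _ _ (Finset.mem_univ j), Function.update_self]
  congr 1
  refine prod_congr rfl fun k hk => ?_
  rw [Function.update_of_ne (Finset.ne_of_mem_erase hk)]

namespace MonoWt

variable {J J' : Fin L → ℤ} {w w' : ℤ} {d d' : ℕ}

theorem add (h : MonoWt J w d) (h' : MonoWt J' w' d) : MonoWt (J + J') (w + w') d where
  nonneg k hk := add_nonneg (h.nonneg k hk) (h'.nonneg k hk)
  wt := by simp [mul_add, sum_add_distrib, h.wt, h'.wt]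
  eq_zero k hk hd := by rw [Pi.add_apply, h.eq_zero k hk hd, h'.eq_zero k hk hd, add_zero]

theorem mono (h : MonoWt J w d) (hd : d ≤ d') : MonoWt J w d' :=
  ⟨h.nonneg, h.wt, fun k hk hk' => h.eq_zero k hk (hd.trans hk')⟩

theorem single {j : Fin L} (hj : (j : ℕ) = 0 ∨ (j : ℕ) + 1 < d) {a : ℤ} (ha : (j : ℕ) = 0 ∨ 0 ≤ a) :
    MonoWt (Pi.single j a) (((j : ℤ) + 1) * a) d where
  nonneg k hk := by
    by_cases hkj : k = j
    · subst hkj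
      rw [Pi.single_eq_same]
      exact ha.resolve_left (by omega)
    · rw [Pi.single_eq_of_ne hkj]
  wt := by
    rw [Finset.sum_eq_single j, Pi.single_eq_same]
    · intro k _ hk
      rw [Pi.single_eq_of_ne hk, mul_zero]
    · simp
  eq_zero k hk hd := by
    have hkj : k ≠ j := by rintro rfl; omega
    rw [Pi.single_eq_of_ne hkj]

theorem zero : MonoWt (0 : Fin L → ℤ) 0 d := ⟨fun _ _ => le_rfl, by simp, fun _ _ _ => rfl⟩

theorem prod_add {b : Fin L → ℝ} (hb : b ∈ dom L b₀) (h : MonoWt J w d) (h' : MonoWt J' w' d') :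
    ∏ k, b k ^ (J + J') k = (∏ k, b k ^ J k) * ∏ k, b k ^ J' k := by
  rw [← Finset.prod_mul_distrib]
  refine prod_congr rfl fun k _ => ?_
  rw [Pi.add_apply]
  by_cases hk : 1 ≤ (k : ℕ)
  · obtain ⟨m, hm⟩ := Int.eq_ofNat_of_zero_le (h.nonneg k hk)
    obtain ⟨m', hm'⟩ := Int.eq_ofNat_of_zero_le (h'.nonneg k hk)
    rw [hm, hm', ← Int.natCast_add, zpow_natCast, zpow_natCast, zpow_natCast, pow_add]
  · have h0 : b k = coord b 1 := by
      rw [coord_one (lt_of_le_of_lt (Nat.zero_le _) k.2)]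
      congr 1
      exact Fin.ext (by simp; omega)
    exact zpow_add₀ (by rw [h0]; exact (coord_mem_Ioo hb).1.ne') _ _

end MonoWt

namespace HomSpan

variable {w w' : ℤ} {d d' : ℕ} {V V' V'' : Submodule ℝ (ℝ → ℝ → ℝ)}
  {U U' : (Fin L → ℝ) → ℝ → ℝ}

theorem of_mono {J : Fin L → ℤ} (hJ : MonoWt J w d) {g : ℝ → ℝ → ℝ} (hg : g ∈ V)
    (hU : EqOnDom b₀ U fun b s => (∏ k, b k ^ J k) * g (coord b 1) s) : U ∈ HomSpan L b₀ w d V :=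
  subset_span ⟨J, hJ, g, hg, hU⟩

theorem mono (hd : d ≤ d') (hV : V ≤ V') : HomSpan L b₀ w d V ≤ HomSpan L b₀ w d' V' :=
  span_mono fun _ ⟨J, hJ, g, hg, e⟩ => ⟨J, hJ.mono hd, g, hV hg, e⟩

/-- To prove that a linear condition holds on `HomSpan`, it suffices to treat monomials. -/
theorem induction {p : ((Fin L → ℝ) → ℝ → ℝ) → Prop} (hU : U ∈ HomSpan L b₀ w d V)
    (congr : ∀ U U', EqOnDom b₀ U U' → p U' → p U)
    (mono : ∀ J : Fin L → ℤ, MonoWt J w d → ∀ g ∈ V,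
      p fun b s => (∏ k, b k ^ J k) * g (coord b 1) s)
    (zero : p 0)
    (add : ∀ U ∈ HomSpan L b₀ w d V, ∀ U' ∈ HomSpan L b₀ w d V, p U → p U' → p (U + U'))
    (smul : ∀ (a : ℝ), ∀ U ∈ HomSpan L b₀ w d V, p U → p (a • U)) : p U := by
  induction hU using span_induction with
  | mem U hU =>
    obtain ⟨J, hJ, g, hg, e⟩ := hU
    exact congr _ _ e (mono J hJ g hg)
  | zero => exact zero
  | add U U' hU hU' h h' => exact add U hU U' hU' h h'
  | smul a U hU h => exact smul a U hU h

theorem congr (hL : 0 < L) (hU : U ∈ HomSpan L b₀ w d V) (h : EqOnDom b₀ U' U) :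
    U' ∈ HomSpan L b₀ w d V := by
  have hJ : MonoWt (Pi.single (⟨0, hL⟩ : Fin L) w) w d := by
    have := MonoWt.single (d := d) (j := (⟨0, hL⟩ : Fin L)) (Or.inl rfl) (a := w) (Or.inl rfl)
    simpa using this
  have h0 : U' - U ∈ HomSpan L b₀ w d V :=
    of_mono hJ (zero_mem V) fun b hb s hs => by simp [h b hb s hs]
  simpa using add_mem h0 hU

theorem smoothPos (hV : ∀ g ∈ V, Smooth2 b₀ g) (hU : U ∈ HomSpan L b₀ w d V) {b : Fin L → ℝ}
    (hb : b ∈ dom L b₀) : SmoothPos (U b) := by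
  refine induction (p := fun U => SmoothPos (U b)) hU (fun U U' e h => h.congr (e b hb))
    (fun J _ g hg => contDiffOn_const.mul ((hV g hg).right (coord_mem_Ioo hb))) contDiffOn_const
    (fun _ _ _ _ h h' => ContDiffOn.add h h') fun a _ _ h => contDiffOn_const.mul h

/-- Operators in the variable `σ` act on the coefficients. -/
theorem map (hL : 0 < L) {Φ : ℝ → (ℝ → ℝ) → ℝ → ℝ} (hΦ : FibLin Φ) (hV : ∀ g ∈ V, Smooth2 b₀ g)
    (h : ∀ g ∈ V, (fun b => Φ b (g b)) ∈ V') (hU : U ∈ HomSpan L b₀ w d V) :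
    (fun b => Φ (coord b 1) (U b)) ∈ HomSpan L b₀ w d V' := by
  refine induction (p := fun U => (fun b => Φ (coord b 1) (U b)) ∈ HomSpan L b₀ w d V') hU
    (fun U U' e h => congr hL h fun b hb s hs => hΦ.congr _ _ _ (e b hb) s hs)
    (fun J hJ g hg => of_mono hJ (h g hg) fun b hb s hs =>
      hΦ.smul _ _ _ ((hV g hg).right (coord_mem_Ioo hb)) s hs)
    (congr hL (zero_mem _) fun b hb s hs => ?_)
    (fun U hU U' hU' h h' => congr hL (add_mem h h') fun b hb s hs =>
      hΦ.add _ _ _ (smoothPos hV hU hb) (smoothPos hV hU' hb) s hs)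
    fun a U hU h => congr hL (smul_mem _ a h) fun b hb s hs =>
      hΦ.smul _ a _ (smoothPos hV hU hb) s hs
  have := hΦ.smul (coord b 1) 0 (fun _ => 0) contDiffOn_const s hs
  rw [zero_mul, zero_mul] at this
  exact this

theorem mul (hVV : ∀ g ∈ V, ∀ g' ∈ V', g * g' ∈ V'') (hU : U ∈ HomSpan L b₀ w d V)
    (hU' : U' ∈ HomSpan L b₀ w' d V') : U * U' ∈ HomSpan L b₀ (w + w') d V'' := by
  induction hU using span_induction with
  | mem U hU =>
    obtain ⟨J, hJ, g, hg, e⟩ := hU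
    induction hU' using span_induction with
    | mem U' hU' =>
      obtain ⟨J', hJ', g', hg', e'⟩ := hU'
      refine of_mono (hJ.add hJ') (hVV g hg g' hg') fun b hb s hs => ?_
      rw [Pi.mul_apply, Pi.mul_apply, e b hb s hs, e' b hb s hs]
      simp only [hJ.prod_add hb hJ', Pi.mul_apply]
      ring
    | zero => simp
    | add g₁ g₂ _ _ h₁ h₂ => rw [mul_add]; exact add_mem h₁ h₂
    | smul a g₁ _ h₁ => rw [mul_smul_comm]; exact smul_mem _ a h₁
  | zero => simp
  | add g₁ g₂ _ _ h₁ h₂ => rw [add_mul]; exact add_mem h₁ h₂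
  | smul a g₁ _ h₁ => rw [smul_mul_assoc]; exact smul_mem _ a h₁

theorem coord_mem {k : ℕ} (hk : 1 ≤ k) (hkd : k = 1 ∨ k < d) {g : ℝ → ℝ → ℝ}
    (hg : g ∈ V) : (fun b s => coord b k * g (coord b 1) s) ∈ HomSpan L b₀ k d V := by
  obtain ⟨k, rfl⟩ : ∃ m, k = m + 1 := ⟨k - 1, by omega⟩
  rcases lt_or_ge k L with h | h
  · have hJ : MonoWt (Pi.single (⟨k, h⟩ : Fin L) 1) ((k + 1 : ℕ) : ℤ) d := by
      have := MonoWt.single (d := d) (j := (⟨k, h⟩ : Fin L)) (by simpa using hkd) (a := 1)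
        (Or.inr zero_le_one)
      simpa using this
    refine of_mono hJ hg fun b hb s hs => ?_
    rw [coord_of_le h]
    congr 1
    rw [Finset.prod_eq_single (⟨k, h⟩ : Fin L)]
    · simp
    · intro j _ hj
      rw [Pi.single_eq_of_ne hj, zpow_zero]
    · simp
  · have : (fun (b : Fin L → ℝ) (s : ℝ) => coord b (k + 1) * g (coord b 1) s) = 0 := by
      funext b s
      rw [coord_of_gt (by omega), zero_mul]
      rfl
    rw [this]
    exact zero_mem _

/-- Multiplication by `b_k`. -/
theorem coord_mul (hL : 0 < L) {k : ℕ} (hk : 1 ≤ k) (hkd : k = 1 ∨ k < d)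
    (hU : U ∈ HomSpan L b₀ w d V) :
    (fun b s => coord b k * U b s) ∈ HomSpan L b₀ (k + w) d V := by
  have h1 := coord_mem (L := L) (b₀ := b₀) hk hkd (Submodule.mem_span_singleton_self (1 : ℝ → ℝ → ℝ))
  have := mul (V'' := V) (fun g hg g' hg' => ?_) h1 hU
  · refine congr hL this fun b hb s hs => ?_
    simp
  · obtain ⟨a, rfl⟩ := Submodule.mem_span_singleton.1 hg
    rw [smul_mul_assoc, one_mul]
    exact V.smul_mem a hg'

end HomSpan

/-- The partial derivative in the entry of `b` with index `j`. -/
def partialS (j : Fin L) (U : (Fin L → ℝ) → ℝ → ℝ) (b : Fin L → ℝ) (s : ℝ) : ℝ :=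
  deriv (fun t => U (update b j t) s) (b j)

theorem eventually_update_mem_dom {b : Fin L → ℝ} (hb : b ∈ dom L b₀) (j : Fin L) :
    ∀ᶠ t in 𝓝 (b j), update b j t ∈ dom L b₀ := by
  have hc : ContinuousAt (fun t => update b j t) (b j) :=
    (continuous_const.update j continuous_id).continuousAt
  exact hc.preimage_mem_nhds ((isOpen_dom L b₀).mem_nhds (by simpa using hb))

theorem EqOnDom.partialS {U U' : (Fin L → ℝ) → ℝ → ℝ} (h : EqOnDom b₀ U U') (j : Fin L) :
    EqOnDom b₀ (partialS j U) (partialS j U') := fun b hb s hs => by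
  refine Filter.EventuallyEq.deriv_eq ?_
  filter_upwards [eventually_update_mem_dom hb j] with t ht
  exact h _ ht s hs

namespace HomSpan

variable {w w' : ℤ} {d d' : ℕ} {V V' V'' : Submodule ℝ (ℝ → ℝ → ℝ)}
  {U U' : (Fin L → ℝ) → ℝ → ℝ}

theorem differentiableAt (hL : 0 < L) (hV : ∀ g ∈ V, Smooth2 b₀ g)
    (hU : U ∈ HomSpan L b₀ w d V) {b : Fin L → ℝ} (hb : b ∈ dom L b₀) {s : ℝ} (hs : 0 < s) :
    DifferentiableAt ℝ (fun b => U b s) b := by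
  refine induction (p := fun U => DifferentiableAt ℝ (fun b => U b s) b) hU
    (fun U U' e h => h.congr_of_eventuallyEq ?_) (fun J hJ g hg => ?_)
    (differentiableAt_const _) (fun _ _ _ _ h h' => h.add h') fun a _ _ h => h.const_mul a
  · filter_upwards [(isOpen_dom L b₀).mem_nhds hb] with b hb
    exact e b hb s hs
  · refine DifferentiableAt.mul ?_ ?_
    · refine (HasFDerivAt.finsetProd (u := Finset.univ) (g := fun k (b : Fin L → ℝ) => b k ^ J k)
        fun k _ => DifferentiableAt.hasFDerivAt ?_).differentiableAt
      by_cases hk : 1 ≤ (k : ℕ)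
      · exact (differentiableAt_apply k b).zpow (Or.inr (hJ.nonneg k hk))
      · refine (differentiableAt_apply k b).zpow (Or.inl ?_)
        have h0 : b k = coord b 1 := by
          rw [coord_one hL]
          congr 1
          exact Fin.ext (by simp; omega)
        rw [h0]
        exact (coord_mem_Ioo hb).1.ne'
    · have h1 := (hV g hg).diff_left (coord_mem_Ioo hb) hs
      have h2 : DifferentiableAt ℝ (fun b : Fin L → ℝ => coord b 1) b := by
        simp only [coord_one hL]; fun_prop
      exact DifferentiableAt.comp (g := fun β => g β s) b h1 h2

theorem partialS_add (hL : 0 < L) (hV : ∀ g ∈ V, Smooth2 b₀ g) (hV' : ∀ g ∈ V', Smooth2 b₀ g)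
    (hU : U ∈ HomSpan L b₀ w d V) (hU' : U' ∈ HomSpan L b₀ w' d' V') (j : Fin L) :
    EqOnDom b₀ (partialS j (U + U')) (partialS j U + partialS j U') := fun b hb s hs => by
  have key : ∀ {w d V} {U : (Fin L → ℝ) → ℝ → ℝ}, (∀ g ∈ V, Smooth2 b₀ g) →
      U ∈ HomSpan L b₀ w d V →
      DifferentiableAt ℝ (fun t => U (update b j t) s) (b j) := fun hV hU => by
    rename_i U
    have h1 : DifferentiableAt ℝ (fun b => U b s) (update b j (b j)) := by
      rw [Function.update_eq_self]
      exact differentiableAt hL hV hU hb hs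
    exact h1.comp (b j) (hasDerivAt_update b j (b j)).differentiableAt
  exact deriv_add (key hV hU) (key hV' hU')

theorem partialS_smul (a : ℝ) (U : (Fin L → ℝ) → ℝ → ℝ) (j : Fin L) :
    partialS j (a • U) = a • partialS j U := by
  funext b s
  exact deriv_const_mul_field a

/-- A generic reduction of statements on partial derivatives to monomials. -/
theorem partialS_mem_of_mono (hL : 0 < L) (hV : ∀ g ∈ V, Smooth2 b₀ g) {j : Fin L}
    (h : ∀ J : Fin L → ℤ, MonoWt J w d → ∀ g ∈ V,
      partialS j (fun b s => (∏ k, b k ^ J k) * g (coord b 1) s) ∈ HomSpan L b₀ w' d V')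
    (hU : U ∈ HomSpan L b₀ w d V) : partialS j U ∈ HomSpan L b₀ w' d V' := by
  refine induction (p := fun U => partialS j U ∈ HomSpan L b₀ w' d V') hU
    (fun U U' e h => congr hL h (e.partialS j)) h ?_
    (fun U hU U' hU' h h' => congr hL (add_mem h h') (partialS_add hL hV hV hU hU' j)) fun a U hU h => ?_
  · have : partialS j (0 : (Fin L → ℝ) → ℝ → ℝ) = 0 := by
      funext b s
      simp [partialS]
    rw [this]
    exact zero_mem _
  · rw [partialS_smul]
    exact smul_mem _ a h

theorem monoWt_sub_single {J : Fin L → ℤ} (hJ : MonoWt J w d) {j : Fin L}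
    (h : (j : ℕ) = 0 ∨ J j ≠ 0) :
    MonoWt (J - Pi.single j 1) (w - ((j : ℤ) + 1)) d where
  nonneg k hk := by
    by_cases hkj : k = j
    · subst hkj
      have := hJ.nonneg k hk
      rw [Pi.sub_apply, Pi.single_eq_same]
      omega
    · rw [Pi.sub_apply, Pi.single_eq_of_ne hkj, sub_zero]
      exact hJ.nonneg k hk
  wt := by
    simp [mul_sub, sum_sub_distrib, hJ.wt]
    rw [Finset.sum_eq_single j, Pi.single_eq_same, mul_one]
    · intro k _ hk
      rw [Pi.single_eq_of_ne hk, mul_zero]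
    · simp
  eq_zero k hk hd := by
    by_cases hkj : k = j
    · subst hkj
      exact absurd (hJ.eq_zero k hk hd) (h.resolve_left (by omega))
    · rw [Pi.sub_apply, Pi.single_eq_of_ne hkj, sub_zero]
      exact hJ.eq_zero k hk hd

theorem prod_sub_single {b : Fin L → ℝ} {J : Fin L → ℤ} {j : Fin L} :
    ∏ k, b k ^ (J - Pi.single j 1 : Fin L → ℤ) k =
      b j ^ (J j - 1) * ∏ k ∈ Finset.univ.erase j, b k ^ J k := by
  rw [← Finset.mul_prod_erase _ _ (Finset.mem_univ j)]
  congr 1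
  · simp
  · refine prod_congr rfl fun k hk => ?_
    rw [Pi.sub_apply, Pi.single_eq_of_ne (Finset.ne_of_mem_erase hk), sub_zero]

/-- The derivative in `b_{j+1}`, `j ≥ 1`, lowers the weight by `j + 1`. -/
theorem partialS_mem (hL : 0 < L) (hV : ∀ g ∈ V, Smooth2 b₀ g) {j : Fin L} (hj : 1 ≤ (j : ℕ))
    (hU : U ∈ HomSpan L b₀ w d V) : partialS j U ∈ HomSpan L b₀ (w - ((j : ℤ) + 1)) d V := by
  refine partialS_mem_of_mono hL hV (fun J hJ g hg => ?_) hU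
  have e : ∀ b ∈ dom L b₀, ∀ s, partialS j (fun b s => (∏ k, b k ^ J k) * g (coord b 1) s) b s =
      (J j : ℝ) * ((∏ k, b k ^ (J - Pi.single j 1 : Fin L → ℤ) k) * g (coord b 1) s) := fun b hb s => by
    have h1 : (fun t => (∏ k, update b j t k ^ J k) *
        g (coord (update b j t) 1) s) = fun t => t ^ J j *
          ((∏ k ∈ Finset.univ.erase j, b k ^ J k) * g (coord b 1) s) := by
      funext t
      rw [prod_update_zpow, (update_mem_dom hb hj t).1]
      ring
    rw [partialS, h1, deriv_mul_const_field, deriv_zpow, prod_sub_single]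
    ring
  by_cases h0 : J j = 0
  · refine congr hL (zero_mem _) fun b hb s _ => ?_
    rw [e b hb s, h0]
    simp
  · refine congr hL (smul_mem _ (J j : ℝ) (of_mono (monoWt_sub_single hJ (Or.inr h0)) hg
      fun b _ s _ => rfl)) fun b hb s _ => ?_
    rw [e b hb s]
    rfl

/-- The derivative in `b_1` lowers the weight by `1`. -/
theorem partialS_zero_mem (hL : 0 < L) (hV : ∀ g ∈ V, Smooth2 b₀ g)
    (hE : ∀ g ∈ V, eulB g ∈ V) (hU : U ∈ HomSpan L b₀ w d V) :
    partialS ⟨0, hL⟩ U ∈ HomSpan L b₀ (w - 1) d V := by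
  refine partialS_mem_of_mono hL hV (fun J hJ g hg => ?_) hU
  set j : Fin L := ⟨0, hL⟩ with hj
  have hJ' : MonoWt (J - Pi.single j 1) (w - 1) d := by
    have := monoWt_sub_single hJ (j := j) (Or.inl rfl)
    simpa [hj] using this
  refine congr hL (add_mem (smul_mem _ (J j : ℝ) (of_mono hJ' hg fun b _ s _ => rfl))
    (of_mono hJ' (hE g hg) fun b _ s _ => rfl)) fun b hb s hs => ?_
  have hb1 := coord_mem_Ioo hb
  have hbj : b j = coord b 1 := (coord_one hL b).symm
  have h1 : (fun t => (∏ k, update b j t k ^ J k) *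
      g (coord (update b j t) 1) s) = fun t => (∏ k ∈ Finset.univ.erase j, b k ^ J k) *
        (t ^ J j * g t s) := by
    funext t
    rw [prod_update_zpow, coord_one hL, ← hj, Function.update_self]
    ring
  have h2 := (hV g hg).diff_left hb1 hs
  rw [← hbj] at h2
  have h3 : b j ≠ 0 := by rw [hbj]; exact hb1.1.ne'
  have h4 := ((hasDerivAt_zpow (J j) (b j) (Or.inl h3)).mul h2.hasDerivAt).deriv
  have h5 : deriv (fun t => t ^ J j * g t s) (b j) = _ := h4
  rw [partialS, h1, deriv_const_mul_field, h5, Pi.add_apply, Pi.add_apply, Pi.smul_apply,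
    Pi.smul_apply, smul_eq_mul, prod_sub_single, ← hbj, eulB, eul]
  rw [zpow_sub_one₀ h3]
  field_simp

/-- `U` does not depend on `b_{j+1}` for `d ≤ j + 1`. -/
theorem partialS_eq_zero {j : Fin L} (hj : 1 ≤ (j : ℕ))
    (hd : d ≤ (j : ℕ) + 1) (hU : U ∈ HomSpan L b₀ w d V) :
    EqOnDom b₀ (partialS j U) 0 := by
  have h : ∀ b ∈ dom L b₀, ∀ s, 0 < s → ∀ t, U (update b j t) s = U b s := by
    refine induction (p := fun U => ∀ b ∈ dom L b₀, ∀ s, 0 < s → ∀ t,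
      U (update b j t) s = U b s) hU (fun U U' e h b hb s hs t => ?_)
      (fun J hJ g hg b hb s hs t => ?_) (fun _ _ _ _ _ => rfl)
      (fun U _ U' _ h h' b hb s hs t => ?_) fun a U _ h b hb s hs t => ?_
    · rw [e b hb s hs, e _ (update_mem_dom hb hj t).2 s hs, h b hb s hs]
    · simp only [(update_mem_dom hb hj t).1]
      congr 1
      refine prod_congr rfl fun k _ => ?_
      by_cases hkj : k = j
      · subst hkj
        rw [hJ.eq_zero k hj hd, zpow_zero, zpow_zero]
      · rw [Function.update_of_ne hkj]
    · simp [h b hb s hs, h' b hb s hs]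
    · simp [h b hb s hs]
  intro b hb s hs
  rw [partialS]
  simp only [h b hb s hs]
  simp

end HomSpan

end

/-! ### The generalized kernel -/

/-- The profiles of the generalized kernel: `T_{2r} = (y τ_r(1 + y²), 0)` and
`T_{2r+1} = (0, y τ_r(1 + y²))`. -/
def tau : ℕ → ℝ → ℝ
  | 0 => fun s => 2 / s
  | r + 1 => fun s => -regInv (tau r) s

theorem tau_zero (s : ℝ) : tau 0 s = 2 / s := rfl

theorem tau_succ (r : ℕ) (s : ℝ) : tau (r + 1) s = -regInv (tau r) s := rfl

theorem smoothPos_tau (r : ℕ) : SmoothPos (tau r) := by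
  induction r with
  | zero => exact contDiffOn_const.div contDiffOn_id fun s hs => (mem_Ioi.1 hs).ne'
  | succ r ih => exact (smoothPos_regInv ih).neg

theorem van_tau (r : ℕ) : Van r (tau r) := by
  induction r with
  | zero => exact ⟨_, smoothPos_tau 0, by simp⟩
  | succ r ih =>
    obtain ⟨G, hG, e⟩ := ih.regInv
    exact ⟨fun s => -G s, hG.neg, fun s hs => by rw [tau_succ, e s hs]; ring⟩

theorem exists_symF_tau (r : ℕ) : ∃ c, SymF ((r : ℤ) - 1) c (tau r) := by
  induction r with
  | zero =>
    exact ⟨0, (SymF.inv.const_mul 2).congr fun s _ => by rw [tau_zero, div_eq_mul_inv]⟩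
  | succ r ih =>
    obtain ⟨c, h⟩ := ih
    refine ⟨c + 2, ?_⟩
    have := (h.regInv (by omega)).neg
    rwa [show (r : ℤ) - 1 + 1 = ((r + 1 : ℕ) : ℤ) - 1 by push_cast; ring] at this

theorem stepO_stepE_tau (r : ℕ) {s : ℝ} (hs : 0 < s) :
    stepO (stepE (tau (r + 1))) s = -tau r s := by
  have h1 : ∀ s, 0 < s → stepE (tau (r + 1)) s = -1 * stepE (regInv (tau r)) s +
      0 * stepE (regInv (tau r)) s := fun s hs => by
    rw [← stepE_lin (-1) 0 (smoothPos_regInv (smoothPos_tau r)) (smoothPos_regInv (smoothPos_tau r))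
      hs]
    exact stepE_congr (fun s _ => by rw [tau_succ]; ring) hs
  have h2 := smoothPos_stepE (smoothPos_regInv (smoothPos_tau r))
  rw [stepO_congr h1 hs, stepO_lin (-1) 0 h2 h2 hs, stepO_stepE_regInv (smoothPos_tau r) hs]
  ring

/-- The asymptotics of `τ_r`. -/
theorem exists_tau_eq (r : ℕ) : ∃ (t th : ℝ) (c : ℕ) (R : ℝ → ℝ), SymF ((r : ℤ) - 1 - 1) c R ∧
    ∀ s, 0 < s → tau r s = s ^ ((r : ℤ) - 1) * (t + th * log s) + R s := by
  induction r with
  | zero =>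
    refine ⟨2, 0, 0, fun _ => 0, SymF.zero, fun s _ => ?_⟩
    rw [tau_zero]
    simp
    ring
  | succ r ih =>
    rcases Nat.eq_zero_or_pos r with rfl | hr
    · obtain ⟨R, hR, e⟩ := exists_regInv_inv
      refine ⟨-1, 1 / 2, 3, fun s => -2 * R s, by simpa using hR.const_mul (-2), fun s hs => ?_⟩
      have h1 : regInv (tau 0) s = 2 * regInv (fun x => x⁻¹) s := by
        rw [← regInv_const_mul]
        exact regInv_congr (fun s _ => by rw [tau_zero, div_eq_mul_inv]) hs
      rw [tau_succ, h1, e s hs]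
      simp
      ring
    · obtain ⟨t, th, c, R, hR, e⟩ := ih
      obtain ⟨κ, κ', R₁, R₂, h₁, h₂, e₁, e₂⟩ := exists_regInv_zpow (q := (r : ℤ) - 1) (by omega)
      have hq : ((r + 1 : ℕ) : ℤ) - 1 - 1 = (r : ℤ) - 1 := by push_cast; ring
      refine ⟨-(κ * t + κ' * th), -(κ * th), c + 3,
        fun s => -(t * R₁ s + th * R₂ s + regInv R s), ?_, fun s hs => ?_⟩
      · rw [hq]
        have h3 := hR.regInv (by omega)
        exact ((((h₁.mono le_rfl (by omega)).const_mul t).add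
          ((h₂.mono le_rfl (by omega)).const_mul th)).add (h3.mono (by omega) (by omega))).neg
      · have s1 : SmoothPos fun s : ℝ => t * s ^ ((r : ℤ) - 1) :=
          contDiffOn_const.mul (smoothPos_zpow _)
        have s2 : SmoothPos fun s : ℝ => th * (s ^ ((r : ℤ) - 1) * log s) :=
          contDiffOn_const.mul (smoothPos_zpow_mul_log _)
        have h := regInv_congr (F := tau r)
          (G := fun s => (t * s ^ ((r : ℤ) - 1) + th * (s ^ ((r : ℤ) - 1) * log s)) + R s)
          (fun s hs => by rw [e s hs]; ring) hs
        rw [regInv_add (ContDiffOn.add s1 s2) hR.smooth hs, regInv_add s1 s2 hs,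
          regInv_const_mul, regInv_const_mul, e₁ s hs, e₂ s hs] at h
        rw [tau_succ, h, show ((r + 1 : ℕ) : ℤ) - 1 = (r : ℤ) - 1 + 1 by push_cast; ring]
        ring

/-! ### Scaling and modulation -/

/-- The operator induced by `Λ - 1` on functions `y F(1 + y²)`. -/
def lamD (F : ℝ → ℝ) (s : ℝ) : ℝ := 2 * (1 - 1 / s) * eul F s

theorem fibLin_lamD : FibLin fun _ => lamD where
  congr b F G h s hs := by
    rw [lamD, lamD, fibLin_eul.congr b F G h s hs]
  add b F G hF hG s hs := by
    rw [lamD, lamD, lamD, fibLin_eul.add b F G hF hG s hs]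
    ring
  smul b a F hF s hs := by
    rw [lamD, lamD, fibLin_eul.smul b a F hF s hs]
    ring

theorem SymF.lamD {r : ℤ} {c : ℕ} {F : ℝ → ℝ} (hF : SymF r c F) : SymF r c (lamD F) := by
  have := (hF.eul.const_mul 2).sub ((hF.eul.div.mono (by omega) le_rfl).const_mul 2)
  exact this.congr fun s _ => by rw [WaveMap.lamD]; ring

theorem Van.lamD {v : ℕ} {F : ℝ → ℝ} (hF : Van v F) : Van v (lamD F) := by
  obtain ⟨G, hG, e⟩ := hF
  refine ⟨fun s => 2 * v * G s + 2 * ((s - 1) * deriv G s),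
    (contDiffOn_const.mul hG).add (contDiffOn_const.mul ((contDiffOn_id.sub contDiffOn_const).mul
      hG.deriv)), fun s hs => ?_⟩
  have h1 := (((hasDerivAt_id s).sub_const 1).pow v).mul (hG.hasDerivAt hs)
  have h2 : deriv F s = _ := (deriv_congr_pos e hs).trans h1.deriv
  rw [WaveMap.lamD, eul, h2]
  simp [id]
  have hs0 := hs.ne'
  rcases v with _ | v
  · simp
    field_simp
  · simp [Nat.add_sub_cancel, pow_succ]
    field_simp

theorem SymVan.symF {q : ℤ} {c v : ℕ} {F : ℝ → ℝ} (h : F ∈ SymVan q c v) : SymF q c F := h.1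

theorem SymVan.van {q : ℤ} {c v : ℕ} {F : ℝ → ℝ} (h : F ∈ SymVan q c v) : Van v F := h.2

/-- Finite sums of products `h(b₁) F(σ)`, with `F` a symbol of order `q`, up to logarithms, that
vanishes to order `v` at `σ = 1`. -/
def CrudeSpan (b₀ : ℝ) (q : ℤ) (v : ℕ) : Submodule ℝ (ℝ → ℝ → ℝ) where
  carrier := {g | ∃ c : ℕ, g ∈ Tens b₀ (LCoef b₀ 0) (SymVan q c v)}
  add_mem' := by
    rintro g g' ⟨c, h⟩ ⟨c', h'⟩
    exact ⟨max c c', add_mem (Tens.mono le_rfl (SymVan.mono le_rfl (le_max_left _ _) le_rfl) h)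
      (Tens.mono le_rfl (SymVan.mono le_rfl (le_max_right _ _) le_rfl) h')⟩
  zero_mem' := ⟨0, zero_mem _⟩
  smul_mem' a g h := by
    obtain ⟨c, h⟩ := h
    exact ⟨c, smul_mem _ a h⟩

/-- The stability properties required from the spaces of coefficients. -/
structure ModStable (b₀ : ℝ) (cc : ℝ → ℝ) (V : Submodule ℝ (ℝ → ℝ → ℝ)) : Prop where
  smooth : ∀ g ∈ V, Smooth2 b₀ g
  eulB : ∀ g ∈ V, eulB g ∈ V
  coef : ∀ g ∈ V, (fun b s => cc b * g b s) ∈ V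
  lamD : ∀ g ∈ V, (fun b => lamD (g b)) ∈ V

theorem ModCoef.mul_mem (hc : ModCoef b₀ cc) {h : ℝ → ℝ} (hh : h ∈ LCoef b₀ 0) :
    (fun b => cc b * h b) ∈ LCoef b₀ 0 := LCoef.mono hc.le (by omega) (LCoef.mul hc.mem hh)

section

variable {b₀ : ℝ} {cc : ℝ → ℝ} {q : ℤ} {v c : ℕ}

theorem smooth2_tens_symVan {g : ℝ → ℝ → ℝ} (hg : g ∈ Tens b₀ (LCoef b₀ 0) (SymVan q c v)) :
    Smooth2 b₀ g :=
  Tens.smooth2 (fun _ h => LCoef.smooth h) (fun _ h => (SymVan.symF h).smooth) hg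

theorem tens_symVan_eulB (hc : ModCoef b₀ cc) {g : ℝ → ℝ → ℝ}
    (hg : g ∈ Tens b₀ (LCoef b₀ 0) (SymVan q c v)) :
    eulB g ∈ Tens b₀ (LCoef b₀ 0) (SymVan q c v) :=
  Tens.map_op (fun _ h => LCoef.smooth h) (fun _ h => (SymVan.symF h).smooth) (domLin_eulB b₀) Tens.domClosed
    (fun k hk F hF => Tens.of_mul (LCoef.of_KCoef hc.le one_pos hk.2) hF fun b _ s _ => by
      have := eul_const_mul_apply (F s) (f := k) (x := b)
      simp only [eulB, mul_comm _ (F s)]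
      exact this) hg

theorem tens_symVan_coef (hc : ModCoef b₀ cc) {g : ℝ → ℝ → ℝ}
    (hg : g ∈ Tens b₀ (LCoef b₀ 0) (SymVan q c v)) :
    (fun b s => cc b * g b s) ∈ Tens b₀ (LCoef b₀ 0) (SymVan q c v) :=
  Tens.map_op (fun _ h => LCoef.smooth h) (fun _ h => (SymVan.symF h).smooth) (domLin_mul b₀ fun b _ => cc b)
    Tens.domClosed (fun k hk F hF => Tens.of_mul (hc.mul_mem hk) hF fun b _ s _ => by
      simp; ring) hg

theorem tens_symVan_lamD {g : ℝ → ℝ → ℝ}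
    (hg : g ∈ Tens b₀ (LCoef b₀ 0) (SymVan q c v)) :
    (fun b => lamD (g b)) ∈ Tens b₀ (LCoef b₀ 0) (SymVan q c v) := by
  have hΦ : DomLin b₀ fun g b => lamD (g b) :=
    ⟨fun g g' h b hb s hs => fibLin_lamD.congr b _ _ (h b hb) s hs,
      fun g g' hg hg' b hb s hs => fibLin_lamD.add b _ _ (hg.right hb) (hg'.right hb) s hs,
      fun a g hg b hb s hs => fibLin_lamD.smul b a _ (hg.right hb) s hs⟩
  exact Tens.map_op (fun _ h => LCoef.smooth h) (fun _ h => (SymVan.symF h).smooth) hΦ Tens.domClosed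
    (fun k hk F hF => Tens.of_mul hk ⟨hF.1.lamD, hF.2.lamD⟩ fun b hb s hs =>
      fibLin_lamD.smul b _ _ hF.1.smooth s hs) hg

theorem Asy.lamD_mem {S : CoefSys b₀} (hc1 : 1 ≤ c) {g : ℝ → ℝ → ℝ} (hg : g ∈ Asy S q c) :
    (fun b => lamD (g b)) ∈ Asy S q c := by
  have h := sub_mem (eulS_mem hg) (le_succ hc1 (inv_mul_mem (eulS_mem hg)))
  refine domClosed _ ((Asy S q c).smul_mem 2 h) _ fun b _ s _ => ?_
  simp [lamD, eulS]
  ring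

theorem CutSpan.lamD_mem {hc : ModCoef b₀ cc} (hc1 : 1 ≤ c) {g : ℝ → ℝ → ℝ}
    (hg : g ∈ CutSpan hc q c) : (fun b => lamD (g b)) ∈ CutSpan hc q c := by
  have h := sub_mem (eulS_mem hg) (le_succ hc1 (inv_mul_mem (eulS_mem hg)))
  refine domClosed _ ((CutSpan hc q c).smul_mem 2 h) _ fun b _ s _ => ?_
  simp [lamD, eulS]
  ring

theorem modStable_profSpan (hc : ModCoef b₀ cc) (r : ℕ) : ModStable b₀ cc (ProfSpan hc r) where
  smooth := by rintro g ⟨c, -, h, -⟩; exact Asy.smooth2 h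
  eulB := by
    rintro g ⟨c, h0, h, h'⟩
    exact ⟨c, h0, eulB_mem_bal hc h, tens_symVan_eulB hc h'⟩
  coef := by
    rintro g ⟨c, h0, h, h'⟩
    exact ⟨c, h0, coef_mul_mem_bal hc h, tens_symVan_coef hc h'⟩
  lamD := by
    rintro g ⟨c, h0, h, h'⟩
    exact ⟨c, h0, Asy.lamD_mem h0 h, tens_symVan_lamD h'⟩

theorem crudeSpan_le_profSpan (hc : ModCoef b₀ cc) {r v : ℕ} (hv : r ≤ v) :
    CrudeSpan b₀ ((r : ℤ) - 1 - 1) v ≤ ProfSpan hc r := by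
  rintro g ⟨c, h⟩
  refine ⟨c + 1, by omega, Asy.of_rest (Tens.mono le_rfl ?_ h),
    Tens.mono le_rfl (SymVan.mono (by omega) (by omega) hv) h⟩
  exact fun F hF => hF.1.mono le_rfl (by omega)

theorem regInv_mem_profSpan (hc : ModCoef b₀ cc) {r : ℕ} (hr : 1 ≤ r) {g : ℝ → ℝ → ℝ}
    (hg : g ∈ ProfSpan hc r) : (fun b => regInv (g b)) ∈ ProfSpan hc (r + 1) := by
  obtain ⟨c, -, h, h'⟩ := hg
  have hq : ((r + 1 : ℕ) : ℤ) - 1 = (r : ℤ) - 1 + 1 := by push_cast; ring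
  refine ⟨c + 3, by omega, ?_, ?_⟩
  · rw [hq]
    exact Asy.regInv_mem (by omega) h
  · rw [hq]
    exact Tens.map_op (fun _ h => LCoef.smooth h) (fun _ h => (SymVan.symF h).smooth) (domLin_regInv b₀)
      Tens.domClosed (fun k hk F hF => Tens.of_mul hk
        ⟨(hF.1.regInv (by omega)).mono le_rfl (by omega), hF.2.regInv⟩
        fun b _ s _ => regInv_const_mul _ _ _) h'

/-- The profile of the part of the error that is linear in `b_k` with `k = 2r` or `k = 2r + 1`. -/
def source (cc : ℝ → ℝ) (r : ℕ) (b s : ℝ) : ℝ := lamD (tau r) s + (2 - 2 * r - cc b) * tau r s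

/-- The cancellation `Λ τ_r ≈ (2r - 1) τ_r`, corrected by the constant `c_{b₁}`, puts the linear
error terms into the class of balanced functions. -/
theorem source_mem (hc : ModCoef b₀ cc) (r : ℕ) :
    source cc r ∈ ProfSpan hc r := by
  obtain ⟨t, th, c, R, hR, e⟩ := exists_tau_eq r
  obtain ⟨c', hτ⟩ := exists_symF_tau r
  set q : ℤ := (r : ℤ) - 1 with hq
  have hcc0 : cc ∈ LCoef b₀ 0 := LCoef.mono hc.le zero_le_one hc.mem
  have h1cc : (fun b => (2 - 2 * r : ℝ) - cc b) ∈ LCoef b₀ 0 :=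
    sub_mem (LCoef.const _) hcc0
  refine ⟨c + c' + 1, by omega, ?_, ?_⟩
  · set F : ℝ → ℝ := fun s => s ^ q * (t + th * log s) with hF
    have hFs : SymF q 1 F := by
      have h1 := (SymF.zpow q).mul ((((SymF.const t).mono le_rfl zero_le_one)).add
        (SymF.log.const_mul th))
      exact h1.mono (by simp) (by omega)
    set G : ℝ → ℝ := fun s => lamD R s + -2 * (eul F s / s) with hG
    have hGs : SymF (q - 1) (c + c' + 1) G :=
      (hR.lamD.mono le_rfl (by omega)).add ((hFs.eul.div.const_mul (-2)).mono le_rfl (by omega))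
    have hRest : (fun b s => (1 : ℝ) * G s) + (fun b s => ((2 - 2 * r : ℝ) - cc b) * R s) ∈
        Tens b₀ (LCoef b₀ 0) (SymFs (q - 1) (c + c' + 1)) :=
      add_mem (Tens.of_mul (LCoef.const 1) hGs fun _ _ _ _ => rfl)
        (Tens.of_mul h1cc (F := R) (hR.mono le_rfl (by omega)) fun _ _ _ _ => rfl)
    refine ⟨(fun b => 2 * th - cc b * t, fun b => -(cc b) * th), ⟨2 * th, ?_, ?_⟩, _, hRest,
      fun b hb s hs => ?_⟩
    · refine LCoef.congr ((LCoef b₀ 1).smul_mem (-t) hc.mem) fun b _ => ?_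
      simp
      ring
    · exact KCoef.congr (zero_mem _) fun b _ => by simp; ring
    · have h1 : lamD (tau r) s = lamD F s + lamD R s := by
        rw [fibLin_lamD.congr b _ (fun s => F s + R s) (fun s hs => e s hs) s hs,
          fibLin_lamD.add b F R hFs.smooth hR.smooth s hs]
      have h2 : eul F s = q * F s + s ^ q * th := eul_zpow_mul_add_log q _ _ hs
      rw [source, h1, e s hs]
      simp [leadTerm, hG]
      rw [show lamD F s = 2 * (1 - 1 / s) * eul F s from rfl, h2]
      simp only [hF, hq]
      push_cast
      ring
  · have h1 : (fun b s => (1 : ℝ) * lamD (tau r) s) +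
        (fun b s => ((2 - 2 * r : ℝ) - cc b) * tau r s) ∈
        Tens b₀ (LCoef b₀ 0) (SymVan q (c + c' + 1) r) :=
      add_mem (Tens.of_mul (LCoef.const 1) ⟨hτ.lamD.mono le_rfl (by omega), (van_tau r).lamD⟩
          fun _ _ _ _ => rfl)
        (Tens.of_mul h1cc ⟨hτ.mono le_rfl (by omega), van_tau r⟩ fun _ _ _ _ => rfl)
    refine Tens.domClosed _ h1 _ fun b _ s _ => ?_
    simp [source]

theorem source_zero_eq (cc : ℝ → ℝ) (b : ℝ) {s : ℝ} (hs : 0 < s) :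
    source (fun b => 1 / 2 * cc b) 0 b s = 4 * s ^ (-2 : ℤ) + -(cc b) * s⁻¹ := by
  have h1 : eul (fun s : ℝ => 2 / s) s = -2 / s := by
    have := eul_zpow (-1) hs
    simp only [zpow_neg_one] at this
    simp only [div_eq_mul_inv]
    rw [eul_const_mul_apply, this]
    push_cast; ring
  rw [source, lamD, tau, h1]
  have : s ^ (-2 : ℤ) = 1 / s ^ 2 := by rw [zpow_neg, zpow_ofNat, one_div]
  rw [this]
  field_simp
  push_cast
  ring

/-- The first correction is explicit. -/
theorem regInv_source_zero_mem (hc : ModCoef b₀ cc) :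
    (fun b => regInv (source (fun b => 1 / 2 * cc b) 0 b)) ∈ ProfSpan hc 1 := by
  obtain ⟨R, hR, e⟩ := exists_regInv_inv
  have hs := fun b s => source_zero_eq cc b (s := s)
  have key : ∀ b s : ℝ, 0 < s → regInv (source (fun b => 1 / 2 * cc b) 0 b) s =
      (-(1 / 2) + 1 / 2 * s⁻¹) - cc b * regInv (fun x => x⁻¹) s := fun b s hs' => by
    have s1 : SmoothPos fun s : ℝ => 4 * s ^ (-2 : ℤ) := contDiffOn_const.mul (smoothPos_zpow _)
    have s2 : SmoothPos fun s : ℝ => -(cc b) * s⁻¹ := contDiffOn_const.mul SymF.inv.smooth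
    rw [regInv_congr (hs b) hs', regInv_add s1 s2 hs', regInv_const_mul, regInv_const_mul,
      regInv_zpow_neg_two hs']
    ring
  have hcc0 : cc ∈ LCoef b₀ 0 := LCoef.mono hc.le zero_le_one hc.mem
  refine ⟨3, by omega, ?_, ?_⟩
  · have hRest : (fun b s => (1 / 2 : ℝ) * s⁻¹) + (fun b s => -cc b * R s) ∈
        Tens b₀ (LCoef b₀ 0) (SymFs (((1 : ℕ) : ℤ) - 1 - 1) 3) :=
      add_mem (Tens.of_mul (F := fun s => s⁻¹) (LCoef.const (1 / 2))
        (SymF.inv.mono (by norm_num) (by norm_num)) fun _ _ _ _ => rfl)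
        (Tens.of_mul (h := fun b => -cc b) (neg_mem hcc0) (F := R)
          (hR.mono (by norm_num) le_rfl) fun _ _ _ _ => rfl)
    refine ⟨(fun b => -(1 / 2) - 1 / 2 * cc b, fun b => 1 / 4 * cc b), ⟨-(1 / 2), ?_, ?_⟩, _, hRest,
      fun b hb s hs => ?_⟩
    · refine LCoef.congr ((LCoef b₀ 1).smul_mem (-(1 / 2)) hc.mem) fun b _ => ?_
      simp
      ring
    · exact KCoef.congr (zero_mem _) fun b _ => by simp; ring
    · show regInv (source (fun b => 1 / 2 * cc b) 0 b) s = _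
      rw [key b s hs, e s hs]
      simp [leadTerm]
      ring
  · have hI : SymF 0 3 (regInv fun x => x⁻¹) := by
      have := SymF.inv.regInv (by norm_num)
      exact this.mono (by norm_num) (by norm_num)
    have hV : Van 1 (regInv fun x => x⁻¹) := by
      have h0 : Van 0 (fun x : ℝ => x⁻¹) := ⟨_, SymF.inv.smooth, by simp⟩
      exact h0.regInv
    have hV' : Van 1 (fun s : ℝ => -(1 / 2) + 1 / 2 * s⁻¹) :=
      ⟨fun s => -(1 / 2) * s⁻¹, contDiffOn_const.mul SymF.inv.smooth, fun s hs => by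
        field_simp; ring⟩
    have hS' : SymF 0 3 (fun s : ℝ => -(1 / 2) + 1 / 2 * s⁻¹) :=
      ((SymF.const _).mono le_rfl (by norm_num)).add
        ((SymF.inv.const_mul (1 / 2)).mono (by norm_num) (by norm_num))
    have h1 : (fun b s => (1 : ℝ) * (-(1 / 2) + 1 / 2 * s⁻¹)) +
        (fun b s => -cc b * regInv (fun x => x⁻¹) s) ∈
        Tens b₀ (LCoef b₀ 0) (SymVan (((1 : ℕ) : ℤ) - 1) 3 1) := by
      simp only [Nat.cast_one, sub_self]
      exact add_mem (Tens.of_mul (F := fun s => -(1 / 2) + 1 / 2 * s⁻¹) (LCoef.const 1) ⟨hS', hV'⟩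
          fun _ _ _ _ => rfl)
        (Tens.of_mul (h := fun b => -cc b) (neg_mem hcc0) ⟨hI, hV⟩ fun _ _ _ _ => rfl)
    refine Tens.domClosed _ h1 _ fun b _ s hs => ?_
    show regInv (source (fun b => 1 / 2 * cc b) 0 b) s = _
    rw [key b s hs]
    simp
    ring

end

/-! ### The recursion for the corrections -/

section

variable {L : ℕ} {b₀ : ℝ} {cc : ℝ → ℝ}

/-- The constants `c_{b₁,i}` in terms of the common factor `cc`. -/
def modC (cc : ℝ → ℝ) (i : ℕ) (b : ℝ) : ℝ := if i = 1 then 1 / 2 * cc b else cc b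

/-- The leading order velocity of `b_{j+1}`. -/
def kap (cc : ℝ → ℝ) (j : Fin L) (b : Fin L → ℝ) : ℝ :=
  coord b (j + 2) - ((j : ℝ) + modC cc (j + 1) (coord b 1)) * coord b 1 * b j

/-- The scaling and modulation terms generated by a correction `y U(b, 1 + y²)` in the coordinate
number `ι + 1`. -/
def flowY (cc : ℝ → ℝ) (ι : ℕ) (U : (Fin L → ℝ) → ℝ → ℝ) (b : Fin L → ℝ) (s : ℝ) : ℝ :=
  coord b 1 * ((1 + ι) * U b s + lamD (U b) s) + ∑ j : Fin L, kap cc j b * partialS j U b s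

theorem modC_mul_mem {V : Submodule ℝ (ℝ → ℝ → ℝ)} (hV : ModStable b₀ cc V) (i : ℕ) :
    ∀ g ∈ V, (fun b s => modC cc i b * g b s) ∈ V := fun g hg => by
  by_cases hi : i = 1
  · have : (fun b s => modC cc i b * g b s) = (1 / 2 : ℝ) • fun b s => cc b * g b s := by
      funext b s
      simp [modC, if_pos hi]
      ring
    rw [this]
    exact V.smul_mem _ (hV.coef g hg)
  · simp only [modC, if_neg hi]
    exact hV.coef g hg

theorem flowY_mem (hL : 0 < L) {V : Submodule ℝ (ℝ → ℝ → ℝ)} (hV : ModStable b₀ cc V) {w : ℤ}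
    {d : ℕ} (hd : 2 ≤ d) {U : (Fin L → ℝ) → ℝ → ℝ} (hU : U ∈ HomSpan L b₀ w d V) (ι : ℕ) :
    flowY cc ι U ∈ HomSpan L b₀ (w + 1) (d + 1) V := by
  have hmono : ∀ {w} {U : (Fin L → ℝ) → ℝ → ℝ}, U ∈ HomSpan L b₀ w d V →
      U ∈ HomSpan L b₀ w (d + 1) V := fun h => HomSpan.mono (Nat.le_succ d) le_rfl h
  have h1 : (fun b s => coord b 1 * ((1 + ι : ℝ) • U + fun b => lamD (U b)) b s) ∈
      HomSpan L b₀ (w + 1) (d + 1) V := by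
    have := HomSpan.coord_mul hL le_rfl (Or.inl rfl) (hmono (add_mem (smul_mem _
      (1 + ι : ℝ) hU) (HomSpan.map hL fibLin_lamD hV.smooth hV.lamD hU)))
    rwa [Nat.cast_one, add_comm] at this
  have h2 : ∀ j : Fin L, (fun b s => kap cc j b * partialS j U b s) ∈
      HomSpan L b₀ (w + 1) (d + 1) V := fun j => by
    by_cases hjd : (j : ℕ) = 0 ∨ (j : ℕ) + 1 < d
    · have hp : partialS j U ∈ HomSpan L b₀ (w - ((j : ℤ) + 1)) (d + 1) V := by
        rcases Nat.eq_zero_or_pos (j : ℕ) with h0 | h0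
        · obtain rfl : j = ⟨0, hL⟩ := Fin.ext h0
          have := hmono (HomSpan.partialS_zero_mem hL hV.smooth hV.eulB hU)
          simpa using this
        · exact hmono (HomSpan.partialS_mem hL hV.smooth h0 hU)
      have a1 := HomSpan.coord_mul hL (k := j + 2) (by omega) (Or.inr (by omega)) hp
      have a2 := HomSpan.coord_mul hL le_rfl (Or.inl rfl) (HomSpan.coord_mul hL (k := j + 1)
        (by omega) (by omega) hp)
      have a3 := HomSpan.map hL (fibLin_mul fun b _ => modC cc (j + 1) b) hV.smooth
        (modC_mul_mem hV (j + 1)) a2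
      rw [show (((j : ℕ) + 2 : ℕ) : ℤ) + (w - ((j : ℤ) + 1)) = w + 1 by push_cast; ring] at a1
      rw [show ((1 : ℕ) : ℤ) + ((((j : ℕ) + 1 : ℕ) : ℤ) + (w - ((j : ℤ) + 1))) = w + 1 by
        push_cast; ring] at a2 a3
      refine HomSpan.congr hL (sub_mem a1 (add_mem (smul_mem _ (j : ℝ) a2) a3))
        fun b _ s _ => ?_
      simp [kap, coord_of_le j.2]
      ring
    · refine HomSpan.congr hL (zero_mem _) fun b hb s hs => ?_
      rw [HomSpan.partialS_eq_zero (by omega) (by omega) hU b hb s hs]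
      simp
  refine HomSpan.congr hL (add_mem h1 (sum_mem (t := Finset.univ) fun j _ => h2 j)) fun b _ s _ => ?_
  simp [flowY, Finset.sum_apply]

theorem CrudeSpan.mul_mem {q q' : ℤ} {v v' : ℕ} {g g' : ℝ → ℝ → ℝ} (h : g ∈ CrudeSpan b₀ q v)
    (h' : g' ∈ CrudeSpan b₀ q' v') : g * g' ∈ CrudeSpan b₀ (q + q') (v + v') := by
  obtain ⟨c, h⟩ := h
  obtain ⟨c', h'⟩ := h'
  have hL : ∀ h ∈ LCoef b₀ 0, ∀ k ∈ LCoef b₀ 0, (fun b => h b * k b) ∈ LCoef b₀ 0 :=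
    fun h hh k hk => by
      have := LCoef.mul hh hk
      rwa [add_zero] at this
  have hF : ∀ F ∈ SymVan q c v, ∀ G ∈ SymVan q' c' v',
      (fun s => F s * G s) ∈ SymVan (q + q') (c + c') (v + v') := fun F hF G hG => by
    obtain ⟨F', hF', e⟩ := SymVan.van hF
    obtain ⟨G', hG', e'⟩ := SymVan.van hG
    exact ⟨(SymVan.symF hF).mul (SymVan.symF hG), fun s => F' s * G' s, hF'.mul hG',
      fun s hs => by simp only [e s hs, e' s hs, pow_add]; ring⟩
  exact ⟨c + c', Tens.mul hL hF h h'⟩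

theorem CrudeSpan.of_symF {q : ℤ} {c v : ℕ} {F : ℝ → ℝ} (hF : SymF q c F) (hv : Van v F) :
    (fun _ s => F s) ∈ CrudeSpan b₀ q v :=
  ⟨c, Tens.of_mul (LCoef.const 1) ⟨hF, hv⟩ fun _ _ _ _ => (one_mul _).symm⟩

theorem CrudeSpan.mono {q q' : ℤ} {v v' : ℕ} (hq : q ≤ q') (hv : v' ≤ v) :
    CrudeSpan b₀ q v ≤ CrudeSpan b₀ q' v' := by
  rintro g ⟨c, h⟩
  exact ⟨c, Tens.mono le_rfl (SymVan.mono hq le_rfl hv) h⟩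

theorem CrudeSpan.smooth2 {q : ℤ} {v : ℕ} {g : ℝ → ℝ → ℝ} (h : g ∈ CrudeSpan b₀ q v) :
    Smooth2 b₀ g := by
  obtain ⟨c, h⟩ := h
  exact smooth2_tens_symVan h

/-! ### Powers of the perturbation, graded by homogeneity -/

/-- The component of weight `2r` of `(∑ E_r)^M`, where `E_r` has weight `2r`. -/
def gpow (E : ℕ → (Fin L → ℝ) → ℝ → ℝ) (M r : ℕ) : (Fin L → ℝ) → ℝ → ℝ :=
  PowerSeries.coeff r (PowerSeries.mk E ^ M)

theorem gpow_succ (E : ℕ → (Fin L → ℝ) → ℝ → ℝ) (M r : ℕ) :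
    gpow E (M + 1) r = ∑ p ∈ Finset.HasAntidiagonal.antidiagonal r, gpow E M p.1 * E p.2 := by
  rw [gpow, pow_succ, PowerSeries.coeff_mul]
  simp only [gpow, PowerSeries.coeff_mk]

theorem gpow_zero_right {E : ℕ → (Fin L → ℝ) → ℝ → ℝ} (h0 : E 0 = 0) (M : ℕ) :
    gpow E (M + 1) 0 = 0 := by
  rw [gpow_succ]
  simp [h0]

theorem gpow_congr {E E' : ℕ → (Fin L → ℝ) → ℝ → ℝ} {r : ℕ} (h : ∀ n < r, E n = E' n)
    (M : ℕ) {n : ℕ} (hn : n < r) : gpow E M n = gpow E' M n := by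
  induction M generalizing n with
  | zero => simp [gpow]
  | succ M ih =>
    rw [gpow_succ, gpow_succ]
    refine sum_congr rfl fun p hp => ?_
    have := Finset.HasAntidiagonal.mem_antidiagonal.1 hp
    rw [ih (by omega), h _ (by omega)]

/-- The component of weight `2r` of a power with exponent at least two only involves `E_n` for
`n < r`. -/
theorem gpow_add_two_congr {E E' : ℕ → (Fin L → ℝ) → ℝ → ℝ} (h0 : E 0 = 0) (h0' : E' 0 = 0) {r : ℕ}
    (h : ∀ n < r, E n = E' n) (M : ℕ) : gpow E (M + 2) r = gpow E' (M + 2) r := by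
  rw [gpow_succ, gpow_succ]
  refine sum_congr rfl fun p hp => ?_
  have := Finset.HasAntidiagonal.mem_antidiagonal.1 hp
  rcases Nat.eq_zero_or_pos p.1 with h1 | h1
  · rw [h1, gpow_zero_right h0, gpow_zero_right h0', zero_mul, zero_mul]
  rcases Nat.eq_zero_or_pos p.2 with h2 | h2
  · rw [h2, h0, h0', mul_zero, mul_zero]
  · rw [gpow_congr h (M + 1) (by omega), h _ (by omega)]

theorem gpow_add_two_one {E : ℕ → (Fin L → ℝ) → ℝ → ℝ} (h0 : E 0 = 0) (M : ℕ) :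
    gpow E (M + 2) 1 = 0 := by
  rw [gpow_add_two_congr (E' := 0) h0 rfl (fun n hn => by
    rw [Nat.lt_one_iff.1 hn, h0]; rfl), gpow_succ]
  simp

theorem gpow_mem {E : ℕ → (Fin L → ℝ) → ℝ → ℝ} {d n : ℕ} (h0 : E 0 = 0)
    (h : ∀ r, 1 ≤ r → r < n → E r ∈ HomSpan L b₀ (2 * r) d (CrudeSpan b₀ ((r : ℤ) - 1) r))
    (M : ℕ) {r : ℕ} (hr : r < n) :
    gpow E M r ∈ HomSpan L b₀ (2 * r) d (CrudeSpan b₀ ((r : ℤ) - M) r) := by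
  induction M generalizing r with
  | zero =>
    rw [gpow, pow_zero, PowerSeries.coeff_one]
    split_ifs with h
    · subst h
      refine HomSpan.of_mono (g := fun _ _ => 1) MonoWt.zero (CrudeSpan.mono (by simp) le_rfl
        (CrudeSpan.of_symF (v := 0) (SymF.const 1) ⟨fun _ => 1, contDiffOn_const, by simp⟩))
        fun b _ s _ => by simp
    · exact zero_mem _
  | succ M ih =>
    rw [gpow_succ]
    refine sum_mem fun p hp => ?_
    have hpr := Finset.HasAntidiagonal.mem_antidiagonal.1 hp
    rcases Nat.eq_zero_or_pos p.2 with h2 | h2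
    · rw [h2, h0, mul_zero]
      exact zero_mem _
    · have := HomSpan.mul (fun g hg g' hg' => CrudeSpan.mul_mem hg hg')
        (ih (r := p.1) (by omega)) (h p.2 h2 (by omega))
      rw [← mul_add, ← Nat.cast_add, hpr] at this
      refine HomSpan.mono le_rfl (CrudeSpan.mono ?_ le_rfl) this
      push_cast
      omega

/-- The graded components add up to the power of the sum. -/
theorem sum_gpow {E : ℕ → (Fin L → ℝ) → ℝ → ℝ} {R : ℕ} (hE : ∀ r, R < r → E r = 0) (M : ℕ)
    (b : Fin L → ℝ) (s : ℝ) :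
    (∀ r, R * M < r → gpow E M r = 0) ∧
    ∑ r ∈ range (R * M + 1), gpow E M r b s = (∑ r ∈ range (R + 1), E r b s) ^ M := by
  set p : Polynomial ((Fin L → ℝ) → ℝ → ℝ) :=
    ∑ r ∈ range (R + 1), Polynomial.monomial r (E r) with hp
  have hcoe : (p : PowerSeries ((Fin L → ℝ) → ℝ → ℝ)) = PowerSeries.mk E := by
    ext n : 1
    rw [Polynomial.coeff_coe, PowerSeries.coeff_mk, hp, Polynomial.finsetSum_coeff]
    simp only [Polynomial.coeff_monomial]
    rw [Finset.sum_ite_eq' (range (R + 1)) n E]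
    split_ifs with h
    · rfl
    · rw [hE n (by simpa using h)]
  have hg : ∀ r, gpow E M r = (p ^ M).coeff r := fun r => by
    rw [gpow, ← hcoe, ← Polynomial.coe_pow, Polynomial.coeff_coe]
  have hdeg : (p ^ M).natDegree ≤ R * M := by
    rw [mul_comm]
    refine Polynomial.natDegree_pow_le_of_le M ?_
    refine Polynomial.natDegree_sum_le_of_forall_le _ _ fun r hr => ?_
    exact (Polynomial.natDegree_monomial_le _).trans (by simpa [Nat.lt_succ_iff] using hr)
  refine ⟨fun r hr => ?_, ?_⟩
  · rw [hg, Polynomial.coeff_eq_zero_of_natDegree_lt (hdeg.trans_lt hr)]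
  · have h1 : (p ^ M).eval 1 = ∑ r ∈ range (R * M + 1), gpow E M r := by
      rw [Polynomial.eval_eq_sum_range' (Nat.lt_succ_of_le hdeg)]
      simp [hg]
    have h2 : p.eval 1 = ∑ r ∈ range (R + 1), E r := by
      rw [hp, Polynomial.eval_finsetSum]
      simp
    rw [Polynomial.eval_pow, h2] at h1
    have h3 := congrFun (congrFun h1 b) s
    simp [Finset.sum_apply] at h3
    exact h3.symm

end

section

variable {L : ℕ} {b₀ : ℝ} {cc : ℝ → ℝ}

/-- The factor `2 Z / (1 + y²)` in front of the even powers of the perturbation. -/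
def evenFac (s : ℝ) : ℝ := 2 * (2 / s - 1) / s

/-- The factor `(2 Z² - 1) / 2` in front of the odd powers of the perturbation. -/
def oddFac (s : ℝ) : ℝ := (2 * (2 / s - 1) ^ 2 - 1) / 2

/-- The component of weight `2r` of the nonlinear error of a perturbation `y ∑ E_r`, given the Taylor
coefficients `κ`, `ς` of the nonlinearity. -/
def nl (κ ς : ℕ → ℝ) (N : ℕ) (E : ℕ → (Fin L → ℝ) → ℝ → ℝ) (r : ℕ) (b : Fin L → ℝ) (s : ℝ) : ℝ :=
  ∑ m ∈ range N, (κ m * (evenFac s * (s - 1) ^ m) * gpow E (2 * m + 2) r b s +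
    ς m * (oddFac s * (s - 1) ^ m) * gpow E (2 * m + 3) r b s)

theorem symF_sub_one_pow (m : ℕ) : SymF m 0 fun s => (s - 1) ^ m := by
  have h1 : SymF 1 0 fun s : ℝ => s - 1 :=
    ((SymF.zpow 1).sub ((SymF.const 1).mono (by norm_num) le_rfl)).congr fun s _ => by simp
  induction m with
  | zero => simpa using SymF.const 1
  | succ m ih =>
    have := ih.mul h1
    simpa only [Nat.cast_succ, pow_succ] using this

theorem symF_two_div_sub_one : SymF 0 0 fun s => 2 / s - 1 :=
  ((SymF.inv.const_mul 2).mono (by norm_num) le_rfl).sub (SymF.const 1)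

theorem symF_evenFac : SymF (-1) 0 evenFac :=
  ((symF_two_div_sub_one.const_mul 2).div).congr fun s _ => rfl

theorem symF_oddFac : SymF 0 0 oddFac := by
  have h := symF_two_div_sub_one.mul symF_two_div_sub_one
  exact (h.sub (SymF.const (1 / 2))).congr fun s _ => by rw [oddFac]; ring

theorem nl_congr (κ ς : ℕ → ℝ) (N : ℕ) {E E' : ℕ → (Fin L → ℝ) → ℝ → ℝ} (h0 : E 0 = 0)
    (h0' : E' 0 = 0) {r : ℕ} (h : ∀ n < r, E n = E' n) : nl κ ς N E r = nl κ ς N E' r := by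
  funext b s
  refine sum_congr rfl fun m _ => ?_
  rw [gpow_add_two_congr h0 h0' h, gpow_add_two_congr h0 h0' h (2 * m + 1)]

theorem nl_one (κ ς : ℕ → ℝ) (N : ℕ) {E : ℕ → (Fin L → ℝ) → ℝ → ℝ} (h0 : E 0 = 0) :
    nl κ ς N E 1 = 0 := by
  funext b s
  refine sum_eq_zero fun m _ => ?_
  rw [gpow_add_two_one h0, gpow_add_two_one h0 (2 * m + 1)]
  simp

theorem CrudeSpan.symF_mul_mem {q q' : ℤ} {c v : ℕ} {F : ℝ → ℝ} (hF : SymF q c F) {g : ℝ → ℝ → ℝ}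
    (hg : g ∈ CrudeSpan b₀ q' v) : (fun b s => F s * g b s) ∈ CrudeSpan b₀ (q + q') v := by
  have := CrudeSpan.mul_mem (CrudeSpan.of_symF (b₀ := b₀) (v := 0) hF ⟨F, hF.smooth, by simp⟩) hg
  rwa [zero_add] at this

theorem mul_gpow_mem (hL : 0 < L) {E : ℕ → (Fin L → ℝ) → ℝ → ℝ} {d n : ℕ} (h0 : E 0 = 0)
    (h : ∀ r, 1 ≤ r → r < n → E r ∈ HomSpan L b₀ (2 * r) d (CrudeSpan b₀ ((r : ℤ) - 1) r))
    {r : ℕ} (hr : r < n) {q : ℤ} {F : ℝ → ℝ} (hF : SymF q 0 F) (a : ℝ) {m M : ℕ}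
    (hq : q + m - M ≤ -3) :
    (fun b s => a * (F s * (s - 1) ^ m) * gpow E M r b s) ∈
      HomSpan L b₀ (2 * r) d (CrudeSpan b₀ ((r : ℤ) - 3) r) := by
  refine HomSpan.map hL (fibLin_mul fun _ s => a * (F s * (s - 1) ^ m))
    (fun g hg => CrudeSpan.smooth2 hg) (fun g hg => ?_) (gpow_mem h0 h M hr)
  exact CrudeSpan.mono (by omega) le_rfl
    (CrudeSpan.symF_mul_mem ((hF.mul (symF_sub_one_pow m)).const_mul a) hg)

theorem nl_mem (hL : 0 < L) (κ ς : ℕ → ℝ) (N : ℕ) {E : ℕ → (Fin L → ℝ) → ℝ → ℝ} {d n : ℕ}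
    (h0 : E 0 = 0)
    (h : ∀ r, 1 ≤ r → r < n → E r ∈ HomSpan L b₀ (2 * r) d (CrudeSpan b₀ ((r : ℤ) - 1) r))
    {r : ℕ} (hr : r ≤ n) :
    nl κ ς N E r ∈ HomSpan L b₀ (2 * r) d (CrudeSpan b₀ ((r : ℤ) - 3) r) := by
  set E' : ℕ → (Fin L → ℝ) → ℝ → ℝ := fun m => if m < n then E m else 0 with hE'
  have h0' : E' 0 = 0 := by simp only [hE', h0, ite_self]
  have h' : ∀ m, 1 ≤ m → m < n + 1 →
      E' m ∈ HomSpan L b₀ (2 * m) d (CrudeSpan b₀ ((m : ℤ) - 1) m) := fun m hm _ => by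
    by_cases hmn : m < n
    · simp only [hE', if_pos hmn]; exact h m hm hmn
    · simp only [hE', if_neg hmn]; exact zero_mem _
  rw [nl_congr κ ς N (E' := E') h0 h0' fun m hm => by simp [hE', show m < n by omega]]
  have hs : ∀ m, ((fun b s => κ m * (evenFac s * (s - 1) ^ m) * gpow E' (2 * m + 2) r b s) +
      fun b s => ς m * (oddFac s * (s - 1) ^ m) * gpow E' (2 * m + 3) r b s) ∈
      HomSpan L b₀ (2 * r) d (CrudeSpan b₀ ((r : ℤ) - 3) r) := fun m =>
    add_mem (mul_gpow_mem hL h0' h' (by omega) symF_evenFac _ (by push_cast; omega))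
      (mul_gpow_mem hL h0' h' (by omega) symF_oddFac _ (by push_cast; omega))
  refine HomSpan.congr hL (sum_mem (t := range N) fun m _ => hs m) fun b _ s _ => ?_
  simp [nl, Finset.sum_apply]

/-- The part of the error which is linear in `b_k`. -/
def linErr (cc : ℝ → ℝ) (k : ℕ) (b : Fin L → ℝ) (s : ℝ) : ℝ :=
  coord b 1 * (coord b k * source (modC cc k) (k / 2) (coord b 1) s)

/-- The even components of the perturbation, graded by weight. -/
def errE (u : ℕ → (Fin L → ℝ) → ℝ → ℝ) (r : ℕ) : (Fin L → ℝ) → ℝ → ℝ :=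
  if r = 0 then 0 else fun b s => coord b (2 * r) * tau r s + u (2 * r) b s

/-- The error that has to be removed by the correction of weight `i`. -/
def errX (cc : ℝ → ℝ) (κ ς : ℕ → ℝ) (u : ℕ → (Fin L → ℝ) → ℝ → ℝ) (i : ℕ) :
    (Fin L → ℝ) → ℝ → ℝ :=
  linErr cc (i - 1) + flowY cc ((i - 1) % 2) (u (i - 1)) +
    if i % 2 = 0 then nl κ ς L (errE u) (i / 2) else 0

/-- The corrections before the cutoff, `u_i` in terms of the preceding ones. -/
def corStep (cc : ℝ → ℝ) (κ ς : ℕ → ℝ) (u : ℕ → (Fin L → ℝ) → ℝ → ℝ) (i : ℕ) :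
    (Fin L → ℝ) → ℝ → ℝ :=
  if i < 2 then 0 else if i % 2 = 0 then fun b s => -regInv (errX cc κ ς u i b) s
    else errX cc κ ς u i

/-- The corrections before the cutoff: `S_i` is `y χ(b₁² (1 + y²)) u_i(b, 1 + y²)` in the coordinate
of the parity of `i`. -/
def cor (cc : ℝ → ℝ) (κ ς : ℕ → ℝ) (i : ℕ) : (Fin L → ℝ) → ℝ → ℝ :=
  corStep cc κ ς (fun j => if _h : j < i then cor cc κ ς j else 0) i

theorem errX_congr {u u' : ℕ → (Fin L → ℝ) → ℝ → ℝ} {κ ς : ℕ → ℝ} {i : ℕ} (hi : 2 ≤ i)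
    (h : ∀ j < i, u j = u' j) : errX cc κ ς u i = errX cc κ ς u' i := by
  have h1 : nl κ ς L (errE u) (i / 2) = nl κ ς L (errE u') (i / 2) :=
    nl_congr κ ς L rfl rfl fun n hn => by
      unfold errE
      rw [h (2 * n) (by omega)]
  rw [errX, errX, h1, h (i - 1) (by omega)]

theorem cor_eq (cc : ℝ → ℝ) (κ ς : ℕ → ℝ) (i : ℕ) :
    cor (L := L) cc κ ς i = corStep cc κ ς (cor cc κ ς) i := by
  rw [cor]
  unfold corStep
  by_cases hi : i < 2
  · rw [if_pos hi, if_pos hi]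
  · rw [errX_congr (u' := cor cc κ ς) (by omega) fun j hj => dif_pos hj]

theorem cor_of_lt {κ ς : ℕ → ℝ} {i : ℕ} (hi : i < 2) : cor (L := L) cc κ ς i = 0 := by
  rw [cor_eq, corStep, if_pos hi]

theorem cor_odd {κ ς : ℕ → ℝ} {i : ℕ} (hi : 2 ≤ i) (ho : i % 2 = 1) :
    cor (L := L) cc κ ς i = errX cc κ ς (cor cc κ ς) i := by
  rw [cor_eq, corStep, if_neg (by omega), if_neg (by omega)]

theorem cor_even {κ ς : ℕ → ℝ} {i : ℕ} (hi : 2 ≤ i) (he : i % 2 = 0) :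
    cor (L := L) cc κ ς i = fun b s => -regInv (errX cc κ ς (cor cc κ ς) i b) s := by
  rw [cor_eq, corStep, if_neg (by omega), if_pos he]

theorem linErr_mem (hL : 0 < L) (hc : ModCoef b₀ cc) {k : ℕ} (hk : 2 ≤ k) :
    linErr cc k ∈ HomSpan L b₀ (k + 1) (k + 1) (ProfSpan hc (k / 2)) := by
  have h1 : modC cc k = cc := by funext b; rw [modC, if_neg (by omega)]
  have := HomSpan.coord_mul hL le_rfl (Or.inl rfl) (HomSpan.coord_mem (L := L) (b₀ := b₀) (k := k) (d := k + 1)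
    (by omega) (Or.inr (by omega)) (source_mem hc (k / 2)))
  rw [Nat.cast_one, add_comm] at this
  unfold linErr
  rw [h1]
  exact this

theorem profSpan_le_crudeSpan (hc : ModCoef b₀ cc) (r : ℕ) :
    ProfSpan hc r ≤ CrudeSpan b₀ ((r : ℤ) - 1) r := by
  rintro g ⟨c, -, -, h⟩
  exact ⟨c, h⟩

theorem errE_mem (hL : 0 < L) (hc : ModCoef b₀ cc) {u : ℕ → (Fin L → ℝ) → ℝ → ℝ} {r d : ℕ}
    (hr : 1 ≤ r) (hd : 2 * r < d)
    (hu : u (2 * r) ∈ HomSpan L b₀ (2 * r) (2 * r) (ProfSpan hc r)) :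
    errE u r ∈ HomSpan L b₀ (2 * r) d (CrudeSpan b₀ ((r : ℤ) - 1) r) := by
  obtain ⟨c, hτ⟩ := exists_symF_tau r
  have h1 := HomSpan.coord_mem (L := L) (b₀ := b₀) (d := d) (k := 2 * r) (by omega) (Or.inr hd)
    (CrudeSpan.of_symF (b₀ := b₀) hτ (van_tau r))
  have h2 := HomSpan.mono hd.le (profSpan_le_crudeSpan hc r) hu
  rw [Nat.cast_mul, Nat.cast_two] at h1
  have := add_mem h1 h2
  rw [errE, if_neg (by omega)]
  exact this

theorem cor_mem (hL : 0 < L) (hc : ModCoef b₀ cc) (κ ς : ℕ → ℝ) (i : ℕ) (hi : 2 ≤ i) :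
    cor (L := L) cc κ ς i ∈ HomSpan L b₀ i i (ProfSpan hc (i / 2)) := by
  induction i using Nat.strong_induction_on with
  | _ i ih =>
  rcases Nat.mod_two_eq_zero_or_one i with he | ho
  · obtain ⟨r, rfl⟩ : ∃ r, i = 2 * r + 2 := ⟨(i - 2) / 2, by omega⟩
    have hdiv : (2 * r + 2) / 2 = r + 1 := by omega
    have hneg : ∀ {U : (Fin L → ℝ) → ℝ → ℝ}, U ∈ HomSpan L b₀ (2 * r + 2 : ℕ) (2 * r + 2)
        (ProfSpan hc (r + 1)) → (fun b s => -U b s) ∈ HomSpan L b₀ (2 * r + 2 : ℕ) (2 * r + 2)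
        (ProfSpan hc (r + 1)) := fun h => neg_mem h
    rw [cor_even hi he, hdiv]
    refine hneg (U := fun b s => regInv (errX cc κ ς (cor cc κ ς) (2 * r + 2) b) s) ?_
    have hX : errX (L := L) cc κ ς (cor cc κ ς) (2 * r + 2) = linErr cc (2 * r + 1) +
        flowY cc 1 (cor cc κ ς (2 * r + 1)) + nl κ ς L (errE (cor cc κ ς)) (r + 1) := by
      rw [errX, if_pos he, hdiv]
      congr 4
      omega
    rcases Nat.eq_zero_or_pos r with rfl | hr
    · have h1 : flowY (L := L) cc 1 (cor cc κ ς (2 * 0 + 1)) = 0 := by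
        rw [cor_of_lt (by omega)]
        funext b s
        simp [flowY, lamD, eul, partialS]
      rw [hX, h1, nl_one _ _ _ rfl, add_zero, add_zero]
      have h2 := HomSpan.coord_mul hL le_rfl (Or.inl rfl) (HomSpan.coord_mem (L := L) (b₀ := b₀) (d := 2)
        le_rfl (Or.inl rfl) (regInv_source_zero_mem hc))
      refine HomSpan.congr hL h2 fun b _ s _ => ?_
      unfold linErr
      rw [regInv_const_mul, regInv_const_mul, show modC cc (2 * 0 + 1) = fun b => 1 / 2 * cc b by
        funext b; simp [modC]]
    · rw [hX]
      have hcor := ih (2 * r + 1) (by omega) (by omega)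
      have h1 := linErr_mem hL hc (k := 2 * r + 1) (by omega)
      rw [show (2 * r + 1) / 2 = r by omega] at h1 hcor
      have h2 := flowY_mem hL (modStable_profSpan hc r) (by omega) hcor 1
      have h3 := nl_mem (b₀ := b₀) hL κ ς L (E := errE (cor (L := L) cc κ ς)) (d := 2 * r + 2)
        (n := r + 1) rfl (fun m hm hmr => errE_mem hL hc hm (by omega) (by
          have := ih (2 * m) (by omega) (by omega)
          rwa [show 2 * m / 2 = m by omega, Nat.cast_mul] at this)) le_rfl
      have h4 : CrudeSpan b₀ (((r + 1 : ℕ) : ℤ) - 3) (r + 1) ≤ ProfSpan hc r := by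
        rw [show ((r + 1 : ℕ) : ℤ) - 3 = (r : ℤ) - 1 - 1 by push_cast; ring]
        exact crudeSpan_le_profSpan hc (by omega)
      have h3' := HomSpan.mono le_rfl h4 h3
      rw [show ((2 * r + 1 : ℕ) : ℤ) + 1 = ((2 * r + 2 : ℕ) : ℤ) by push_cast; ring] at h1 h2
      rw [show 2 * ((r + 1 : ℕ) : ℤ) = ((2 * r + 2 : ℕ) : ℤ) by push_cast; ring] at h3'
      exact HomSpan.map hL fibLin_regInv (modStable_profSpan hc r).smooth
        (fun g hg => regInv_mem_profSpan hc hr hg) (add_mem (add_mem h1 h2) h3')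
  · obtain ⟨r, rfl⟩ : ∃ r, i = 2 * r + 1 := ⟨i / 2, by omega⟩
    have hX : errX (L := L) cc κ ς (cor cc κ ς) (2 * r + 1) = linErr cc (2 * r) +
        flowY cc 0 (cor cc κ ς (2 * r)) := by
      rw [errX, if_neg (by omega), add_zero]
      congr 2
      omega
    rw [cor_odd hi ho, hX, show (2 * r + 1) / 2 = r by omega]
    have hcor := ih (2 * r) (by omega) (by omega)
    have h1 := linErr_mem hL hc (k := 2 * r) (by omega)
    rw [show 2 * r / 2 = r by omega] at h1 hcor
    exact add_mem h1 (flowY_mem hL (modStable_profSpan hc r) (by omega) hcor 0)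

end

/-! ### The operators of the problem in the variable `σ = 1 + y²` -/

theorem hasDerivAt_mul_comp {F : ℝ → ℝ} (hF : SmoothPos F) (y : ℝ) :
    HasDerivAt (fun y => y * F (1 + y ^ 2)) (F (1 + y ^ 2) + lamD F (1 + y ^ 2)) y := by
  refine ((hasDerivAt_id y).mul (hF.comp_one_add_sq y)).congr_deriv ?_
  have := (one_add_sq_pos y).ne'
  simp [id, lamD, eul]
  field_simp
  ring

theorem Lam0_mul_comp {F : ℝ → ℝ} (hF : SmoothPos F) (y : ℝ) :
    Lam0 (fun y => y * F (1 + y ^ 2)) y = y * (2 * F (1 + y ^ 2) + lamD F (1 + y ^ 2)) := by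
  rw [Lam0, (hasDerivAt_mul_comp hF y).deriv]
  ring

/-- The Hamiltonian, written with the potential `cos 2Q = 2 Z² - 1`. -/
theorem stepO_stepE_eq {F : ℝ → ℝ} (hF : SmoothPos F) {s : ℝ} (hs : 0 < s) :
    stepO (stepE F) s = 2 * (s - 1) * (2 * F s / s ^ 2 - 2 * deriv F s / s - 2 * deriv (deriv F) s) -
      (2 + 2 / s) * (2 * F s / s + 2 * deriv F s) := by
  have hs0 := hs.ne'
  have h1 : HasDerivAt (stepE F) (2 * F s / s ^ 2 - 2 * deriv F s / s - 2 * deriv (deriv F) s) s := by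
    have d1 := hF.hasDerivAt hs
    have d2 := hF.deriv.hasDerivAt hs
    refine ((((hasDerivAt_const s (2 : ℝ)).div (hasDerivAt_id s) hs0).neg).mul
      (d1.add ((hasDerivAt_id s).mul d2))).congr_deriv ?_
    simp [id]
    field_simp
    ring
  rw [stepO, eul, h1.deriv, stepE, eul]
  field_simp
  ring

theorem sin_Q (y : ℝ) : sin (Q y) = LamQ y := by
  have h := sin_arctan y
  have h' := cos_arctan y
  have hs := one_add_sq_pos y
  have h1 : √(1 + y ^ 2) ≠ 0 := (sqrt_pos.2 hs).ne'
  have h2 := sq_sqrt hs.le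
  rw [Q, sin_two_mul, h, h', LamQ]
  field_simp
  rw [h2]

theorem cos_Q (y : ℝ) : cos (Q y) = 2 / (1 + y ^ 2) - 1 := by
  rw [Q, cos_two_mul, cos_sq_arctan]
  ring

theorem hasDerivAt_Q (y : ℝ) : HasDerivAt Q (2 / (1 + y ^ 2)) y := by
  refine ((hasDerivAt_arctan y).const_mul 2).congr_deriv ?_
  ring

/-- The nonlinear part of the error of the perturbation `y E(1 + y²)`, as a function of the value
`e` of `E` and of `s = 1 + y²`. -/
def nlFun (K S : ℝ → ℝ) (e s : ℝ) : ℝ :=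
  evenFac s * e ^ 2 * K ((s - 1) * e ^ 2) + oddFac s * e ^ 3 * S ((s - 1) * e ^ 2)

/-- The second component of the flow at `Q + y E(1 + y²)`: the Hamiltonian and the nonlinear
error. -/
theorem flow_snd {K S : ℝ → ℝ} (hK : ∀ e, cos (2 * e) = 1 + e ^ 2 * K (e ^ 2))
    (hS : ∀ e, sin (2 * e) = e * (2 + e ^ 2 * S (e ^ 2))) {E : ℝ → ℝ} (hE : SmoothPos E)
    {y : ℝ} (hy : 0 < y) :
    deriv (deriv fun x => Q x + x * E (1 + x ^ 2)) y + deriv (fun x => Q x + x * E (1 + x ^ 2)) y / y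
      - nonlin (Q y + y * E (1 + y ^ 2)) / y ^ 2 =
    -(y * (stepO (stepE E) (1 + y ^ 2) + nlFun K S (E (1 + y ^ 2)) (1 + y ^ 2))) := by
  have hs := one_add_sq_pos y
  have hs0 := hs.ne'
  have hy0 := hy.ne'
  have d1 : ∀ x, HasDerivAt (fun x => Q x + x * E (1 + x ^ 2))
      (2 / (1 + x ^ 2) + (E (1 + x ^ 2) + 2 * x ^ 2 * deriv E (1 + x ^ 2))) x := fun x => by
    refine ((hasDerivAt_Q x).add (hasDerivAt_mul_comp hE x)).congr_deriv ?_
    have := (one_add_sq_pos x).ne'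
    rw [lamD, eul]
    field_simp
    ring
  have d2 : HasDerivAt (fun x => 2 / (1 + x ^ 2) + (E (1 + x ^ 2) + 2 * x ^ 2 * deriv E (1 + x ^ 2)))
      (-(4 * y) / (1 + y ^ 2) ^ 2 + (6 * y * deriv E (1 + y ^ 2) +
        4 * y ^ 3 * deriv (deriv E) (1 + y ^ 2))) y := by
    have e3 : HasDerivAt (fun x : ℝ => 2 * x ^ 2) (4 * y) y :=
      ((hasDerivAt_pow 2 y).const_mul 2).congr_deriv (by norm_num; ring)
    have e4 := (hasDerivAt_const y (2 : ℝ)).div (hasDerivAt_one_add_sq y) hs0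
    refine (e4.add ((hE.comp_one_add_sq y).add (e3.mul (hE.deriv.comp_one_add_sq y)))).congr_deriv ?_
    simp
    ring
  have hd : deriv (fun x => Q x + x * E (1 + x ^ 2)) = fun x =>
      2 / (1 + x ^ 2) + (E (1 + x ^ 2) + 2 * x ^ 2 * deriv E (1 + x ^ 2)) :=
    funext fun x => (d1 x).deriv
  rw [hd, d2.deriv, nonlin, mul_add, sin_add, hK, hS (y * _), sin_two_mul,
    cos_two_mul, sin_Q, cos_Q, stepO_stepE_eq hE hs, nlFun, evenFac, oddFac, LamQ,
    show (1 + y ^ 2 - 1) * E (1 + y ^ 2) ^ 2 = (y * E (1 + y ^ 2)) ^ 2 by ring]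
  beta_reduce
  generalize K _ = k
  generalize S _ = σ
  generalize deriv (deriv E) _ = E2
  generalize deriv E _ = E1
  generalize E _ = E0
  field_simp
  ring

theorem Gam_eq {y : ℝ} (hy : 0 < y) :
    Gam y = LamQ y * (-1 / (8 * y ^ 2) + 1 / 2 * log y + y ^ 2 / 8) := by
  have hpos : ∀ x ∈ uIcc 1 y, 0 < x := fun x hx => lt_of_lt_of_le (lt_min one_pos hy) hx.1
  have hd : ∀ x ∈ uIcc 1 y, HasDerivAt
      (fun x => -1 / (8 * x ^ 2) + 1 / 2 * log x + x ^ 2 / 8) (1 / (x * LamQ x ^ 2)) x := by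
    intro x hx
    have hx := hpos x hx
    have hx0 := hx.ne'
    have e1 : HasDerivAt (fun x : ℝ => 8 * x ^ 2) (16 * x) x :=
      ((hasDerivAt_pow 2 x).const_mul 8).congr_deriv (by norm_num; ring)
    have e2 := (hasDerivAt_const x (-1 : ℝ)).div e1 (by positivity)
    have e3 := (hasDerivAt_log hx0).const_mul (1 / 2)
    have e4 := (hasDerivAt_pow 2 x).div_const 8
    refine ((e2.add e3).add e4).congr_deriv ?_
    rw [LamQ]
    have := (one_add_sq_pos x).ne'
    field_simp
    ring
  have hc : ContinuousOn (fun x => 1 / (x * LamQ x ^ 2)) (uIcc 1 y) := by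
    refine continuousOn_const.div ?_ fun x hx => ?_
    · refine continuousOn_id.mul (ContinuousOn.pow ?_ 2)
      exact ContinuousOn.div (by fun_prop) (by fun_prop) fun x _ => (one_add_sq_pos x).ne'
    · have hx := hpos x hx
      rw [LamQ]
      positivity
  rw [Gam, integral_eq_sub_of_hasDerivAt hd hc.intervalIntegrable]
  norm_num

/-- `H⁻¹` acts on functions `y F(1 + y²)` through `regInv`. -/
theorem Hinv_eq {F f : ℝ → ℝ} (hF : SmoothPos F) (hf : ∀ x, 0 < x → f x = x * F (1 + x ^ 2))
    {y : ℝ} (hy : 0 < y) : Hinv f y = y * regInv F (1 + y ^ 2) := by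
  set w := regInv F with hw
  have hws : SmoothPos w := smoothPos_regInv hF
  have hcont : ∀ {G : ℝ → ℝ}, SmoothPos G → Continuous fun x : ℝ => G (1 + x ^ 2) := fun hG =>
    continuous_iff_continuousAt.2 fun x => (hG.comp_one_add_sq x).continuousAt
  have hne : ∀ x : ℝ, 1 + x ^ 2 ≠ 0 := fun x => (one_add_sq_pos x).ne'
  have hw1 : w 1 = 0 := by simp [hw, regInv]
  set N : ℝ → ℝ := fun s => w s / s ^ 2 + deriv w s / s with hN
  have hNs : SmoothPos N := by
    refine ContDiffOn.add (ContDiffOn.div hws (contDiffOn_id.pow 2) fun s hs => ?_)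
      hws.deriv.div_id
    exact pow_ne_zero 2 (mem_Ioi.1 hs).ne'
  have hode : ∀ s, 0 < s → F s = -s * (8 * N s + 4 * (s - 1) * deriv N s) := fun s hs => by
    have hs0 := hs.ne'
    have h1 : HasDerivAt N (deriv (deriv w) s / s - 2 * w s / s ^ 3) s := by
      refine (((hws.hasDerivAt hs).div (hasDerivAt_pow 2 s) (pow_ne_zero 2 hs0)).add
        ((hws.deriv.hasDerivAt hs).div (hasDerivAt_id s) hs0)).congr_deriv ?_
      simp only [id]
      field_simp
      push_cast
      ring
    rw [← stepO_stepE_regInv hF hs, stepO_stepE_eq hws hs, h1.deriv, hN]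
    field_simp
    ring
  -- The antiderivatives are the Wronskians of `y w(1 + y²)` with the two elements of the kernel.
  set G2 : ℝ → ℝ := fun x => -(4 * x ^ 4) * N (1 + x ^ 2) with hG2
  set h : ℝ → ℝ := fun x => -1 / 4 + x * (x * log x) + x ^ 4 / 4 with hh
  set G1 : ℝ → ℝ := fun x => h x * (-(2 * x ^ 2) * N (1 + x ^ 2)) + w (1 + x ^ 2) * (1 + x ^ 2) / 2
    with hG1
  have ch : Continuous h := by
    have := continuous_mul_log
    simp only [hh]
    fun_prop
  have cG2 : Continuous G2 := Continuous.mul (by fun_prop) (hcont hNs)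
  have cG1 : Continuous G1 :=
    (ch.mul (Continuous.mul (by fun_prop) (hcont hNs))).add
      (((hcont hws).mul (by fun_prop)).div_const 2)
  have dG2 : ∀ x, HasDerivAt G2 (2 * x ^ 3 * F (1 + x ^ 2) / (1 + x ^ 2)) x := fun x => by
    have e3 : HasDerivAt (fun x : ℝ => -(4 * x ^ 4)) (-(16 * x ^ 3)) x :=
      ((hasDerivAt_pow 4 x).const_mul 4).neg.congr_deriv (by norm_num; ring)
    refine (e3.mul (hNs.comp_one_add_sq x)).congr_deriv ?_
    rw [hode _ (one_add_sq_pos x)]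
    have := hne x
    field_simp
    ring
  have dG1 : ∀ x, 0 < x → HasDerivAt G1 (x * h x * F (1 + x ^ 2) / (1 + x ^ 2)) x := fun x hx => by
    have e3 : HasDerivAt (fun x : ℝ => -(2 * x ^ 2)) (-(4 * x)) x :=
      ((hasDerivAt_pow 2 x).const_mul 2).neg.congr_deriv (by norm_num; ring)
    have e4 : HasDerivAt h (2 * x * log x + x + x ^ 3) x := by
      have := (((hasDerivAt_id x).mul ((hasDerivAt_id x).mul (hasDerivAt_log hx.ne'))).const_add
        (-1 / 4)).add ((hasDerivAt_pow 4 x).div_const 4)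
      refine this.congr_deriv ?_
      simp [id]
      field_simp
      ring
    refine ((e4.mul (e3.mul (hNs.comp_one_add_sq x))).add (((hws.comp_one_add_sq x).mul (hasDerivAt_one_add_sq x)).div_const
      2)).congr_deriv ?_
    rw [hode _ (one_add_sq_pos x)]
    have hw' : w (1 + x ^ 2) =
        (1 + x ^ 2) ^ 2 * N (1 + x ^ 2) - (1 + x ^ 2) * deriv w (1 + x ^ 2) := by
      simp only [hN]
      have := hne x
      field_simp
      ring
    simp [hh]
    rw [hw']
    have := hne x
    field_simp
    ring
  have i2 : ∫ x in (0 : ℝ)..y, f x * LamQ x * x = G2 y := by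
    have h1 : EqOn (fun x => f x * LamQ x * x) (fun x => 2 * x ^ 3 * F (1 + x ^ 2) / (1 + x ^ 2))
        (uIoc 0 y) := fun x hx => by
      rw [uIoc_of_le hy.le] at hx
      simp only [hf x hx.1, LamQ]
      ring
    rw [intervalIntegral.integral_congr_ae (ae_of_all _ fun x hx => h1 hx),
      integral_eq_sub_of_hasDerivAt (fun x _ => dG2 x)]
    · simp [hG2]
    · refine Continuous.intervalIntegrable ?_ _ _
      exact Continuous.div (Continuous.mul (by fun_prop) (hcont hF)) (by fun_prop) hne
  have i1 : ∫ x in (0 : ℝ)..y, f x * Gam x * x = G1 y := by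
    have h1 : EqOn (fun x => f x * Gam x * x) (fun x => x * h x * F (1 + x ^ 2) / (1 + x ^ 2))
        (uIoc 0 y) := fun x hx => by
      rw [uIoc_of_le hy.le] at hx
      have hx0 := hx.1.ne'
      have := hne x
      simp only [hf x hx.1, Gam_eq hx.1, LamQ, hh]
      field_simp
      ring
    rw [intervalIntegral.integral_congr_ae (ae_of_all _ fun x hx => h1 hx),
      intervalIntegral.integral_eq_sub_of_hasDerivAt_of_le hy.le cG1.continuousOn
        (fun x hx => dG1 x hx.1)]
    · simp [hG1, hw1]
    · refine Continuous.intervalIntegrable ?_ _ _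
      exact Continuous.div ((continuous_id.mul ch).mul (hcont hF)) (by fun_prop) hne
  rw [Hinv, i1, i2, Gam_eq hy, LamQ]
  simp only [hG1, hG2, hh]
  have := hne y
  have := hy.ne'
  field_simp
  ring

theorem T_eq (r : ℕ) : (∀ y, 0 < y → T (2 * r) y = (y * tau r (1 + y ^ 2), 0)) ∧
    ∀ y, 0 < y → T (2 * r + 1) y = (0, y * tau r (1 + y ^ 2)) := by
  have h0 : ∀ y, Hinv (fun _ => 0) y = 0 := fun y => by simp [Hinv]
  have hodd : ∀ r, (∀ y, 0 < y → T (2 * r) y = (y * tau r (1 + y ^ 2), 0)) →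
      ∀ y, 0 < y → T (2 * r + 1) y = (0, y * tau r (1 + y ^ 2)) := fun r h y hy => by
    have h1 : Hinv (fun x => (T (2 * r) x).2) y = 0 := by
      rw [Hinv_eq (F := fun _ => 0) contDiffOn_const (fun x hx => by rw [h x hx]; simp) hy]
      simp [regInv, avg]
    show -HHinv (T (2 * r)) y = _
    rw [HHinv, h1, h y hy]
    simp
  induction r with
  | zero =>
    have h : ∀ y, 0 < y → T (2 * 0) y = (y * tau 0 (1 + y ^ 2), 0) := fun y _ => by
      show (LamQ y, (0 : ℝ)) = _
      rw [tau_zero, LamQ]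
      congr 1
      ring
    exact ⟨h, hodd 0 h⟩
  | succ r ih =>
    have h : ∀ y, 0 < y → T (2 * (r + 1)) y = (y * tau (r + 1) (1 + y ^ 2), 0) := fun y hy => by
      show -HHinv (T (2 * r + 1)) y = _
      rw [HHinv, Hinv_eq (smoothPos_tau r) (fun x hx => by rw [ih.2 x hx]) hy, ih.2 y hy, tau_succ]
      simp
    exact ⟨h, hodd (r + 1) h⟩

/-! ### Taylor expansion of the nonlinearity -/

theorem exists_contDiff_hasSum {c : ℕ → ℝ} (hc : ∀ n, c n ≠ 0)
    (h : Tendsto (fun n => ‖c n.succ‖ / ‖c n‖) atTop (𝓝 0)) :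
    ∃ K : ℝ → ℝ, ContDiff ℝ ∞ K ∧ ∀ z, HasSum (fun n => c n * z ^ n) (K z) := by
  have hr := FormalMultilinearSeries.ofScalars_radius_eq_top_of_tendsto (𝕜 := ℝ) ℝ c
    (Eventually.of_forall hc) h
  have hp := (FormalMultilinearSeries.ofScalars ℝ c).hasFPowerSeriesOnBall (by rw [hr]; simp)
  rw [hr] at hp
  refine ⟨(FormalMultilinearSeries.ofScalars ℝ c).sum, ?_, fun z => ?_⟩
  · have h1 : AnalyticOnNhd ℝ (FormalMultilinearSeries.ofScalars ℝ c).sum univ := by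
      have := hp.analyticOnNhd
      rwa [Metric.eball_top] at this
    exact contDiffOn_univ.1 (h1.contDiffOn uniqueDiffOn_univ)
  · have h1 := hp.hasSum (y := z) (by simp)
    rw [zero_add] at h1
    refine h1.congr_fun fun n => ?_
    rw [FormalMultilinearSeries.ofScalars_apply_eq, smul_eq_mul]

theorem exists_even_nonlin : ∃ K S : ℝ → ℝ, ContDiff ℝ ∞ K ∧ ContDiff ℝ ∞ S ∧
    (∀ e, cos (2 * e) = 1 + e ^ 2 * K (e ^ 2)) ∧
    ∀ e, sin (2 * e) = e * (2 + e ^ 2 * S (e ^ 2)) := by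
  have key : ∀ j : ℕ, ∃ K : ℝ → ℝ, ContDiff ℝ ∞ K ∧ ∀ z, HasSum
      (fun n => (-1) ^ (n + 1) * 2 ^ (2 * n + j) / ((2 * n + j).factorial : ℝ) * z ^ n) (K z) := fun j => by
    refine exists_contDiff_hasSum (fun n => by positivity) ?_
    have h2 : Tendsto (fun n : ℕ => 4 * (1 / ((n : ℝ) + 1))) atTop (𝓝 (4 * 0)) :=
      tendsto_one_div_add_atTop_nhds_zero_nat.const_mul 4
    rw [mul_zero] at h2
    refine squeeze_zero (fun n => by positivity) (fun n => ?_) h2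
    rw [show 2 * n.succ + j = 2 * n + j + 1 + 1 by omega, Nat.factorial_succ, Nat.factorial_succ]
    simp only [norm_mul, norm_div, norm_pow, norm_neg, norm_one, one_pow, one_mul, norm_ofNat,
      norm_natCast]
    push_cast
    have hf : (0 : ℝ) < (2 * n + j).factorial := by positivity
    have h1 : (2 : ℝ) ^ (2 * n + j + 1 + 1) / ((2 * (n : ℝ) + j + 1 + 1) *
        ((2 * (n : ℝ) + j + 1) * (2 * n + j).factorial)) / (2 ^ (2 * n + j) / (2 * n + j).factorial) =
        4 * (1 / ((2 * (n : ℝ) + j + 1 + 1) * (2 * n + j + 1))) := by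
      field_simp
      ring
    rw [h1]
    gcongr
    nlinarith [(Nat.cast_nonneg n : (0 : ℝ) ≤ n), (Nat.cast_nonneg j : (0 : ℝ) ≤ j)]
  obtain ⟨K, hK, hKs⟩ := key 2
  obtain ⟨S, hS, hSs⟩ := key 3
  refine ⟨K, S, hK, hS, fun e => ?_, fun e => ?_⟩
  · have h1 := (hasSum_nat_add_iff' 1).2 (hasSum_cos (2 * e))
    have h2 := (hKs (e ^ 2)).mul_left (e ^ 2)
    have h3 := h1.unique (h2.congr_fun fun n => by
      rw [show 2 * (n + 1) = 2 * n + 2 by ring, mul_pow]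
      ring)
    simp at h3
    linarith
  · have h1 := (hasSum_nat_add_iff' 1).2 (hasSum_sin (2 * e))
    have h2 := (hSs (e ^ 2)).mul_left (e ^ 3)
    have h3 := h1.unique (h2.congr_fun fun n => by
      rw [show 2 * (n + 1) + 1 = 2 * n + 3 by ring, mul_pow]
      ring)
    simp at h3
    linarith

/-! ### The cut-off corrections -/

section

variable {L : ℕ} {b₀ : ℝ} {cc χ : ℝ → ℝ} {κ ς : ℕ → ℝ}

/-- The functions in one of the spaces `CutSpan hc q c` that vanish for `b₁² σ > 2`. -/
def CutAll (hc : ModCoef b₀ cc) (q : ℤ) : Submodule ℝ (ℝ → ℝ → ℝ) where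
  carrier := {g | (∃ c, 1 ≤ c ∧ g ∈ CutSpan hc q c) ∧
    ∀ b ∈ Ioo 0 b₀, ∀ s, 2 < b ^ 2 * s → g b s = 0}
  add_mem' := by
    rintro g g' ⟨⟨c, h1, h⟩, h0⟩ ⟨⟨c', h1', h'⟩, h0'⟩
    exact ⟨⟨max c c', le_max_of_le_left h1, add_mem (CutSpan.mono (le_max_left _ _) h)
      (CutSpan.mono (le_max_right _ _) h')⟩, fun b hb s hs => by simp [h0 b hb s hs, h0' b hb s hs]⟩
  zero_mem' := ⟨⟨1, le_rfl, zero_mem _⟩, fun _ _ _ _ => rfl⟩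
  smul_mem' a _ := fun ⟨⟨c, h1, h⟩, h0⟩ => ⟨⟨c, h1, smul_mem _ a h⟩,
    fun b hb s hs => by simp [h0 b hb s hs]⟩

theorem isOpen_beyond (b : ℝ) : IsOpen {s : ℝ | 2 < b ^ 2 * s} :=
  isOpen_lt continuous_const (by fun_prop)

theorem eul_const_zero (x : ℝ) : eul (fun _ => 0) x = 0 := by simp [eul]

theorem CutAll.eulS_mem {hc : ModCoef b₀ cc} {q : ℤ} {g : ℝ → ℝ → ℝ} (hg : g ∈ CutAll hc q) :
    eulS g ∈ CutAll hc q := by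
  obtain ⟨⟨c, h1, h⟩, h0⟩ := hg
  refine ⟨⟨c, h1, CutSpan.eulS_mem h⟩, fun b hb s hs => ?_⟩
  exact (eul_congr (isOpen_beyond b) (fun s hs => h0 b hb s hs) s hs).trans (eul_const_zero s)

theorem modStable_cutAll (hc : ModCoef b₀ cc) (q : ℤ) : ModStable b₀ cc (CutAll hc q) where
  smooth := fun _ ⟨⟨_, _, h⟩, _⟩ => CutSpan.smooth2 h
  eulB := fun g ⟨⟨c, h1, h⟩, h0⟩ => ⟨⟨c, h1, CutSpan.eulB_mem h⟩, fun b hb s hs => by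
    have hΩ : IsOpen {b : ℝ | b ∈ Ioo 0 b₀ ∧ 2 < b ^ 2 * s} :=
      isOpen_Ioo.inter (isOpen_lt (f := fun _ => (2 : ℝ)) (g := fun b : ℝ => b ^ 2 * s)
        continuous_const (by fun_prop))
    exact (eul_congr hΩ (g := fun _ => 0) (fun b hb => h0 b hb.1 s hb.2) b ⟨hb, hs⟩).trans
      (eul_const_zero b)⟩
  coef := fun _ ⟨⟨c, h1, h⟩, h0⟩ => ⟨⟨c, h1, CutSpan.coef_mul_mem h⟩,
    fun b hb s hs => by simp [h0 b hb s hs]⟩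
  lamD := fun _ ⟨⟨c, h1, h⟩, h0⟩ => ⟨⟨c, h1, CutSpan.lamD_mem h1 h⟩, fun b hb s hs => by
    simp only [WaveMap.lamD]
    rw [eul_congr (isOpen_beyond b) (fun s hs => h0 b hb s hs) s hs, eul_const_zero, mul_zero]⟩

/-- The cut-off corrections `U_i`. -/
def cutCor (χ cc : ℝ → ℝ) (κ ς : ℕ → ℝ) (i : ℕ) (b : Fin L → ℝ) (s : ℝ) : ℝ :=
  χ (coord b 1 ^ 2 * s) * cor cc κ ς i b s

theorem cutCor_mem (hL : 0 < L) (hc : ModCoef b₀ cc) (hχ : Cutoff χ) (κ ς : ℕ → ℝ) {i : ℕ}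
    (hi : 2 ≤ i) :
    cutCor (L := L) χ cc κ ς i ∈ HomSpan L b₀ i i (CutAll hc (((i / 2 : ℕ) : ℤ) - 1)) :=
  HomSpan.map hL (fibLin_mul fun b s => χ (b ^ 2 * s)) (modStable_profSpan hc _).smooth
    (fun _ ⟨c, h1, h, _⟩ => ⟨⟨c, h1, cutoff_mem hχ h⟩, fun b _ s hs => by
      simp [hχ.zero _ hs.le]⟩) (cor_mem hL hc κ ς i hi)

/-- The corrections `S_i`. -/
def corS (χ cc : ℝ → ℝ) (κ ς : ℕ → ℝ) (i : ℕ) (b : Fin L → ℝ) (y : ℝ) : ℝ × ℝ :=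
  place (i % 2) (y * cutCor χ cc κ ς i b (1 + y ^ 2))

theorem place_sum {α : Type*} (t : Finset α) (ι : ℕ) (f : α → ℝ) :
    place ι (∑ a ∈ t, f a) = ∑ a ∈ t, place ι (f a) := by
  unfold place
  split_ifs <;> simp [Prod.ext_iff, Prod.fst_sum, Prod.snd_sum]

theorem place_smul (ι : ℕ) (a x : ℝ) : place ι (a * x) = a • place ι x := by
  unfold place
  split_ifs <;> simp

theorem homogeneous_corS (hL : 0 < L) (hc : ModCoef b₀ cc) (hχ : Cutoff χ) (i : ℕ) :
    Homogeneous b₀ i (i : ℤ) (i % 2) i (corS (L := L) χ cc κ ς i) := by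
  rcases Nat.lt_or_ge i 2 with h2 | h2
  · refine ⟨0, fun _ => 0, fun _ _ _ => 0, fun m => m.elim0, fun m => m.elim0, fun m => m.elim0,
      fun b _ y _ => ?_⟩
    simp [corS, cutCor, cor_of_lt h2, place]
  · obtain ⟨n, f, g, e⟩ := Submodule.mem_span_set'.1 (cor_mem hL hc κ ς i h2)
    choose J hJ G hG hgG using fun m => (g m).2
    have hi2 : 2 * (i / 2) + i % 2 = i := by omega
    refine ⟨n, J, fun m b y => place (i % 2) (y * cutoff χ (f m • G m) b (1 + y ^ 2)), fun m =>
      ⟨fun b y => y * cutoff χ (f m • G m) b (1 + y ^ 2), ?_, fun _ _ _ _ => rfl⟩,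
      fun m => (hJ m).nonneg, fun m => (hJ m).wt, fun b hb y _ => ?_⟩
    · have := scalarAdmissible_cutoff hc hχ (r := i / 2) (ι := i % 2) (by omega)
        (by omega) (smul_mem _ (f m) (hG m))
      rwa [hi2] at this
    · simp only [← place_smul, ← place_sum, corS]
      congr 1
      rw [cutCor, ← e, Finset.sum_apply, Finset.sum_apply, mul_sum, mul_sum]
      refine sum_congr rfl fun m _ => ?_
      rw [Pi.smul_apply, Pi.smul_apply, hgG m b hb _ (one_add_sq_pos y), cutoff, Pi.smul_apply,
        Pi.smul_apply, smul_eq_mul, smul_eq_mul]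
      ring

theorem partialB_place {U : (Fin L → ℝ) → ℝ → ℝ} (ι : ℕ) (j : Fin L) {b : Fin L → ℝ} {y : ℝ}
    (hU : DifferentiableAt ℝ (fun b => U b (1 + y ^ 2)) b) :
    partialB j (fun b y => place ι (y * U b (1 + y ^ 2))) b y =
      place ι (y * partialS j U b (1 + y ^ 2)) := by
  have h1 : DifferentiableAt ℝ (fun t => U (update b j t) (1 + y ^ 2)) (b j) := by
    have h2 : DifferentiableAt ℝ (fun b => U b (1 + y ^ 2)) (update b j (b j)) := by
      rwa [Function.update_eq_self]
    exact h2.comp (b j) (hasDerivAt_update b j (b j)).differentiableAt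
  have h3 := h1.hasDerivAt.const_mul y
  unfold partialB place
  split_ifs
  · exact (h3.prodMk (hasDerivAt_const _ (0 : ℝ))).deriv
  · exact ((hasDerivAt_const _ (0 : ℝ)).prodMk h3).deriv

theorem cutCor_differentiableAt (hL : 0 < L) (hc : ModCoef b₀ cc) (hχ : Cutoff χ) {i : ℕ}
    (hi : 2 ≤ i) {b : Fin L → ℝ} (hb : b ∈ dom L b₀) {s : ℝ} (hs : 0 < s) :
    DifferentiableAt ℝ (fun b => cutCor χ cc κ ς i b s) b :=
  HomSpan.differentiableAt hL (modStable_cutAll hc _).smooth (cutCor_mem hL hc hχ κ ς hi) hb hs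

theorem cutCor_smoothPos (hL : 0 < L) (hc : ModCoef b₀ cc) (hχ : Cutoff χ) {i : ℕ}
    (hi : 2 ≤ i) {b : Fin L → ℝ} (hb : b ∈ dom L b₀) : SmoothPos (cutCor χ cc κ ς i b) :=
  HomSpan.smoothPos (modStable_cutAll hc _).smooth (cutCor_mem hL hc hχ κ ς hi) hb

theorem partialB_corS (hL : 0 < L) (hc : ModCoef b₀ cc) (hχ : Cutoff χ) {i : ℕ}
    (hi : 2 ≤ i) (j : Fin L) {b : Fin L → ℝ} (hb : b ∈ dom L b₀) (y : ℝ) :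
    partialB j (corS χ cc κ ς i) b y =
      place (i % 2) (y * partialS j (cutCor χ cc κ ς i) b (1 + y ^ 2)) :=
  partialB_place _ j (cutCor_differentiableAt hL hc hχ hi hb (one_add_sq_pos y))

theorem partialB_corS_eq_zero (hL : 0 < L) (hc : ModCoef b₀ cc) (hχ : Cutoff χ) {i : ℕ}
    {j : Fin L} (hi : 2 ≤ i) (hj : i ≤ (j : ℕ) + 1) {b : Fin L → ℝ} (hb : b ∈ dom L b₀) (y : ℝ) :
    partialB j (corS χ cc κ ς i) b y = 0 := by
  rw [partialB_corS hL hc hχ hi j hb, HomSpan.partialS_eq_zero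
    (by omega) hj (cutCor_mem hL hc hχ κ ς hi) b hb _ (one_add_sq_pos y)]
  simp [place]

end

/-! ### The equation of the approximate profile -/

namespace FibLin

variable {Φ : ℝ → (ℝ → ℝ) → ℝ → ℝ}

theorem mul_add (hΦ : FibLin Φ) (b a : ℝ) {F G : ℝ → ℝ} (hF : SmoothPos F) (hG : SmoothPos G)
    {s : ℝ} (hs : 0 < s) : Φ b (fun x => a * F x + G x) s = a * Φ b F s + Φ b G s := by
  rw [hΦ.add b (fun x => a * F x) G (contDiffOn_const.mul hF) hG s hs, hΦ.smul b a F hF s hs]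

theorem sum {α : Type*} (hΦ : FibLin Φ) (b : ℝ) (t : Finset α) {F : α → ℝ → ℝ}
    (hF : ∀ a ∈ t, SmoothPos (F a)) {s : ℝ} (hs : 0 < s) :
    Φ b (fun x => ∑ a ∈ t, F a x) s = ∑ a ∈ t, Φ b (F a) s := by
  classical
  induction t using Finset.induction_on with
  | empty =>
    have := hΦ.smul b 0 (fun _ => 0) contDiffOn_const s hs
    rw [zero_mul, zero_mul] at this
    simpa using this
  | insert a t ha ih =>
    simp only [sum_insert ha]
    have h1 : SmoothPos fun x => ∑ a ∈ t, F a x :=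
      ContDiffOn.sum fun a' ha' => hF a' (Finset.mem_insert_of_mem ha')
    rw [hΦ.add b (F a) _ (hF a (Finset.mem_insert_self a t)) h1 s hs,
      ih fun a' ha' => hF a' (Finset.mem_insert_of_mem ha')]

end FibLin

theorem fibLin_stepO_stepE : FibLin fun _ F => stepO (stepE F) where
  congr _ _ _ h _ hs := stepO_congr (fun _ hs => stepE_congr h hs) hs
  add b F G hF hG s hs := by
    rw [← fibLin_stepO.add b _ _ (smoothPos_stepE hF) (smoothPos_stepE hG) s hs]
    exact stepO_congr (fun s hs => fibLin_stepE.add b F G hF hG s hs) hs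
  smul b a F hF s hs := by
    rw [← fibLin_stepO.smul b a _ (smoothPos_stepE hF) s hs]
    exact stepO_congr (fun s hs => fibLin_stepE.smul b a F hF s hs) hs

section

variable {L : ℕ} {b₀ : ℝ} {cc : ℝ → ℝ} {K S : ℝ → ℝ} {R : ℕ}
  {U : ℕ → (Fin L → ℝ) → ℝ → ℝ}

/-- The first component of the perturbation of `Q`, divided by `y`. -/
def pertE (U : ℕ → (Fin L → ℝ) → ℝ → ℝ) (R : ℕ) (b : Fin L → ℝ) (s : ℝ) : ℝ :=
  ∑ r ∈ range R, (coord b (2 * r + 2) * tau (r + 1) s + U (2 * r + 2) b s)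

/-- The second component of the perturbation of `Q`, divided by `y`. -/
def pertW (U : ℕ → (Fin L → ℝ) → ℝ → ℝ) (R : ℕ) (b : Fin L → ℝ) (s : ℝ) : ℝ :=
  ∑ r ∈ range R, (coord b (2 * r + 1) * tau r s + U (2 * r + 3) b s)

/-- The first component of the error, divided by `y`. -/
def psiOne (cc : ℝ → ℝ) (U : ℕ → (Fin L → ℝ) → ℝ → ℝ) (R : ℕ) (b : Fin L → ℝ) (s : ℝ) : ℝ :=
  ∑ r ∈ range R,
    (linErr cc (2 * r + 2) b s - U (2 * r + 3) b s + flowY cc 0 (U (2 * r + 2)) b s)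

/-- The second component of the error, divided by `y`. -/
def psiTwo (cc K S : ℝ → ℝ) (U : ℕ → (Fin L → ℝ) → ℝ → ℝ) (R : ℕ) (b : Fin L → ℝ) (s : ℝ) : ℝ :=
  ∑ r ∈ range R,
    (linErr cc (2 * r + 1) b s + stepO (stepE (U (2 * r + 2) b)) s + flowY cc 1 (U (2 * r + 3)) b s) +
  nlFun K S (pertE U R b s) s

theorem sum_Ico_parity {M : Type*} [AddCommMonoid M] (f : ℕ → M) (a R : ℕ) :
    ∑ i ∈ Finset.Ico a (a + 2 * R), f i =
      ∑ r ∈ range R, (f (2 * r + a) + f (2 * r + a + 1)) := by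
  induction R with
  | zero => simp
  | succ R ih =>
    rw [show a + 2 * (R + 1) = a + 2 * R + 1 + 1 by ring, Finset.sum_Ico_succ_top (by omega),
      Finset.sum_Ico_succ_top (by omega), ih, Finset.sum_range_succ, add_assoc]
    rw [show a + 2 * R = 2 * R + a by ring]

/-- The generalized kernel and corrections are sorted by parity into the two components. -/
theorem sum_T_add_place (hR : 2 * R = L + 1) {a V : ℕ → ℝ} (ha : a (L + 1) = 0) {y : ℝ}
    (hy : 0 < y) :
    ∑ i ∈ Finset.Icc 1 L, a i • T i y + ∑ i ∈ Finset.Icc 2 (L + 2), place (i % 2) (y * V i) =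
      (y * ∑ r ∈ range R, (a (2 * r + 2) * tau (r + 1) (1 + y ^ 2) + V (2 * r + 2)),
        y * ∑ r ∈ range R, (a (2 * r + 1) * tau r (1 + y ^ 2) + V (2 * r + 3))) := by
  have h1 : ∑ i ∈ Finset.Icc 1 L, a i • T i y = ∑ i ∈ Finset.Ico 1 (1 + 2 * R), a i • T i y := by
    rw [show 1 + 2 * R = L + 1 + 1 by omega, Finset.sum_Ico_succ_top (by omega), ha, zero_smul,
      add_zero]
    rfl
  have h2 : Finset.Icc 2 (L + 2) = Finset.Ico 2 (2 + 2 * R) := by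
    ext i
    simp only [Finset.mem_Icc, Finset.mem_Ico]
    omega
  rw [h1, h2, sum_Ico_parity, sum_Ico_parity, ← sum_add_distrib, mul_sum,
    mul_sum, prod_mk_sum]
  refine sum_congr rfl fun r _ => ?_
  rw [(T_eq r).2 y hy, show 2 * r + 1 + 1 = 2 * (r + 1) by ring, (T_eq (r + 1)).1 y hy,
    show 2 * (r + 1) % 2 = 0 by omega, show 2 * (r + 1) + 1 = 2 * r + 3 by ring,
    show (2 * r + 3) % 2 = 1 by omega]
  simp only [place, Prod.smul_mk, smul_eq_mul, if_pos, one_ne_zero, if_false, Prod.mk_add_mk]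
  ext <;> simp <;> ring

theorem coord_sub (b b' : Fin L → ℝ) (k : ℕ) : coord (b - b') k = coord b k - coord b' k := by
  unfold coord
  split_ifs <;> simp

theorem coord_kap (cc : ℝ → ℝ) (b : Fin L → ℝ) {k : ℕ} (hk : 1 ≤ k) :
    coord (fun j => kap cc j b) k =
      coord b (k + 1) - ((k : ℝ) - 1 + modC cc k (coord b 1)) * coord b 1 * coord b k := by
  obtain ⟨k, rfl⟩ : ∃ m, k = m + 1 := ⟨k - 1, by omega⟩
  rcases lt_or_ge k L with h | h
  · rw [coord_of_le h, kap, coord_of_le h]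
    push_cast
    ring
  · rw [coord_of_gt (by omega), coord_of_gt (b := b) (k := k + 1 + 1) (by omega),
      coord_of_gt (b := b) (k := k + 1) (by omega)]
    ring

theorem fderiv_apply_eq_sum {f : (Fin L → ℝ) → ℝ} {b : Fin L → ℝ} (hf : DifferentiableAt ℝ f b)
    (v : Fin L → ℝ) :
    fderiv ℝ f b v = ∑ j, v j * deriv (fun t => f (update b j t)) (b j) := by
  have h : ∀ j, deriv (fun t => f (update b j t)) (b j) = fderiv ℝ f b (Pi.single j 1) :=
    fun j => by
      have h1 : HasFDerivAt f (fderiv ℝ f b) (update b j (b j)) := by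
        rw [Function.update_eq_self]
        exact hf.hasFDerivAt
      exact (h1.comp_hasDerivAt (b j) (hasDerivAt_update b j (b j))).deriv
  simp only [h]
  conv_lhs => rw [← Finset.univ_sum_single v]
  rw [map_sum]
  refine sum_congr rfl fun j _ => ?_
  rw [← smul_eq_mul, ← map_smul, ← Pi.single_smul, smul_eq_mul, mul_one]

theorem modTerm_eq {χ : ℝ → ℝ} (hR : 2 * R = L + 1) {Sv : ℕ → (Fin L → ℝ) → ℝ → ℝ × ℝ}
    {b b' : Fin L → ℝ} {y : ℝ} (hy : 0 < y)
    (hS : ∀ i, 2 ≤ i → ∀ j : Fin L, partialB j (Sv i) b y =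
      place (i % 2) (y * partialS j (U i) b (1 + y ^ 2)))
    (hS0 : ∀ i, 2 ≤ i → ∀ j : Fin L, i ≤ (j : ℕ) + 1 → partialB j (Sv i) b y = 0)
    (hcc : ∀ b, cc b = 4 / cutMass χ b) {c : Fin L → ℝ} (hc : c = b' - fun j => kap cc j b) :
    modTerm χ Sv b b' y =
      (y * ∑ r ∈ range R, (coord c (2 * r + 2) * tau (r + 1) (1 + y ^ 2) +
          ∑ j, c j * partialS j (U (2 * r + 2)) b (1 + y ^ 2)),
        y * ∑ r ∈ range R, (coord c (2 * r + 1) * tau r (1 + y ^ 2) +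
          ∑ j, c j * partialS j (U (2 * r + 3)) b (1 + y ^ 2))) := by
  rw [← sum_T_add_place hR (a := coord c) (V := fun i => ∑ j, c j * partialS j (U i) b (1 + y ^ 2))
    (coord_of_gt (by omega)) hy, modTerm]
  have h1 : ∑ i ∈ Finset.Icc 1 L, coord c i • T i y = ∑ j : Fin L, c j • T (j + 1) y := by
    rw [show Finset.Icc 1 L = Finset.Ico 1 (L + 1) from rfl, Finset.sum_Ico_eq_sum_range,
      Nat.add_sub_cancel, Finset.sum_range]
    refine sum_congr rfl fun j _ => ?_
    rw [add_comm 1, coord_of_le j.2]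
  have h2 : ∑ i ∈ Finset.Icc 2 (L + 2),
      place (i % 2) (y * ∑ j, c j * partialS j (U i) b (1 + y ^ 2)) =
      ∑ j : Fin L, c j • ∑ i ∈ Finset.Icc 2 (L + 2), partialB j (Sv i) b y := by
    simp only [Finset.smul_sum]
    rw [Finset.sum_comm]
    refine sum_congr rfl fun i hi => ?_
    rw [mul_sum, place_sum]
    refine sum_congr rfl fun j _ => ?_
    rw [hS i (Finset.mem_Icc.1 hi).1, ← place_smul]
    congr 1
    ring
  rw [h1, h2, ← sum_add_distrib]
  refine sum_congr rfl fun j _ => ?_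
  rw [← smul_add]
  congr 1
  · rw [hc, Pi.sub_apply, kap, cMod_eq, ← hcc]
    simp only [modC]
    split_ifs <;> ring
  · congr 1
    refine Finset.sum_subset (fun i hi => ?_) fun i hi hi' => ?_
    · simp only [Finset.mem_Icc] at hi ⊢; omega
    · simp only [Finset.mem_Icc] at hi hi'
      exact hS0 i hi.1 j (by omega)

/-- The algebraic identity behind the first component of the equation. -/
theorem psiOne_eq (hR : 2 * R = L + 1) (hU : ∀ i, 2 ≤ i → ∀ b ∈ dom L b₀, SmoothPos (U i b))
    {b : Fin L → ℝ} (hb : b ∈ dom L b₀) {s : ℝ} (hs : 0 < s) :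
    psiOne cc U R b s = ∑ r ∈ range R, (coord (fun j => kap cc j b) (2 * r + 2) * tau (r + 1) s +
        ∑ j, kap cc j b * partialS j (U (2 * r + 2)) b s) - pertW U R b s +
      coord b 1 * (2 / s + pertE U R b s + lamD (pertE U R b) s) := by
  have h1 : lamD (pertE U R b) s = ∑ r ∈ range R,
      (coord b (2 * r + 2) * lamD (tau (r + 1)) s + lamD (U (2 * r + 2) b) s) := by
    have := fibLin_lamD.sum 0 (range R) (F := fun r s =>
      coord b (2 * r + 2) * tau (r + 1) s + U (2 * r + 2) b s) (fun r _ =>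
        (contDiffOn_const.mul (smoothPos_tau _)).add (hU _ (by omega) b hb)) hs
    refine this.trans (sum_congr rfl fun r _ => ?_)
    exact fibLin_lamD.mul_add 0 _ (smoothPos_tau _) (hU _ (by omega) b hb) hs
  have h2 : ∑ r ∈ range R, (coord b (2 * (r + 1) + 1) * tau (r + 1) s -
      coord b (2 * r + 1) * tau r s) = -(coord b 1 * (2 / s)) := by
    rw [Finset.sum_range_sub fun r => coord b (2 * r + 1) * tau r s, coord_of_gt (by omega),
      tau_zero]
    ring
  rw [h1, add_assoc (2 / s), mul_add, ← neg_neg (coord b 1 * (2 / s)), ← h2]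
  simp only [psiOne, pertE, pertW, ← sum_add_distrib, ← sum_sub_distrib,
    ← Finset.sum_neg_distrib, mul_sum]
  refine sum_congr rfl fun r _ => ?_
  rw [coord_kap cc b (by omega), linErr, source, flowY, show (2 * r + 2) / 2 = r + 1 by omega,
    show 2 * (r + 1) + 1 = 2 * r + 2 + 1 by ring]
  push_cast
  ring

theorem psiTwo_eq (hU : ∀ i, 2 ≤ i → ∀ b ∈ dom L b₀, SmoothPos (U i b))
    {b : Fin L → ℝ} (hb : b ∈ dom L b₀) {s : ℝ} (hs : 0 < s) :
    psiTwo cc K S U R b s = ∑ r ∈ range R, (coord (fun j => kap cc j b) (2 * r + 1) * tau r s +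
        ∑ j, kap cc j b * partialS j (U (2 * r + 3)) b s) +
      (stepO (stepE (pertE U R b)) s + nlFun K S (pertE U R b s) s) +
      coord b 1 * (2 * pertW U R b s + lamD (pertW U R b) s) := by
  have h1 : lamD (pertW U R b) s = ∑ r ∈ range R,
      (coord b (2 * r + 1) * lamD (tau r) s + lamD (U (2 * r + 3) b) s) := by
    have := fibLin_lamD.sum 0 (range R) (F := fun r s =>
      coord b (2 * r + 1) * tau r s + U (2 * r + 3) b s) (fun r _ =>
        (contDiffOn_const.mul (smoothPos_tau _)).add (hU _ (by omega) b hb)) hs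
    refine this.trans (sum_congr rfl fun r _ => ?_)
    exact fibLin_lamD.mul_add 0 _ (smoothPos_tau _) (hU _ (by omega) b hb) hs
  have h2 : stepO (stepE (pertE U R b)) s = ∑ r ∈ range R,
      (coord b (2 * r + 2) * -tau r s + stepO (stepE (U (2 * r + 2) b)) s) := by
    have := fibLin_stepO_stepE.sum 0 (range R) (F := fun r s =>
      coord b (2 * r + 2) * tau (r + 1) s + U (2 * r + 2) b s) (fun r _ =>
        (contDiffOn_const.mul (smoothPos_tau _)).add (hU _ (by omega) b hb)) hs
    refine this.trans (sum_congr rfl fun r _ => ?_)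
    rw [← stepO_stepE_tau r hs]
    exact fibLin_stepO_stepE.mul_add 0 _ (smoothPos_tau _) (hU _ (by omega) b hb) hs
  rw [h1, h2, psiTwo, ← add_assoc, add_right_comm _ (nlFun K S _ s)]
  congr 1
  simp only [pertW, mul_sum, ← sum_add_distrib]
  refine sum_congr rfl fun r _ => ?_
  rw [coord_kap cc b (by omega), linErr, source, flowY, show (2 * r + 1) / 2 = r by omega]
  push_cast
  ring

end

section

variable {L : ℕ} {b₀ : ℝ} {cc χ K S : ℝ → ℝ} {κ ς : ℕ → ℝ} {R : ℕ}

/-- The error `ψ_b`. -/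
def psiVec (cc K S : ℝ → ℝ) (U : ℕ → (Fin L → ℝ) → ℝ → ℝ) (R : ℕ) (b : Fin L → ℝ) (y : ℝ) : ℝ × ℝ :=
  (y * psiOne cc U R b (1 + y ^ 2), y * psiTwo cc K S U R b (1 + y ^ 2))

theorem profile_corS (hR : 2 * R = L + 1) (b : Fin L → ℝ) {y : ℝ} (hy : 0 < y) :
    profile (corS χ cc κ ς) b y = (Q y + y * pertE (cutCor χ cc κ ς) R b (1 + y ^ 2),
      y * pertW (cutCor χ cc κ ς) R b (1 + y ^ 2)) := by
  have := sum_T_add_place hR (a := coord b) (V := fun i => cutCor χ cc κ ς i b (1 + y ^ 2))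
    (coord_of_gt (by omega)) hy
  rw [profile, add_assoc]
  simp [corS, this, pertE, pertW]

theorem smoothPos_pertE {U : ℕ → (Fin L → ℝ) → ℝ → ℝ} {b : Fin L → ℝ}
    (hU : ∀ i, 2 ≤ i → SmoothPos (U i b)) : SmoothPos (pertE U R b) :=
  ContDiffOn.sum fun _ _ => (contDiffOn_const.mul (smoothPos_tau _)).add (hU _ (by omega))

theorem smoothPos_pertW {U : ℕ → (Fin L → ℝ) → ℝ → ℝ} {b : Fin L → ℝ}
    (hU : ∀ i, 2 ≤ i → SmoothPos (U i b)) : SmoothPos (pertW U R b) :=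
  ContDiffOn.sum fun _ _ => (contDiffOn_const.mul (smoothPos_tau _)).add (hU _ (by omega))

theorem hasDerivWithinAt_coord {I : Set ℝ} {b : ℝ → Fin L → ℝ} {b' : Fin L → ℝ} {t : ℝ}
    (h : HasDerivWithinAt b b' I t) (k : ℕ) :
    HasDerivWithinAt (fun t => coord (b t) k) (coord b' k) I t := by
  unfold coord
  split_ifs with hk
  · exact hasDerivWithinAt_pi.1 h _
  · exact hasDerivWithinAt_const _ _ _

/-- The equation of the approximate profile along a curve of parameters. -/
theorem profile_equation (hR : 2 * R = L + 1) (hc : ModCoef b₀ cc)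
    (hcc : ∀ b, cc b = 4 / cutMass χ b) (hχ : Cutoff χ)
    (hK : ∀ e, cos (2 * e) = 1 + e ^ 2 * K (e ^ 2))
    (hS : ∀ e, sin (2 * e) = e * (2 + e ^ 2 * S (e ^ 2)))
    {I : Set ℝ} {b : ℝ → Fin L → ℝ} {b' : Fin L → ℝ} {t : ℝ} (hb : b t ∈ dom L b₀)
    (hd : HasDerivWithinAt b b' I t) {y : ℝ} (hy : 0 < y) :
    ∃ D : ℝ × ℝ, HasDerivWithinAt (fun t => profile (corS χ cc κ ς) (b t) y) D I t ∧
      D - F (profile (corS χ cc κ ς) (b t)) y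
          + coord (b t) 1 • LamVec (profile (corS χ cc κ ς) (b t)) y
        = modTerm χ (corS χ cc κ ς) (b t) b' y + psiVec cc K S (cutCor χ cc κ ς) R (b t) y := by
  have hL : 0 < L := by omega
  set U := cutCor (L := L) χ cc κ ς with hUdef
  have hU : ∀ i, 2 ≤ i → ∀ b ∈ dom L b₀, SmoothPos (U i b) := fun i hi b hb =>
    cutCor_smoothPos hL hc hχ hi hb
  set s := 1 + y ^ 2 with hs
  have hs0 : 0 < s := one_add_sq_pos y
  have hdU : ∀ i, 2 ≤ i → HasDerivWithinAt (fun t => U i (b t) s)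
      (∑ j, b' j * partialS j (U i) (b t) s) I t := fun i hi => by
    have h1 := cutCor_differentiableAt (κ := κ) (ς := ς) hL hc hχ hi hb hs0
    have h2 := h1.hasFDerivAt.comp_hasDerivWithinAt t hd
    rw [fderiv_apply_eq_sum h1] at h2
    exact h2
  have hdE : HasDerivWithinAt (fun t => pertE U R (b t) s) (∑ r ∈ range R,
      (coord b' (2 * r + 2) * tau (r + 1) s +
        ∑ j, b' j * partialS j (U (2 * r + 2)) (b t) s)) I t :=
    HasDerivWithinAt.fun_sum fun r _ =>
      ((hasDerivWithinAt_coord hd _).mul_const _).add (hdU _ (by omega))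
  have hdW : HasDerivWithinAt (fun t => pertW U R (b t) s) (∑ r ∈ range R,
      (coord b' (2 * r + 1) * tau r s +
        ∑ j, b' j * partialS j (U (2 * r + 3)) (b t) s)) I t :=
    HasDerivWithinAt.fun_sum fun r _ =>
      ((hasDerivWithinAt_coord hd _).mul_const _).add (hdU _ (by omega))
  have hE := smoothPos_pertE (R := R) fun i hi => hU i hi _ hb
  have hW := smoothPos_pertW (R := R) fun i hi => hU i hi _ hb
  refine ⟨_, (((hdE.const_mul y).const_add (Q y)).prodMk (hdW.const_mul y)).congr
    (fun t _ => profile_corS hR (b t) hy) (profile_corS hR (b t) hy), ?_⟩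
  have e1 : (fun x => (profile (corS χ cc κ ς) (b t) x).1) =ᶠ[𝓝 y]
      fun x => Q x + x * pertE U R (b t) (1 + x ^ 2) := by
    filter_upwards [lt_mem_nhds hy] with x hx
    rw [profile_corS hR _ hx]
  have e2 : (fun x => (profile (corS χ cc κ ς) (b t) x).2) =ᶠ[𝓝 y]
      fun x => x * pertW U R (b t) (1 + x ^ 2) := by
    filter_upwards [lt_mem_nhds hy] with x hx
    rw [profile_corS hR _ hx]
  have hF : F (profile (corS χ cc κ ς) (b t)) y = (y * pertW U R (b t) s,
      -(y * (stepO (stepE (pertE U R (b t))) s + nlFun K S (pertE U R (b t) s) s))) := by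
    rw [F, e1.deriv.deriv_eq, e1.deriv_eq, profile_corS hR _ hy, ← flow_snd hK hS hE hy]
  have hΛ : LamVec (profile (corS χ cc κ ς) (b t)) y =
      (y * (2 / s + pertE U R (b t) s + lamD (pertE U R (b t)) s),
        y * (2 * pertW U R (b t) s + lamD (pertW U R (b t)) s)) := by
    have h1 := ((hasDerivAt_Q y).add (hasDerivAt_mul_comp hE y)).deriv
    rw [LamVec, ← Lam0_mul_comp hW, Lam, Lam0, Lam0, e1.deriv_eq, e2.deriv_eq, profile_corS hR _ hy]
    rw [show (fun x => Q x + x * pertE U R (b t) (1 + x ^ 2)) =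
      Q + fun x => x * pertE U R (b t) (1 + x ^ 2) from rfl, h1]
    congr 1
    ring
  have hM := modTerm_eq (cc := cc) (U := U) (χ := χ) (Sv := corS χ cc κ ς) (b := b t) (b' := b') hR hy
    (fun i hi j => partialB_corS hL hc hχ hi j hb y)
    (fun i hi j hj => partialB_corS_eq_zero hL hc hχ hi hj hb y) hcc rfl
  rw [hF, hΛ, hM, psiVec, psiOne_eq (b₀ := b₀) hR hU hb hs0, psiTwo_eq (b₀ := b₀) hU hb hs0]
  ext
  · simp [coord_sub, sub_mul, sum_sub_distrib, sum_add_distrib]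
    ring
  · simp [coord_sub, sub_mul, sum_sub_distrib, sum_add_distrib]
    ring

end

/-! ### Symbol estimates for homogeneous functions -/

theorem eul_iterate_eq_eulS (g : ℝ → ℝ → ℝ) (n : ℕ) (b : ℝ) : eul^[n] (g b) = eulS^[n] g b := by
  induction n generalizing g with
  | zero => rfl
  | succ n ih =>
    rw [Function.iterate_succ_apply, Function.iterate_succ_apply, ← ih]
    rfl

theorem iterate_eulS_mem {M : Submodule ℝ (ℝ → ℝ → ℝ)} (hM : ∀ g ∈ M, eulS g ∈ M) (n : ℕ)
    {g : ℝ → ℝ → ℝ} (hg : g ∈ M) : eulS^[n] g ∈ M := by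
  induction n generalizing g with
  | zero => exact hg
  | succ n ih => exact ih (hM g hg)

/-- The region of the points of `D` with `σ ≥ 1`, for functions which are smooth on `σ > 0`. -/
def farOn {P : Type*} (D : Set (P × ℝ)) : SymRegion P :=
  ⟨Ioi 0, {z | z ∈ D ∧ 1 ≤ z.2}, isOpen_Ioi, fun _ x h =>
    mem_Ioi.2 (zero_lt_one.trans_le (show 1 ≤ x from h.2))⟩

section

variable {P : Type*} {D : Set (P × ℝ)} {w w₁ w₂ : P → ℝ → ℝ} {f g : P → ℝ → ℝ}

theorem SymF.sym {r : ℤ} {c : ℕ} {F : ℝ → ℝ} (h : SymF r c F) :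
    Sym (farOn D) (fun _ s => s ^ r * (1 + Real.log s) ^ c) (fun _ => F) :=
  fun n => ⟨fun _ => h.smooth, fun m hm => by
    obtain ⟨C, hC, hb⟩ := (h n).2 m hm
    exact ⟨C, hC, fun _ x hx => hb () x hx.2⟩⟩

theorem Sym.inv_mul (hf : Sym (farOn D) w f) :
    Sym (farOn D) (fun p s => s⁻¹ * w p s) (fun p s => s⁻¹ * f p s) := by
  have := (Sym.zpow (Q := farOn D) (fun _ h => h) (-1)).mul hf
  simpa only [zpow_neg_one] using this

theorem Sym.stepE (hf : Sym (farOn D) w f) :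
    Sym (farOn D) (fun p s => s⁻¹ * w p s) (fun p => stepE (f p)) :=
  ((hf.add hf.eul).inv_mul.const_mul (-2)).congr fun p s _ => by
    simp only [WaveMap.stepE]
    ring

theorem Sym.stepO (hw : ∀ p s, (p, s) ∈ D → 1 ≤ s → 0 ≤ w p s) (hf : Sym (farOn D) w f) :
    Sym (farOn D) w (fun p => stepO (f p)) := by
  refine (((hf.add hf.eul).add ((hf.sub hf.eul).inv_mul.mono zero_le_one fun p s hs => ?_)).const_mul
    2).congr fun p s _ => by simp only [WaveMap.stepO]; ring
  rw [one_mul]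
  exact mul_le_of_le_one_left (hw p s hs.1 hs.2) (inv_le_one_of_one_le₀ hs.2)

theorem Sym.adS (hw : ∀ p s, (p, s) ∈ D → 1 ≤ s → 0 ≤ w p s) (hf : Sym (farOn D) w f) (k : ℕ) :
    Sym (farOn D) (fun p s => s ^ (-(((k + 1) / 2 : ℕ) : ℤ)) * w p s) (fun p => adS k (f p)) := by
  induction k with
  | zero => simpa [WaveMap.adS] using hf
  | succ k ih =>
    by_cases hk : Even k
    · simp only [WaveMap.adS, if_pos hk]
      obtain ⟨m, rfl⟩ := hk
      refine ih.stepE.mono zero_le_one fun p s hs => ?_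
      have hs0 : s ≠ 0 := (zero_lt_one.trans_le (show 1 ≤ s from hs.2)).ne'
      rw [← mul_assoc, one_mul, show (m + m + 1 + 1) / 2 = (m + m + 1) / 2 + 1 by omega,
        Nat.cast_add, neg_add, zpow_add₀ hs0, mul_comm s⁻¹]
      simp
    · simp only [WaveMap.adS, if_neg hk]
      obtain ⟨m, rfl⟩ := Nat.not_even_iff_odd.1 hk
      rw [show (2 * m + 1 + 1 + 1) / 2 = (2 * m + 1 + 1) / 2 by omega]
      refine ih.stepO fun p s h h1 => mul_nonneg (zpow_nonneg (by linarith) _) (hw p s h h1)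

/-- Symbols with weight `w`, up to powers of `1 + log σ`. -/
def LogSym (D : Set (P × ℝ)) (w f : P → ℝ → ℝ) : Prop :=
  ∃ c : ℕ, Sym (farOn D) (fun p s => w p s * (1 + log s) ^ c) f

namespace LogSym

theorem of_sym (hf : Sym (farOn D) w f) : LogSym D w f := ⟨0, by simpa using hf⟩

theorem congr (hf : LogSym D w f) (h : ∀ p s, 0 < s → g p s = f p s) : LogSym D w g := by
  obtain ⟨c, hf⟩ := hf
  exact ⟨c, hf.congr fun p s hs => h p s hs⟩

theorem mono (hf : LogSym D w f) {C : ℝ} (hC : 0 ≤ C)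
    (h : ∀ p s, (p, s) ∈ D → 1 ≤ s → w p s ≤ C * w₁ p s) : LogSym D w₁ f := by
  obtain ⟨c, hf⟩ := hf
  refine ⟨c, hf.mono hC fun p s hs => ?_⟩
  have := log_nonneg (show 1 ≤ s from hs.2)
  rw [← mul_assoc]
  exact mul_le_mul_of_nonneg_right (h p s hs.1 hs.2) (by positivity)

theorem add (hw : ∀ p s, (p, s) ∈ D → 1 ≤ s → 0 ≤ w p s) (hf : LogSym D w f) (hg : LogSym D w g) :
    LogSym D w (fun p s => f p s + g p s) := by
  obtain ⟨c, hf⟩ := hf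
  obtain ⟨c', hg⟩ := hg
  have key : ∀ {f : P → ℝ → ℝ} {c c' : ℕ}, c ≤ c' →
      Sym (farOn D) (fun p s => w p s * (1 + log s) ^ c) f →
      Sym (farOn D) (fun p s => w p s * (1 + log s) ^ c') f := fun h hf =>
    hf.mono zero_le_one fun p s hs => by
      have := log_nonneg (show 1 ≤ s from hs.2)
      rw [one_mul]
      exact mul_le_mul_of_nonneg_left (pow_le_pow_right₀ (by linarith) h) (hw p s hs.1 hs.2)
  exact ⟨max c c', (key (le_max_left _ _) hf).add (key (le_max_right _ _) hg)⟩

theorem sum {ι : Type*} (hw : ∀ p s, (p, s) ∈ D → 1 ≤ s → 0 ≤ w p s) (t : Finset ι)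
    {F : ι → P → ℝ → ℝ} (h : ∀ i ∈ t, LogSym D w (F i)) :
    LogSym D w (fun p s => ∑ i ∈ t, F i p s) := by
  classical
  induction t using Finset.induction_on with
  | empty => exact ⟨0, by simpa using Sym.zero⟩
  | insert a t ha ih =>
    simp only [sum_insert ha]
    exact (h a (Finset.mem_insert_self _ _)).add hw
      (ih fun i hi => h i (Finset.mem_insert_of_mem hi))

theorem mul (hf : LogSym D w₁ f) (hg : LogSym D w₂ g) :
    LogSym D (fun p s => w₁ p s * w₂ p s) (fun p s => f p s * g p s) := by
  obtain ⟨c, hf⟩ := hf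
  obtain ⟨c', hg⟩ := hg
  exact ⟨c + c', (hf.mul hg).mono zero_le_one fun p s _ => le_of_eq (by ring)⟩

theorem pow (hf : LogSym D w f) (k : ℕ) : LogSym D (fun p s => w p s ^ k) (fun p s => f p s ^ k) := by
  obtain ⟨c, hf⟩ := hf
  exact ⟨c * k, (hf.pow k).mono zero_le_one fun p s _ => le_of_eq (by rw [mul_pow, pow_mul, one_mul])⟩

theorem of_symF {r : ℤ} {c : ℕ} {F : ℝ → ℝ} (h : SymF r c F) :
    LogSym D (fun _ s => s ^ r) (fun _ => F) := ⟨c, h.sym⟩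

end LogSym

end

/-- The parameters `b ∈ dom L b₀` with `|b_k| ≤ K b_1^k`. -/
abbrev Par (L : ℕ) (b₀ K : ℝ) : Type :=
  {b : Fin L → ℝ // b ∈ dom L b₀ ∧ ∀ k : ℕ, 1 ≤ k → k ≤ L → |coord b k| ≤ K * coord b 1 ^ k}

section

variable {L : ℕ} {b₀ K : ℝ} {cc : ℝ → ℝ} {D : Set (Par L b₀ K × ℝ)}
  {V : Submodule ℝ (ℝ → ℝ → ℝ)} {U : (Fin L → ℝ) → ℝ → ℝ} {w : ℤ} {d : ℕ}

theorem Par.mem (p : Par L b₀ K) : coord p.1 1 ∈ Ioo 0 b₀ := p.2.1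

/-- A monomial of weight `w` is of size `b_1^w`. -/
theorem MonoWt.exists_bound (hL : 0 < L) {J : Fin L → ℤ} (hJ : MonoWt J w d) :
    ∃ C, 0 ≤ C ∧ ∀ p : Par L b₀ K, |∏ k, p.1 k ^ J k| ≤ C * coord p.1 1 ^ w := by
  refine ⟨∏ k, (max 1 K) ^ (J k).toNat, Finset.prod_nonneg fun k _ => by positivity, fun p => ?_⟩
  have hb := p.mem.1
  have h1 : coord p.1 1 ^ w = ∏ k : Fin L, coord p.1 1 ^ (((k : ℤ) + 1) * J k) := by
    have key : ∀ t : Finset (Fin L), coord p.1 1 ^ (∑ k ∈ t, ((k : ℤ) + 1) * J k) =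
        ∏ k ∈ t, coord p.1 1 ^ (((k : ℤ) + 1) * J k) := fun t => by
      classical
      induction t using Finset.induction_on with
      | empty => simp
      | insert a t ha ih => rw [sum_insert ha, Finset.prod_insert ha, zpow_add₀ hb.ne', ih]
    rw [← hJ.wt, key]
  rw [h1, Finset.abs_prod, ← Finset.prod_mul_distrib]
  refine Finset.prod_le_prod (fun k _ => abs_nonneg _) fun k _ => ?_
  rcases Nat.eq_zero_or_pos (k : ℕ) with h0 | h0
  · have hk : p.1 k = coord p.1 1 := by
      rw [coord_one hL]
      exact congrArg p.1 (Fin.ext h0)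
    rw [hk, h0, abs_of_pos (zpow_pos hb _)]
    simp
    exact le_mul_of_one_le_left (zpow_pos hb _).le (one_le_pow₀ (le_max_left _ _))
  · obtain ⟨m, hm⟩ := Int.eq_ofNat_of_zero_le (hJ.nonneg k h0)
    have hk := p.2.2 (k + 1) (by omega) (by omega)
    rw [coord_of_le k.2] at hk
    rw [hm, zpow_natCast, zpow_mul, zpow_natCast, Int.toNat_natCast, ← mul_pow, abs_pow]
    refine pow_le_pow_left₀ (abs_nonneg _) (hk.trans ?_) m
    rw [← Nat.cast_succ, zpow_natCast]
    exact mul_le_mul_of_nonneg_right (le_max_right _ _) (by positivity)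

/-- Symbol estimates for the coefficients give symbol estimates for homogeneous functions. -/
theorem HomSpan.exists_sym (hL : 0 < L) {W : ℕ → ℝ → ℝ → ℝ}
    (hW : ∀ c c' b s, c ≤ c' → b ∈ Ioo 0 b₀ → 1 ≤ s → 0 ≤ W c b s ∧ W c b s ≤ W c' b s)
    (h : ∀ g ∈ V, ∃ c, Sym (farOn D) (fun p s => W c (coord p.1 1) s) fun p => g (coord p.1 1))
    (hU : U ∈ HomSpan L b₀ w d V) :
    ∃ c, Sym (farOn D) (fun p s => coord p.1 1 ^ w * W c (coord p.1 1) s) fun p => U p.1 := by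
  have key : ∀ {f : Par L b₀ K → ℝ → ℝ} {c c' : ℕ}, c ≤ c' →
      Sym (farOn D) (fun p s => coord p.1 1 ^ w * W c (coord p.1 1) s) f →
      Sym (farOn D) (fun p s => coord p.1 1 ^ w * W c' (coord p.1 1) s) f := fun h hf =>
    hf.mono zero_le_one fun p s hs => by
      rw [one_mul]
      exact mul_le_mul_of_nonneg_left (hW _ _ _ _ h p.mem hs.2).2 (zpow_pos p.mem.1 _).le
  refine HomSpan.induction (p := fun U => ∃ c, Sym (farOn D)
    (fun p s => coord p.1 1 ^ w * W c (coord p.1 1) s) fun p => U p.1) hU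
    (fun U U' e ⟨c, h⟩ => ⟨c, h.congr fun p s hs => e p.1 p.2.1 s hs⟩) (fun J hJ g hg => ?_)
    ⟨0, Sym.zero⟩ (fun U _ U' _ ⟨c, h⟩ ⟨c', h'⟩ =>
      ⟨max c c', (key (le_max_left _ _) h).add (key (le_max_right _ _) h')⟩)
    fun a U _ ⟨c, h⟩ => ⟨c, h.const_mul a⟩
  obtain ⟨c, hg⟩ := h g hg
  obtain ⟨C, hC, hb⟩ := hJ.exists_bound (b₀ := b₀) (K := K) hL
  refine ⟨c, (hg.param_mul fun p => ∏ k, p.1 k ^ J k).mono hC fun p s hs => ?_⟩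
  rw [← mul_assoc]
  exact mul_le_mul_of_nonneg_right (hb p) (hW _ _ _ _ le_rfl p.mem hs.2).1

theorem HomSpan.logSym_of_crudeSpan (hL : 0 < L) {q : ℤ} {v : ℕ}
    (hU : U ∈ HomSpan L b₀ w d (CrudeSpan b₀ q v)) :
    LogSym D (fun p s => coord p.1 1 ^ w * s ^ q) fun p => U p.1 := by
  suffices h : ∃ c : ℕ, Sym (farOn D) (fun p s => coord p.1 1 ^ w * (s ^ q * (1 + log s) ^ c))
      fun p => U p.1 by
    obtain ⟨c, h⟩ := h
    exact ⟨c, by simpa only [mul_assoc] using h⟩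
  refine HomSpan.exists_sym (D := D) hL (W := fun c _ s => s ^ q * (1 + log s) ^ c)
    (fun c c' b s h _ hs => ?_) (fun g hg => ?_) hU
  · have := log_nonneg hs
    have hs0 : 0 < s := by linarith
    exact ⟨by positivity, mul_le_mul_of_nonneg_left (pow_le_pow_right₀ (by linarith) h)
      (by positivity)⟩
  · obtain ⟨c, hg⟩ := hg
    refine ⟨c, ?_⟩
    induction hg using span_induction with
    | mem g hg =>
      obtain ⟨k, hk, F, hF, e⟩ := hg
      obtain ⟨C, hC, hb⟩ := KCoef.exists_bound hk.1
      refine ((hF.1.sym.param_mul fun p : Par L b₀ K => k (coord p.1 1)).mono hC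
        fun p s hs => ?_).congr fun p s hs => e _ p.mem s hs
      have := Real.log_nonneg (show 1 ≤ s from hs.2)
      have hs0 : 0 < s := zero_lt_one.trans_le hs.2
      refine mul_le_mul_of_nonneg_right ?_ (by positivity)
      simpa using hb _ p.mem
    | zero => exact Sym.zero
    | add g g' _ _ h h' => exact h.add h'
    | smul a g _ h => exact h.const_mul a

theorem HomSpan.exists_sym_of_profSpan (hL : 0 < L) (hc : ModCoef b₀ cc) {r : ℕ}
    (hU : U ∈ HomSpan L b₀ w d (ProfSpan hc r)) :
    ∃ c : ℕ, Sym (farOn D) (fun p s => coord p.1 1 ^ w * (s ^ ((r : ℤ) - 1) *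
      ((1 + |log (coord p.1 1 ^ 2 * s)|) / |log (coord p.1 1)| +
        (1 + log s) ^ c / s))) fun p => U p.1 := by
  refine HomSpan.exists_sym hL (W := fun c b s => s ^ ((r : ℤ) - 1) *
    ((1 + |log (b ^ 2 * s)|) / |log b| + (1 + log s) ^ c / s))
    (fun c c' b s h hb hs => ?_) (fun g hg => ?_) hU
  · have := log_nonneg hs
    have hs0 : 0 < s := by linarith
    refine ⟨by positivity, mul_le_mul_of_nonneg_left (add_le_add_right ?_ _) (by positivity)⟩
    exact div_le_div_of_nonneg_right (pow_le_pow_right₀ (by linarith) h) hs0.le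
  · obtain ⟨c, h1, hg, -⟩ := hg
    refine ⟨c, fun n => ⟨fun p => (Asy.smooth2 hg).right p.mem, fun m _ => ?_⟩⟩
    obtain ⟨C, hC, hb⟩ := exists_bound_bal hc
      (iterate_eulS_mem (M := Asy (balSys hc) _ c) (fun _ => Asy.eulS_mem) m hg)
    refine ⟨C, hC, fun p s hs => ?_⟩
    rw [eul_iterate_eq_eulS]
    exact hb _ p.mem s hs.2

theorem HomSpan.sym_of_profSpan_outer (hL : 0 < L) (hc : ModCoef b₀ cc) {r : ℕ}
    (hD : ∀ p s, (p, s) ∈ D → 1 ≤ coord p.1 1 ^ 2 * s)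
    (hU : U ∈ HomSpan L b₀ w d (ProfSpan hc r)) :
    Sym (farOn D) (fun p s => coord p.1 1 ^ w * (s ^ ((r : ℤ) - 1) *
      ((1 + log (coord p.1 1 ^ 2 * s)) / |log (coord p.1 1)|))) fun p => U p.1 := by
  obtain ⟨c, h⟩ := HomSpan.exists_sym_of_profSpan (D := D) hL hc hU
  obtain ⟨C, hC, hb⟩ := hc.exists_log_pow_div_le c
  refine h.mono (C := 1 + C) (by linarith) fun p s hs => ?_
  have hx := hD p s hs.1
  have hlx := log_nonneg hx
  have hs0 : 0 < s := zero_lt_one.trans_le hs.2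
  have hl := hc.one_le p.mem
  rw [mul_left_comm (1 + C)]
  refine mul_le_mul_of_nonneg_left ?_ (zpow_pos p.mem.1 _).le
  rw [mul_left_comm (1 + C)]
  refine mul_le_mul_of_nonneg_left ?_ (zpow_pos hs0 _).le
  rw [abs_of_nonneg hlx, add_mul, one_mul]
  refine add_le_add_right ((hb _ p.mem s hx).2.trans ?_) _
  rw [← mul_div_assoc]
  refine div_le_div_of_nonneg_right ?_ (by linarith)
  nlinarith

theorem HomSpan.sym_of_cutAll (hL : 0 < L) (hc : ModCoef b₀ cc) {q : ℤ}
    (hD : ∀ p s, (p, s) ∈ D → 1 ≤ coord p.1 1 ^ 2 * s)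
    (hU : U ∈ HomSpan L b₀ w d (CutAll hc q)) :
    Sym (farOn D) (fun p _ => coord p.1 1 ^ (w - 2 * q) / |log (coord p.1 1)|)
      fun p => U p.1 := by
  suffices h : ∃ _ : ℕ, Sym (farOn D) (fun p _ => coord p.1 1 ^ w *
      (coord p.1 1 ^ (-(2 * q)) / |log (coord p.1 1)|)) fun p => U p.1 by
    refine h.choose_spec.mono zero_le_one fun p s _ => le_of_eq ?_
    rw [one_mul, ← mul_div_assoc, ← zpow_add₀ p.mem.1.ne', sub_eq_add_neg]
  refine HomSpan.exists_sym (D := D) hL (W := fun _ b _ => b ^ (-(2 * q)) / |log b|)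
    (fun c c' b s h hb hs => ⟨?_, le_rfl⟩) (fun g hg => ⟨0, fun n => ⟨fun p => ?_, fun m _ => ?_⟩⟩) hU
  · have := zpow_pos hb.1 (-(2 * q))
    positivity
  · exact ((modStable_cutAll hc q).smooth g hg).right p.mem
  · obtain ⟨⟨c, -, h⟩, h0⟩ := iterate_eulS_mem (M := CutAll hc q) (fun _ => CutAll.eulS_mem) m hg
    obtain ⟨C, hC, hb⟩ := CutSpan.exists_bound h
    obtain ⟨E, hE⟩ := (isCompact_Icc (a := (1 : ℝ)) (b := 2)).exists_bound_of_continuousOn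
      (f := fun x : ℝ => x ^ q)
      (fun x hx => (continuousAt_zpow₀ x q (Or.inl (by linarith [hx.1]))).continuousWithinAt)
    have hE0 : 0 ≤ E := (norm_nonneg _).trans (hE 1 (by norm_num))
    refine ⟨C * E, mul_nonneg hC hE0, fun p s hs => ?_⟩
    have hβ := p.mem.1
    have hβq := zpow_pos hβ (-(2 * q))
    rw [eul_iterate_eq_eulS]
    rcases le_or_gt (coord p.1 1 ^ 2 * s) 2 with h2 | h2
    · refine (hb _ p.mem s (hD p s hs.1) h2).trans ?_
      rw [mul_assoc]
      refine mul_le_mul_of_nonneg_left ?_ hC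
      simp only [← mul_div_assoc]
      refine div_le_div_of_nonneg_right ?_ (abs_nonneg _)
      have h3 : s ^ q = (coord p.1 1 ^ 2 * s) ^ q * coord p.1 1 ^ (-(2 * q)) := by
        rw [mul_zpow, ← zpow_natCast, ← zpow_mul, mul_right_comm, ← zpow_add₀ hβ.ne']
        simp
      rw [h3]
      exact mul_le_mul_of_nonneg_right ((le_abs_self _).trans (hE _ ⟨hD p s hs.1, h2⟩)) hβq.le
    · rw [h0 _ p.mem s h2, abs_zero]
      positivity

end

/-! ### The error in the outer region -/

/-- Powers of `|log b|` are dominated by `b⁻¹`. -/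
theorem exists_mul_abs_log_pow_le (n : ℕ) :
    ∃ C, 0 ≤ C ∧ ∀ b ∈ Ioo (0 : ℝ) 1, b * |log b| ^ n ≤ C := by
  obtain ⟨C, hC, h⟩ := exists_one_add_log_pow_le n one_pos
  refine ⟨C, hC, fun b hb => ?_⟩
  have h1 := h b⁻¹ ((one_le_inv₀ hb.1).2 hb.2.le)
  have h2 : |log b| ≤ 1 + log b⁻¹ := by
    rw [abs_of_nonpos (log_nonpos hb.1.le hb.2.le), log_inv]
    linarith
  rw [rpow_one] at h1
  calc _ ≤ b * (C * b⁻¹) := mul_le_mul_of_nonneg_left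
        ((pow_le_pow_left₀ (abs_nonneg _) h2 n).trans h1) hb.1.le
    _ = C := by rw [mul_left_comm, mul_inv_cancel₀ hb.1.ne', mul_one]

theorem ModCoef.lt_one {b₀ : ℝ} {cc : ℝ → ℝ} (hc : ModCoef b₀ cc) {b : ℝ} (hb : b ∈ Ioo 0 b₀) :
    b ∈ Ioo (0 : ℝ) 1 := ⟨hb.1, by linarith [hb.2, hc.le]⟩

section

variable {P : Type*} {D : Set (P × ℝ)} {w w₁ w₂ : P → ℝ → ℝ} {f g : P → ℝ → ℝ}

theorem LogSym.mono_log (hf : LogSym D w f) {C : ℝ} (hC : 0 ≤ C) (n : ℕ)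
    (h : ∀ p s, (p, s) ∈ D → 1 ≤ s → w p s ≤ C * (w₁ p s * (1 + log s) ^ n)) :
    LogSym D w₁ f := by
  obtain ⟨c, hf⟩ := hf
  refine ⟨n + c, hf.mono hC fun p s hs => ?_⟩
  have := log_nonneg (show 1 ≤ s from hs.2)
  rw [pow_add, ← mul_assoc, ← mul_assoc, mul_assoc C]
  exact mul_le_mul_of_nonneg_right (h p s hs.1 hs.2) (by positivity)

/-- A small power of `σ` absorbs the logarithms. -/
theorem LogSym.sym (hf : LogSym D w f) (hw : ∀ p s, (p, s) ∈ D → 1 ≤ s → 0 ≤ w p s)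
    (hw₁ : ∀ p s, (p, s) ∈ D → 1 ≤ s → 0 ≤ w₁ p s) {A : ℝ} (hA : 0 ≤ A)
    (h : ∀ p s, (p, s) ∈ D → 1 ≤ s → w p s ^ 3 * s ≤ A * w₁ p s ^ 3) : Sym (farOn D) w₁ f := by
  obtain ⟨c, hf⟩ := hf
  obtain ⟨C, hC, hb⟩ := exists_one_add_log_pow_le (c * 3) one_pos
  refine hf.mono (C := max 1 (C * A)) (by positivity) fun p s hs => ?_
  have h1 := hb s hs.2
  rw [rpow_one, pow_mul] at h1
  have hw1 := hw₁ p s hs.1 hs.2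
  have hm : 1 ≤ max 1 (C * A) := le_max_left _ _
  refine le_of_pow_le_pow_left₀ three_ne_zero (by positivity) ?_
  calc _ = w p s ^ 3 * ((1 + log s) ^ c) ^ 3 := by ring
    _ ≤ w p s ^ 3 * (C * s) :=
      mul_le_mul_of_nonneg_left h1 (pow_nonneg (hw p s hs.1 hs.2) 3)
    _ = C * (w p s ^ 3 * s) := by ring
    _ ≤ C * (A * w₁ p s ^ 3) := mul_le_mul_of_nonneg_left (h p s hs.1 hs.2) hC
    _ = C * A * w₁ p s ^ 3 := by ring
    _ ≤ max 1 (C * A) ^ 3 * w₁ p s ^ 3 := by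
      refine mul_le_mul_of_nonneg_right ((le_max_right 1 _).trans ?_) (by positivity)
      exact le_self_pow₀ hm three_ne_zero
    _ = _ := by ring

end

section

variable {L : ℕ} {b₀ K₀ : ℝ} {cc χ : ℝ → ℝ} {κ ς : ℕ → ℝ} {D : Set (Par L b₀ K₀ × ℝ)}

/-- The square of the perturbation is bounded where `b₁² σ` is at most a power of `log σ`. -/
theorem sym_sub_one_mul_sq (hD : ∀ p s, (p, s) ∈ D → 1 ≤ s →
      coord p.1 1 ^ 2 * s ≤ 5 * (1 + log s) ^ 4) {E : Par L b₀ K₀ → ℝ → ℝ}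
    (hE : LogSym D (fun p _ => coord p.1 1 ^ 2) E) :
    Sym (farOn D) (fun _ _ => 1) fun p s => (s - 1) * E p s ^ 2 := by
  have h1 : LogSym D (fun _ s => s ^ (1 : ℤ)) fun _ s => s - 1 := by
    simpa using LogSym.of_symF (D := D) (symF_sub_one_pow 1)
  have h2 := h1.mul (hE.pow 2)
  obtain ⟨C, hC, hb⟩ := exists_one_add_log_pow_le 24 two_pos
  refine h2.sym (fun p s _ hs => by positivity) (fun _ _ _ _ => zero_le_one) (A := 5 ^ 6 * C)
    (by positivity) fun p s h hs => ?_
  have hs0 : 0 < s := by linarith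
  have h3 := hb s hs
  rw [rpow_two] at h3
  have h4 := pow_le_pow_left₀ (by positivity) (hD p s h hs) 6
  rw [zpow_one, one_pow, mul_one, ← mul_le_mul_iff_left₀ (by positivity : 0 < s ^ 2)]
  calc _ = (coord p.1 1 ^ 2 * s) ^ 6 := by ring
    _ ≤ 5 ^ 6 * (1 + log s) ^ 24 := h4.trans (le_of_eq (by ring))
    _ ≤ 5 ^ 6 * (C * s ^ 2) := by gcongr
    _ = _ := by ring

theorem exists_coord_bound (k : ℕ) (hk : 1 ≤ k) :
    ∃ C, 0 ≤ C ∧ ∀ p : Par L b₀ K₀, |coord p.1 k| ≤ C * coord p.1 1 ^ k :=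
  ⟨max K₀ 0, le_max_right _ _, fun p => by
    have := p.mem.1
    rcases le_or_gt k L with h | h
    · exact (p.2.2 k hk h).trans (mul_le_mul_of_nonneg_right (le_max_left _ _) (by positivity))
    · rw [coord_of_gt h, abs_zero]
      positivity⟩

theorem logSym_coord_mul_tau {k : ℕ} (hk : 1 ≤ k) (r : ℕ) :
    LogSym D (fun p s => coord p.1 1 ^ k * s ^ ((r : ℤ) - 1)) fun p s => coord p.1 k * tau r s := by
  obtain ⟨c, hτ⟩ := exists_symF_tau r
  obtain ⟨C, hC, hb⟩ := exists_coord_bound (L := L) (b₀ := b₀) (K₀ := K₀) k hk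
  obtain ⟨c', h⟩ := LogSym.of_symF (D := D) hτ
  refine ⟨c', (h.param_mul fun p : Par L b₀ K₀ => coord p.1 k).mono hC fun p s hs => ?_⟩
  have := log_nonneg (show 1 ≤ s from hs.2)
  have hs0 : 0 < s := zero_lt_one.trans_le hs.2
  rw [mul_assoc (coord p.1 1 ^ k), ← mul_assoc C]
  exact mul_le_mul_of_nonneg_right (hb p) (by positivity)

/-- The points with `1 ≤ b₁² σ ≤ 5 |log b₁|⁴`. -/
def outD (L : ℕ) (b₀ K₀ : ℝ) : Set (Par L b₀ K₀ × ℝ) :=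
  {z | 1 ≤ coord z.1.1 1 ^ 2 * z.2 ∧ coord z.1.1 1 ^ 2 * z.2 ≤ 5 * |log (coord z.1.1 1)| ^ 4}

/-- In the outer region, the weight of the `j`-th component of the error is `b_1^(j+2)` times this
factor. -/
def outW (R : ℕ) (p : Par L b₀ K₀) (s : ℝ) : ℝ :=
  (coord p.1 1 ^ 2 * s) ^ (R - 2) * (1 + log (coord p.1 1 ^ 2 * s)) / |log (coord p.1 1)|

theorem inv_le_outW (hc : ModCoef b₀ cc) (R : ℕ) {p : Par L b₀ K₀} {s : ℝ} (h : (p, s) ∈ outD L b₀ K₀) :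
    0 < |log (coord p.1 1)|⁻¹ ∧ |log (coord p.1 1)|⁻¹ ≤ outW R p s := by
  have h1 : 1 ≤ coord p.1 1 ^ 2 * s := h.1
  have hl := hc.one_le p.mem
  have h2 := log_nonneg h1
  refine ⟨by positivity, ?_⟩
  rw [outW, div_eq_mul_inv]
  refine le_mul_of_one_le_left (by positivity) ?_
  exact one_le_mul_of_one_le_of_one_le (one_le_pow₀ h1) (by linarith)

theorem outD_log (hc : ModCoef b₀ cc) {p : Par L b₀ K₀} {s : ℝ} (h : (p, s) ∈ outD L b₀ K₀)
    (hs : 1 ≤ s) : |log (coord p.1 1)| ≤ 1 + log s ∧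
      coord p.1 1 ^ 2 * s ≤ 5 * (1 + log s) ^ 4 := by
  have h1 : 1 ≤ coord p.1 1 ^ 2 * s := h.1
  have h2 := hc.log_sq_mul p.mem (by linarith : 0 < s)
  have h3 := log_nonneg h1
  have h4 : |log (coord p.1 1)| ≤ 1 + log s := by
    linarith [abs_nonneg (log (coord p.1 1))]
  exact ⟨h4, h.2.trans (mul_le_mul_of_nonneg_left (pow_le_pow_left₀ (abs_nonneg _) h4 4)
    (by norm_num))⟩

variable {R : ℕ}

theorem sym_of_pow_outer (hc : ModCoef b₀ cc) {j r : ℕ} (hr : r ≤ R - 2) {f : Par L b₀ K₀ → ℝ → ℝ}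
    {w q : ℤ} (hw : w = j + 2 * q) (hq : q = r)
    (h : Sym (farOn (outD L b₀ K₀)) (fun p s => coord p.1 1 ^ w * (s ^ q *
      ((1 + log (coord p.1 1 ^ 2 * s)) / |log (coord p.1 1)|))) f) :
    Sym (farOn (outD L b₀ K₀)) (fun p s => coord p.1 1 ^ j * outW R p s) f := by
  refine h.mono zero_le_one fun p s hs => ?_
  have h1 : 1 ≤ coord p.1 1 ^ 2 * s := hs.1.1
  have hl := hc.one_le p.mem
  have h2 := log_nonneg h1
  have hβ := p.mem.1
  subst hq
  rw [hw, zpow_add₀ hβ.ne', zpow_natCast, zpow_natCast, zpow_mul, zpow_natCast, one_mul, outW,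
    mul_assoc, ← mul_assoc (_ ^ r), show (coord p.1 1 ^ (2 : ℤ)) = coord p.1 1 ^ 2 from rfl,
    ← mul_pow, mul_div_assoc]
  exact mul_le_mul_of_nonneg_left (mul_le_mul_of_nonneg_right (pow_le_pow_right₀ h1 hr)
    (by positivity)) (by positivity)

theorem sym_of_inv_outer (hc : ModCoef b₀ cc) {j : ℕ} {f : Par L b₀ K₀ → ℝ → ℝ} {w : ℤ}
    (h : Sym (farOn (outD L b₀ K₀)) (fun p _ => coord p.1 1 ^ w / |log (coord p.1 1)|) f)
    (hw : w = j) :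
    Sym (farOn (outD L b₀ K₀)) (fun p s => coord p.1 1 ^ j * outW R p s) f := by
  refine h.mono zero_le_one fun p s hs => ?_
  have hβ := p.mem.1
  rw [hw, zpow_natCast, one_mul, div_eq_mul_inv]
  exact mul_le_mul_of_nonneg_left (inv_le_outW hc R hs.1).2 (by positivity)

theorem linErr_zero_of_gt {k : ℕ} (hk : L < k) (b : Fin L → ℝ) (s : ℝ) : linErr cc k b s = 0 := by
  rw [linErr, coord_of_gt hk]
  ring

theorem sym_psiOne_outer (hR : 2 * R = L + 1) (hc : ModCoef b₀ cc) (hχ : Cutoff χ) :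
    Sym (farOn (outD L b₀ K₀)) (fun p s => coord p.1 1 ^ 3 * outW R p s)
      fun p => psiOne cc (cutCor χ cc κ ς) R p.1 := by
  have hL : 0 < L := by omega
  have hD : ∀ p s, (p, s) ∈ outD L b₀ K₀ → 1 ≤ coord p.1 1 ^ 2 * s := fun p s h => h.1
  refine Sym.sum _ fun r hr => ((Sym.sub ?_ ?_).add ?_)
  · by_cases h : r + 1 < R
    · exact sym_of_pow_outer hc (j := 3) (r := r) (by omega) (by push_cast; omega) (by push_cast; omega)
        (HomSpan.sym_of_profSpan_outer hL hc hD (linErr_mem hL hc (k := 2 * r + 2) (by omega)))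
    · exact Sym.zero.congr fun p s _ => linErr_zero_of_gt (by omega) _ _
  · exact sym_of_inv_outer hc (j := 3) (HomSpan.sym_of_cutAll hL hc hD
      (cutCor_mem hL hc hχ κ ς (i := 2 * r + 3) (by omega)))
      (by push_cast; omega)
  · exact sym_of_inv_outer hc (j := 3) (HomSpan.sym_of_cutAll hL hc hD
      (flowY_mem hL (modStable_cutAll hc _) (by omega)
        (cutCor_mem hL hc hχ κ ς (i := 2 * r + 2) (by omega)) 0)) (by push_cast; omega)

end

section

variable {L : ℕ} {b₀ K₀ : ℝ} {cc χ K S : ℝ → ℝ} {κ ς : ℕ → ℝ} {D : Set (Par L b₀ K₀ × ℝ)} {R : ℕ}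

/-- The nonlinear error of a perturbation of size `b_1²`. -/
theorem logSym_nlFun (hK : ContDiff ℝ ∞ K) (hS : ContDiff ℝ ∞ S)
    (hD : ∀ p s, (p, s) ∈ D → 1 ≤ s → coord p.1 1 ^ 2 * s ≤ 5 * (1 + log s) ^ 4)
    (hD' : ∀ p s, (p, s) ∈ D → 1 ≤ coord p.1 1 ^ 2 * s)
    {E : Par L b₀ K₀ → ℝ → ℝ} (hE : LogSym D (fun p _ => coord p.1 1 ^ 2) E) :
    LogSym D (fun p _ => coord p.1 1 ^ 6) fun p s => nlFun K S (E p s) s := by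
  have hz := sym_sub_one_mul_sq hD hE
  have h1 := ((LogSym.of_symF (D := D) symF_evenFac).mul (hE.pow 2)).mul (LogSym.of_sym (hz.comp hK))
  have h2 := ((LogSym.of_symF (D := D) symF_oddFac).mul (hE.pow 3)).mul (LogSym.of_sym (hz.comp hS))
  refine LogSym.add (fun p s _ _ => by have := p.mem.1; positivity)
    (h1.mono zero_le_one fun p s h hs => ?_) (h2.mono zero_le_one fun p s h hs => ?_)
  · have hs0 : 0 < s := by linarith
    have h3 : s⁻¹ ≤ coord p.1 1 ^ 2 := (inv_le_iff_one_le_mul₀ hs0).2 (hD' p s h)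
    rw [zpow_neg_one, mul_one, one_mul]
    calc _ ≤ coord p.1 1 ^ 2 * (coord p.1 1 ^ 2) ^ 2 := by gcongr
      _ = _ := by ring
  · exact le_of_eq (by rw [zpow_zero]; ring)

theorem ModCoef.log_mul_le_one {b₀ : ℝ} {cc : ℝ → ℝ} (hc : ModCoef b₀ cc) {b : ℝ}
    (hb : b ∈ Ioo 0 b₀) : |Real.log b| * b ≤ 1 :=
  (mul_le_mul_of_nonneg_right (hc.abs_log_le hb) hb.1.le).trans_eq (inv_mul_cancel₀ hb.1.ne')

theorem logSym_pertE_outer (hR : 2 * R = L + 1) (hc : ModCoef b₀ cc) (hχ : Cutoff χ) :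
    LogSym (outD L b₀ K₀) (fun p _ => coord p.1 1 ^ 2)
      fun p => pertE (cutCor χ cc κ ς) R p.1 := by
  have hL : 0 < L := by omega
  have hw : ∀ p s, (p, s) ∈ outD L b₀ K₀ → 1 ≤ s → 0 ≤ coord p.1 1 ^ 2 := fun p s _ _ => by positivity
  refine LogSym.sum hw _ fun r hr => LogSym.add hw ?_ (LogSym.of_sym ?_)
  · refine (logSym_coord_mul_tau (k := 2 * r + 2) (by omega) (r + 1)).mono_log (C := 5 ^ r)
      (by positivity) (4 * r) fun p s h hs => ?_
    have h1 := pow_le_pow_left₀ (zero_le_one.trans h.1) (outD_log hc h hs).2 r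
    have hβ := p.mem.1
    rw [show ((r + 1 : ℕ) : ℤ) - 1 = r by push_cast; ring, zpow_natCast]
    calc _ = coord p.1 1 ^ 2 * (coord p.1 1 ^ 2 * s) ^ r := by rw [mul_pow]; ring
      _ ≤ coord p.1 1 ^ 2 * (5 * (1 + log s) ^ 4) ^ r := by gcongr
      _ = _ := by rw [mul_pow, pow_mul]; ring
  · refine (HomSpan.sym_of_cutAll hL hc (fun p s h => h.1)
      (cutCor_mem hL hc hχ κ ς (i := 2 * r + 2) (by omega))).mono zero_le_one
      fun p s _ => ?_
    have hβ := p.mem.1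
    rw [one_mul, show ((2 * r + 2 : ℕ) : ℤ) - 2 * ((((2 * r + 2) / 2 : ℕ) : ℤ) - 1) = (2 : ℕ) by
      omega, zpow_natCast]
    exact div_le_self (by positivity) (hc.one_le p.mem)

theorem sym_linErr_one_outer (hc : ModCoef b₀ cc) :
    Sym (farOn (outD L b₀ K₀)) (fun p s => coord p.1 1 ^ 4 * outW R p s)
      fun p => linErr cc 1 p.1 := by
  refine sym_of_inv_outer hc (w := 4) ?_ rfl
  obtain ⟨C, hC, hb⟩ := KCoef.exists_bound hc.memK
  have h1 := (Sym.zpow (Q := farOn (outD L b₀ K₀)) (fun _ h => h) (-2)).param_mul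
    fun p => 4 * coord p.1 1 ^ 2
  have h2 := (Sym.zpow (Q := farOn (outD L b₀ K₀)) (fun _ h => h) (-1)).param_mul
    fun p => -(cc (coord p.1 1)) * coord p.1 1 ^ 2
  refine ((h1.mono (C := 4) (by norm_num) fun p s hs => ?_).add
    (h2.mono hC fun p s hs => ?_)).congr fun p s hs => ?_
  · have hβ := p.mem.1
    have hs0 : 0 < s := zero_lt_one.trans_le hs.2
    have hl := hc.one_le p.mem
    have h3 : s⁻¹ ≤ coord p.1 1 ^ 2 := (inv_le_iff_one_le_mul₀ hs0).2 hs.1.1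
    have h4 := hc.log_mul_le_one p.mem
    have h5 : coord p.1 1 ≤ 1 := by linarith [p.mem.2, hc.le]
    rw [abs_of_pos (by positivity), zpow_neg, mul_assoc, show ((2 : ℤ)) = ((2 : ℕ) : ℤ) from rfl,
      zpow_natCast, ← inv_pow]
    refine mul_le_mul_of_nonneg_left ?_ (by norm_num)
    rw [le_div_iff₀ (by linarith)]
    calc _ ≤ coord p.1 1 ^ 2 * (coord p.1 1 ^ 2) ^ 2 * |log (coord p.1 1)| := by gcongr
      _ = coord p.1 1 ^ 4 * (coord p.1 1 * (|log (coord p.1 1)| * coord p.1 1)) := by ring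
      _ ≤ coord p.1 1 ^ 4 * 1 := mul_le_mul_of_nonneg_left (mul_le_one₀ h5 (by positivity) h4)
          (by positivity)
      _ = _ := mul_one _
  · have hβ := p.mem.1
    have hs0 : 0 < s := zero_lt_one.trans_le hs.2
    have hl := hc.one_le p.mem
    have h3 : s⁻¹ ≤ coord p.1 1 ^ 2 := (inv_le_iff_one_le_mul₀ hs0).2 hs.1.1
    have h4 := hb _ p.mem
    rw [pow_one] at h4
    rw [zpow_neg_one, abs_mul, abs_neg, abs_of_pos (by positivity : 0 < coord p.1 1 ^ 2)]
    calc _ ≤ C * (|log (coord p.1 1)|)⁻¹ * coord p.1 1 ^ 2 * coord p.1 1 ^ 2 := by gcongr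
      _ = C * (coord p.1 1 ^ 4 / |log (coord p.1 1)|) := by rw [div_eq_mul_inv]; ring
  · have h3 : modC cc 1 = fun b => 1 / 2 * cc b := by funext b; simp [modC]
    rw [linErr, h3, source_zero_eq cc _ hs, zpow_neg_one]
    ring

theorem sym_psiTwo_outer (hR : 2 * R = L + 1) (hc : ModCoef b₀ cc) (hχ : Cutoff χ)
    (hK : ContDiff ℝ ∞ K) (hS : ContDiff ℝ ∞ S) :
    Sym (farOn (outD L b₀ K₀)) (fun p s => coord p.1 1 ^ 4 * outW R p s)
      fun p => psiTwo cc K S (cutCor χ cc κ ς) R p.1 := by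
  have hL : 0 < L := by omega
  have hD : ∀ p s, (p, s) ∈ outD L b₀ K₀ → 1 ≤ coord p.1 1 ^ 2 * s := fun p s h => h.1
  refine (Sym.sum _ fun r hr => ((Sym.add ?_ ?_).add ?_)).add ?_
  · rcases Nat.eq_zero_or_pos r with rfl | h0
    · exact sym_linErr_one_outer hc
    · have hr' := Finset.mem_range.1 hr
      exact sym_of_pow_outer hc (j := 4) (r := r - 1) (by omega) (by push_cast; omega)
        (by omega) (HomSpan.sym_of_profSpan_outer hL hc hD
          (linErr_mem hL hc (k := 2 * r + 1) (by omega)))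
  · have h1 := HomSpan.sym_of_cutAll hL hc hD
      (cutCor_mem hL hc hχ κ ς (i := 2 * r + 2) (by omega))
    refine sym_of_inv_outer hc (w := 4) ((h1.stepE.stepO fun p s _ hs => ?_).mono zero_le_one
      fun p s hs => ?_) rfl
    · have hβ := p.mem.1
      positivity
    · have hβ := p.mem.1
      have hs0 : 0 < s := zero_lt_one.trans_le hs.2
      have h3 : s⁻¹ ≤ coord p.1 1 ^ 2 := (inv_le_iff_one_le_mul₀ hs0).2 (hD p s hs.1)
      rw [one_mul, show ((2 * r + 2 : ℕ) : ℤ) - 2 * ((((2 * r + 2) / 2 : ℕ) : ℤ) - 1) = (2 : ℕ) by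
        omega, zpow_natCast, ← mul_div_assoc]
      refine div_le_div_of_nonneg_right ?_ (abs_nonneg _)
      calc _ ≤ coord p.1 1 ^ 2 * coord p.1 1 ^ 2 := by gcongr
        _ = coord p.1 1 ^ (4 : ℕ) := by ring
  · exact sym_of_inv_outer hc (j := 4) (HomSpan.sym_of_cutAll hL hc hD
      (flowY_mem hL (modStable_cutAll hc _) (by omega)
        (cutCor_mem hL hc hχ κ ς (i := 2 * r + 3) (by omega)) 1)) (by push_cast; omega)
  · have h1 := logSym_nlFun hK hS (fun p s h hs => (outD_log hc h hs).2) hD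
      (logSym_pertE_outer (K₀ := K₀) (κ := κ) (ς := ς) hR hc hχ)
    obtain ⟨C, hC, hb⟩ := exists_mul_abs_log_pow_le 7
    refine sym_of_inv_outer hc (w := 4) (h1.sym (fun p s _ _ => ?_) (fun p s _ _ => ?_)
      (A := 5 * C) (by positivity) fun p s h hs => ?_) rfl
    · positivity
    · have hβ := p.mem.1
      positivity
    · have hβ := p.mem.1
      have hl := hc.one_le p.mem
      have h5 : coord p.1 1 ≤ 1 := by linarith [p.mem.2, hc.le]
      have h6 := hb _ (hc.lt_one p.mem)
      rw [div_pow, ← mul_div_assoc, le_div_iff₀ (by positivity)]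
      set β := coord p.1 1
      set l := |log β|
      calc _ = β ^ 16 * (β ^ 2 * s) * l ^ 3 := by ring
        _ ≤ β ^ 16 * (5 * l ^ 4) * l ^ 3 :=
          mul_le_mul_of_nonneg_right (mul_le_mul_of_nonneg_left h.2 (by positivity)) (by positivity)
        _ = 5 * β ^ 12 * β ^ 3 * (β * l ^ 7) := by ring
        _ ≤ 5 * β ^ 12 * 1 * C := by
          gcongr
          exact pow_le_one₀ hβ.le h5
        _ = 5 * C * (β ^ 4) ^ 3 := by ring
        _ = _ := by norm_cast

end

/-! ### The error in the inner region -/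

section

variable {L : ℕ} {b₀ K₀ : ℝ} {cc χ K S KN SN : ℝ → ℝ} {κ ς : ℕ → ℝ} {D : Set (Par L b₀ K₀ × ℝ)} {R : ℕ}

theorem errE_cor_mem (hL : 0 < L) (hc : ModCoef b₀ cc) (κ ς : ℕ → ℝ) {r d : ℕ} (hr : 1 ≤ r)
    (hd : 2 * r < d) :
    errE (cor (L := L) cc κ ς) r ∈ HomSpan L b₀ (2 * r) d (CrudeSpan b₀ ((r : ℤ) - 1) r) :=
  errE_mem hL hc hr hd (by
    have := cor_mem (L := L) hL hc κ ς (2 * r) (by omega)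
    rwa [show 2 * r / 2 = r by omega, Nat.cast_mul] at this)

theorem smoothPos_errX (hL : 0 < L) (hc : ModCoef b₀ cc) (κ ς : ℕ → ℝ) (r : ℕ) {b : Fin L → ℝ}
    (hb : b ∈ dom L b₀) :
    SmoothPos (linErr (L := L) cc (2 * r + 1) b) ∧
      SmoothPos (flowY (L := L) cc 1 (cor cc κ ς (2 * r + 1)) b) ∧
      SmoothPos (nl (L := L) κ ς L (errE (cor cc κ ς)) (r + 1) b) := by
  refine ⟨?_, ?_, ?_⟩
  · obtain ⟨c, hτ⟩ := exists_symF_tau ((2 * r + 1) / 2)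
    exact contDiffOn_const.mul (contDiffOn_const.mul
      (hτ.lamD.smooth.add (contDiffOn_const.mul hτ.smooth)))
  · rcases Nat.eq_zero_or_pos r with rfl | hr
    · have h1 : flowY (L := L) cc 1 (cor cc κ ς (2 * 0 + 1)) = 0 := by
        rw [cor_of_lt (by omega)]
        funext b s
        simp [flowY, lamD, eul, partialS]
      rw [h1]
      exact contDiffOn_const
    · exact HomSpan.smoothPos (modStable_profSpan hc _).smooth (flowY_mem hL (modStable_profSpan hc _)
        (by omega) (cor_mem hL hc κ ς (2 * r + 1) (by omega)) 1) hb
  · exact HomSpan.smoothPos (fun g hg => CrudeSpan.smooth2 hg) (nl_mem hL κ ς L rfl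
      (fun m hm hmr => errE_cor_mem hL hc κ ς hm (show 2 * m < 2 * r + 2 by omega)) le_rfl) hb

theorem isOpen_inner (b : ℝ) : IsOpen {s : ℝ | b ^ 2 * s < 1} :=
  isOpen_lt (by fun_prop) continuous_const

theorem cutCor_inner (hχ : Cutoff χ) (i : ℕ) {b : Fin L → ℝ} {s : ℝ}
    (h : coord b 1 ^ 2 * s < 1) : cutCor χ cc κ ς i b s = cor cc κ ς i b s := by
  rw [cutCor, hχ.one _ h.le, one_mul]

/-- The scaling and modulation terms are local. -/
theorem flowY_cutCor_inner (hχ : Cutoff χ) (ι i : ℕ) {b : Fin L → ℝ} {s : ℝ}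
    (h : coord b 1 ^ 2 * s < 1) :
    flowY cc ι (cutCor χ cc κ ς i) b s = flowY cc ι (cor cc κ ς i) b s := by
  have h1 : ∀ j, partialS j (cutCor χ cc κ ς i) b s = partialS j (cor cc κ ς i) b s := fun j => by
    refine Filter.EventuallyEq.deriv_eq ?_
    have hc : ContinuousAt (fun t => coord (update b j t) 1 ^ 2 * s) (b j) := by
      have h2 : Continuous fun t => coord (update b j t) 1 := by
        simp only [coord_one (lt_of_le_of_lt (Nat.zero_le _) j.2)]
        have h3 : Continuous fun t => update b j t := continuous_const.update j continuous_id
        exact continuous_pi_iff.1 h3 _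
      exact ((h2.pow 2).mul continuous_const).continuousAt
    have h3 := hc.eventually_lt continuousAt_const (by simpa using h)
    filter_upwards [h3] with t ht
    exact cutCor_inner hχ i ht
  have h2 := eul_congr (isOpen_inner (coord b 1)) (f := cutCor χ cc κ ς i b) (g := cor cc κ ς i b)
    (fun s hs => cutCor_inner hχ i hs) s h
  simp only [flowY, h1, lamD, h2, cutCor_inner hχ i h]

/-- Below the cutoff scale the first component of the error vanishes. -/
theorem psiOne_inner (hχ : Cutoff χ) {b : Fin L → ℝ} {s : ℝ}
    (h : coord b 1 ^ 2 * s < 1) : psiOne cc (cutCor χ cc κ ς) R b s = 0 := by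
  refine sum_eq_zero fun r _ => ?_
  rw [flowY_cutCor_inner hχ 0 _ h, cutCor_inner hχ _ h, cor_odd (by omega) (by omega), errX,
    if_neg (by omega), add_zero, Pi.add_apply, Pi.add_apply, show 2 * r + 3 - 1 = 2 * r + 2 by omega,
    show (2 * r + 2) % 2 = 0 by omega]
  ring

/-- What remains of the second component below the cutoff scale: the scaling and modulation of the
last correction, and the part of high homogeneity of the nonlinear error. -/
def innerRem (cc K S : ℝ → ℝ) (κ ς : ℕ → ℝ) (R : ℕ) (b : Fin L → ℝ) (s : ℝ) : ℝ :=
  flowY cc 1 (cor cc κ ς (L + 2)) b s + (nlFun K S (pertE (cor cc κ ς) R b s) s -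
    ∑ r ∈ range R, nl κ ς L (errE (cor cc κ ς)) (r + 1) b s)

theorem psiTwo_inner (hR : 2 * R = L + 1) (hc : ModCoef b₀ cc) (hχ : Cutoff χ)
    {b : Fin L → ℝ} (hb : b ∈ dom L b₀) {s : ℝ} (hs : 0 < s) (h : coord b 1 ^ 2 * s < 1) :
    psiTwo cc K S (cutCor χ cc κ ς) R b s = innerRem cc K S κ ς R b s := by
  have hL : 0 < L := by omega
  have hE : pertE (cutCor χ cc κ ς) R b s = pertE (cor cc κ ς) R b s :=
    sum_congr rfl fun r _ => by rw [cutCor_inner hχ _ h]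
  have h0 : flowY (L := L) cc 1 (cor cc κ ς 1) = 0 := by
    rw [cor_of_lt (by omega)]
    funext b s
    simp [flowY, lamD, eul, partialS]
  have key : ∀ r, linErr cc (2 * r + 1) b s + stepO (stepE (cutCor χ cc κ ς (2 * r + 2) b)) s +
      flowY cc 1 (cutCor χ cc κ ς (2 * r + 3)) b s =
      (flowY cc 1 (cor cc κ ς (2 * (r + 1) + 1)) b s - flowY cc 1 (cor cc κ ς (2 * r + 1)) b s) -
        nl κ ς L (errE (cor cc κ ς)) (r + 1) b s := fun r => by
    have h1 : stepO (stepE (cutCor χ cc κ ς (2 * r + 2) b)) s =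
        stepO (stepE (cor cc κ ς (2 * r + 2) b)) s :=
      adS_congr (isOpen_inner (coord b 1)) 2 (fun s hs => cutCor_inner hχ _ hs) s h
    have h2 : stepO (stepE (cor cc κ ς (2 * r + 2) b)) s =
        -errX cc κ ς (cor cc κ ς) (2 * r + 2) b s := by
      obtain ⟨s1, s2, s3⟩ := smoothPos_errX hL hc κ ς r hb
      have hX : SmoothPos (errX cc κ ς (cor cc κ ς) (2 * r + 2) b) := by
        rw [errX, if_pos (by omega), show 2 * r + 2 - 1 = 2 * r + 1 by omega,
          show (2 * r + 1) % 2 = 1 by omega, show (2 * r + 2) / 2 = r + 1 by omega]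
        exact ContDiffOn.add (ContDiffOn.add s1 s2) s3
      rw [cor_even (by omega) (by omega), ← stepO_stepE_regInv hX hs, ← neg_one_mul,
        ← fibLin_stepO_stepE.smul 0 (-1) _ (smoothPos_regInv hX) s hs]
      simp only [neg_one_mul]
    rw [h1, h2, flowY_cutCor_inner hχ 1 _ h, errX, if_pos (by omega),
      show 2 * r + 2 - 1 = 2 * r + 1 by omega, show (2 * r + 1) % 2 = 1 by omega,
      show (2 * r + 2) / 2 = r + 1 by omega, Pi.add_apply, Pi.add_apply, Pi.add_apply, Pi.add_apply,
      show 2 * (r + 1) + 1 = 2 * r + 3 by ring]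
    ring
  rw [psiTwo, sum_congr rfl fun r _ => key r, sum_sub_distrib,
    Finset.sum_range_sub fun r => flowY cc 1 (cor cc κ ς (2 * r + 1)) b s, hE, innerRem,
    show 2 * R + 1 = L + 2 by omega, show 2 * 0 + 1 = 1 from rfl, h0, Pi.zero_apply, Pi.zero_apply]
  ring

/-- The even components of the perturbation that are present in the profile. -/
def truncE (cc : ℝ → ℝ) (κ ς : ℕ → ℝ) (R r : ℕ) : (Fin L → ℝ) → ℝ → ℝ :=
  if r ≤ R then errE (cor cc κ ς) r else 0

theorem truncE_zero : truncE (L := L) cc κ ς R 0 = 0 := by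
  rw [truncE, if_pos (Nat.zero_le _)]
  rfl

theorem truncE_mem (hL : 0 < L) (hc : ModCoef b₀ cc) (κ ς : ℕ → ℝ) (R : ℕ) {r : ℕ} (hr : 1 ≤ r) :
    truncE (L := L) cc κ ς R r ∈
      HomSpan L b₀ (2 * r) (2 * R + 1) (CrudeSpan b₀ ((r : ℤ) - 1) r) := by
  rw [truncE]
  split_ifs with h
  · exact errE_cor_mem hL hc κ ς hr (by omega)
  · exact zero_mem _

theorem sum_truncE (b : Fin L → ℝ) (s : ℝ) :
    ∑ r ∈ range (R + 1), truncE cc κ ς R r b s = pertE (cor cc κ ς) R b s := by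
  rw [Finset.sum_range_succ', truncE_zero, pertE]
  simp
  refine sum_congr rfl fun r hr => ?_
  have := Finset.mem_range.1 hr
  rw [truncE, if_pos (by omega), errE, if_neg (by omega), show 2 * (r + 1) = 2 * r + 2 by ring]

/-- The part of high homogeneity of a power of the perturbation. -/
def gpowTail (cc : ℝ → ℝ) (κ ς : ℕ → ℝ) (R M : ℕ) (b : Fin L → ℝ) (s : ℝ) : ℝ :=
  ∑ r ∈ Finset.Ico (R + 1) (R * M + 1), gpow (truncE cc κ ς R) M r b s

theorem pow_pertE {M : ℕ} (hM : 1 ≤ M) (b : Fin L → ℝ) (s : ℝ) :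
    pertE (cor cc κ ς) R b s ^ M = ∑ r ∈ range (R + 1), gpow (truncE cc κ ς R) M r b s +
      gpowTail cc κ ς R M b s := by
  rw [← sum_truncE, ← (sum_gpow (E := truncE cc κ ς R) (fun r hr => by
    rw [truncE, if_neg (by omega)]) M b s).2, gpowTail, Finset.sum_range_add_sum_Ico]
  have := Nat.le_mul_of_pos_right R hM
  omega

/-- Taylor's formula of order `N` at `0`, with coefficients `κ` and smooth remainder `G`. -/
structure Taylor (N : ℕ) (F : ℝ → ℝ) (κ : ℕ → ℝ) (G : ℝ → ℝ) : Prop where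
  eq : ∀ x, F x = ∑ n ∈ range N, κ n * x ^ n + x ^ N * G x
  rem : ContDiff ℝ ∞ G

theorem Taylor.smooth {N : ℕ} {F G : ℝ → ℝ} (h : Taylor N F κ G) : ContDiff ℝ ∞ F := by
  rw [show F = _ from funext h.eq]
  exact (ContDiff.sum fun _ _ => by fun_prop).add ((contDiff_id.pow N).mul h.rem)

/-- The nonlinear error is the sum of its components of low homogeneity, of components of high
homogeneity, and of the remainder in the Taylor expansion of the nonlinearity. -/
theorem nlFun_sub_nl (hK : Taylor L K κ KN) (hS : Taylor L S ς SN) (b : Fin L → ℝ) (s : ℝ) :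
    nlFun K S (pertE (cor cc κ ς) R b s) s -
        ∑ r ∈ range R, nl κ ς L (errE (cor cc κ ς)) (r + 1) b s =
      ∑ m ∈ range L, (κ m * (evenFac s * (s - 1) ^ m) * gpowTail cc κ ς R (2 * m + 2) b s +
        ς m * (oddFac s * (s - 1) ^ m) * gpowTail cc κ ς R (2 * m + 3) b s) +
      (evenFac s * pertE (cor cc κ ς) R b s ^ 2 * ((s - 1) * pertE (cor cc κ ς) R b s ^ 2) ^ L *
          KN ((s - 1) * pertE (cor cc κ ς) R b s ^ 2) +
        oddFac s * pertE (cor cc κ ς) R b s ^ 3 * ((s - 1) * pertE (cor cc κ ς) R b s ^ 2) ^ L *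
          SN ((s - 1) * pertE (cor cc κ ς) R b s ^ 2)) := by
  have h1 : ∑ r ∈ range R, nl κ ς L (errE (cor cc κ ς)) (r + 1) b s =
      ∑ r ∈ range (R + 1), nl κ ς L (truncE cc κ ς R) r b s := by
    rw [Finset.sum_range_succ']
    have h0 : nl κ ς L (truncE (L := L) cc κ ς R) 0 b s = 0 := by
      refine sum_eq_zero fun m _ => ?_
      rw [gpow_zero_right truncE_zero (2 * m + 1), gpow_zero_right truncE_zero (2 * m + 2)]
      simp
    rw [h0, add_zero]
    refine sum_congr rfl fun r hr => ?_
    have := Finset.mem_range.1 hr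
    rw [nl_congr κ ς L (E' := truncE cc κ ς R) rfl truncE_zero fun n hn => by
      rw [truncE, if_pos (by omega)]]
  set e := pertE (cor cc κ ς) R b s with he
  have h2 : ∀ m, κ m * (evenFac s * (s - 1) ^ m) * gpowTail cc κ ς R (2 * m + 2) b s +
      ς m * (oddFac s * (s - 1) ^ m) * gpowTail cc κ ς R (2 * m + 3) b s =
      (evenFac s * e ^ 2 * (κ m * ((s - 1) * e ^ 2) ^ m) +
        oddFac s * e ^ 3 * (ς m * ((s - 1) * e ^ 2) ^ m)) -
      ∑ r ∈ range (R + 1),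
        (κ m * (evenFac s * (s - 1) ^ m) * gpow (truncE cc κ ς R) (2 * m + 2) r b s +
          ς m * (oddFac s * (s - 1) ^ m) * gpow (truncE cc κ ς R) (2 * m + 3) r b s) := fun m => by
    have e1 := pow_pertE (cc := cc) (κ := κ) (ς := ς) (R := R) (M := 2 * m + 2) (by omega) b s
    have e2 := pow_pertE (cc := cc) (κ := κ) (ς := ς) (R := R) (M := 2 * m + 3) (by omega) b s
    rw [← he] at e1 e2
    rw [sum_add_distrib, ← mul_sum, ← mul_sum, ← sub_eq_of_eq_add' e1,
      ← sub_eq_of_eq_add' e2, mul_pow, ← pow_mul]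
    ring
  have h3 : ∑ r ∈ range (R + 1), nl κ ς L (truncE cc κ ς R) r b s =
      ∑ m ∈ range L, ∑ r ∈ range (R + 1),
        (κ m * (evenFac s * (s - 1) ^ m) * gpow (truncE cc κ ς R) (2 * m + 2) r b s +
          ς m * (oddFac s * (s - 1) ^ m) * gpow (truncE cc κ ς R) (2 * m + 3) r b s) := by
    simp only [nl]
    rw [Finset.sum_comm]
  rw [h1, h3, sum_congr rfl fun m _ => h2 m, sum_sub_distrib, sum_add_distrib,
    ← mul_sum, ← mul_sum, nlFun, hK.eq, hS.eq]
  ring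

end

section

variable {L : ℕ} {b₀ K₀ : ℝ} {cc χ K S KN SN : ℝ → ℝ} {κ ς : ℕ → ℝ} {R : ℕ}

/-- The points with `b₁² σ < 1`. -/
def inD (L : ℕ) (b₀ K₀ : ℝ) : Set (Par L b₀ K₀ × ℝ) := {z | coord z.1.1 1 ^ 2 * z.2 < 1}

/-- Homogeneity in excess is a gain of powers of `b₁² σ`. -/
theorem zpow_mul_zpow_le_inner {β s : ℝ} (hβ : 0 < β) (hs : 1 ≤ s) (h : β ^ 2 * s ≤ 1) {w q w' q' : ℤ}
    (n : ℕ) (hw : w' + 2 * n ≤ w) (hq : q ≤ q' + n) (hβ1 : β ≤ 1) :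
    β ^ w * s ^ q ≤ β ^ w' * s ^ q' := by
  have hs0 : 0 < s := by linarith
  calc _ ≤ β ^ (w' + 2 * n) * s ^ (q' + n) :=
        mul_le_mul (zpow_le_zpow_right_of_le_one₀ hβ hβ1 hw) (zpow_le_zpow_right₀ hs hq)
          (by positivity) (by positivity)
    _ = β ^ w' * s ^ q' * (β ^ 2 * s) ^ n := by
      rw [zpow_add₀ hβ.ne', zpow_add₀ hs0.ne', zpow_mul, zpow_natCast, zpow_natCast, mul_pow,
        show β ^ (2 : ℤ) = β ^ 2 from rfl]
      ring
    _ ≤ _ := mul_le_of_le_one_right (by positivity) (pow_le_one₀ (by positivity) h)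

theorem logSym_gpowTail (hL : 0 < L) (hc : ModCoef b₀ cc) {q : ℤ} {F : ℝ → ℝ} (hF : SymF q 0 F)
    (a : ℝ) {m M : ℕ} (hq : q + m - M ≤ -3) :
    LogSym (inD L b₀ K₀) (fun p s => coord p.1 1 ^ (2 * (R : ℤ) + 2) * s ^ ((R : ℤ) - 2))
      fun p s => a * (F s * (s - 1) ^ m) * gpowTail cc κ ς R M p.1 s := by
  have hw : ∀ (p : Par L b₀ K₀) (s : ℝ), (p, s) ∈ inD L b₀ K₀ → 1 ≤ s →
      0 ≤ coord p.1 1 ^ (2 * (R : ℤ) + 2) * s ^ ((R : ℤ) - 2) := fun p s _ hs => by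
    have := p.mem.1
    have hs0 : 0 < s := by linarith
    positivity
  refine (LogSym.sum hw (Finset.Ico (R + 1) (R * M + 1)) (F := fun r p s =>
    a * (F s * (s - 1) ^ m) * gpow (truncE cc κ ς R) M r p.1 s) fun r hr => ?_).congr
      fun p s _ => by rw [gpowTail, mul_sum]
  have hr' := (Finset.mem_Ico.1 hr).1
  have h1 := mul_gpow_mem (b₀ := b₀) (n := r + 1) hL truncE_zero (fun r hr _ =>
    truncE_mem hL hc κ ς R hr) (Nat.lt_succ_self r) hF a hq
  refine (HomSpan.logSym_of_crudeSpan hL h1).mono zero_le_one fun p s h hs => ?_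
  rw [one_mul]
  exact zpow_mul_zpow_le_inner p.mem.1 hs (le_of_lt h) (r - R - 1) (by omega) (by omega)
    (hc.lt_one p.mem).2.le

theorem logSym_pertE_inner (hL : 0 < L) (hc : ModCoef b₀ cc) :
    LogSym (inD L b₀ K₀) (fun p _ => coord p.1 1 ^ 2) fun p => pertE (cor cc κ ς) R p.1 := by
  refine (LogSym.sum (fun p s _ _ => by positivity) (range (R + 1)) (F := fun r p =>
    truncE cc κ ς R r p.1) fun r _ => ?_).congr fun p s _ => (sum_truncE p.1 s).symm
  rcases Nat.eq_zero_or_pos r with rfl | hr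
  · rw [truncE_zero]
    exact LogSym.of_sym Sym.zero
  · refine (HomSpan.logSym_of_crudeSpan hL (truncE_mem hL hc κ ς R hr)).mono zero_le_one
      fun p s h hs => ?_
    have := zpow_mul_zpow_le_inner (w := 2 * r) (q := (r : ℤ) - 1) (w' := 2) (q' := 0) p.mem.1 hs
      (le_of_lt h) (r - 1) (by omega) (by omega) (hc.lt_one p.mem).2.le
    rw [zpow_zero, mul_one] at this
    rw [one_mul]
    exact this

theorem logSym_taylor_inner (hL : 0 < L) (hR : 2 * R = L + 1) (hc : ModCoef b₀ cc) {F Φ : ℝ → ℝ}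
    {q : ℤ} {M : ℕ} (hF : SymF q 0 F) (hΦ : ContDiff ℝ ∞ Φ) (hq : q + 3 ≤ M) (hM : 2 ≤ M) :
    LogSym (inD L b₀ K₀) (fun p s => coord p.1 1 ^ (2 * (R : ℤ) + 2) * s ^ ((R : ℤ) - 2))
      fun p s => F s * pertE (cor cc κ ς) R p.1 s ^ M *
        ((s - 1) * pertE (cor cc κ ς) R p.1 s ^ 2) ^ L *
          Φ ((s - 1) * pertE (cor cc κ ς) R p.1 s ^ 2) := by
  have hE := logSym_pertE_inner (K₀ := K₀) (κ := κ) (ς := ς) (R := R) hL hc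
  have hz := sym_sub_one_mul_sq (fun p s h hs => by
    have h1 : 1 ≤ (1 + log s) ^ 4 := one_le_pow₀ (by linarith [log_nonneg hs])
    have h2 : coord p.1 1 ^ 2 * s < 1 := h
    linarith) hE
  have h1 : LogSym (inD L b₀ K₀) (fun _ s => s ^ (1 : ℤ)) fun _ s => s - 1 := by
    simpa using LogSym.of_symF (D := inD L b₀ K₀) (symF_sub_one_pow 1)
  refine ((((LogSym.of_symF hF).mul (hE.pow M)).mul ((h1.mul (hE.pow 2)).pow L)).mul
    (LogSym.of_sym (hz.comp hΦ))).mono zero_le_one fun p s h hs => ?_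
  have hs0 : 0 < s := by linarith
  have hβ := p.mem.1
  rw [mul_one, one_mul]
  have e : s ^ q * (coord p.1 1 ^ 2) ^ M * (s ^ (1 : ℤ) * (coord p.1 1 ^ 2) ^ 2) ^ L =
      coord p.1 1 ^ (2 * (M : ℤ) + 4 * L) * s ^ (q + L) := by
    rw [zpow_add₀ hβ.ne', zpow_add₀ hs0.ne', zpow_natCast, zpow_one, mul_pow, ← pow_mul, ← pow_mul,
      ← pow_mul, show (2 * (M : ℤ)) = ((2 * M : ℕ) : ℤ) by push_cast; ring,
      show (4 * (L : ℤ)) = ((2 * 2 * L : ℕ) : ℤ) by push_cast; ring, zpow_natCast, zpow_natCast]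
    ring
  rw [e]
  exact zpow_mul_zpow_le_inner hβ hs (le_of_lt h) (R + M - 2) (by omega) (by omega)
    (hc.lt_one p.mem).2.le

/-- The symbol estimate for the second component of the error below the cutoff scale. -/
theorem exists_sym_innerRem (hR : 2 * R = L + 1) (hc : ModCoef b₀ cc)
    (hK : Taylor L K κ KN) (hS : Taylor L S ς SN) :
    ∃ c : ℕ, Sym (farOn (inD L b₀ K₀)) (fun p s => coord p.1 1 ^ (L + 3) * (s ^ ((R : ℤ) - 1) *
      ((1 + |log (coord p.1 1 ^ 2 * s)|) / |log (coord p.1 1)| +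
        (1 + log s) ^ c / s))) fun p => innerRem cc K S κ ς R p.1 := by
  have hL : 0 < L := by omega
  have hw : ∀ (p : Par L b₀ K₀) (s : ℝ), (p, s) ∈ inD L b₀ K₀ → 1 ≤ s →
      0 ≤ coord p.1 1 ^ (2 * (R : ℤ) + 2) * s ^ ((R : ℤ) - 2) := fun p s _ hs => by
    have := p.mem.1
    have hs0 : 0 < s := by linarith
    positivity
  have h1 := flowY_mem (cc := cc) hL (modStable_profSpan hc _) (by omega)
    (cor_mem hL hc κ ς (L + 2) (by omega)) 1
  rw [show (L + 2) / 2 = R by omega] at h1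
  obtain ⟨c, h1⟩ := HomSpan.exists_sym_of_profSpan (D := inD L b₀ K₀) hL hc h1
  obtain ⟨c', h2⟩ : LogSym (inD L b₀ K₀) (fun p s => coord p.1 1 ^ (2 * (R : ℤ) + 2) * s ^ ((R : ℤ) - 2))
      fun p s => nlFun K S (pertE (cor cc κ ς) R p.1 s) s -
        ∑ r ∈ range R, nl κ ς L (errE (cor cc κ ς)) (r + 1) p.1 s := by
    refine LogSym.congr (LogSym.add hw (LogSym.sum hw (range L) fun m _ => LogSym.add hw
      (logSym_gpowTail hL hc symF_evenFac (κ m) (m := m) (M := 2 * m + 2) (by push_cast; omega))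
      (logSym_gpowTail hL hc symF_oddFac (ς m) (m := m) (M := 2 * m + 3) (by push_cast; omega)))
      (LogSym.add hw
        (logSym_taylor_inner hL hR hc symF_evenFac hK.rem (M := 2) (by norm_num) le_rfl)
        (logSym_taylor_inner hL hR hc symF_oddFac hS.rem (M := 3) (by norm_num) (by norm_num))))
      fun p s _ => nlFun_sub_nl hK hS p.1 s
  have hexp : (((L + 2 : ℕ) : ℤ) + 1) = ((L + 3 : ℕ) : ℤ) := by push_cast; ring
  have hexp' : 2 * (R : ℤ) + 2 = ((L + 3 : ℕ) : ℤ) := by push_cast; omega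
  refine ⟨max c c', (h1.mono zero_le_one fun p s hs => ?_).add
    (h2.mono zero_le_one fun p s hs => ?_)⟩
  · have hβ := p.mem.1
    have hs1 : 1 ≤ s := hs.2
    have hs0 : 0 < s := by linarith
    have hl := log_nonneg hs1
    rw [hexp, zpow_natCast, one_mul]
    refine mul_le_mul_of_nonneg_left (mul_le_mul_of_nonneg_left (add_le_add_right ?_ _)
      (by positivity)) (by positivity)
    exact div_le_div_of_nonneg_right (pow_le_pow_right₀ (by linarith) (le_max_left _ _)) hs0.le
  · have hβ := p.mem.1
    have hs1 : 1 ≤ s := hs.2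
    have hs0 : 0 < s := by linarith
    have hl := log_nonneg hs1
    beta_reduce
    rw [hexp', zpow_natCast, one_mul, mul_assoc]
    refine mul_le_mul_of_nonneg_left ?_ (by positivity)
    rw [show (R : ℤ) - 2 = (R : ℤ) - 1 - 1 by ring, zpow_sub_one₀ hs0.ne', mul_assoc]
    refine mul_le_mul_of_nonneg_left ?_ (by positivity)
    have h3 : s⁻¹ * (1 + log s) ^ c' ≤ (1 + log s) ^ max c c' / s := by
      rw [div_eq_inv_mul]
      exact mul_le_mul_of_nonneg_left (pow_le_pow_right₀ (by linarith) (le_max_right _ _))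
        (by positivity)
    have h4 : 0 ≤ (1 + |log (coord p.1 1 ^ 2 * s)|) / |log (coord p.1 1)| := by positivity
    linarith

/-! ### Pointwise bounds for the adapted derivatives of the error -/

theorem psiOne_adS_inner (hχ : Cutoff χ) (k : ℕ) {b : Fin L → ℝ} {s : ℝ}
    (h : coord b 1 ^ 2 * s < 1) : adS k (psiOne cc (cutCor χ cc κ ς) R b) s = 0 := by
  have h0 : ∀ k s, adS k (fun _ => 0) s = 0 := fun k => by
    induction k with
    | zero => exact fun _ => rfl
    | succ k ih =>
      intro s
      rw [adS, show adS k (fun _ => 0) = fun _ => 0 from funext ih]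
      split_ifs <;> simp [stepE, stepO, eul]
  rw [adS_congr (isOpen_inner (coord b 1)) k (G := fun _ => 0)
    (fun s hs => psiOne_inner hχ hs) s h, h0]

theorem exists_psiTwo_inner_bound (hR : 2 * R = L + 1) (hc : ModCoef b₀ cc)
    (hχ : Cutoff χ) (hK : Taylor L K κ KN) (hS : Taylor L S ς SN) :
    ∃ c : ℕ, ∀ k : ℕ, ∃ C, 0 ≤ C ∧ ∀ (p : Par L b₀ K₀) (s : ℝ), coord p.1 1 ^ 2 * s < 1 → 1 ≤ s →
      |adS k (psiTwo cc K S (cutCor χ cc κ ς) R p.1) s| ≤ C * (s ^ (-(((k + 1) / 2 : ℕ) : ℤ)) *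
        (coord p.1 1 ^ (L + 3) * (s ^ ((R : ℤ) - 1) *
          ((1 + |log (coord p.1 1 ^ 2 * s)|) / |log (coord p.1 1)| +
            (1 + log s) ^ c / s)))) := by
  obtain ⟨c, h⟩ := exists_sym_innerRem (K₀ := K₀) hR hc hK hS
  refine ⟨c, fun k => ?_⟩
  obtain ⟨C, hC, hb⟩ := (h.adS (fun p s _ hs => by
    have hβ := p.mem.1
    have hs0 : 0 < s := by linarith
    have hl := log_nonneg hs
    positivity) k).exists_bound
  refine ⟨C, hC, fun p s hx hs => ?_⟩
  have hΩ : IsOpen {s : ℝ | 0 < s ∧ coord p.1 1 ^ 2 * s < 1} := isOpen_Ioi.inter (isOpen_inner _)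
  rw [adS_congr hΩ k (G := innerRem cc K S κ ς R p.1)
    (fun s hs => psiTwo_inner hR hc hχ p.2.1 hs.1 hs.2) s ⟨by linarith, hx⟩]
  exact hb p s ⟨hx, hs⟩

end

/-! ### Bounds for the radial norms -/

/-- A pointwise bound with an explicit antiderivative gives a bound for the norm. -/
theorem radNorm_le {R A : ℝ} {f g G : ℝ → ℝ} (hR : 0 ≤ R) (hA : 0 ≤ A)
    (hG : ∀ y, HasDerivAt G (g y) y) (hg : Continuous g) (hg0 : ∀ y, 0 ≤ y → 0 ≤ g y)
    (hf : ∀ y, 0 < y → y ≤ R → f y ^ 2 * y ≤ g y) (hGA : G R - G 0 ≤ A ^ 2) :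
    radNorm R f ≤ ofReal A := by
  have h1 : ∫⁻ y in Ioc (0 : ℝ) R, ofReal (f y ^ 2 * y) ≤ ofReal (A ^ 2) := by
    calc _ ≤ ∫⁻ y in Ioc (0 : ℝ) R, ofReal (g y) :=
          setLIntegral_mono' measurableSet_Ioc fun y hy => ENNReal.ofReal_le_ofReal (hf y hy.1 hy.2)
      _ = ofReal (∫ y in Ioc (0 : ℝ) R, g y) := by
          rw [ofReal_integral_eq_lintegral_ofReal]
          · exact (hg.integrableOn_Icc (μ := volume)).mono_set Ioc_subset_Icc_self
          · exact (ae_restrict_iff' measurableSet_Ioc).2 (ae_of_all _ fun y hy => hg0 y hy.1.le)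
      _ = ofReal (G R - G 0) := by
          rw [← intervalIntegral.integral_of_le hR, integral_eq_sub_of_hasDerivAt
            (fun y _ => hG y) (hg.intervalIntegrable _ _)]
      _ ≤ _ := ENNReal.ofReal_le_ofReal hGA
  calc _ ≤ ofReal (A ^ 2) ^ (1 / 2 : ℝ) := ENNReal.rpow_le_rpow h1 (by norm_num)
    _ = _ := by
      rw [ENNReal.ofReal_rpow_of_nonneg (by positivity) (by norm_num), ← sqrt_eq_rpow,
        sqrt_sq hA]

theorem hasDerivAt_scaled (β y : ℝ) : HasDerivAt (fun y => β ^ 2 * (1 + y ^ 2)) (β ^ 2 * (2 * y)) y := by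
  simpa using (hasDerivAt_one_add_sq y).const_mul (β ^ 2)

theorem hasDerivAt_neg_inv_sqrt (y : ℝ) : HasDerivAt (fun y => -(√(1 + y ^ 2))⁻¹)
    (1 / ((1 + y ^ 2) * √(1 + y ^ 2)) * y) y := by
  have hs := one_add_sq_pos y
  have h2 := (((hasDerivAt_one_add_sq y).sqrt hs.ne').inv (sqrt_pos.2 hs).ne').neg
  refine h2.congr_deriv ?_
  have h3 := sqrt_pos.2 hs
  rw [sq_sqrt hs.le]
  field_simp

/-- The weights `x^{-1/2} (1 + x)⁻¹`, with `x = β²σ`, and `σ^{-3/2}` are integrable in `y`. -/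
theorem radNorm_le_arctan {R A B₁ B₂ β : ℝ} {f : ℝ → ℝ} (hR : 0 ≤ R) (hA : 0 ≤ A) (hβ : 0 < β)
    (hB₁ : 0 ≤ B₁) (hB₂ : 0 ≤ B₂)
    (hf : ∀ y, 0 < y → y ≤ R → f y ^ 2 ≤ B₁ * (1 / (√(β ^ 2 * (1 + y ^ 2)) *
      (1 + β ^ 2 * (1 + y ^ 2)))) + B₂ * (1 / ((1 + y ^ 2) * √(1 + y ^ 2))))
    (hAB : 2 * B₁ / β ^ 2 + B₂ ≤ A ^ 2) : radNorm R f ≤ ofReal A := by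
  have hx : ∀ y, 0 < β ^ 2 * (1 + y ^ 2) := fun y => by positivity
  refine radNorm_le (g := fun y => B₁ * (1 / (√(β ^ 2 * (1 + y ^ 2)) *
      (1 + β ^ 2 * (1 + y ^ 2))) * y) + B₂ * (1 / ((1 + y ^ 2) * √(1 + y ^ 2)) * y))
    (G := fun y => B₁ * (arctan √(β ^ 2 * (1 + y ^ 2)) / β ^ 2) + B₂ * -(√(1 + y ^ 2))⁻¹)
    hR hA (fun y => ?_) ?_ (fun y hy => ?_) (fun y hy hyR => ?_) ?_
  · refine HasDerivAt.add (HasDerivAt.const_mul _ ?_) ((hasDerivAt_neg_inv_sqrt y).const_mul _)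
    have h1 := (((hasDerivAt_scaled β y).sqrt (hx y).ne').arctan).div_const (β ^ 2)
    refine h1.congr_deriv ?_
    rw [sq_sqrt (hx y).le]
    have := sqrt_pos.2 (hx y)
    have := hx y
    field_simp
  · have h1 : ∀ y : ℝ, √(β ^ 2 * (1 + y ^ 2)) * (1 + β ^ 2 * (1 + y ^ 2)) ≠ 0 := fun y =>
      (mul_pos (sqrt_pos.2 (hx y)) (by linarith [hx y])).ne'
    have h2 : ∀ y : ℝ, (1 + y ^ 2) * √(1 + y ^ 2) ≠ 0 := fun y =>
      (mul_pos (one_add_sq_pos y) (sqrt_pos.2 (one_add_sq_pos y))).ne'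
    fun_prop (disch := first | exact h1 | exact h2 | simp_all)
  · have := hx y
    positivity
  · calc _ ≤ _ := mul_le_mul_of_nonneg_right (hf y hy hyR) hy.le
      _ = _ := by ring
  · have h1 : arctan √(β ^ 2 * (1 + R ^ 2)) ≤ 2 := by
      linarith [arctan_lt_pi_div_two √(β ^ 2 * (1 + R ^ 2)), pi_lt_four]
    have h2 : 0 ≤ arctan √(β ^ 2 * (1 + 0 ^ 2)) := arctan_nonneg.2 (sqrt_nonneg _)
    have h3 : 0 ≤ (√(1 + R ^ 2))⁻¹ := by positivity
    refine le_trans ?_ hAB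
    have h4 : B₁ * (arctan √(β ^ 2 * (1 + R ^ 2)) / β ^ 2) ≤ 2 * B₁ / β ^ 2 := by
      rw [← mul_div_assoc]
      exact div_le_div_of_nonneg_right (by nlinarith) (by positivity)
    have h5 : 0 ≤ B₁ * (arctan √(β ^ 2 * (1 + 0 ^ 2)) / β ^ 2) := by positivity
    have h6 : 0 ≤ B₂ * (√(1 + R ^ 2))⁻¹ := by positivity
    have h7 : (√(1 + (0 : ℝ) ^ 2))⁻¹ = 1 := by simp
    rw [h7]
    linarith

/-- The weight `x^{-3/4}`, with `x = β²σ`, costs the growth of its antiderivative. -/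
theorem radNorm_le_quarter {R A B₁ B₂ β X : ℝ} {f : ℝ → ℝ} (hR : 0 ≤ R) (hA : 0 ≤ A) (hβ : 0 < β)
    (hB₁ : 0 ≤ B₁) (hB₂ : 0 ≤ B₂)
    (hf : ∀ y, 0 < y → y ≤ R → f y ^ 2 ≤ B₁ * (1 / (√(β ^ 2 * (1 + y ^ 2)) *
      √√(β ^ 2 * (1 + y ^ 2)))) + B₂ * (1 / ((1 + y ^ 2) * √(1 + y ^ 2))))
    (hX : √√(β ^ 2 * (1 + R ^ 2)) ≤ X)
    (hAB : 2 * B₁ * X / β ^ 2 + B₂ ≤ A ^ 2) : radNorm R f ≤ ofReal A := by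
  have hx : ∀ y, 0 < β ^ 2 * (1 + y ^ 2) := fun y => by positivity
  refine radNorm_le (g := fun y => B₁ * (1 / (√(β ^ 2 * (1 + y ^ 2)) *
      √√(β ^ 2 * (1 + y ^ 2))) * y) + B₂ * (1 / ((1 + y ^ 2) * √(1 + y ^ 2)) * y))
    (G := fun y => B₁ * (2 * √√(β ^ 2 * (1 + y ^ 2)) / β ^ 2) + B₂ * -(√(1 + y ^ 2))⁻¹)
    hR hA (fun y => ?_) ?_ (fun y hy => ?_) (fun y hy hyR => ?_) ?_
  · refine HasDerivAt.add (HasDerivAt.const_mul _ ?_) ((hasDerivAt_neg_inv_sqrt y).const_mul _)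
    have h2 := sqrt_pos.2 (hx y)
    have h3 := sqrt_pos.2 h2
    have h1 := ((((hasDerivAt_scaled β y).sqrt (hx y).ne').sqrt h2.ne').const_mul 2).div_const (β ^ 2)
    refine h1.congr_deriv ?_
    field_simp
  · have h1 : ∀ y : ℝ, √(β ^ 2 * (1 + y ^ 2)) * √√(β ^ 2 * (1 + y ^ 2)) ≠ 0 := fun y =>
      (mul_pos (sqrt_pos.2 (hx y)) (sqrt_pos.2 (sqrt_pos.2 (hx y)))).ne'
    have h2 : ∀ y : ℝ, (1 + y ^ 2) * √(1 + y ^ 2) ≠ 0 := fun y =>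
      (mul_pos (one_add_sq_pos y) (sqrt_pos.2 (one_add_sq_pos y))).ne'
    fun_prop (disch := first | exact h1 | exact h2 | simp_all)
  · have := hx y
    positivity
  · calc _ ≤ _ := mul_le_mul_of_nonneg_right (hf y hy hyR) hy.le
      _ = _ := by ring
  · have h2 : 0 ≤ √√(β ^ 2 * (1 + 0 ^ 2)) := sqrt_nonneg _
    refine le_trans ?_ hAB
    have h4 : B₁ * (2 * √√(β ^ 2 * (1 + R ^ 2)) / β ^ 2) ≤ 2 * B₁ * X / β ^ 2 := by
      rw [← mul_div_assoc]
      exact div_le_div_of_nonneg_right (by nlinarith) (by positivity)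
    have h5 : 0 ≤ B₁ * (2 * √√(β ^ 2 * (1 + 0 ^ 2)) / β ^ 2) := by positivity
    have h6 : 0 ≤ B₂ * (√(1 + R ^ 2))⁻¹ := by positivity
    have h7 : (√(1 + (0 : ℝ) ^ 2))⁻¹ = 1 := by simp
    rw [h7]
    linarith

/-- The norm over a bounded interval. -/
theorem radNorm_le_const {R A B : ℝ} {f : ℝ → ℝ} (hR : 0 ≤ R) (hA : 0 ≤ A) (hB : 0 ≤ B)
    (hf : ∀ y, 0 < y → y ≤ R → f y ^ 2 ≤ B) (hAB : B * R ^ 2 ≤ A ^ 2) :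
    radNorm R f ≤ ofReal A := by
  refine radNorm_le (g := fun y => B * y) (G := fun y => B * (y ^ 2 / 2)) hR hA (fun y => ?_)
    (by fun_prop) (fun y hy => by positivity)
    (fun y hy hyR => mul_le_mul_of_nonneg_right (hf y hy hyR) hy.le) ?_
  · refine HasDerivAt.const_mul _ ?_
    have := (hasDerivAt_pow 2 y).div_const 2
    refine this.congr_deriv ?_
    simp
  · nlinarith [mul_nonneg hB (sq_nonneg R)]

/-! ### Pointwise bounds of the error -/

/-- A majorant of `(1 + |log x|)²` for `x < 1` and of `x⁻² (1 + log x)²` for `x ≥ 1`. -/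
def logMaj (x : ℝ) : ℝ := 1 / (√x * ((1 + x) * √√(1 + x)))

theorem logMaj_pos {x : ℝ} (hx : 0 < x) : 0 < logMaj x := by
  have h1 : 0 < √x := sqrt_pos.2 hx
  have h2 : 0 < √√(1 + x) := sqrt_pos.2 (sqrt_pos.2 (by linarith))
  unfold logMaj
  positivity

theorem logMaj_le {x : ℝ} (hx : 0 < x) : logMaj x ≤ 1 / (√x * (1 + x)) := by
  have h1 : 0 < √x := sqrt_pos.2 hx
  have h2 : 1 ≤ √√(1 + x) := one_le_sqrt.2 (one_le_sqrt.2 (by linarith))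
  refine one_div_le_one_div_of_le (by positivity) (mul_le_mul_of_nonneg_left ?_ h1.le)
  exact le_mul_of_one_le_right (by linarith) h2

theorem mul_logMaj_le {x : ℝ} (hx : 0 < x) : x * logMaj x ≤ 1 / (√x * √√x) := by
  have h1 : 0 < √x := sqrt_pos.2 hx
  have h2 : 0 < √√x := sqrt_pos.2 h1
  have h3 : √√x ≤ √√(1 + x) := sqrt_le_sqrt (sqrt_le_sqrt (by linarith))
  rw [logMaj, mul_one_div, div_le_div_iff₀ (mul_pos h1 (mul_pos (by linarith) (h2.trans_le h3)))
    (by positivity)]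
  calc _ = √x * (x * √√x) := by ring
    _ ≤ √x * ((1 + x) * √√(1 + x)) := by gcongr; linarith
    _ = _ := by ring

theorem exists_log_sq_le_logMaj : ∃ C, 0 ≤ C ∧
    (∀ x, 0 < x → x < 1 → (1 + |log x|) ^ 2 ≤ C * logMaj x) ∧
    ∀ x, 1 ≤ x → (1 + log x) ^ 2 ≤ C * (x ^ 2 * logMaj x) := by
  obtain ⟨C₁, hC₁, h₁⟩ := exists_one_add_log_pow_le 2 (ε := 1 / 2) (by norm_num)
  obtain ⟨C₂, hC₂, h₂⟩ := exists_one_add_log_pow_le 2 (ε := 1 / 2 * (1 / 2)) (by norm_num)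
  refine ⟨4 * C₁ + 4 * C₂, by positivity, fun x hx hx1 => ?_, fun x hx => ?_⟩
  · have h3 := h₁ x⁻¹ ((one_le_inv₀ hx).2 hx1.le)
    rw [← sqrt_eq_rpow, log_inv, sqrt_inv] at h3
    rw [abs_of_nonpos (log_nonpos hx.le hx1.le)]
    have h4 : 0 < √x := sqrt_pos.2 hx
    have h5 : √√(1 + x) ≤ 2 := by
      rw [sqrt_le_left (by norm_num), sqrt_le_left (by norm_num)]
      linarith
    have h6 : 0 < √√(1 + x) := sqrt_pos.2 (sqrt_pos.2 (by linarith))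
    have h7 : (√x)⁻¹ ≤ 4 * logMaj x := by
      rw [logMaj, mul_one_div, inv_eq_one_div, div_le_div_iff₀ h4 (by positivity), one_mul,
        mul_comm 4]
      refine mul_le_mul_of_nonneg_left ?_ h4.le
      nlinarith
    have h8 := logMaj_pos hx
    calc _ ≤ C₁ * (√x)⁻¹ := h3
      _ ≤ C₁ * (4 * logMaj x) := by gcongr
      _ ≤ _ := by nlinarith [mul_nonneg hC₂ h8.le]
  · have hx0 : 0 < x := by linarith
    have h3 := h₂ x hx
    rw [rpow_mul hx0.le, ← sqrt_eq_rpow, ← sqrt_eq_rpow] at h3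
    have h4 : 0 < √x := sqrt_pos.2 hx0
    have h4' : 0 < √√x := sqrt_pos.2 h4
    have h5 : √√(1 + x) ≤ 2 * √√x := by
      have : √√(16 * x) = 2 * √√x := by
        rw [show (16 : ℝ) * x = 4 ^ 2 * x by ring, sqrt_mul (by norm_num),
          sqrt_sq (by norm_num), show (4 : ℝ) = 2 ^ 2 by norm_num, sqrt_mul (by norm_num),
          sqrt_sq (by norm_num)]
      rw [← this]
      exact sqrt_le_sqrt (sqrt_le_sqrt (by linarith))
    have h6 : 0 < √√(1 + x) := sqrt_pos.2 (sqrt_pos.2 (by linarith))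
    have h7 : √√x ≤ 4 * (x ^ 2 * logMaj x) := by
      rw [logMaj, mul_one_div, mul_div_assoc', le_div_iff₀ (by positivity)]
      have e1 := mul_self_sqrt hx0.le
      have e2 := mul_self_sqrt h4.le
      calc _ ≤ √√x * (√x * ((2 * x) * (2 * √√x))) := by gcongr; linarith
        _ = 4 * (x * (√x * (√√x * √√x))) := by ring
        _ = _ := by rw [e2, e1]; ring
    have h8 := logMaj_pos hx0
    calc _ ≤ C₂ * √√x := h3
      _ ≤ C₂ * (4 * (x ^ 2 * logMaj x)) := by gcongr
      _ ≤ _ := by nlinarith [mul_nonneg hC₁ (mul_pos (pow_pos hx0 2) h8).le]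

section

variable {L : ℕ} {b₀ K₀ : ℝ} {cc χ K S KN SN : ℝ → ℝ} {κ ς : ℕ → ℝ} {R : ℕ}

/-- The weight of the squared error; the first term is spread over the scale `b₁² σ ∼ 1`, the second
one is concentrated at `σ ∼ 1`. -/
def errW (β s : ℝ) : ℝ := logMaj (β ^ 2 * s) / |log β| ^ 2 + 1 / (s * √s)

theorem errW_nonneg {β s : ℝ} (hβ : 0 < β) (hs : 1 ≤ s) : 0 ≤ errW β s := by
  have := logMaj_pos (x := β ^ 2 * s) (by positivity)
  unfold errW
  positivity

/-- The powers of `y` left over by `adapted_eq_adS` and by the symbol bounds combine to `σ^{1-k}` for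
both parities of `k`. -/
theorem zpow_parity {s : ℝ} (hs : 1 ≤ s) (k : ℕ) :
    s ^ (1 + k % 2) * (s ^ (-(((k + 1) / 2 : ℕ) : ℤ))) ^ 2 = s ^ (1 - (k : ℤ)) := by
  have hs0 : s ≠ 0 := by linarith
  rw [← zpow_natCast, ← zpow_natCast, ← zpow_mul, ← zpow_add₀ hs0]
  congr 1
  push_cast
  omega

/-- A symbol bound with the outer weight becomes a bound for the square by the integrable weight
`errW`; `j` is the index of the coordinate of the error. -/
theorem exists_outer_sq_bound (hL : 3 ≤ L) (hR : 2 * R = L + 1) (hc : ModCoef b₀ cc) {j : ℕ}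
    (hj : j ≤ 1) {f : Par L b₀ K₀ → ℝ → ℝ}
    (hf : Sym (farOn (outD L b₀ K₀)) (fun p s => coord p.1 1 ^ (3 + j) * outW R p s) f) (k : ℕ) :
    ∃ C, 0 ≤ C ∧ ∀ (p : Par L b₀ K₀) (s : ℝ), (p, s) ∈ outD L b₀ K₀ → 1 ≤ s →
      s ^ (1 + k % 2) * adS k (f p) s ^ 2 ≤
        C * (coord p.1 1 ^ (2 * L + 6) * s ^ ((L : ℤ) + 1 - j - k) * errW (coord p.1 1) s) := by
  obtain ⟨C, hC, h⟩ := (hf.adS (fun p s h hs => by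
    have hβ := p.mem.1
    have := (inv_le_outW hc R h).1.le.trans (inv_le_outW hc R h).2
    positivity) k).exists_bound
  obtain ⟨C', hC', -, h'⟩ := exists_log_sq_le_logMaj
  refine ⟨C ^ 2 * C', by positivity, fun p s hp hs => ?_⟩
  have h1 := h p s ⟨hp, hs⟩
  have hβ := p.mem.1
  set β := coord p.1 1
  have hx : 1 ≤ β ^ 2 * s := hp.1
  have h2 := h' _ hx
  have hs0 : 0 < s := by linarith
  have hl := hc.one_le p.mem
  have hl0 : 0 < |log β| := by linarith
  have h3 := logMaj_pos (x := β ^ 2 * s) (by linarith)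
  have h4 : adS k (f p) s ^ 2 ≤ (C * (s ^ (-(((k + 1) / 2 : ℕ) : ℤ)) *
      (β ^ (3 + j) * outW R p s))) ^ 2 := sq_le_sq.2 (h1.trans (le_abs_self _))
  have hW : outW R p s ^ 2 ≤ C' * ((β ^ 2 * s) ^ (L - 1) * (logMaj (β ^ 2 * s) / |log β| ^ 2)) := by
    rw [outW, div_pow, mul_pow, ← pow_mul, mul_div_assoc', mul_div_assoc',
      show (R - 2) * 2 = L - 3 by omega, show L - 1 = L - 3 + 2 by omega, pow_add]
    refine div_le_div_of_nonneg_right ?_ (by positivity)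
    calc _ ≤ (β ^ 2 * s) ^ (L - 3) * (C' * ((β ^ 2 * s) ^ 2 * logMaj (β ^ 2 * s))) := by gcongr
      _ = _ := by ring
  have hpow : s ^ (1 - (k : ℤ)) * (β ^ (3 + j)) ^ 2 * (β ^ 2 * s) ^ (L - 1) ≤
      β ^ (2 * L + 6) * s ^ ((L : ℤ) + 1 - j - k) := by
    have e : s ^ (1 - (k : ℤ)) * s ^ (L - 1) = s ^ ((L : ℤ) + 1 - j - k) * s ^ j * s⁻¹ := by
      rw [← zpow_natCast, ← zpow_natCast s j, ← zpow_neg_one, ← zpow_add₀ hs0.ne',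
        ← zpow_add₀ hs0.ne', ← zpow_add₀ hs0.ne']
      congr 1
      push_cast [show 1 ≤ L by omega]
      ring
    have e2 : s⁻¹ * s ^ j * β ^ (2 * j) ≤ β ^ 2 := by
      have h5 : s⁻¹ ≤ β ^ 2 := (inv_le_iff_one_le_mul₀ hs0).2 hx
      interval_cases j
      · simpa using h5
      · rw [pow_one, inv_mul_cancel₀ hs0.ne', one_mul]
    calc _ = s ^ (1 - (k : ℤ)) * s ^ (L - 1) * β ^ (6 + 2 * j + 2 * (L - 1)) := by
          rw [mul_pow, ← pow_mul, ← pow_mul, pow_add, pow_add, show (3 + j) * 2 = 6 + 2 * j by ring,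
            pow_add]
          ring
      _ = β ^ (6 + 2 * (L - 1)) * s ^ ((L : ℤ) + 1 - j - k) * (s⁻¹ * s ^ j * β ^ (2 * j)) := by
          rw [e, pow_add, pow_add, pow_add]
          ring
      _ ≤ β ^ (6 + 2 * (L - 1)) * s ^ ((L : ℤ) + 1 - j - k) * β ^ 2 := by gcongr
      _ = _ := by
          rw [mul_right_comm, ← pow_add, show 6 + 2 * (L - 1) + 2 = 2 * L + 6 by omega]
  have hle : logMaj (β ^ 2 * s) / |log β| ^ 2 ≤ errW β s :=
    le_add_of_nonneg_right (by positivity)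
  calc _ ≤ s ^ (1 + k % 2) * (C * (s ^ (-(((k + 1) / 2 : ℕ) : ℤ)) *
          (β ^ (3 + j) * outW R p s))) ^ 2 := by gcongr
    _ = C ^ 2 * (s ^ (1 + k % 2) * (s ^ (-(((k + 1) / 2 : ℕ) : ℤ))) ^ 2) * (β ^ (3 + j)) ^ 2 *
          outW R p s ^ 2 := by ring
    _ ≤ C ^ 2 * s ^ (1 - (k : ℤ)) * (β ^ (3 + j)) ^ 2 *
          (C' * ((β ^ 2 * s) ^ (L - 1) * (logMaj (β ^ 2 * s) / |log β| ^ 2))) := by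
        rw [zpow_parity hs]
        exact mul_le_mul_of_nonneg_left hW (by positivity)
    _ = C ^ 2 * C' * ((s ^ (1 - (k : ℤ)) * (β ^ (3 + j)) ^ 2 * (β ^ 2 * s) ^ (L - 1)) *
          (logMaj (β ^ 2 * s) / |log β| ^ 2)) := by ring
    _ ≤ _ := by gcongr

theorem exists_psiOne_sq_bound (hL : 3 ≤ L) (hR : 2 * R = L + 1) (hc : ModCoef b₀ cc)
    (hχ : Cutoff χ) (k : ℕ) :
    ∃ C, 0 ≤ C ∧ ∀ (p : Par L b₀ K₀) (s : ℝ), 1 ≤ s →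
      coord p.1 1 ^ 2 * s ≤ 5 * |log (coord p.1 1)| ^ 4 →
      s ^ (1 + k % 2) * adS k (psiOne cc (cutCor χ cc κ ς) R p.1) s ^ 2 ≤
        C * (coord p.1 1 ^ (2 * L + 6) * s ^ ((L : ℤ) + 1 - k) * errW (coord p.1 1) s) := by
  obtain ⟨C, hC, h⟩ := exists_outer_sq_bound (j := 0) hL hR hc (by omega)
    (sym_psiOne_outer (K₀ := K₀) (κ := κ) (ς := ς) hR hc hχ) k
  refine ⟨C, hC, fun p s hs hx => ?_⟩
  rcases lt_or_ge (coord p.1 1 ^ 2 * s) 1 with h1 | h1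
  · rw [psiOne_adS_inner hχ k h1]
    have := errW_nonneg p.mem.1 hs
    have hβ := p.mem.1
    have hs0 : 0 < s := by linarith
    rw [zero_pow two_ne_zero, mul_zero]
    positivity
  · simpa using h p s ⟨h1, hx⟩ hs

theorem exists_psiTwo_sq_bound (hL : 3 ≤ L) (hR : 2 * R = L + 1) (hc : ModCoef b₀ cc)
    (hχ : Cutoff χ) (hK : Taylor L K κ KN) (hS : Taylor L S ς SN)
    (k : ℕ) :
    ∃ C, 0 ≤ C ∧ ∀ (p : Par L b₀ K₀) (s : ℝ), 1 ≤ s →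
      coord p.1 1 ^ 2 * s ≤ 5 * |log (coord p.1 1)| ^ 4 →
      s ^ (1 + k % 2) * adS k (psiTwo cc K S (cutCor χ cc κ ς) R p.1) s ^ 2 ≤
        C * (coord p.1 1 ^ (2 * L + 6) * s ^ ((L : ℤ) - k) * errW (coord p.1 1) s) := by
  obtain ⟨C, hC, h⟩ := exists_outer_sq_bound (j := 1) hL hR hc (by omega)
    (sym_psiTwo_outer (K₀ := K₀) (κ := κ) (ς := ς) hR hc hχ hK.smooth hS.smooth) k
  obtain ⟨c, h'⟩ := exists_psiTwo_inner_bound (K₀ := K₀) hR hc hχ hK hS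
  obtain ⟨C', hC', h'⟩ := h' k
  obtain ⟨A, hA, hlog, -⟩ := exists_log_sq_le_logMaj
  obtain ⟨B, hB, hlog'⟩ := exists_one_add_log_pow_le (c * 2) (ε := 1 / 2) (by norm_num)
  refine ⟨C + C' ^ 2 * (2 * (A + B)), by positivity, fun p s hs hx => ?_⟩
  have hW := errW_nonneg p.mem.1 hs
  have hβ := p.mem.1
  have hl := hc.one_le p.mem
  have hs0 : 0 < s := by linarith
  rw [add_mul]
  rcases lt_or_ge (coord p.1 1 ^ 2 * s) 1 with h1 | h1
  · refine le_add_of_nonneg_of_le (by positivity) ?_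
    have h2 := h' p s h1 hs
    set β := coord p.1 1
    set x := β ^ 2 * s with hxdef
    have hx0 : 0 < x := by positivity
    have h3 := hlog x hx0 h1
    have h4 := hlog' s hs
    rw [← sqrt_eq_rpow] at h4
    have hls := log_nonneg hs
    have hq : 0 < √s := sqrt_pos.2 hs0
    have e1 : ((1 + |log x|) / |log β| + (1 + log s) ^ c / s) ^ 2 ≤
        2 * (A + B) * errW β s := by
      have h5 : ((1 + |log x|) / |log β|) ^ 2 ≤ A * (logMaj x / |log β| ^ 2) := by
        rw [div_pow, mul_div_assoc']
        exact div_le_div_of_nonneg_right h3 (by positivity)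
      have h6 : ((1 + log s) ^ c / s) ^ 2 ≤ B * (1 / (s * √s)) := by
        rw [div_pow, ← pow_mul, mul_one_div, div_le_div_iff₀ (by positivity) (by positivity)]
        have := mul_self_sqrt hs0.le
        calc _ ≤ B * √s * (s * √s) := by gcongr
          _ = B * (s * (√s * √s)) := by ring
          _ = _ := by rw [this]; ring
      have h7 := (logMaj_pos hx0).le
      have h8 : 0 ≤ logMaj x / |log β| ^ 2 := by positivity
      have h9 : 0 ≤ 1 / (s * √s) := by positivity
      rw [errW, ← hxdef]
      nlinarith [sq_nonneg ((1 + |log x|) / |log β| - (1 + log s) ^ c / s),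
        mul_nonneg hA h9, mul_nonneg hB h8]
    set lw := (1 + |log x|) / |log β| + (1 + log s) ^ c / s
    calc _ ≤ s ^ (1 + k % 2) * (C' * (s ^ (-(((k + 1) / 2 : ℕ) : ℤ)) *
          (β ^ (L + 3) * (s ^ ((R : ℤ) - 1) * lw)))) ^ 2 :=
          mul_le_mul_of_nonneg_left (sq_le_sq.2 (h2.trans (le_abs_self _))) (by positivity)
      _ = C' ^ 2 * (s ^ (1 + k % 2) * (s ^ (-(((k + 1) / 2 : ℕ) : ℤ))) ^ 2 *
          (s ^ ((R : ℤ) - 1)) ^ 2) * β ^ (2 * L + 6) * lw ^ 2 := by ring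
      _ = C' ^ 2 * s ^ ((L : ℤ) - k) * β ^ (2 * L + 6) * lw ^ 2 := by
          rw [zpow_parity hs, ← zpow_natCast (s ^ ((R : ℤ) - 1)), ← zpow_mul, ← zpow_add₀ hs0.ne',
            show 1 - (k : ℤ) + ((R : ℤ) - 1) * (2 : ℕ) = L - k by push_cast; omega]
      _ ≤ C' ^ 2 * s ^ ((L : ℤ) - k) * β ^ (2 * L + 6) * (2 * (A + B) * errW β s) := by gcongr
      _ = _ := by ring
  · refine le_add_of_le_of_nonneg ?_ (by positivity)
    have := h p s ⟨h1, hx⟩ hs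
    rwa [show (L : ℤ) + 1 - (1 : ℕ) - k = L - k by push_cast; ring] at this

end

/-! ### Norms of the error -/

section

variable {L l : ℕ} {b₀ β B X : ℝ} {cc g F : ℝ → ℝ}

theorem one_le_of_mem (hc : ModCoef b₀ cc) (hβ : β ∈ Ioo 0 b₀) :
    0 < β ∧ β ≤ 1 ∧ 1 ≤ |log β| ∧ |log β| * β ≤ 1 :=
  ⟨hβ.1, (hc.lt_one hβ).2.le, hc.one_le hβ, hc.log_mul_le_one hβ⟩

theorem B1_nonneg (l : ℕ) (hβ : 0 < β) : 0 ≤ B1 l β := by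
  unfold B1
  positivity

theorem sq_mul_one_add_sq_le (hc : ModCoef b₀ cc) (hβ : β ∈ Ioo 0 b₀) {y : ℝ} (hy0 : 0 ≤ y)
    (hy : y ≤ 2 * B1 l β) : β ^ 2 * (1 + y ^ 2) ≤ 5 * |log β| ^ 4 := by
  obtain ⟨h0, h1, hl, -⟩ := one_le_of_mem hc hβ
  have h2 : β * y ≤ 2 * |log β| ^ 2 := by
    calc β * y ≤ β * (2 * B1 l β) := mul_le_mul_of_nonneg_left hy h0.le
      _ = 2 * |log β| ^ (1 + l % 2) := by
        rw [B1]
        field_simp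
      _ ≤ _ := mul_le_mul_of_nonneg_left (pow_le_pow_right₀ hl (by omega)) zero_le_two
  have h3 := pow_le_pow_left₀ (mul_nonneg h0.le hy0) h2 2
  have h4 : β ^ 2 ≤ |log β| ^ 4 := (pow_le_one₀ h0.le h1).trans (one_le_pow₀ hl)
  nlinarith

theorem one_add_log_le (hc : ModCoef b₀ cc) (hβ : β ∈ Ioo 0 b₀) {s : ℝ} (hs : 1 ≤ s)
    (hx : β ^ 2 * s ≤ 5 * |log β| ^ 4) : 1 + log s ≤ 12 * |log β| := by
  obtain ⟨h0, h1, hl, -⟩ := one_le_of_mem hc hβ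
  have h2 := hc.log_sq_mul hβ (show 0 < s by linarith)
  have h3 := log_le_log (by positivity) hx
  have hl0 : 0 < |log β| := by linarith
  rw [log_mul (x := 5) (by norm_num) (by positivity), log_pow] at h3
  have h4 := log_le_sub_one_of_pos (show (0 : ℝ) < 5 by norm_num)
  have h5 := log_le_sub_one_of_pos hl0
  push_cast at h3
  linarith

/-- At the top level both parts of the weight are integrable up to `b_1⁻² |log b_1|⁻²`. -/
theorem radNorm_le_top (hc : ModCoef b₀ cc) (hβ : β ∈ Ioo 0 b₀) (hX : 0 ≤ X) (hB : 0 ≤ B)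
    (hg : ∀ y, 0 < y → y ≤ X → g y ^ 2 ≤ B * (β ^ (2 * L + 6) * errW β (1 + y ^ 2))) :
    radNorm X g ≤ ofReal (√(3 * B) * (β ^ (L + 2) / |log β|)) := by
  obtain ⟨h0, h1, hl, hlβ⟩ := one_le_of_mem hc hβ
  have hl0 : 0 < |log β| := by linarith
  refine radNorm_le_arctan (B₁ := B * β ^ (2 * L + 6) / |log β| ^ 2)
    (B₂ := B * β ^ (2 * L + 6)) hX (by positivity) h0 (by positivity) (by positivity)
    (fun y hy hyX => ?_) ?_
  · have h2 := logMaj_le (x := β ^ 2 * (1 + y ^ 2)) (by positivity)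
    calc _ ≤ _ := hg y hy hyX
      _ = B * β ^ (2 * L + 6) / |log β| ^ 2 * logMaj (β ^ 2 * (1 + y ^ 2)) +
          B * β ^ (2 * L + 6) * (1 / ((1 + y ^ 2) * √(1 + y ^ 2))) := by
        rw [errW]
        ring
      _ ≤ _ := add_le_add_left (mul_le_mul_of_nonneg_left h2 (by positivity)) _
  · have h2 : β ^ 2 ≤ 1 / |log β| ^ 2 := by
      rw [le_div_iff₀ (by positivity)]
      nlinarith [mul_pos hl0 h0]
    rw [mul_pow, sq_sqrt (by positivity)]
    calc _ = 2 * B * β ^ (2 * L + 4) / |log β| ^ 2 + B * β ^ (2 * L + 4) * β ^ 2 := by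
          rw [show 2 * L + 6 = 2 * L + 4 + 2 by ring, pow_add β (2 * L + 4)]
          field_simp
      _ ≤ 2 * B * β ^ (2 * L + 4) / |log β| ^ 2 +
          B * β ^ (2 * L + 4) * (1 / |log β| ^ 2) :=
        add_le_add_right (mul_le_mul_of_nonneg_left h2 (by positivity)) _
      _ = _ := by
        rw [div_pow, ← pow_mul, show (L + 2) * 2 = 2 * L + 4 by ring]
        ring

/-- One level below, the weight is critical and the size of the region costs a factor `|log b_1|`. -/
theorem radNorm_le_subtop (hc : ModCoef b₀ cc) (hβ : β ∈ Ioo 0 b₀) (hX : 0 ≤ X) (hB : 0 ≤ B) {C : ℝ}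
    (hC : β * |log β| ^ 5 ≤ C) (hC0 : 0 ≤ C)
    (hXβ : ∀ y, 0 ≤ y → y ≤ X → β ^ 2 * (1 + y ^ 2) ≤ 5 * |log β| ^ 4)
    (hg : ∀ y, 0 < y → y ≤ X →
      g y ^ 2 ≤ B * (β ^ (2 * L + 6) * (1 + y ^ 2) * errW β (1 + y ^ 2))) :
    radNorm X g ≤ ofReal (√((4 + 5 * C) * B) *
      (β ^ (L + 1) / |log β| ^ (1 / 2 : ℝ))) := by
  obtain ⟨h0, h1, hl, hlβ⟩ := one_le_of_mem hc hβ
  have hl0 : 0 < |log β| := by linarith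
  rw [← sqrt_eq_rpow]
  refine radNorm_le_quarter (B₁ := B * β ^ (2 * L + 4) / |log β| ^ 2) (X := 2 * |log β|)
    (B₂ := 5 * B * β ^ (2 * L + 4) * |log β| ^ 4) hX (by positivity) h0 (by positivity)
    (by positivity) (fun y hy hyX => ?_) ?_ ?_
  · have h2 := mul_logMaj_le (x := β ^ 2 * (1 + y ^ 2)) (by positivity)
    have h3 := hXβ y hy.le hyX
    calc _ ≤ _ := hg y hy hyX
      _ = B * β ^ (2 * L + 4) / |log β| ^ 2 *
            (β ^ 2 * (1 + y ^ 2) * logMaj (β ^ 2 * (1 + y ^ 2))) +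
          B * β ^ (2 * L + 4) * (β ^ 2 * (1 + y ^ 2)) * (1 / ((1 + y ^ 2) * √(1 + y ^ 2))) := by
        rw [errW, show 2 * L + 6 = 2 * L + 4 + 2 by ring, pow_add β (2 * L + 4)]
        ring
      _ ≤ B * β ^ (2 * L + 4) / |log β| ^ 2 * (1 / (√(β ^ 2 * (1 + y ^ 2)) *
            √√(β ^ 2 * (1 + y ^ 2)))) +
          B * β ^ (2 * L + 4) * (5 * |log β| ^ 4) * (1 / ((1 + y ^ 2) * √(1 + y ^ 2))) := by
        gcongr
      _ = _ := by ring
  · rw [sqrt_le_left (by positivity), sqrt_le_left (by positivity)]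
    nlinarith [hXβ X hX le_rfl, pow_pos hl0 4]
  · rw [mul_pow, sq_sqrt (by positivity), div_pow, sq_sqrt hl0.le, ← pow_mul,
      show (L + 1) * 2 = 2 * L + 2 by ring]
    have h2 : β ^ 2 * |log β| ^ 4 ≤ C / |log β| := by
      rw [le_div_iff₀ hl0]
      calc _ = β * (β * |log β| ^ 5) := by ring
        _ ≤ 1 * (β * |log β| ^ 5) := by gcongr
        _ ≤ C := by rwa [one_mul]
    calc _ = 4 * B * β ^ (2 * L + 2) / |log β| +
          5 * B * β ^ (2 * L + 2) * (β ^ 2 * |log β| ^ 4) := by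
          rw [show 2 * L + 4 = 2 * L + 2 + 2 by ring, pow_add β (2 * L + 2)]
          field_simp
          ring
      _ ≤ 4 * B * β ^ (2 * L + 2) / |log β| +
          5 * B * β ^ (2 * L + 2) * (C / |log β|) :=
        add_le_add_right (mul_le_mul_of_nonneg_left h2 (by positivity)) _
      _ = _ := by ring

/-- `n` levels below the top, the size of the region costs `n` factors `b_1⁻² |log b_1|⁴`. -/
theorem radNorm_le_level (hc : ModCoef b₀ cc) (hβ : β ∈ Ioo 0 b₀) (hX : 0 ≤ X) (hB : 0 ≤ B) {n : ℕ}
    (hn : n ≤ L) (hXβ : ∀ y, 0 ≤ y → y ≤ X → β ^ 2 * (1 + y ^ 2) ≤ 5 * |log β| ^ 4)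
    (hg : ∀ y, 0 < y → y ≤ X →
      g y ^ 2 ≤ B * (β ^ (2 * L + 6) * (1 + y ^ 2) ^ n * errW β (1 + y ^ 2))) :
    radNorm X g ≤ ofReal (√(3 * 5 ^ L * B) *
      (β ^ (L + 2 - n) * |log β| ^ (2 * L))) := by
  obtain ⟨h0, h1, hl, hlβ⟩ := one_le_of_mem hc hβ
  have hl0 : 0 < |log β| := by linarith
  set q := |log β| ^ 2 / β with hq
  have hq0 : 0 < q := by positivity
  refine (radNorm_le_top (L := L) hc hβ hX (B := 5 ^ n * B * (q ^ n) ^ 2) (by positivity)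
    fun y hy hyX => (hg y hy hyX).trans ?_).trans (ENNReal.ofReal_le_ofReal ?_)
  · have h2 : (1 + y ^ 2) ^ n ≤ 5 ^ n * (q ^ n) ^ 2 := by
      rw [← pow_mul, mul_comm n, pow_mul, ← mul_pow]
      refine pow_le_pow_left₀ (by positivity) ?_ n
      rw [hq, div_pow, mul_div_assoc', le_div_iff₀ (by positivity), ← pow_mul]
      rw [mul_comm]
      exact hXβ y hy.le hyX
    have h3 := errW_nonneg h0 (show 1 ≤ 1 + y ^ 2 by nlinarith)
    calc _ ≤ B * (β ^ (2 * L + 6) * (5 ^ n * (q ^ n) ^ 2) * errW β (1 + y ^ 2)) := by gcongr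
      _ = _ := by ring
  · rw [← mul_assoc, sqrt_mul (by positivity), sqrt_sq (by positivity), mul_assoc]
    refine mul_le_mul (sqrt_le_sqrt ?_) ?_ (by positivity) (by positivity)
    · rw [← mul_assoc]
      exact mul_le_mul_of_nonneg_right (mul_le_mul_of_nonneg_left
        (pow_le_pow_right₀ (by norm_num) hn) (by norm_num)) hB
    · calc _ = β ^ (L + 2 - n) * (|log β| ^ (2 * n) / |log β|) := by
            rw [hq, div_pow, ← pow_mul, show β ^ (L + 2) = β ^ (L + 2 - n) * β ^ n by
              rw [← pow_add]; congr 1; omega]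
            field_simp
        _ ≤ β ^ (L + 2 - n) * |log β| ^ (2 * L) := by
            gcongr
            exact (div_le_self (by positivity) hl).trans (pow_le_pow_right₀ hl (by omega))

theorem adapted_sq_le (hF : SmoothPos F) (k : ℕ) {y : ℝ} (hy : 0 < y) :
    adapted k (fun x => x * F (1 + x ^ 2)) y ^ 2 ≤
      (1 + y ^ 2) ^ (1 + k % 2) * adS k F (1 + y ^ 2) ^ 2 := by
  rw [adapted_eq_adS k hF y hy, mul_pow, ← pow_mul, mul_comm (1 + k % 2), pow_mul]
  gcongr
  linarith

theorem weighted_adapted_sq_le (hF : SmoothPos F) (k j : ℕ) {y : ℝ} (hy : 0 < y) :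
    ((1 + |log y|) / (1 + y ^ j) * adapted k (fun x => x * F (1 + x ^ 2)) y) ^ 2 *
        (1 + y ^ 2) ^ j ≤
      4 * 2 ^ j * (1 + log (1 + y ^ 2)) ^ 2 *
        ((1 + y ^ 2) ^ (1 + k % 2) * adS k F (1 + y ^ 2) ^ 2) := by
  have hs : 1 ≤ 1 + y ^ 2 := by nlinarith
  have hls := log_nonneg hs
  have h1 : (1 + |log y|) * y ≤ 2 * ((1 + log (1 + y ^ 2)) * √(1 + y ^ 2)) := by
    have hq : 1 ≤ √(1 + y ^ 2) := one_le_sqrt.2 hs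
    have hyq : y ≤ √(1 + y ^ 2) := le_sqrt_of_sq_le (by linarith)
    have h2 : 0 ≤ log (1 + y ^ 2) * √(1 + y ^ 2) := by positivity
    rcases le_or_gt 1 y with h | h
    · have h3 : log y ≤ log (1 + y ^ 2) := log_le_log hy (by nlinarith)
      rw [abs_of_nonneg (log_nonneg h)]
      calc _ ≤ (1 + log (1 + y ^ 2)) * √(1 + y ^ 2) := by gcongr
        _ ≤ _ := by nlinarith
    · have h3 := abs_log_mul_self_lt y hy h.le
      rw [abs_mul, abs_of_pos hy] at h3
      nlinarith
  have h2 : (1 + y ^ 2) ^ j ≤ 2 ^ j * (1 + y ^ j) ^ 2 := by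
    have hyj : 0 < y ^ j := pow_pos hy j
    have h3 := add_pow_le zero_le_one (sq_nonneg y) j
    rw [one_pow, ← pow_mul, mul_comm 2 j, pow_mul] at h3
    calc _ ≤ 2 ^ (j - 1) * (1 + (y ^ j) ^ 2) := h3
      _ ≤ _ := mul_le_mul (pow_le_pow_right₀ one_le_two (by omega)) (by nlinarith) (by positivity)
        (by positivity)
  have h3 : ((1 + |log y|) * y) ^ 2 ≤ 4 * (1 + log (1 + y ^ 2)) ^ 2 * (1 + y ^ 2) := by
    refine (pow_le_pow_left₀ (by positivity) h1 2).trans_eq ?_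
    rw [mul_pow, mul_pow, sq_sqrt (by linarith)]
    ring
  have h4 : (y ^ (k % 2)) ^ 2 ≤ (1 + y ^ 2) ^ (k % 2) := by
    rw [← pow_mul, mul_comm, pow_mul]
    gcongr
    linarith
  rw [adapted_eq_adS k hF y hy, div_mul_eq_mul_div, div_pow, div_mul_eq_mul_div,
    div_le_iff₀ (by positivity)]
  calc _ = ((1 + |log y|) * y) ^ 2 * (y ^ (k % 2)) ^ 2 * adS k F (1 + y ^ 2) ^ 2 *
        (1 + y ^ 2) ^ j := by
        rw [pow_add]
        ring
    _ ≤ 4 * (1 + log (1 + y ^ 2)) ^ 2 * (1 + y ^ 2) * (1 + y ^ 2) ^ (k % 2) *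
          adS k F (1 + y ^ 2) ^ 2 * (2 ^ j * (1 + y ^ j) ^ 2) := by gcongr
    _ = _ := by
        rw [pow_add]
        ring

/-- The two kinds of norms in terms of a bound of one component of the error. -/
theorem radNorm_adapted_le (hc : ModCoef b₀ cc) (hβ : β ∈ Ioo 0 b₀) (hF : SmoothPos F) {k N : ℕ}
    (hB : 0 ≤ B)
    (hg : ∀ s, 1 ≤ s → β ^ 2 * s ≤ 5 * |log β| ^ 4 →
      s ^ (1 + k % 2) * adS k F s ^ 2 ≤ B * (β ^ (2 * L + 6) * s ^ N * errW β s)) :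
    (N = 0 → radNorm (2 * B1 l β) (adapted k fun x => x * F (1 + x ^ 2)) ≤
      ofReal (√(3 * B) * (β ^ (L + 2) / |log β|))) ∧
    (∀ C, β * |log β| ^ 5 ≤ C → 0 ≤ C → N = 1 →
      radNorm (2 * B1 l β) (adapted k fun x => x * F (1 + x ^ 2)) ≤
        ofReal (√((4 + 5 * C) * B) * (β ^ (L + 1) / |log β| ^ (1 / 2 : ℝ)))) ∧
    (N ≤ L → radNorm (2 * B1 l β) (adapted k fun x => x * F (1 + x ^ 2)) ≤
      ofReal (√(3 * 5 ^ L * B) * (β ^ (L + 2 - N) * |log β| ^ (2 * L)))) ∧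
    ∀ j n, j + n = N → n ≤ L → j ≤ L + 1 →
      radNorm (2 * B1 l β) (fun y => (1 + |log y|) / (1 + y ^ j) *
        adapted k (fun x => x * F (1 + x ^ 2)) y) ≤
      ofReal (√(3 * 5 ^ L * (576 * 2 ^ (L + 1) * B)) *
        (β ^ (L + 2 - n) * |log β| ^ (2 * L + 1))) := by
  have hX : 0 ≤ 2 * B1 l β := mul_nonneg zero_le_two (B1_nonneg l hβ.1)
  have hXβ : ∀ y, 0 ≤ y → y ≤ 2 * B1 l β → β ^ 2 * (1 + y ^ 2) ≤ 5 * |log β| ^ 4 :=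
    fun y hy0 hy => sq_mul_one_add_sq_le hc hβ hy0 hy
  have hs : ∀ y : ℝ, 1 ≤ 1 + y ^ 2 := fun y => by nlinarith
  have hg' : ∀ y, 0 < y → y ≤ 2 * B1 l β → adapted k (fun x => x * F (1 + x ^ 2)) y ^ 2 ≤
      B * (β ^ (2 * L + 6) * (1 + y ^ 2) ^ N * errW β (1 + y ^ 2)) := fun y hy hyX =>
    (adapted_sq_le hF k hy).trans (hg _ (hs y) (hXβ y hy.le hyX))
  refine ⟨fun h => radNorm_le_top hc hβ hX hB fun y hy hyX => ?_,
    fun C hC hC0 h => radNorm_le_subtop hc hβ hX hB hC hC0 hXβ fun y hy hyX => ?_,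
    fun h => radNorm_le_level hc hβ hX hB h hXβ hg', fun j n hN hn hj => ?_⟩
  · simpa [h] using hg' y hy hyX
  · simpa [h] using hg' y hy hyX
  · obtain ⟨h0, h1, hl, hlβ⟩ := one_le_of_mem hc hβ
    have hl0 : 0 < |log β| := by linarith
    refine (radNorm_le_level (L := L) (n := n) (B := 576 * 2 ^ (L + 1) * B * |log β| ^ 2) hc hβ
      hX (by positivity) hn hXβ fun y hy hyX => ?_).trans_eq ?_
    · have h2 := weighted_adapted_sq_le hF k j hy
      have h3 := hg _ (hs y) (hXβ y hy.le hyX)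
      have h4 := one_add_log_le hc hβ (hs y) (hXβ y hy.le hyX)
      have h5 := log_nonneg (hs y)
      have h6 := errW_nonneg h0 (hs y)
      have h7 : (2 : ℝ) ^ j ≤ 2 ^ (L + 1) := pow_le_pow_right₀ one_le_two hj
      refine le_of_mul_le_mul_right (h2.trans ?_) (show 0 < (1 + y ^ 2) ^ j by positivity)
      calc _ ≤ 4 * 2 ^ (L + 1) * (12 * |log β|) ^ 2 *
            (B * (β ^ (2 * L + 6) * (1 + y ^ 2) ^ N * errW β (1 + y ^ 2))) := by gcongr
        _ = _ := by
          rw [← hN, pow_add (1 + y ^ 2)]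
          ring
    · rw [← mul_assoc (3 * 5 ^ L), sqrt_mul (by positivity), sqrt_sq hl0.le]
      congr 1
      ring

end

section

variable {L : ℕ} {b₀ K₀ : ℝ} {cc χ K S KN SN : ℝ → ℝ} {κ ς : ℕ → ℝ} {R : ℕ}

/-- Near the origin the second component of the error is of size `b_1^(L+3)`: the logarithm of
`b_1² σ` is compensated by the factor `|log b_1|⁻¹`. -/
theorem radNorm_le_local {β M C : ℝ} {c k : ℕ} {F : ℝ → ℝ} (hc : ModCoef b₀ cc) (hβ : β ∈ Ioo 0 b₀)
    (hM : 1 ≤ M) (hMβ : β ^ 2 * (1 + (2 * M) ^ 2) < 1) (hC : 0 ≤ C) (hF : SmoothPos F)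
    (h : ∀ s, β ^ 2 * s < 1 → 1 ≤ s → |adS k F s| ≤ C * (s ^ (-(((k + 1) / 2 : ℕ) : ℤ)) *
      (β ^ (L + 3) * (s ^ ((R : ℤ) - 1) * ((1 + |log (β ^ 2 * s)|) / |log β| +
        (1 + log s) ^ c / s))))) :
    radNorm (2 * M) (adapted k fun x => x * F (1 + x ^ 2)) ≤
      ofReal (C * ((1 + (2 * M) ^ 2) ^ (R + 2) * (3 + log (1 + (2 * M) ^ 2) +
        (1 + log (1 + (2 * M) ^ 2)) ^ c)) * (2 * M) * β ^ (L + 3)) := by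
  obtain ⟨h0, h1, hl, -⟩ := one_le_of_mem hc hβ
  set τ := 1 + (2 * M) ^ 2 with hτ
  have hτ1 : 1 ≤ τ := by nlinarith
  have hlτ := log_nonneg hτ1
  refine radNorm_le_const (B := (C * (τ ^ (R + 2) * (3 + log τ + (1 + log τ) ^ c)) *
    β ^ (L + 3)) ^ 2) (by linarith) (by positivity) (by positivity) (fun y hy hyM => ?_)
    (le_of_eq (by ring))
  set s := 1 + y ^ 2 with hs
  have hs1 : 1 ≤ s := by nlinarith
  have hs0 : 0 < s := by linarith
  have hsτ : s ≤ τ := by rw [hs, hτ]; nlinarith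
  have hls := log_nonneg hs1
  have hlog : log s ≤ log τ := log_le_log hs0 hsτ
  have hx : β ^ 2 * s < 1 := (mul_le_mul_of_nonneg_left hsτ (sq_nonneg β)).trans_lt hMβ
  have h2 : (1 + |log (β ^ 2 * s)|) / |log β| ≤ 3 + log τ := by
    rw [div_le_iff₀ (by linarith)]
    have h3 := hc.log_sq_mul hβ hs0
    have h4 := log_nonpos (show 0 ≤ β ^ 2 * s by positivity) hx.le
    rw [abs_of_nonpos h4]
    nlinarith
  have h3 : (1 + log s) ^ c / s ≤ (1 + log τ) ^ c :=
    (div_le_self (by positivity) hs1).trans (pow_le_pow_left₀ (by linarith) (by linarith) c)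
  have h4 : s ^ (-(((k + 1) / 2 : ℕ) : ℤ)) ≤ 1 := zpow_le_one_of_nonpos₀ hs1 (by omega)
  have h5 : s ^ ((R : ℤ) - 1) ≤ τ ^ R :=
    (zpow_le_zpow_right₀ hs1 (show (R : ℤ) - 1 ≤ R by omega)).trans
      (by rw [zpow_natCast]; exact pow_le_pow_left₀ hs0.le hsτ R)
  have h6 : y ^ (1 + k % 2) ≤ τ ^ 2 := by
    have : y ≤ s := by rw [hs]; nlinarith [sq_nonneg (y - 1)]
    exact (pow_le_pow_left₀ hy.le (this.trans hsτ) _).trans (pow_le_pow_right₀ hτ1 (by omega))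
  rw [adapted_eq_adS k hF y hy, ← hs]
  refine sq_le_sq.2 ?_
  rw [abs_mul, abs_of_pos (pow_pos hy _)]
  refine le_trans ?_ (le_abs_self _)
  calc _ ≤ τ ^ 2 * (C * (1 * (β ^ (L + 3) * (τ ^ R * (3 + log τ + (1 + log τ) ^ c))))) := by
        refine mul_le_mul h6 ((h s hx hs1).trans ?_) (abs_nonneg _) (by positivity)
        gcongr
    _ = _ := by
        rw [pow_add]
        ring

theorem radNorm_add_le {X A B C : ℝ} {f g : ℝ → ℝ} (hA : 0 ≤ A) (hB : 0 ≤ B)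
    (hf : radNorm X f ≤ ofReal A) (hg : radNorm X g ≤ ofReal B) (h : A + B ≤ C) :
    radNorm X f + radNorm X g ≤ ofReal C :=
  (add_le_add hf hg).trans (by
    rw [← ENNReal.ofReal_add hA hB]
    exact ENNReal.ofReal_le_ofReal h)

end

end WaveMap

end

open WaveMap

theorem mainTheorem4 (ℓ : ℕ) (hℓ : 2 ≤ ℓ) (χ : ℝ → ℝ) (hχ : ContDiff ℝ ∞ χ)
    (hχ_one : ∀ r : ℝ, r ≤ 1 → χ r = 1) (hχ_zero : ∀ r : ℝ, 2 ≤ r → χ r = 0) :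
    ∃ (b₀ M₀ : ℝ) (bstar : ℝ → ℝ)
      (S : ℕ → (Fin (WaveMap.bigL ℓ) → ℝ) → ℝ → ℝ × ℝ)
      (ψ : (Fin (WaveMap.bigL ℓ) → ℝ) → ℝ → ℝ × ℝ),
      0 < b₀ ∧ b₀ < 1 ∧ 0 < M₀ ∧
      (∀ M : ℝ, M₀ ≤ M → 0 < bstar M ∧ bstar M ≤ b₀) ∧
      -- the corrections `S_i`
      (∀ i : ℕ, 1 ≤ i → i ≤ WaveMap.bigL ℓ + 2 →
        WaveMap.Homogeneous b₀ i (i : ℤ) (i % 2) i (S i)) ∧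
      (∀ b ∈ WaveMap.dom (WaveMap.bigL ℓ) b₀, ∀ y : ℝ, 0 ≤ y → S 1 b y = 0) ∧
      (∀ (i : ℕ) (j : Fin (WaveMap.bigL ℓ)), 2 ≤ i → i ≤ (j : ℕ) + 1 →
        ∀ b ∈ WaveMap.dom (WaveMap.bigL ℓ) b₀, ∀ y : ℝ, 0 ≤ y →
          WaveMap.partialB j (S i) b y = 0) ∧
      -- the equation along every `C¹` map `b` on an interval
      (∀ (I : Set ℝ) (b : ℝ → Fin (WaveMap.bigL ℓ) → ℝ), I.OrdConnected →
        ContDiffOn ℝ 1 b I → (∀ s ∈ I, b s ∈ WaveMap.dom (WaveMap.bigL ℓ) b₀) →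
        ∀ s ∈ I, ∀ y : ℝ, 0 < y →
          ∃ D : ℝ × ℝ,
            HasDerivWithinAt (fun σ => WaveMap.profile S (b σ) y) D I s ∧
            D - WaveMap.F (WaveMap.profile S (b s)) y
                + WaveMap.coord (b s) 1 • WaveMap.LamVec (WaveMap.profile S (b s)) y
              = WaveMap.modTerm χ S (b s) (derivWithin b I s) y + ψ (b s) y) ∧
      -- the bounds on the error
      (∃ p : ℕ, ∀ K : ℝ, 0 < K → ∃ C : ℝ, 0 < C ∧ ∃ CM : ℝ → ℝ, ∀ M : ℝ, M₀ ≤ M →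
        ∀ b ∈ WaveMap.dom (WaveMap.bigL ℓ) (bstar M),
        (∀ k : ℕ, 1 ≤ k → k ≤ WaveMap.bigL ℓ →
          |WaveMap.coord b k| ≤ K * WaveMap.coord b 1 ^ k) →
        -- (i) global bounds
        (∀ k : ℕ, 2 ≤ k → k + 1 ≤ WaveMap.bigL ℓ →
          WaveMap.radNorm (2 * WaveMap.B1 ℓ (WaveMap.coord b 1))
              (WaveMap.adapted k fun y => (ψ b y).1)
            + WaveMap.radNorm (2 * WaveMap.B1 ℓ (WaveMap.coord b 1))
              (WaveMap.adapted (k - 1) fun y => (ψ b y).2)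
            ≤ ENNReal.ofReal (C * (WaveMap.coord b 1 ^ (k + 1)
                * |Real.log (WaveMap.coord b 1)| ^ p))) ∧
        (WaveMap.radNorm (2 * WaveMap.B1 ℓ (WaveMap.coord b 1))
              (WaveMap.adapted (WaveMap.bigL ℓ) fun y => (ψ b y).1)
            + WaveMap.radNorm (2 * WaveMap.B1 ℓ (WaveMap.coord b 1))
              (WaveMap.adapted (WaveMap.bigL ℓ - 1) fun y => (ψ b y).2)
            ≤ ENNReal.ofReal (C * (WaveMap.coord b 1 ^ (WaveMap.bigL ℓ + 1)
                / |Real.log (WaveMap.coord b 1)| ^ (1 / 2 : ℝ)))) ∧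
        (WaveMap.radNorm (2 * WaveMap.B1 ℓ (WaveMap.coord b 1))
              (WaveMap.adapted (WaveMap.bigL ℓ + 1) fun y => (ψ b y).1)
            + WaveMap.radNorm (2 * WaveMap.B1 ℓ (WaveMap.coord b 1))
              (WaveMap.adapted (WaveMap.bigL ℓ) fun y => (ψ b y).2)
            ≤ ENNReal.ofReal (C * (WaveMap.coord b 1 ^ (WaveMap.bigL ℓ + 2)
                / |Real.log (WaveMap.coord b 1)|))) ∧
        -- (ii) logarithmic weighted bounds
        (∀ m k : ℕ, 1 ≤ m → k ≤ m → m ≤ WaveMap.bigL ℓ + 1 →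
          WaveMap.radNorm (2 * WaveMap.B1 ℓ (WaveMap.coord b 1))
              (fun y => (1 + |Real.log y|) / (1 + y ^ (m - k))
                * WaveMap.adapted k (fun x => (ψ b x).1) y)
            ≤ ENNReal.ofReal (C * (WaveMap.coord b 1 ^ (m + 1)
                * |Real.log (WaveMap.coord b 1)| ^ p))) ∧
        (∀ m k : ℕ, 1 ≤ m → k ≤ m → m ≤ WaveMap.bigL ℓ →
          WaveMap.radNorm (2 * WaveMap.B1 ℓ (WaveMap.coord b 1))
              (fun y => (1 + |Real.log y|) / (1 + y ^ (m - k))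
                * WaveMap.adapted k (fun x => (ψ b x).2) y)
            ≤ ENNReal.ofReal (C * (WaveMap.coord b 1 ^ (m + 2)
                * |Real.log (WaveMap.coord b 1)| ^ p))) ∧
        -- (iii) improved local bound
        (∀ k : ℕ, 2 ≤ k → k ≤ WaveMap.bigL ℓ + 1 →
          WaveMap.radNorm (2 * M) (WaveMap.adapted k fun y => (ψ b y).1)
            + WaveMap.radNorm (2 * M) (WaveMap.adapted (k - 1) fun y => (ψ b y).2)
            ≤ ENNReal.ofReal (CM M * WaveMap.coord b 1 ^ (WaveMap.bigL ℓ + 3)))) := by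
  have hL : 3 ≤ bigL ℓ := by
    unfold bigL
    omega
  obtain ⟨R, hR⟩ : ∃ R, 2 * R = bigL ℓ + 1 := ⟨(bigL ℓ + 1) / 2, by
    unfold bigL
    omega⟩
  have hL0 : 0 < bigL ℓ := by omega
  obtain ⟨b₀, hc⟩ := exists_modCoef ⟨hχ, hχ_one, hχ_zero⟩
  obtain ⟨K, S, hKs, hSs, hcos, hsin⟩ := exists_even_nonlin
  obtain ⟨κ, hκ⟩ := exists_taylor_coeff isOpen_univ convex_univ (mem_univ 0) hKs.contDiffOn
  obtain ⟨ς, hς⟩ := exists_taylor_coeff isOpen_univ convex_univ (mem_univ 0) hSs.contDiffOn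
  obtain ⟨KN, hKN, hKN'⟩ := hκ (bigL ℓ)
  obtain ⟨SN, hSN, hSN'⟩ := hς (bigL ℓ)
  simp only [sub_zero, mem_univ, forall_const] at hKN' hSN'
  have hK : Taylor (bigL ℓ) K κ KN := ⟨hKN', contDiffOn_univ.1 hKN⟩
  have hS : Taylor (bigL ℓ) S ς SN := ⟨hSN', contDiffOn_univ.1 hSN⟩
  replace hχ : Cutoff χ := ⟨hχ, hχ_one, hχ_zero⟩
  set cc : ℝ → ℝ := fun b => 4 / cutMass χ b with hcc
  refine ⟨b₀, 1, fun M => b₀ / (1 + 2 * M), corS χ cc κ ς,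
    psiVec cc K S (cutCor χ cc κ ς) R, hc.pos, by linarith [hc.le], one_pos,
    fun M hM => ⟨div_pos hc.pos (by linarith), div_le_self hc.pos.le (by linarith)⟩,
    fun i _ _ => homogeneous_corS hL0 hc hχ i, fun b _ y _ => ?_,
    fun i j hi hij b hb y _ =>
      partialB_corS_eq_zero hL0 hc hχ hi hij hb y,
    fun I b _ hb hI s hs y hy => profile_equation hR hc (fun _ => rfl) hχ hcos hsin
      (hI s hs) ((hb.differentiableOn one_ne_zero) s hs).hasDerivWithinAt hy,
    2 * bigL ℓ + 1, fun K₀ _ => ?_⟩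
  · simp [corS, cutCor, cor_of_lt, place]
  generalize bigL ℓ = L at *
  choose C₁ hC₁ hb₁ using exists_psiOne_sq_bound (K₀ := K₀) (κ := κ) (ς := ς) hL hR hc hχ
  choose C₂ hC₂ hb₂ using exists_psiTwo_sq_bound (K₀ := K₀) hL hR hc hχ hK hS
  obtain ⟨c, h₃⟩ := exists_psiTwo_inner_bound (K₀ := K₀) hR hc hχ hK hS
  choose C₃ hC₃ hb₃ using h₃
  obtain ⟨C₅, hC₅, hb₅⟩ := exists_mul_abs_log_pow_le 5
  -- One constant for the finitely many derivatives in question.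
  set D := ∑ k ∈ Finset.range (L + 2), (C₁ k + C₂ k) with hD
  have hCD : ∀ k ≤ L + 1, C₁ k ≤ D ∧ C₂ k ≤ D := fun k hk => by
    have := Finset.single_le_sum (f := fun k => C₁ k + C₂ k)
      (fun i _ => add_nonneg (hC₁ i) (hC₂ i)) (Finset.mem_range.2 (show k < L + 2 by omega))
    exact ⟨by linarith [hC₂ k], by linarith [hC₁ k]⟩
  have hD0 : 0 ≤ D := Finset.sum_nonneg fun k _ => add_nonneg (hC₁ k) (hC₂ k)
  set D₃ := ∑ k ∈ Finset.range (L + 2), C₃ k with hD₃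
  have hCD₃ : ∀ k ≤ L + 1, C₃ k ≤ D₃ := fun k hk =>
    Finset.single_le_sum (fun i _ => hC₃ i) (Finset.mem_range.2 (show k < L + 2 by omega))
  have hD₃0 : 0 ≤ D₃ := Finset.sum_nonneg fun k _ => hC₃ k
  set A := √(3 * D) + √((4 + 5 * C₅) * D) + √(3 * 5 ^ L * D) +
    √(3 * 5 ^ L * (576 * 2 ^ (L + 1) * D)) with hA
  have a₁ := Real.sqrt_nonneg (3 * D)
  have a₂ := Real.sqrt_nonneg ((4 + 5 * C₅) * D)
  have a₃ := Real.sqrt_nonneg (3 * 5 ^ L * D)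
  have a₄ := Real.sqrt_nonneg (3 * 5 ^ L * (576 * 2 ^ (L + 1) * D))
  -- Adding two norms with the same bound.
  have hadd : ∀ {X a x : ℝ} {f g : ℝ → ℝ}, 0 ≤ a → 0 ≤ x → a ≤ A →
      radNorm X f ≤ ENNReal.ofReal (a * x) → radNorm X g ≤ ENNReal.ofReal (a * x) →
      radNorm X f + radNorm X g ≤ ENNReal.ofReal ((2 * A + 1) * x) := fun ha hx h hf hg =>
    radNorm_add_le (mul_nonneg ha hx) (mul_nonneg ha hx) hf hg (by nlinarith)
  refine ⟨2 * A + 1, by linarith, fun M => D₃ * ((1 + (2 * M) ^ 2) ^ (R + 2) *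
    (3 + Real.log (1 + (2 * M) ^ 2) + (1 + Real.log (1 + (2 * M) ^ 2)) ^ c)) * (2 * M),
    fun M hM b hb hbK => ?_⟩
  have hbM : coord b 1 * (1 + 2 * M) < b₀ := (lt_div_iff₀ (by linarith)).1 hb.2
  have hβ : coord b 1 ∈ Ioo 0 b₀ := ⟨hb.1, by nlinarith [hb.1]⟩
  set p : Par L b₀ K₀ := ⟨b, hβ, hbK⟩ with hp
  have hF₁ : SmoothPos (psiOne cc (cutCor χ cc κ ς) R b) :=
    (sym_psiOne_outer (K₀ := K₀) (κ := κ) (ς := ς) hR hc hχ 0).1 p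
  have hF₂ : SmoothPos (psiTwo cc K S (cutCor χ cc κ ς) R b) :=
    (sym_psiTwo_outer (K₀ := K₀) (κ := κ) (ς := ς) hR hc hχ hK.smooth hS.smooth 0).1 p
  obtain ⟨h0, h1, hl, -⟩ := one_le_of_mem hc hβ
  have hβ5 := hb₅ _ (hc.lt_one hβ)
  have key₁ := fun k (hk : k ≤ L + 1) => radNorm_adapted_le (L := L) (l := ℓ) (k := k)
    (N := L + 1 - k) hc hβ hF₁ hD0 fun s hs hx => (hb₁ k p s hs hx).trans (by
      have := errW_nonneg h0 hs
      have hs0 : 0 < s := by linarith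
      rw [show (L : ℤ) + 1 - k = (L + 1 - k : ℕ) by omega, zpow_natCast]
      exact mul_le_mul_of_nonneg_right (hCD k hk).1 (by positivity))
  have key₂ := fun k (hk : k ≤ L) => radNorm_adapted_le (L := L) (l := ℓ) (k := k)
    (N := L - k) hc hβ hF₂ hD0 fun s hs hx => (hb₂ k p s hs hx).trans (by
      have := errW_nonneg h0 hs
      have hs0 : 0 < s := by linarith
      rw [show (L : ℤ) - k = (L - k : ℕ) by omega, zpow_natCast]
      exact mul_le_mul_of_nonneg_right (hCD k (by omega)).2 (by positivity))
  have hlog : |Real.log (coord b 1)| ^ (2 * L) ≤ |Real.log (coord b 1)| ^ (2 * L + 1) :=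
    pow_le_pow_right₀ hl (by omega)
  refine ⟨fun k hk hkL => ?_, ?_, ?_, fun m k hm hk hmL => ?_, fun m k hm hk hmL => ?_,
    fun k hk hkL => ?_⟩
  · have e₁ := (key₁ k (by omega)).2.2.1 (by omega)
    have e₂ := (key₂ (k - 1) (by omega)).2.2.1 (by omega)
    rw [show L + 2 - (L + 1 - k) = k + 1 by omega] at e₁
    rw [show L + 2 - (L - (k - 1)) = k + 1 by omega] at e₂
    have h2 : √(3 * 5 ^ L * D) * (coord b 1 ^ (k + 1) * |Real.log (coord b 1)| ^ (2 * L)) ≤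
        √(3 * 5 ^ L * D) * (coord b 1 ^ (k + 1) * |Real.log (coord b 1)| ^ (2 * L + 1)) := by
      gcongr
    exact hadd a₃ (by positivity) (by linarith) (e₁.trans (ENNReal.ofReal_le_ofReal h2))
      (e₂.trans (ENNReal.ofReal_le_ofReal h2))
  · exact hadd a₂ (by positivity) (by linarith) ((key₁ L (by omega)).2.1 _ hβ5 hC₅ (by omega))
      ((key₂ (L - 1) (by omega)).2.1 _ hβ5 hC₅ (by omega))
  · exact hadd a₁ (by positivity) (by linarith) ((key₁ (L + 1) le_rfl).1 (by omega))
      ((key₂ L le_rfl).1 (by omega))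
  · have e := (key₁ k (by omega)).2.2.2 (m - k) (L + 1 - m) (by omega) (by omega) (by omega)
    rw [show L + 2 - (L + 1 - m) = m + 1 by omega] at e
    exact e.trans (ENNReal.ofReal_le_ofReal
      (mul_le_mul_of_nonneg_right (by linarith) (by positivity)))
  · have e := (key₂ k (by omega)).2.2.2 (m - k) (L - m) (by omega) (by omega) (by omega)
    rw [show L + 2 - (L - m) = m + 2 by omega] at e
    exact e.trans (ENNReal.ofReal_le_ofReal
      (mul_le_mul_of_nonneg_right (by linarith) (by positivity)))
  · have hMβ : coord b 1 ^ 2 * (1 + (2 * M) ^ 2) < 1 := by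
      have h3 : (coord b 1 * (1 + 2 * M)) ^ 2 < 1 :=
        pow_lt_one₀ (by positivity) (by linarith [hc.le]) two_ne_zero
      nlinarith [mul_nonneg (sq_nonneg (coord b 1)) (show 0 ≤ M by linarith)]
    have e₁ : radNorm (2 * M) (adapted k fun y => (psiVec cc K S (cutCor χ cc κ ς) R b y).1) ≤
        ENNReal.ofReal 0 := by
      refine radNorm_le_const (B := 0) (by linarith) le_rfl le_rfl (fun y hy hyM => ?_) (by simp)
      have : adapted k (fun y => (psiVec cc K S (cutCor χ cc κ ς) R b y).1) y = _ :=
        adapted_eq_adS k hF₁ y hy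
      rw [psiOne_adS_inner hχ k (lt_of_le_of_lt (mul_le_mul_of_nonneg_left (by nlinarith)
        (sq_nonneg _)) hMβ), mul_zero] at this
      rw [this, zero_pow two_ne_zero]
    have e₂ := radNorm_le_local (L := L) (R := R) (c := c) (k := k - 1) hc hβ hM hMβ hD₃0 hF₂
      fun s hx hs => (hb₃ (k - 1) p s hx hs).trans (mul_le_mul_of_nonneg_right
        (hCD₃ _ (by omega)) (by
          have hs0 : 0 < s := by linarith
          have := Real.log_nonneg hs
          have hβ0 : 0 < coord p.1 1 := h0
          positivity))
    have hτ := Real.log_nonneg (show 1 ≤ 1 + (2 * M) ^ 2 by nlinarith)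
    exact radNorm_add_le le_rfl (by positivity) e₁ e₂ (by rw [zero_add])
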